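/- **Combined matching-pseudoflow algorithm.** Let $B=(V_1;V_2,E)$ be a bipartite graph with $n_1=|V_1|$, $n_2=|V_2|$ and $m=|E|$, let $\kappa$ be the cardinality of a maximum matching of $B$, and let $\lambda\ge 1$ be the word length. The computation model is a unit-cost random access machine which, besides the usual operations on integers, performs the operations AND, OR and LEAD (position of the leading nonzero bit) on $\lambda$-bit words, each in one step, and whose working memory is initially zero. The graph is given by the adjacency lists of all nodes, in arbitrary order, together with the characteristic vectors OUT$(v)$, $v\in V_1$, and IN$(b)$, $b\in V_2$, of the sets of neighbours, each cut into $\lambda$-bit words. The *combined algorithm with parameter $\ell$* maintains a matching; its edges are called $WT_2$ branches (rooted at the $V_2$-node), the unmatched $V_1$-nodes $ST_1$ branches, and the unmatched $V_2$-nodes $WT_1$ branches. The *label* of a node is the number of $V_1$-nodes on a shortest path from it to a $WT_1$ branch in the residual network (edges directed from $V_1$ to $V_2$, matching edges also from $V_2$ to $V_1$). The algorithm starts with a greedy maximal matching, found by scanning, for every $V_1$-node, its adjacency list and its OUT words alternately. It then works in stages. In stage $k$, where $k$ is the lowest label of an $ST_1$ branch, it generates the layered network by a breadth-first search starting from the $WT_1$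 branches, and performs a maximal set of sequences of mergers with backtracking, each node being visited at most once, along paths whose labels decrease from $k$ to $0$; every such path that reaches a $WT_1$ branch increases the matching by one edge. The algorithm ends when no $ST_1$ branch has a finite label. Stages $k\le\ell$ are executed without words, by scanning adjacency lists; all later stages are executed with words: the layers are obtained by OR and AND from the words SUB-IN, and the mergers by AND and LEAD from the words SUB-OUT, where SUB-IN and SUB-OUT are the characteristic vectors of the neighbours that lie in $WT_2$ branches, and are maintained throughout the algorithm. Assume $m\ge 1$, $n_1\le m$ and $\lambda\le n_2$. Then for every constant $c>0$ there is a constant $C$ that depends only on $c$ such that, for all such graphs and word lengths with $\kappa^2\ge c\,m$ (that is, $\kappa^2\in\Omega(m)$), the combined algorithm with parameter $$\ell=\kappa\sqrt{\frac{\kappa}{m\lambda}}$$ terminates with a maximum matching of $B$ after at most $$C\left(\min\left\{n_1\kappa,\ \frac{n_1n_2}{\lambda},\ m\right\}+\kappa^2+\kappa^{1.5}\sqrt{\frac{m}{\lambda}}\right)$$ steps. -/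

import Mathlib

namespace MatchingPseudoflow

/-! ## Bipartite graphs, matchings, adjacency lists -/

/-- A bipartite graph on `V₁ = Fin n₁`, `V₂ = Fin n₂`, together with its adjacency lists
(out-neighbours of the `V₁`-nodes, in-neighbours of the `V₂`-nodes), in an arbitrary order. -/
structure BipGraph (n₁ n₂ : ℕ) where
  edges : Finset (Fin n₁ × Fin n₂)
  outList : Fin n₁ → List (Fin n₂)
  inList : Fin n₂ → List (Fin n₁)
  outList_nodup : ∀ v, (outList v).Nodup
  inList_nodup : ∀ b, (inList b).Nodup
  mem_outList : ∀ v b, b ∈ outList v ↔ (v, b) ∈ edges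
  mem_inList : ∀ b v, v ∈ inList b ↔ (v, b) ∈ edges

/-- A matching: a set of edges, no two of which share an end node. -/
def BipGraph.IsMatching {n₁ n₂ : ℕ} (G : BipGraph n₁ n₂) (M : Finset (Fin n₁ × Fin n₂)) : Prop :=
  M ⊆ G.edges ∧ ∀ e ∈ M, ∀ f ∈ M, (e.1 = f.1 ∨ e.2 = f.2) → e = f

open Classical in
/-- `κ`, the cardinality of a maximum matching. -/
noncomputable def BipGraph.kappa {n₁ n₂ : ℕ} (G : BipGraph n₁ n₂) : ℕ :=
  (G.edges.powerset.filter (fun M => G.IsMatching M)).sup Finset.card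

/-- `m`, the number of edges (arcs from `V₁` to `V₂`). -/
def BipGraph.m {n₁ n₂ : ℕ} (G : BipGraph n₁ n₂) : ℕ := G.edges.card

/-! ## The machine model: a unit-cost random access machine with `λ`-bit word operations -/

/-- The registers that the program uses. -/
inductive Reg : Type
  -- inputs: sizes of the two sides, word length, last stage run without words
  | n1 | n2 | lam | thr
  -- number of `WT₂` branches, mode (1 = with words), main loop flag
  | K | uw | go
  -- argument, result and temporaries of the scans
  | fv | fb | res | act | ti | tq | tw | tx
  -- creating a branch
  | nv | nb | aj
  -- greedy initialization
  | gv
  -- layered network: current layer, stage label, number of words, queue bounds, loop counters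
  | p | L | nw | qh | qe | qt | sj | h | x | b | e | rr | i
  -- mergers: strong node, `ST₂` branch (root, left child, right child), label of `rc`, depth
  | u | cur | lc | rc | pl | d | busy
  deriving DecidableEq

/-- The arrays that the program uses; every array has two indices (the second one is often `0`). -/
inductive Arr : Type
  -- inputs: adjacency lists with their lengths, and the words OUT and IN
  | outDeg | outAdj | inDeg | inAdj | outW | inW
  -- scan pointers (into lists and into words) that are never reset
  | outPtr | outWPtr | inPtr | inWPtr
  -- branches: nodes with a given index, index + 1 of a node, parent, child
  | node1 | node2 | idx1 | idx2 | par | chl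
  -- words: nodes in `WT₂` branches, SUB-OUT, SUB-IN
  | used1 | used2 | subOut | subIn
  -- per stage: labels, visited marks, scan pointers, queue, layer words, REACHED, VISITED, stack
  | lab | vis | sPtr | sWPtr | queue | lay1 | lay2 | reached | unvis | stk
  deriving DecidableEq

/-- Binary operations: arithmetic and comparisons on integers, boolean operations on words. -/
inductive BinOp : Type
  | add | sub | mul | div | mod | lt | eq | and | or

/-- Expressions. `lead` is the leading-bit operation, `bit j` is the word whose only nonzero bit
is bit `j`. -/
inductive Expr : Type
  | lit (n : ℕ)
  | reg (r : Reg)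
  | cell (a : Arr) (i j : Expr)
  | bin (o : BinOp) (s t : Expr)
  | lead (s : Expr)
  | bit (s : Expr)

/-- Commands. A condition holds when its value is nonzero. -/
inductive Cmd : Type
  | skip
  | assign (r : Reg) (s : Expr)
  | put (a : Arr) (i j s : Expr)
  | seq (c c' : Cmd)
  | ifte (s : Expr) (c c' : Cmd)
  | whilst (s : Expr) (c : Cmd)

/-- The memory: registers and array cells hold natural numbers. -/
structure Mem where
  reg : Reg → ℕ
  arr : Arr → ℕ → ℕ → ℕ

/-- Value of a binary operation; subtraction is truncated, comparisons return `1` or `0`, and the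
boolean operations act on words of `lam` bits. -/
def BinOp.eval (lam : ℕ) : BinOp → ℕ → ℕ → ℕ
  | add, a, b => a + b
  | sub, a, b => a - b
  | mul, a, b => a * b
  | div, a, b => a / b
  | mod, a, b => a % b
  | lt, a, b => if a < b then 1 else 0
  | eq, a, b => if a = b then 1 else 0
  | and, a, b => (a &&& b) % 2 ^ lam
  | or, a, b => (a ||| b) % 2 ^ lam

/-- Value of an expression. The positions in a word are numbered from `1` for `lead`, which returns
`0` on the zero word, and from `0` for `bit`. -/
def Expr.eval (lam : ℕ) (s : Mem) : Expr → ℕ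
  | lit n => n
  | reg r => s.reg r
  | cell a e f => s.arr a (e.eval lam s) (f.eval lam s)
  | bin o e f => o.eval lam (e.eval lam s) (f.eval lam s)
  | lead e => Nat.size (e.eval lam s % 2 ^ lam)
  | bit e => if e.eval lam s < lam then 2 ^ e.eval lam s else 0

/-- Cost of evaluating an expression: the number of constants, register reads, memory reads and
operations in it. -/
def Expr.cost : Expr → ℕ
  | lit _ => 1
  | reg _ => 1
  | cell _ e f => e.cost + f.cost + 1
  | bin _ e f => e.cost + f.cost + 1
  | lead e => e.cost + 1
  | bit e => e.cost + 1

/-- Write to a register. -/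
def Mem.setReg (s : Mem) (r : Reg) (a : ℕ) : Mem :=
  ⟨Function.update s.reg r a, s.arr⟩

/-- Write to an array cell. -/
def Mem.setCell (s : Mem) (A : Arr) (i j a : ℕ) : Mem :=
  ⟨s.reg, Function.update s.arr A
    (Function.update (s.arr A) i (Function.update (s.arr A i) j a))⟩

/-- `Exec lam c s t s'`: on a machine with `lam`-bit words, the command `c`, started in the memory
`s`, terminates after `t` steps in the memory `s'`. -/
inductive Exec (lam : ℕ) : Cmd → Mem → ℕ → Mem → Prop
  | skip (s : Mem) : Exec lam .skip s 1 s
  | assign (r : Reg) (e : Expr) (s : Mem) :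
      Exec lam (.assign r e) s (e.cost + 1) (s.setReg r (e.eval lam s))
  | put (A : Arr) (i j e : Expr) (s : Mem) :
      Exec lam (.put A i j e) s (i.cost + j.cost + e.cost + 1)
        (s.setCell A (i.eval lam s) (j.eval lam s) (e.eval lam s))
  | seq {c c' : Cmd} {s s' s'' : Mem} {t t' : ℕ} :
      Exec lam c s t s' → Exec lam c' s' t' s'' → Exec lam (.seq c c') s (t + t') s''
  | ifTrue {e : Expr} {c c' : Cmd} {s s' : Mem} {t : ℕ} : e.eval lam s ≠ 0 →
      Exec lam c s t s' → Exec lam (.ifte e c c') s (e.cost + 1 + t) s'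
  | ifFalse {e : Expr} {c c' : Cmd} {s s' : Mem} {t : ℕ} : e.eval lam s = 0 →
      Exec lam c' s t s' → Exec lam (.ifte e c c') s (e.cost + 1 + t) s'
  | whileTrue {e : Expr} {c : Cmd} {s s' s'' : Mem} {t t' : ℕ} : e.eval lam s ≠ 0 →
      Exec lam c s t s' → Exec lam (.whilst e c) s' t' s'' →
      Exec lam (.whilst e c) s (e.cost + 1 + t + t') s''
  | whileFalse {e : Expr} {c : Cmd} {s : Mem} : e.eval lam s = 0 →
      Exec lam (.whilst e c) s (e.cost + 1) s

/-! ## Concrete syntax -/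

instance (n : ℕ) : OfNat Expr n := ⟨.lit n⟩
instance : Add Expr := ⟨.bin .add⟩
instance : Sub Expr := ⟨.bin .sub⟩
instance : Mul Expr := ⟨.bin .mul⟩
instance : Div Expr := ⟨.bin .div⟩
instance : Mod Expr := ⟨.bin .mod⟩

local prefix:max "§" => Expr.reg
local infix:50 " ≺ " => Expr.bin BinOp.lt
local infix:50 " ≐ " => Expr.bin BinOp.eq
local infixl:65 " ⊓⊓ " => Expr.bin BinOp.and
local infixl:65 " ⊔⊔ " => Expr.bin BinOp.or
local infix:40 " ≔ " => Cmd.assign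
local infixr:30 " ;; " => Cmd.seq

/-- The entry of the array `a` with the given indices. -/
def Arr.el (a : Arr) (i : Expr) (j : Expr := 0) : Expr := .cell a i j

open MatchingPseudoflow.Reg MatchingPseudoflow.Arr MatchingPseudoflow.Expr MatchingPseudoflow.Cmd

/-- `r := r + 1` -/
def incr (r : Reg) : Cmd := r ≔ §r + 1

/-- Is bit `j` of the bit vector stored in row `i` of `a` nonzero? -/
def hasBit (a : Arr) (i j : Expr) : Expr := a.el i (j / §lam) ⊓⊓ bit (j % §lam)

/-- Set bit `j` of the bit vector stored in row `i` of `a`. -/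
def setBit (a : Arr) (i j : Expr) : Cmd :=
  put a i (j / §lam) (a.el i (j / §lam) ⊔⊔ bit (j % §lam))

/-- Clear bit `j` of the bit vector stored in row `i` of `a`. -/
def clearBit (a : Arr) (i j : Expr) : Cmd :=
  put a i (j / §lam) (a.el i (j / §lam) - hasBit a i j)

/-! ## The algorithm

The branches are represented as follows. There are `K` branches of type `WT₂`; the `V₁`-nodes in
them are numbered `node1 0, …, node1 (K - 1)`, the `V₂`-nodes `node2 0, …, node2 (K - 1)`, and
`idx1`, `idx2` give the number plus one of a node (`0` if the node is a singleton branch, that is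
`ST₁` for a `V₁`-node and `WT₁` for a `V₂`-node). The `V₂`-node number `j` is the root of a branch
whose child is the `V₁`-node number `chl j`, and `par` is the inverse of `chl`. -/

/-- Scan for a neighbour of the node in register `a` that is a singleton branch. The search resumes
where the previous search from this node stopped. With words (`uw = 1`) it alternates between the
next entry of the adjacency list and the next word of the bit vector of neighbours, from which the
nodes in `WT₂` branches (the bit vector `used`) are removed; without words it uses the list only.
The result is the neighbour plus one, or zero. -/
def scan (a n : Reg) (ptr deg adj idx wptr W used : Arr) : Cmd :=
  res ≔ 0 ;; act ≔ 1 ;;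
  whilst (§act) (
    ti ≔ ptr.el (§a) ;;
    ifte (§ti ≺ deg.el (§a))
      (tx ≔ adj.el (§a) (§ti) ;;
       ifte (idx.el (§tx) ≐ 0)
        (res ≔ §tx + 1 ;; act ≔ 0)
        (put ptr (§a) 0 (§ti + 1)))
      (act ≔ 0) ;;
    ifte (§act * §uw)
      (tq ≔ wptr.el (§a) ;;
       ifte (§tq * §lam ≺ §n)
        (tw ≔ W.el (§a) (§tq) ;;
         tw ≔ §tw - (§tw ⊓⊓ used.el 0 (§tq)) ;;
         ifte (lead (§tw) ≐ 0)
          (put wptr (§a) 0 (§tq + 1))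
          (res ≔ §tq * §lam + lead (§tw) ;; act ≔ 0))
        (act ≔ 0))
      skip)

/-- Look for a `WT₁` neighbour of the `V₁`-node `fv`. -/
def findFree : Cmd := scan fv n2 outPtr outDeg outAdj idx2 outWPtr outW used2

/-- Look for an `ST₁` neighbour of the `V₂`-node `fb`. -/
def findStrong : Cmd := scan fb n1 inPtr inDeg inAdj idx1 inWPtr inW used1

/-- The singleton branches `nv` (in `V₁`) and `nb` (in `V₂`) enter the `WT₂` branches: they get the
number `K`, and a row and a column are added to SUB-OUT and SUB-IN. -/
def addNodes : Cmd :=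
  put node1 (§K) 0 (§nv) ;; put node2 (§K) 0 (§nb) ;;
  put idx1 (§nv) 0 (§K + 1) ;; put idx2 (§nb) 0 (§K + 1) ;;
  setBit used1 0 (§nv) ;; setBit used2 0 (§nb) ;;
  aj ≔ 0 ;;
  whilst (§aj ≺ §K + 1) (
    ifte (hasBit outW (§nv) (node2.el (§aj)))
      (setBit subOut (§K) (§aj) ;; setBit subIn (§aj) (§K)) skip ;;
    ifte (hasBit outW (node1.el (§aj)) (§nb))
      (setBit subOut (§aj) (§K) ;; setBit subIn (§K) (§aj)) skip ;;
    incr aj) ;;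
  incr K

/-- Greedy initialization, with words. -/
def greedy : Cmd :=
  uw ≔ 1 ;; gv ≔ 0 ;;
  whilst (§gv ≺ §n1) (
    fv ≔ §gv ;; findFree ;;
    ifte (§res)
      (nv ≔ §gv ;; nb ≔ §res - 1 ;;
       put par (§K) 0 (§K) ;; put chl (§K) 0 (§K) ;; addNodes)
      skip ;;
    incr gv)

/-- Put the branch with root number `rr` into layer `p`. -/
def enqueue : Cmd :=
  put lab (§rr) 0 (§p) ;; put queue (§qt) 0 (§rr) ;; incr qt

/-- Reset the words `V₁LAYER(p)` and `V₂LAYER(p)`. -/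
def clearLayer : Cmd :=
  x ≔ 0 ;;
  whilst (§x ≺ §nw) (put lay1 (§p) (§x) 0 ;; put lay2 (§p) (§x) 0 ;; incr x)

/-- Restrict `V₁LAYER(p)` to the nodes that are not reached yet, and list the branches of layer `p`
with the operation `lead`, updating REACHED and `V₂LAYER(p)`. -/
def convertLayer : Cmd :=
  x ≔ 0 ;;
  whilst (§x ≺ §nw) (
    tw ≔ lay1.el (§p) (§x) ⊓⊓ reached.el 0 (§x) ;;
    put lay1 (§p) (§x) (§tw) ;;
    whilst (lead (§tw)) (
      i ≔ §x * §lam + lead (§tw) - 1 ;;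
      tw ≔ §tw - bit (lead (§tw) - 1) ;;
      clearBit reached 0 (§i) ;;
      rr ≔ par.el (§i) ;;
      setBit lay2 (§p) (§rr) ;;
      enqueue) ;;
    incr x)

/-- Start of a stage: all labels and marks are erased. -/
def resetStage : Cmd :=
  sj ≔ 0 ;;
  whilst (§sj ≺ §K) (
    put lab (§sj) 0 0 ;; put vis (§sj) 0 0 ;; put sPtr (§sj) 0 0 ;; put sWPtr (§sj) 0 0 ;;
    ifte (§uw) (setBit reached 0 (§sj) ;; setBit unvis 0 (§sj)) skip ;;
    incr sj) ;;
  nw ≔ §K / §lam + 1 ;; L ≔ 0 ;; qh ≔ 0 ;; qt ≔ 0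

/-- The 1-layer: the `WT₂` branches whose child has a `WT₁` neighbour. -/
def firstLayer : Cmd :=
  p ≔ 1 ;;
  ifte (§uw) clearLayer skip ;;
  sj ≔ 0 ;;
  whilst (§sj ≺ §K) (
    fv ≔ node1.el (§sj) ;; findFree ;;
    ifte (§res)
      (ifte (§uw) (setBit lay1 1 (§sj)) (rr ≔ par.el (§sj) ;; enqueue))
      skip ;;
    incr sj) ;;
  ifte (§uw) convertLayer skip ;;
  qe ≔ §qt

/-- From layer `p`, which is the segment `qh, …, qe - 1` of the queue, to layer `p + 1`: with words,
by the union of the SUB-IN words; without words, by scanning the adjacency lists. -/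
def nextLayer : Cmd :=
  incr p ;;
  ifte (§uw) clearLayer skip ;;
  h ≔ §qh ;;
  whilst (§h ≺ §qe) (
    ifte (§uw)
      (x ≔ 0 ;;
       whilst (§x ≺ §nw) (
        put lay1 (§p) (§x) (lay1.el (§p) (§x) ⊔⊔ subIn.el (queue.el (§h)) (§x)) ;; incr x))
      (b ≔ node2.el (queue.el (§h)) ;; e ≔ 0 ;;
       whilst (§e ≺ inDeg.el (§b)) (
        rr ≔ par.el (idx1.el (inAdj.el (§b) (§e)) - 1) ;;
        ifte (lab.el (§rr) ≐ 0) enqueue skip ;;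
        incr e)) ;;
    incr h) ;;
  ifte (§uw) convertLayer skip ;;
  qh ≔ §qe ;; qe ≔ §qt

/-- The layered network. Layers are generated until one is found, layer `p`, in which some branch has
an `ST₁` neighbour; then `L = p + 1` is the label of the stage. Without words, the generation stops
when the label of the stage is seen to exceed `thr`. If no label is found then `L = 0`. -/
def layeredNetwork : Cmd :=
  resetStage ;; firstLayer ;;
  whilst ((§L ≐ 0) * (§qh ≺ §qe) * (§uw + (§p ≺ §thr))) (
    h ≔ §qh ;;
    whilst ((§h ≺ §qe) * (§L ≐ 0)) (
      fb ≔ node2.el (queue.el (§h)) ;; findStrong ;;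
      ifte (§res) (L ≔ §p + 1) skip ;;
      incr h) ;;
    ifte (§L ≐ 0) nextLayer skip)

/-- Mark the branch with root `cur` as visited. -/
def visit : Cmd :=
  put vis (§cur) 0 1 ;; ifte (§uw) (clearBit unvis 0 (§cur)) skip

/-- Look for a merger from the right child `rc`, of label `pl`, to an unvisited `WT₂` branch of label
`pl - 1`. The search resumes where the previous one from `rc` in the same stage stopped. The result
is the number of the root plus one, or zero. -/
def findWeak : Cmd :=
  res ≔ 0 ;; act ≔ 1 ;;
  whilst (§act) (
    ifte (§uw)
      (tq ≔ sWPtr.el (§rc) ;;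
       ifte (§tq ≺ §nw)
        (tw ≔ lay2.el (§pl - 1) (§tq) ⊓⊓ subOut.el (§rc) (§tq) ⊓⊓ unvis.el 0 (§tq) ;;
         ifte (lead (§tw) ≐ 0)
          (put sWPtr (§rc) 0 (§tq + 1))
          (res ≔ §tq * §lam + lead (§tw) ;; act ≔ 0))
        (act ≔ 0))
      (fv ≔ node1.el (§rc) ;; ti ≔ sPtr.el (§rc) ;;
       ifte (§ti ≺ outDeg.el (§fv))
        (put sPtr (§rc) 0 (§ti + 1) ;;
         tx ≔ idx2.el (outAdj.el (§fv) (§ti)) ;;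
         ifte ((lab.el (§tx - 1) + 1 ≐ §pl) * (vis.el (§tx - 1) ≐ 0))
          (res ≔ §tx ;; act ≔ 0) skip)
        (act ≔ 0)))

/-- Reverse the last merger: the `ST₂` branch with root `cur` is split; its left child returns to the
branch that it came from, or, at depth zero, becomes an `ST₁` branch again, which ends the search. -/
def backtrack : Cmd :=
  ifte (§d ≐ 0)
    (busy ≔ 0)
    (d ≔ §d - 1 ;; cur ≔ stk.el (§d) ;;
     rc ≔ §lc ;; put par (§rc) 0 (§cur) ;;
     lc ≔ chl.el (§cur) ;; put chl (§cur) 0 (§rc))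

/-- A sequence of mergers, starting with the merger from the `ST₁` branch `u` to the `WT₂` branch with
root `cur`, of label `L - 1`. The current `ST₂` branch has root `cur`, left child `lc` and right child
`rc`; the number `K` stands for `u`, and, in a successful path, for the `WT₁` branch at its end. -/
def mergers : Cmd :=
  d ≔ 0 ;; put stk 0 0 (§cur) ;;
  lc ≔ §K ;; put par (§lc) 0 (§cur) ;; rc ≔ chl.el (§cur) ;; visit ;;
  busy ≔ 1 ;;
  whilst (§busy) (
    pl ≔ §L - 1 - §d ;;
    ifte (§pl ≐ 1)
      (fv ≔ node1.el (§rc) ;; findFree ;;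
       ifte (§res)
        (put chl (§cur) 0 (§lc) ;; put par (§rc) 0 (§K) ;; put chl (§K) 0 (§rc) ;;
         nv ≔ §u ;; nb ≔ §res - 1 ;; addNodes ;; busy ≔ 0)
        backtrack)
      (findWeak ;;
       ifte (§res)
        (put chl (§cur) 0 (§lc) ;;
         lc ≔ §rc ;; cur ≔ §res - 1 ;; put par (§lc) 0 (§cur) ;; rc ≔ chl.el (§cur) ;;
         incr d ;; put stk (§d) 0 (§cur) ;; visit)
        backtrack))

/-- All mergers of stage `L`: every unvisited branch of layer `L - 1` is tried in turn. -/
def runStage : Cmd :=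
  h ≔ §qh ;;
  whilst (§h ≺ §qe) (
    cur ≔ queue.el (§h) ;;
    ifte (vis.el (§cur) ≐ 0)
      (fb ≔ node2.el (§cur) ;; findStrong ;;
       ifte (§res) (u ≔ §res - 1 ;; mergers) skip)
      skip ;;
    incr h)

/-- The combined algorithm: greedy initialization with words, then the stages with label at most
`thr` without words, and all later stages with words. -/
def combined : Cmd :=
  greedy ;; uw ≔ 0 ;; go ≔ 1 ;;
  whilst (§go) (
    layeredNetwork ;;
    ifte (§L)
      runStage
      (ifte ((§uw ≐ 0) * (§qh ≺ §qe)) (uw ≔ 1) (go ≔ 0)))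

/-! ## Input and output -/

/-- Is `(v, b)` an edge, for natural numbers `v` and `b`? -/
def BipGraph.edgeNat {n₁ n₂ : ℕ} (G : BipGraph n₁ n₂) (v b : ℕ) : Prop :=
  ∃ (hv : v < n₁) (hb : b < n₂), (⟨v, hv⟩, ⟨b, hb⟩) ∈ G.edges

open Classical in
/-- The initial memory: the adjacency lists with their lengths, the words OUT and IN (bit `r` of the
word `OUT^q(v)` tells whether `(v, q * lam + r)` is an edge), the two sizes, the word length and the
stage `ℓ` after which words are used. Everything else is zero. -/
noncomputable def initMem {n₁ n₂ : ℕ} (G : BipGraph n₁ n₂) (lam ℓ : ℕ) : Mem where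
  reg
    | .n1 => n₁
    | .n2 => n₂
    | .lam => lam
    | .thr => ℓ
    | _ => 0
  arr
    | .outDeg => fun v _ => if hv : v < n₁ then (G.outList ⟨v, hv⟩).length else 0
    | .outAdj => fun v k => if hv : v < n₁ then ((G.outList ⟨v, hv⟩).map Fin.val).getD k 0 else 0
    | .inDeg => fun b _ => if hb : b < n₂ then (G.inList ⟨b, hb⟩).length else 0
    | .inAdj => fun b k => if hb : b < n₂ then ((G.inList ⟨b, hb⟩).map Fin.val).getD k 0 else 0
    | .outW => fun v q => ∑ r ∈ Finset.range lam, if G.edgeNat v (q * lam + r) then 2 ^ r else 0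
    | .inW => fun b q => ∑ r ∈ Finset.range lam, if G.edgeNat (q * lam + r) b then 2 ^ r else 0
    | _ => fun _ _ => 0

/-- The set of edges in the `WT₂` branches, the output of the algorithm. -/
def output (s : Mem) : Finset (ℕ × ℕ) :=
  (Finset.range (s.reg .K)).image
    fun j => (s.arr .node1 (s.arr .chl j 0) 0, s.arr .node2 j 0)

end MatchingPseudoflow

set_option linter.unusedSimpArgs false

namespace MatchingPseudoflow

/-! ## Weakest preconditions with time -/

/-! The algorithm is of Hopcroft-Karp type. Its correctness and the number of its stages follow from
a dual argument with distance functions; its running time follows from an amortised count that is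
carried along in the specification of every command.

Stages. `Layers` says that the labels found by the search are correct as far as they have been
generated. The central notion is `Dist G s k`: a function `Φ` on the `V₂`-nodes that vanishes on the
unmatched ones and drops by at most one on each residual step through a branch certifies that every
unmatched `V₁`-node has label at least `k`. A stage with label `L` produces such a certificate for
`L + 1` (`Between.dist`). The new `Φ` is the old label, plus one on the branches that were visited,
and is one on the new branches. This is legitimate for two reasons. A visited branch whose search
failed has no neighbour that would force the smaller value (`Path.settle`). A visited branch on a
successful path has received the child of the previous branch, whose label was larger by one
(`Path.win`). Since the label of the stage was attained at its start, a stage without augmentation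
would contradict the new certificate (`Between.K_lt`).

Duality. For each level `0 < i < k` the roots at levels at least `i` and the children of the
branches at levels at most `i` cover all edges, so `κ` is at most `K` plus the number of branches at
level `i` (`kappa_le_level`). Hence each of these `k - 1` disjoint levels has at least `κ - K`
branches, and `k (κ - K) ≤ κ` (`Dist.mul_le`). If the search runs dry then one level is empty, the
cover has size `K`, and the matching is maximum (`Network.kappa_le`).

Time. Matched nodes remain matched, so the pointers of the scans for singleton branches never move
back. Their total advance, together with `K ^ 2` for the SUB words, is the potential `pot` that pays
for the scans and for `addNodes`. In the end the pointers of `V₂` sum to at most `κ²`, and those of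
`V₁` to at most `m`, `n₁ κ` and `n₁ (n₂ / λ + 2) + κ²` (`Base.sum_inPtr_le`, `Base.sum_outPtr_le`).
Apart from this a stage costs `O(m + κ)` without words and `O((κ + 1) (κ / λ + 3))` with words
(`wp_layeredNetwork`, `wp_runStage`). The budget is `ℓ + 1` stages without words and `W + 1` stages
with words. Here `W` is the number of augmentations that are missing when words come in, and `(ℓ +
1) W ≤ κ` by duality. The choice of `ℓ` makes both `ℓ m` and `(κ / ℓ) (κ² / λ)` equal to `κ^{1.5}
√(m / λ)` up to rounding; the remaining terms are `O(κ²)` because `m ≤ κ² / c` and `W ≤ κ`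
(`time_bound`). -/

/-- The command `c` started in `s` terminates, and its running time and final memory satisfy `Q`. -/
def wp (lam : ℕ) (c : Cmd) (s : Mem) (Q : ℕ → Mem → Prop) : Prop :=
  ∃ t s', Exec lam c s t s' ∧ Q t s'

section Rules

variable {lam : ℕ} {s : Mem} {Q R : ℕ → Mem → Prop}

theorem wp_skip : wp lam .skip s Q ↔ Q 1 s := by
  constructor
  · rintro ⟨t, s', h, hQ⟩; cases h; exact hQ
  · intro h; exact ⟨_, _, .skip s, h⟩

theorem wp_assign {r : Reg} {e : Expr} :
    wp lam (.assign r e) s Q ↔ Q (e.cost + 1) (s.setReg r (e.eval lam s)) := by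
  constructor
  · rintro ⟨t, s', h, hQ⟩; cases h; exact hQ
  · intro h; exact ⟨_, _, .assign r e s, h⟩

theorem wp_put {A : Arr} {i j e : Expr} :
    wp lam (.put A i j e) s Q ↔ Q (i.cost + j.cost + e.cost + 1)
      (s.setCell A (i.eval lam s) (j.eval lam s) (e.eval lam s)) := by
  constructor
  · rintro ⟨t, s', h, hQ⟩; cases h; exact hQ
  · intro h; exact ⟨_, _, .put A i j e s, h⟩

theorem wp_seq {c c' : Cmd} :
    wp lam (.seq c c') s Q ↔ wp lam c s (fun t s' => wp lam c' s' (fun t' s'' => Q (t + t') s'')) := by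
  constructor
  · rintro ⟨t, s', h, hQ⟩; cases h with | seq h h' => exact ⟨_, _, h, _, _, h', hQ⟩
  · rintro ⟨t, s', h, t', s'', h', hQ⟩; exact ⟨_, _, .seq h h', hQ⟩

theorem wp_ifte {e : Expr} {c c' : Cmd} :
    wp lam (.ifte e c c') s Q ↔
      (e.eval lam s ≠ 0 → wp lam c s (fun t s' => Q (e.cost + 1 + t) s')) ∧
      (e.eval lam s = 0 → wp lam c' s (fun t s' => Q (e.cost + 1 + t) s')) := by
  constructor
  · rintro ⟨t, s', h, hQ⟩
    cases h with
    | ifTrue he h => exact ⟨fun _ => ⟨_, _, h, hQ⟩, fun h0 => absurd h0 he⟩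
    | ifFalse he h => exact ⟨fun h0 => absurd he h0, fun _ => ⟨_, _, h, hQ⟩⟩
  · rintro ⟨h1, h2⟩
    by_cases he : e.eval lam s = 0
    · obtain ⟨t, s', h, hQ⟩ := h2 he; exact ⟨_, _, .ifFalse he h, hQ⟩
    · obtain ⟨t, s', h, hQ⟩ := h1 he; exact ⟨_, _, .ifTrue he h, hQ⟩

/-! ### Frames -/

/-- Does the command contain an assignment to the register? -/
def Cmd.modR : Cmd → Reg → Bool
  | .skip, _ => false
  | .assign r _, r' => decide (r = r')
  | .put _ _ _ _, _ => false
  | .seq c c', r => c.modR r || c'.modR r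
  | .ifte _ c c', r => c.modR r || c'.modR r
  | .whilst _ c, r => c.modR r

/-- Does the command contain a write to the array? -/
def Cmd.modA : Cmd → Arr → Bool
  | .skip, _ => false
  | .assign _ _, _ => false
  | .put A _ _ _, A' => decide (A = A')
  | .seq c c', r => c.modA r || c'.modA r
  | .ifte _ c c', r => c.modA r || c'.modA r
  | .whilst _ c, r => c.modA r

/-- Two memories that agree on everything that the command does not write to. -/
structure Frame (c : Cmd) (s s' : Mem) : Prop where
  reg : ∀ r, c.modR r = false → s'.reg r = s.reg r
  arr : ∀ A, c.modA A = false → s'.arr A = s.arr A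

theorem Frame.refl (c : Cmd) (s : Mem) : Frame c s s := ⟨fun _ _ => rfl, fun _ _ => rfl⟩

theorem Frame.trans {c : Cmd} {s s' s'' : Mem} (h : Frame c s s') (h' : Frame c s' s'') :
    Frame c s s'' :=
  ⟨fun r hr => (h'.reg r hr).trans (h.reg r hr), fun A hA => (h'.arr A hA).trans (h.arr A hA)⟩

theorem Exec.frame {c : Cmd} {s s' : Mem} {t : ℕ} (h : Exec lam c s t s') : Frame c s s' := by
  induction h with
  | skip s => exact Frame.refl _ _
  | assign r e s =>
    refine ⟨fun r' hr => ?_, fun _ _ => rfl⟩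
    have : r' ≠ r := by rintro rfl; simp [Cmd.modR] at hr
    simp [Mem.setReg, Function.update_of_ne this]
  | put A i j e s =>
    refine ⟨fun _ _ => rfl, fun A' hA => ?_⟩
    have : A' ≠ A := by rintro rfl; simp [Cmd.modA] at hA
    simp [Mem.setCell, Function.update_of_ne this]
  | seq _ _ ih ih' =>
    constructor
    · intro r hr; simp only [Cmd.modR, Bool.or_eq_false_iff] at hr
      exact (ih'.reg r hr.2).trans (ih.reg r hr.1)
    · intro r hr; simp only [Cmd.modA, Bool.or_eq_false_iff] at hr
      exact (ih'.arr r hr.2).trans (ih.arr r hr.1)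
  | ifTrue _ _ ih =>
    constructor
    · intro r hr; simp only [Cmd.modR, Bool.or_eq_false_iff] at hr; exact ih.reg r hr.1
    · intro r hr; simp only [Cmd.modA, Bool.or_eq_false_iff] at hr; exact ih.arr r hr.1
  | ifFalse _ _ ih =>
    constructor
    · intro r hr; simp only [Cmd.modR, Bool.or_eq_false_iff] at hr; exact ih.reg r hr.2
    · intro r hr; simp only [Cmd.modA, Bool.or_eq_false_iff] at hr; exact ih.arr r hr.2
  | whileTrue _ _ _ ih ih' =>
    exact ⟨fun r hr => (ih'.reg r hr).trans (ih.reg r hr),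
      fun r hr => (ih'.arr r hr).trans (ih.arr r hr)⟩
  | whileFalse _ => exact Frame.refl _ _

/-- A command leaves alone whatever it contains no write to. Hence specifications need to mention
only what changes; the rest is recovered from the frame at each call. -/
theorem wp_call {c : Cmd} (h : wp lam c s R)
    (k : ∀ t s', Frame c s s' → R t s' → Q t s') : wp lam c s Q := by
  obtain ⟨t, s', h, hR⟩ := h
  exact ⟨t, s', h, k t s' h.frame hR⟩

theorem wp_call_seq {c c' : Cmd} (h : wp lam c s R)
    (k : ∀ t s', Frame c s s' → R t s' → wp lam c' s' (fun t' s'' => Q (t + t') s'')) :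
    wp lam (.seq c c') s Q :=
  wp_seq.2 (wp_call h k)

/-- The invariant sees the time spent so far, which makes amortised bounds possible. The measure `μ`
serves termination only and is unrelated to the time. -/
theorem wp_while {e : Expr} {c : Cmd} (I : ℕ → Mem → Prop) (μ : Mem → ℕ) (h0 : I 0 s)
    (step : ∀ t s', Frame c s s' → I t s' → e.eval lam s' ≠ 0 →
      wp lam c s' (fun t' s'' => I (t + (e.cost + 1 + t')) s'' ∧ μ s'' < μ s'))
    (done : ∀ t s', Frame c s s' → I t s' → e.eval lam s' = 0 → Q (t + (e.cost + 1)) s') :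
    wp lam (.whilst e c) s Q := by
  -- Generalised to a loop entered after `t` steps, so that the induction on the measure goes
  -- through.
  suffices H : ∀ n t s', μ s' = n → Frame c s s' → I t s' →
      wp lam (.whilst e c) s' (fun t' s'' => Q (t + t') s'') by
    simpa using H _ 0 s rfl (Frame.refl _ _) h0
  intro n
  induction n using Nat.strong_induction_on with
  | _ n ih =>
    intro t s' hn F hI
    by_cases he : e.eval lam s' = 0
    · exact ⟨_, _, .whileFalse he, done t s' F hI he⟩
    · obtain ⟨t1, s1, hx, hI1, hlt⟩ := step t s' F hI he
      obtain ⟨t2, s2, hx2, hQ⟩ := ih _ (hn ▸ hlt) _ s1 rfl (F.trans hx.frame) hI1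
      refine ⟨_, _, .whileTrue he hx hx2, ?_⟩
      convert hQ using 1
      omega

end Rules

/-! ### Evaluation -/

section Eval

variable (lam : ℕ) (s : Mem)

@[simp] theorem Expr.ofNat_eq (n : ℕ) : (OfNat.ofNat n : Expr) = .lit n := rfl
@[simp] theorem Expr.add_eq (a b : Expr) : a + b = .bin .add a b := rfl
@[simp] theorem Expr.sub_eq (a b : Expr) : a - b = .bin .sub a b := rfl
@[simp] theorem Expr.mul_eq (a b : Expr) : a * b = .bin .mul a b := rfl
@[simp] theorem Expr.div_eq (a b : Expr) : a / b = .bin .div a b := rfl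
@[simp] theorem Expr.mod_eq (a b : Expr) : a % b = .bin .mod a b := rfl

attribute [simp] Expr.eval Expr.cost BinOp.eval Arr.el incr

@[simp] theorem Mem.setReg_reg (r r' : Reg) (a : ℕ) :
    (s.setReg r a).reg r' = if r' = r then a else s.reg r' := by
  simp [Mem.setReg, Function.update_apply]

@[simp] theorem Mem.setReg_arr (r : Reg) (a : ℕ) : (s.setReg r a).arr = s.arr := rfl

@[simp] theorem Mem.setCell_reg (A : Arr) (i j a : ℕ) : (s.setCell A i j a).reg = s.reg := rfl

theorem Mem.setCell_arr (A A' : Arr) (i j a i' j' : ℕ) :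
    (s.setCell A i j a).arr A' i' j' = if A' = A ∧ i' = i ∧ j' = j then a else s.arr A' i' j' := by
  simp only [Mem.setCell, Function.update_apply]
  by_cases h : A' = A
  · subst h; by_cases hi : i' = i
    · subst hi; simp [Function.update_apply]
    · simp [hi]
  · simp [h]

theorem Mem.setCell_arr_ne {A A' : Arr} (h : A' ≠ A) (i j a : ℕ) :
    (s.setCell A i j a).arr A' = s.arr A' := by
  simp [Mem.setCell, Function.update_of_ne h]

@[simp] theorem Mem.setCell_arr_self (A : Arr) (i j a : ℕ) :
    (s.setCell A i j a).arr A = fun i' j' => if i' = i ∧ j' = j then a else s.arr A i' j' := by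
  funext i' j'; simp [Mem.setCell_arr]

@[simp] theorem Mem.setCell_arr_other (A A' : Arr) (i j a : ℕ) (h : (A' = A) = False) :
    (s.setCell A i j a).arr A' = s.arr A' := 
  Mem.setCell_arr_ne s (of_eq_false h) i j a

end Eval

/-! ### Bit vectors that are cut into words -/

/-- Bit `j` of a bit vector that is cut into words of `lam` bits. -/
def bitAt (lam : ℕ) (row : ℕ → ℕ) (j : ℕ) : Bool := (row (j / lam)).testBit (j % lam)

section Bits

variable {lam : ℕ}

theorem bitAt_mul_add (row : ℕ → ℕ) {q r : ℕ} (hr : r < lam) :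
    bitAt lam row (q * lam + r) = (row q).testBit r := by
  have h0 : 0 < lam := by omega
  have h1 : (q * lam + r) / lam = q := by
    rw [mul_comm, Nat.mul_add_div h0, Nat.div_eq_of_lt hr, add_zero]
  have h2 : (q * lam + r) % lam = r := by
    rw [mul_comm, Nat.mul_add_mod, Nat.mod_eq_of_lt hr]
  rw [bitAt, h1, h2]

/-- Without common bits no carry occurs; the induction splits off the lowest bit. -/
theorem add_eq_or_of_and_eq_zero (x : ℕ) : ∀ y : ℕ, x &&& y = 0 → x + y = x ||| y := by
  induction x using Nat.strong_induction_on with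
  | _ x ih =>
    intro y h
    rcases Nat.eq_zero_or_pos x with rfl | hx
    · simp
    have h2 : x / 2 &&& y / 2 = 0 := by rw [← Nat.and_div_two, h]
    have h1 := ih (x / 2) (by omega) (y / 2) h2
    rw [← Nat.or_div_two] at h1
    have h3 : (x ||| y) % 2 = (x % 2) ||| (y % 2) := by
      simpa using Nat.or_mod_two_pow (a := x) (b := y) (n := 1)
    have h4 : (x % 2) &&& (y % 2) = 0 := by
      have := Nat.and_mod_two_pow (a := x) (b := y) (n := 1)
      rw [h] at this; simpa using this.symm
    rcases Nat.mod_two_eq_zero_or_one x with hx2 | hx2 <;>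
      rcases Nat.mod_two_eq_zero_or_one y with hy2 | hy2 <;>
      rw [hx2, hy2] at h3 h4 <;>
      first
      | exact absurd h4 (by decide)
      | (change (x ||| y) % 2 = 0 at h3; omega)
      | (change (x ||| y) % 2 = 1 at h3; omega)

/-- The program forms set differences of words by subtraction. No borrow occurs, since `a` is the
carry-free sum of `a &&& b` and the difference. -/
theorem testBit_sub_and (a b : ℕ) (r : ℕ) :
    (a - (a &&& b)).testBit r = (a.testBit r && !b.testBit r) := by
  have h : (a &&& b) + (a.ldiff b) = a := by
    rw [add_eq_or_of_and_eq_zero]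
    · apply Nat.eq_of_testBit_eq; intro i; simp [Nat.testBit_ldiff]
      cases a.testBit i <;> cases b.testBit i <;> rfl
    · apply Nat.eq_of_testBit_eq; intro i; simp [Nat.testBit_ldiff]
      cases a.testBit i <;> cases b.testBit i <;> simp
  have : a - (a &&& b) = a.ldiff b := by omega
  rw [this, Nat.testBit_ldiff]

theorem size_pos_testBit {a : ℕ} (h : a ≠ 0) : a.testBit (a.size - 1) = true := by
  have h1 : 0 < a.size := Nat.size_pos.2 (Nat.pos_of_ne_zero h)
  have h2 : 2 ^ (a.size - 1) ≤ a := Nat.lt_size.1 (by omega)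
  have h3 : a < 2 ^ (a.size - 1 + 1) := by
    rw [Nat.sub_add_cancel h1]; exact Nat.lt_size_self a
  rw [Nat.testBit_eq_decide_div_mod_eq]
  have : a / 2 ^ (a.size - 1) = 1 := by
    apply Nat.div_eq_of_lt_le <;> simp [pow_succ] at * <;> omega
  simp [this]

theorem testBit_hasBit (w r : ℕ) (hr : r < lam) :
    (w &&& 2 ^ r) % 2 ^ lam = if w.testBit r then 2 ^ r else 0 := by
  rw [Nat.and_two_pow]
  have : 2 ^ r < 2 ^ lam := Nat.pow_lt_pow_right (by norm_num) hr
  cases w.testBit r <;> simp [Nat.mod_eq_of_lt this]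

end Bits

/-- The effect of `setBit`. -/
def Mem.setB (lam : ℕ) (s : Mem) (A : Arr) (i j : ℕ) : Mem :=
  s.setCell A i (j / lam) ((s.arr A i (j / lam) ||| 2 ^ (j % lam)) % 2 ^ lam)

/-- The effect of `clearBit`. -/
def Mem.clearB (lam : ℕ) (s : Mem) (A : Arr) (i j : ℕ) : Mem :=
  s.setCell A i (j / lam) (s.arr A i (j / lam) - (s.arr A i (j / lam) &&& 2 ^ (j % lam)))

section SetBits

variable {lam : ℕ} (s : Mem)

@[simp] theorem Mem.setB_reg (A : Arr) (i j : ℕ) : (s.setB lam A i j).reg = s.reg := rfl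
@[simp] theorem Mem.clearB_reg (A : Arr) (i j : ℕ) : (s.clearB lam A i j).reg = s.reg := rfl

@[simp] theorem Mem.setB_arr_other (A A' : Arr) (i j : ℕ) (h : (A' = A) = False) :
    (s.setB lam A i j).arr A' = s.arr A' :=
  Mem.setCell_arr_ne s (of_eq_false h) _ _ _

@[simp] theorem Mem.clearB_arr_other (A A' : Arr) (i j : ℕ) (h : (A' = A) = False) :
    (s.clearB lam A i j).arr A' = s.arr A' :=
  Mem.setCell_arr_ne s (of_eq_false h) _ _ _

theorem div_mod_inj {a b l : ℕ} (h1 : a / l = b / l) (h2 : a % l = b % l) : a = b := by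
  rw [← Nat.div_add_mod a l, ← Nat.div_add_mod b l, h1, h2]

theorem bitAt_setB (hlam : 0 < lam) (A : Arr) (i j i' j' : ℕ) :
    bitAt lam ((s.setB lam A i j).arr A i') j' =
      (decide (i' = i ∧ j' = j) || bitAt lam (s.arr A i') j') := by
  simp only [bitAt, Mem.setB, Mem.setCell_arr_self]
  by_cases h : i' = i ∧ j' / lam = j / lam
  · obtain ⟨rfl, hj⟩ := h
    have hr := Nat.mod_lt j' hlam
    simp only [hj, and_self, if_true, true_and, Nat.testBit_mod_two_pow, hr, decide_true,
      Bool.true_and, Nat.testBit_or, Nat.testBit_two_pow]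
    rw [Bool.or_comm]
    congr 1
    rw [decide_eq_decide]
    exact ⟨fun h => div_mod_inj hj h.symm, fun h => by rw [h]⟩
  · rw [if_neg h]
    have : ¬ (i' = i ∧ j' = j) := fun ⟨h1, h2⟩ => h ⟨h1, by rw [h2]⟩
    simp [this]

theorem bitAt_clearB (A : Arr) (i j i' j' : ℕ) :
    bitAt lam ((s.clearB lam A i j).arr A i') j' =
      (!decide (i' = i ∧ j' = j) && bitAt lam (s.arr A i') j') := by
  simp only [bitAt, Mem.clearB, Mem.setCell_arr_self]
  by_cases h : i' = i ∧ j' / lam = j / lam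
  · obtain ⟨rfl, hj⟩ := h
    simp only [hj, and_self, if_true, true_and, testBit_sub_and, Nat.testBit_two_pow]
    rw [Bool.and_comm]
    congr 2
    rw [decide_eq_decide]
    exact ⟨fun h => div_mod_inj hj h.symm, fun h => by rw [h]⟩
  · rw [if_neg h]
    have : ¬ (i' = i ∧ j' = j) := fun ⟨h1, h2⟩ => h ⟨h1, by rw [h2]⟩
    simp [this]

variable {s} {Q : ℕ → Mem → Prop}

theorem eval_hasBit (hl : s.reg .lam = lam) (hlam : 0 < lam) (a : Arr) (i j : Expr) :
    (hasBit a i j).eval lam s =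
      if bitAt lam (s.arr a (i.eval lam s)) (j.eval lam s) then 2 ^ (j.eval lam s % lam) else 0 := by
  have hr := Nat.mod_lt (j.eval lam s) hlam
  simp [hasBit, hl, hr, testBit_hasBit, bitAt]
  split_ifs with h <;> simp_all

theorem eval_hasBit_ne (hl : s.reg .lam = lam) (hlam : 0 < lam) (a : Arr) (i j : Expr) :
    (hasBit a i j).eval lam s ≠ 0 ↔ bitAt lam (s.arr a (i.eval lam s)) (j.eval lam s) = true := by
  rw [eval_hasBit hl hlam]; split_ifs with h <;> simp [h]

theorem wp_setBit (hl : s.reg .lam = lam) (hlam : 0 < lam) {a : Arr} {i j : Expr} :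
    wp lam (setBit a i j) s Q ↔
      Q (2 * i.cost + 3 * j.cost + 10) (s.setB lam a (i.eval lam s) (j.eval lam s)) := by
  have hr := Nat.mod_lt (j.eval lam s) hlam
  simp only [setBit, wp_put, Mem.setB]
  simp [hl, hr]
  ring_nf

theorem wp_clearBit (hl : s.reg .lam = lam) (hlam : 0 < lam) {a : Arr} {i j : Expr} :
    wp lam (clearBit a i j) s Q ↔
      Q (3 * i.cost + 4 * j.cost + 14) (s.clearB lam a (i.eval lam s) (j.eval lam s)) := by
  have hr := Nat.mod_lt (j.eval lam s) hlam
  have h1 : 2 ^ (j.eval lam s % lam) % 2 ^ lam = 2 ^ (j.eval lam s % lam) :=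
    Nat.mod_eq_of_lt (Nat.pow_lt_pow_right (by norm_num) hr)
  simp only [clearBit, wp_put, Mem.clearB]
  simp [hl, hr, hasBit, Nat.and_two_pow]
  ring_nf
  cases Nat.testBit _ _ <;> simp [h1]

end SetBits

/-! ## The scans -/

section Lead

variable {lam x : ℕ}

theorem lead_eq_zero (h : Nat.size (x % 2 ^ lam) = 0) {r : ℕ} (hr : r < lam) :
    x.testBit r = false := by
  rw [Nat.size_eq_zero] at h
  have : (x % 2 ^ lam).testBit r = false := by rw [h]; simp
  simpa [Nat.testBit_mod_two_pow, hr] using this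

theorem lead_ne_zero (h : Nat.size (x % 2 ^ lam) ≠ 0) :
    Nat.size (x % 2 ^ lam) - 1 < lam ∧ x.testBit (Nat.size (x % 2 ^ lam) - 1) = true := by
  have := size_pos_testBit (a := x % 2 ^ lam) (fun h0 => h (by rw [h0]; rfl))
  simpa [Nat.testBit_mod_two_pow] using this

end Lead

/-- `deg` and `adj` are adjacency lists and `W` the bit vectors of the relation `E`, whose second
argument is less than `n`. -/
structure Adj (E : ℕ → ℕ → Prop) (lam n : ℕ) (deg adj W : ℕ → ℕ → ℕ) : Prop where
  mem : ∀ v k, k < deg v 0 → E v (adj v k)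
  ex : ∀ v b, E v b → ∃ k < deg v 0, adj v k = b
  inj : ∀ v k k', k < deg v 0 → k' < deg v 0 → adj v k = adj v k' → k = k'
  bit : ∀ v q r, r < lam → ((W v q).testBit r = true ↔ E v (q * lam + r))
  word : ∀ v q, W v q < 2 ^ lam
  lt : ∀ v b, E v b → b < n

/-- All nodes that the scan pointers have passed have a nonzero index. -/
structure ScanInv (E : ℕ → ℕ → Prop) (lam n : ℕ) (ptr deg adj idx wptr : ℕ → ℕ → ℕ) : Prop where
  le : ∀ v, ptr v 0 ≤ deg v 0
  passed : ∀ v k, k < ptr v 0 → idx (adj v k) 0 ≠ 0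
  wle : ∀ v, wptr v 0 * lam < n + lam
  wpassed : ∀ v b, E v b → b < wptr v 0 * lam → idx b 0 ≠ 0

/-- A node never leaves the `WT₂` branches, so whatever a pointer has passed stays useless; this is
why pointers are never reset. -/
theorem ScanInv.mono {E : ℕ → ℕ → Prop} {lam n : ℕ} {ptr deg adj idx idx' wptr : ℕ → ℕ → ℕ}
    (h : ScanInv E lam n ptr deg adj idx wptr) (hi : ∀ b, idx b 0 ≠ 0 → idx' b 0 ≠ 0) :
    ScanInv E lam n ptr deg adj idx' wptr :=
  ⟨h.le, fun v k hk => hi _ (h.passed v k hk), h.wle, fun v b hE hb => hi _ (h.wpassed v b hE hb)⟩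

/-- The effect of a scan from node `v` in memory `s`, ending in memory `s'` after `t` steps. -/
structure ScanPost (E : ℕ → ℕ → Prop) (lam n v : ℕ) (ptr deg adj idx wptr : Arr)
    (s : Mem) (t : ℕ) (s' : Mem) : Prop where
  inv : ScanInv E lam n (s'.arr ptr) (s.arr deg) (s.arr adj) (s.arr idx) (s'.arr wptr)
  other : ∀ w, w ≠ v → s'.arr ptr w 0 = s.arr ptr w 0
  wother : ∀ w, w ≠ v → s'.arr wptr w 0 = s.arr wptr w 0
  mono : s.arr ptr v 0 ≤ s'.arr ptr v 0
  -- List and words advance alternately, and the list moves first; so it can get ahead by one entry.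
  words : s.reg .uw ≠ 0 → s'.arr ptr v 0 + s.arr wptr v 0 ≤ s.arr ptr v 0 + s'.arr wptr v 0 + 1
  fail : s'.reg .res = 0 → ∀ b, E v b → s.arr idx b 0 ≠ 0
  succ : s'.reg .res ≠ 0 → E v (s'.reg .res - 1) ∧ s.arr idx (s'.reg .res - 1) 0 = 0
  -- Everything is charged to the list pointer, since each iteration except possibly the last one
  -- moves it, with or without words.
  time : t + 100 * s.arr ptr v 0 ≤ 100 * s'.arr ptr v 0 + 120


-- An exhausted list or an exhausted bit vector each prove that no singleton neighbour exists, so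
-- the scan may stop at whichever ends first.
set_option maxHeartbeats 1000000 in
theorem wp_scan {lam : ℕ} {E : ℕ → ℕ → Prop} {a n : Reg} {ptr deg adj idx wptr W used : Arr}
    (ha : ∀ r ∈ [Reg.res, .act, .ti, .tq, .tw, .tx], a ≠ r ∧ n ≠ r)
    (hA : ∀ A ∈ [deg, adj, idx, W, used], A ≠ ptr ∧ A ≠ wptr) (hp : ptr ≠ wptr)
    {s : Mem} {N : ℕ} (hn : s.reg n = N) (hl : s.reg .lam = lam)
    (hadj : Adj E lam N (s.arr deg) (s.arr adj) (s.arr W))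
    (hinv : ScanInv E lam N (s.arr ptr) (s.arr deg) (s.arr adj) (s.arr idx) (s.arr wptr))
    (hused : ∀ b, bitAt lam (s.arr used 0) b = true ↔ s.arr idx b 0 ≠ 0) :
    wp lam (scan a n ptr deg adj idx wptr W used) s
      (ScanPost E lam N (s.reg a) ptr deg adj idx wptr s) := by
  subst hn
  simp only [List.mem_cons, List.not_mem_nil, or_false, forall_eq_or_imp, forall_eq] at ha hA
  obtain ⟨⟨a1, n1⟩, ⟨a2, n2⟩, ⟨a3, n3⟩, ⟨a4, n4⟩, ⟨a5, n5⟩, a6, n6⟩ := ha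
  obtain ⟨⟨d1, d2⟩, ⟨e1, e2⟩, ⟨i1, i2⟩, ⟨w1, w2⟩, u1, u2⟩ := hA
  simp only [scan, ↓wp_seq, wp_assign]
  refine wp_while (fun t s' =>
    ScanInv E lam (s.reg n) (s'.arr ptr) (s.arr deg) (s.arr adj) (s.arr idx) (s'.arr wptr) ∧
    (∀ w, w ≠ s.reg a → s'.arr ptr w 0 = s.arr ptr w 0) ∧
    (∀ w, w ≠ s.reg a → s'.arr wptr w 0 = s.arr wptr w 0) ∧
    s.arr ptr (s.reg a) 0 ≤ s'.arr ptr (s.reg a) 0 ∧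
    ((s'.reg .act = 1 ∧ s'.reg .res = 0 ∧
      t + 100 * s.arr ptr (s.reg a) 0 ≤ 100 * s'.arr ptr (s.reg a) 0 ∧
      (s.reg .uw ≠ 0 → s'.arr ptr (s.reg a) 0 + s.arr wptr (s.reg a) 0 ≤
        s.arr ptr (s.reg a) 0 + s'.arr wptr (s.reg a) 0)) ∨
     (s'.reg .act = 0 ∧ t + 100 * s.arr ptr (s.reg a) 0 ≤ 100 * s'.arr ptr (s.reg a) 0 + 100 ∧
      (s.reg .uw ≠ 0 → s'.arr ptr (s.reg a) 0 + s.arr wptr (s.reg a) 0 ≤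
        s.arr ptr (s.reg a) 0 + s'.arr wptr (s.reg a) 0 + 1) ∧
      (s'.reg .res = 0 → ∀ b, E (s.reg a) b → s.arr idx b 0 ≠ 0) ∧
      (s'.reg .res ≠ 0 → E (s.reg a) (s'.reg .res - 1) ∧ s.arr idx (s'.reg .res - 1) 0 = 0))))
    -- The summand `act` covers the last iteration, which need not move the pointer.
    (fun s' => s.arr deg (s.reg a) 0 - s'.arr ptr (s.reg a) 0 + s'.reg .act) ?_ ?_ ?_
  · simp [hinv]
  · intro t s' F hI he
    obtain ⟨hinv', ho, hwo, hmono, hI⟩ := hI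
    simp only [Expr.eval] at he
    obtain ⟨hact, hres, ht, hw⟩ | h := hI
    swap
    · exact absurd h.1 he
    have fa : s'.reg a = s.reg a := (F.reg a (by simp [Cmd.modR, a1.symm, a2.symm, a3.symm, a4.symm, a5.symm, a6.symm])).trans (by simp [a1, a2])
    have fn : s'.reg n = s.reg n := (F.reg n (by simp [Cmd.modR, n1.symm, n2.symm, n3.symm, n4.symm, n5.symm, n6.symm])).trans (by simp [n1, n2])
    have fl : s'.reg .lam = lam := ((F.reg .lam (by simp [Cmd.modR])).trans (by simp)).trans hl
    have fu : s'.reg .uw = s.reg .uw := (F.reg .uw (by simp [Cmd.modR])).trans (by simp)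
    have f1 : s'.arr deg = s.arr deg := F.arr deg (by simp [Cmd.modA, d1.symm, d2.symm])
    have f2 : s'.arr adj = s.arr adj := F.arr adj (by simp [Cmd.modA, e1.symm, e2.symm])
    have f3 : s'.arr idx = s.arr idx := F.arr idx (by simp [Cmd.modA, i1.symm, i2.symm])
    have f4 : s'.arr W = s.arr W := F.arr W (by simp [Cmd.modA, w1.symm, w2.symm])
    have f5 : s'.arr used = s.arr used := F.arr used (by simp [Cmd.modA, u1.symm, u2.symm])
    clear F
    set v := s.reg a with hv
    have hle := hinv'.le v
    -- The truncation in the AND is void because the words of `W` have only `lam` bits.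
    have hword : (s.arr W v (s'.arr wptr v 0) &&& s.arr used 0 (s'.arr wptr v 0)) % 2 ^ lam =
        (s.arr W v (s'.arr wptr v 0) &&& s.arr used 0 (s'.arr wptr v 0)) :=
      Nat.mod_eq_of_lt (lt_of_le_of_lt Nat.and_le_left (hadj.word _ _))
    have hstep : s'.arr ptr v 0 < s.arr deg v 0 → s.arr idx (s.arr adj v (s'.arr ptr v 0)) 0 ≠ 0 →
        ScanInv E lam (s.reg n) (fun i j => if i = v ∧ j = 0 then s'.arr ptr v 0 + 1 else s'.arr ptr i j)
          (s.arr deg) (s.arr adj) (s.arr idx) (s'.arr wptr) := by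
      intro h1 h2
      refine ⟨fun w => ?_, fun w k hk => ?_, hinv'.wle, hinv'.wpassed⟩
      · by_cases hwv : w = v
        · subst hwv; simpa using h1
        · simpa [hwv] using hinv'.le w
      · by_cases hwv : w = v
        · subst hwv
          simp only [and_self, if_true] at hk
          rcases Nat.lt_succ_iff_lt_or_eq.1 hk with hk | rfl
          · exact hinv'.passed _ _ hk
          · exact h2
        · simp only [hwv, false_and, if_false] at hk; exact hinv'.passed _ _ hk
    have hall : s'.arr ptr v 0 = s.arr deg v 0 → ∀ b, E v b → s.arr idx b 0 ≠ 0 := by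
      intro h1 b hb
      obtain ⟨k, hk, rfl⟩ := hadj.ex v b hb
      exact hinv'.passed v k (h1 ▸ hk)
    simp only [↓wp_seq, wp_assign]
    rw [wp_ifte]
    simp only [Arr.el, Expr.ofNat_eq, Expr.eval, BinOp.eval, Mem.setReg_reg, Mem.setReg_arr, if_true, fa, fn, fl, fu,
      f1, f2, f3, f4, f5, a1, a2, a3, a4, a5, a6, n1, n2, n3, n4, n5, n6, if_false]
    by_cases hk : s'.arr ptr v 0 < s.arr deg v 0
    swap
    · have hk' : s'.arr ptr v 0 = s.arr deg v 0 := le_antisymm hle (not_lt.1 hk)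
      simp only [hk, ↓wp_assign, ↓wp_skip, ↓wp_ifte, if_false]
      simp [hres]
      exact ⟨⟨hinv', ho, hwo, hmono, by omega, fun h => by have := hw h; omega, hall hk'⟩, by omega⟩
    by_cases hi : s.arr idx (s.arr adj v (s'.arr ptr v 0)) 0 = 0
    · simp [hk, hi, ↓wp_assign, ↓wp_skip, ↓wp_seq, ↓wp_ifte, hact, f2, f3, fa, a1, a2, a3, a6]
      exact ⟨hinv', ho, hwo, hmono, by omega, fun h => by have := hw h; omega, hadj.mem _ _ hk⟩
    have hst := hstep hk hi
    have ho' : ∀ w, ¬ w = v → (if w = v then s'.arr ptr v 0 + 1 else s'.arr ptr w 0) = s.arr ptr w 0 :=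
      fun w h => by rw [if_neg h, ho w h]
    by_cases hu : s.reg .uw = 0
    · simp [hk, hi, ↓wp_assign, ↓wp_skip, ↓wp_seq, ↓wp_ifte, ↓wp_put, hact, f2, f3, fa, fu, a1, a2, a3, a6, hu,
        hp.symm]
      exact ⟨⟨hst, ho', hwo, by omega, hres, by omega⟩, by omega⟩
    by_cases hq : s'.arr wptr v 0 * lam < s.reg n
    swap
    -- The word pointer is beyond `N`, and so beyond every neighbour.
    · have hlast : ∀ b, E v b → s.arr idx b 0 ≠ 0 := fun b hb =>
        hinv'.wpassed v b hb (lt_of_lt_of_le (hadj.lt _ _ hb) (not_lt.1 hq))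
      simp [hk, hi, ↓wp_assign, ↓wp_skip, ↓wp_seq, ↓wp_ifte, ↓wp_put, hact, f2, f3, fa, fu, fl, fn,
        a1, a2, a3, a4, a6, n1, n3, n4, n6, hu, hp.symm, hq, not_lt.1 hq, hres]
      exact ⟨⟨hst, ho', hwo, by omega, by omega, by have := hw hu; omega, hlast⟩, by omega⟩
    by_cases hz : Nat.size ((s.arr W v (s'.arr wptr v 0) - (s.arr W v (s'.arr wptr v 0) &&&
        s.arr used 0 (s'.arr wptr v 0))) % 2 ^ lam) = 0
    · simp [hk, hi, ↓wp_assign, ↓wp_skip, ↓wp_seq, ↓wp_ifte, ↓wp_put, hact, f2, f3, f4, f5, fa, fu, fl, fn,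
        a1, a2, a3, a4, a5, a6, n1, n3, n4, n6, hu, hp, hp.symm, hq, hres, w1, u1, hword, hz]
      refine ⟨⟨⟨hst.1, hst.2, fun w => ?_, fun w b hb hb' => ?_⟩, ho', ?_, by omega, by omega,
        by have := hw hu; omega⟩, by omega⟩
      · by_cases hwv : w = v
        · subst hwv; simp [add_mul]; exact hq
        · simpa [hwv] using hinv'.wle w
      · by_cases hwv : w = v
        · subst hwv
          simp only [and_self, if_true, add_mul, one_mul] at hb'
          by_cases hb2 : b < s'.arr wptr v 0 * lam
          · exact hinv'.wpassed _ _ hb hb2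
          -- The remaining case is a neighbour in the word just read. Its bit vanished when the used
          -- nodes were removed, so it is used.
          obtain ⟨r, rfl⟩ := Nat.exists_eq_add_of_le (not_lt.1 hb2)
          have hr : r < lam := by omega
          have h1 := lead_eq_zero hz hr
          rw [testBit_sub_and, (hadj.bit _ _ _ hr).2 hb] at h1
          rw [← hused, bitAt_mul_add _ hr]
          simpa using h1
        · simp only [hwv, false_and, if_false] at hb'; exact hinv'.wpassed _ _ hb hb'
      · intro w h; rw [if_neg h, hwo w h]
    · obtain ⟨h1, h2⟩ := lead_ne_zero hz
      simp [hk, hi, ↓wp_assign, ↓wp_skip, ↓wp_seq, ↓wp_ifte, ↓wp_put, hact, f2, f3, f4, f5, fa, fu, fl, fn,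
        a1, a2, a3, a4, a5, a6, n1, n3, n4, n6, hu, hp, hp.symm, hq, hres, w1, u1, hword, hz]
      rw [testBit_sub_and, Bool.and_eq_true, hadj.bit _ _ _ h1] at h2
      refine ⟨⟨hst, ho', hwo, by omega, by omega, by have := hw hu; omega, ?_⟩, by omega⟩
      rw [Nat.add_sub_assoc (by omega)]
      refine ⟨h2.1, ?_⟩
      have h3 := h2.2
      by_contra h4
      rw [← Ne, ← hused, bitAt_mul_add _ h1] at h4
      simp [h4] at h3
  · rintro t s' F ⟨h1, h2, h3, h4, h5⟩ he
    simp only [Expr.eval] at he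
    obtain ⟨h, _⟩ | ⟨h6, h7, h8, h9, h10⟩ := h5
    · omega
    · refine ⟨h1, h2, h3, h4, h8, h9, h10, ?_⟩
      simp only [Expr.cost, Expr.ofNat_eq]
      omega

/-! ## Agreement of memories -/

/-- The memories agree on the given registers and arrays. -/
def Agree (R : List Reg) (A : List Arr) (s s' : Mem) : Prop :=
  (∀ r ∈ R, s'.reg r = s.reg r) ∧ ∀ a ∈ A, s'.arr a = s.arr a

/-- The side condition is a finite syntactic check, evaluated anew at each use. -/
theorem Frame.agree {c : Cmd} {s s' : Mem} (F : Frame c s s') {R : List Reg} {A : List Arr}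
    (h : (R.all (fun r => !c.modR r) && A.all (fun a => !c.modA a)) = true := by decide) :
    Agree R A s s' := by
  simp only [Bool.and_eq_true, List.all_eq_true, Bool.not_eq_true'] at h
  exact ⟨fun r hr => F.reg r (h.1 r hr), fun a ha => F.arr a (h.2 a ha)⟩

theorem Frame.r {c : Cmd} {s s' : Mem} (F : Frame c s s') (r : Reg)
    (h : c.modR r = false := by decide) : s'.reg r = s.reg r := F.reg r h

theorem Frame.a {c : Cmd} {s s' : Mem} (F : Frame c s s') (A : Arr)
    (h : c.modA A = false := by decide) : s'.arr A = s.arr A := F.arr A h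

/-! ## The basic invariants -/

section Base

variable {n₁ n₂ : ℕ} (G : BipGraph n₁ n₂) (lam : ℕ)

/-- The input is intact. -/
structure Static (s : Mem) : Prop where
  n1 : s.reg .n1 = n₁
  n2 : s.reg .n2 = n₂
  word : s.reg .lam = lam
  adj1 : Adj G.edgeNat lam n₂ (s.arr .outDeg) (s.arr .outAdj) (s.arr .outW)
  adj2 : Adj (flip G.edgeNat) lam n₁ (s.arr .inDeg) (s.arr .inAdj) (s.arr .inW)
  sum1 : ∑ v ∈ Finset.range n₁, s.arr .outDeg v 0 = G.m
  sum2 : ∑ b ∈ Finset.range n₂, s.arr .inDeg b 0 = G.m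

/-- The nodes in `WT₂` branches are numbered, and the bit vectors are correct. -/
structure Nodes (s : Mem) : Prop where
  idx1_node1 : ∀ j < s.reg .K, s.arr .idx1 (s.arr .node1 j 0) 0 = j + 1
  idx1_le : ∀ v, s.arr .idx1 v 0 ≤ s.reg .K
  node1_idx1 : ∀ v, s.arr .idx1 v 0 ≠ 0 → s.arr .node1 (s.arr .idx1 v 0 - 1) 0 = v
  node1_lt : ∀ j < s.reg .K, s.arr .node1 j 0 < n₁
  idx2_node2 : ∀ j < s.reg .K, s.arr .idx2 (s.arr .node2 j 0) 0 = j + 1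
  idx2_le : ∀ v, s.arr .idx2 v 0 ≤ s.reg .K
  node2_idx2 : ∀ v, s.arr .idx2 v 0 ≠ 0 → s.arr .node2 (s.arr .idx2 v 0 - 1) 0 = v
  node2_lt : ∀ j < s.reg .K, s.arr .node2 j 0 < n₂
  used1 : ∀ v, bitAt lam (s.arr .used1 0) v = true ↔ s.arr .idx1 v 0 ≠ 0
  used2 : ∀ v, bitAt lam (s.arr .used2 0) v = true ↔ s.arr .idx2 v 0 ≠ 0
  subOut : ∀ i j, bitAt lam (s.arr .subOut i) j = true ↔
    i < s.reg .K ∧ j < s.reg .K ∧ G.edgeNat (s.arr .node1 i 0) (s.arr .node2 j 0)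
  subIn : ∀ i j, bitAt lam (s.arr .subIn j) i = true ↔
    i < s.reg .K ∧ j < s.reg .K ∧ G.edgeNat (s.arr .node1 i 0) (s.arr .node2 j 0)

/-- The scan pointers are correct. -/
structure Scans (s : Mem) : Prop where
  scan1 : ScanInv G.edgeNat lam n₂ (s.arr .outPtr) (s.arr .outDeg) (s.arr .outAdj) (s.arr .idx2)
    (s.arr .outWPtr)
  scan2 : ScanInv (flip G.edgeNat) lam n₁ (s.arr .inPtr) (s.arr .inDeg) (s.arr .inAdj) (s.arr .idx1)
    (s.arr .inWPtr)
  -- A node that is still unmatched was scanned at most once, by the greedy phase with words. Its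
  -- word pointer is at most `n₂ / lam + 1`, and its list pointer is ahead by at most one.
  ptr1 : ∀ v, s.arr .idx1 v 0 = 0 → s.arr .outPtr v 0 ≤ n₂ / lam + 2
  -- The scans on the `V₂` side start from roots of `WT₂` branches only.
  ptr2 : ∀ b, s.arr .idx2 b 0 = 0 → s.arr .inPtr b 0 = 0

structure Base (s : Mem) : Prop where
  static : Static G lam s
  nodes : Nodes G lam s
  scans : Scans G lam s

/-- The potential that pays for the scans and for the creation of branches. -/
def pot (n₁ n₂ : ℕ) (s : Mem) : ℕ :=
  100 * (∑ v ∈ Finset.range n₁, s.arr .outPtr v 0 + ∑ b ∈ Finset.range n₂, s.arr .inPtr b 0)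
    + 1000 * s.reg .K ^ 2

variable {G lam} {s s' : Mem}

theorem Static.congr (h : Static G lam s)
    (H : Agree [.n1, .n2, .lam] [.outDeg, .outAdj, .inDeg, .inAdj, .outW, .inW] s s') :
    Static G lam s' := by
  obtain ⟨h1, h2⟩ := H
  simp only [List.mem_cons, List.not_mem_nil, or_false, forall_eq_or_imp, forall_eq] at h1 h2
  obtain ⟨r1, r2, r3⟩ := h1
  obtain ⟨a1, a2, a3, a4, a5, a6⟩ := h2
  constructor <;> simp only [r1, r2, r3, a1, a2, a3, a4, a5, a6]
  exacts [h.n1, h.n2, h.word, h.adj1, h.adj2, h.sum1, h.sum2]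

theorem Nodes.congr (h : Nodes G lam s)
    (H : Agree [.K] [.node1, .node2, .idx1, .idx2, .used1, .used2, .subOut, .subIn] s s') :
    Nodes G lam s' := by
  obtain ⟨h1, h2⟩ := H
  simp only [List.mem_cons, List.not_mem_nil, or_false, forall_eq_or_imp, forall_eq] at h1 h2
  obtain ⟨a1, a2, a3, a4, a5, a6, a7, a8⟩ := h2
  constructor <;> simp only [h1, a1, a2, a3, a4, a5, a6, a7, a8]
  exacts [h.1, h.2, h.3, h.4, h.5, h.6, h.7, h.8, h.9, h.10, h.11, h.12]

theorem Scans.congr (h : Scans G lam s)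
    (H : Agree [] [.outPtr, .outDeg, .outAdj, .idx2, .outWPtr, .inPtr, .inDeg, .inAdj, .idx1, .inWPtr]
      s s') : Scans G lam s' := by
  obtain ⟨h1, h2⟩ := H
  simp only [List.mem_cons, List.not_mem_nil, or_false, forall_eq_or_imp, forall_eq] at h1 h2
  obtain ⟨a1, a2, a3, a4, a5, a6, a7, a8, a9, a10⟩ := h2
  constructor <;> simp only [h1, a1, a2, a3, a4, a5, a6, a7, a8, a9, a10]
  exacts [h.1, h.2, h.3, h.4]

theorem Agree.mono {R R' : List Reg} {A A' : List Arr} (h : Agree R A s s')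
    (hs : (R'.all (fun r => r ∈ R) && A'.all (fun a => a ∈ A)) = true := by decide) :
    Agree R' A' s s' := by
  simp only [Bool.and_eq_true, List.all_eq_true, decide_eq_true_eq] at hs
  exact ⟨fun r hr => h.1 r (hs.1 r hr), fun a ha => h.2 a (hs.2 a ha)⟩

theorem Base.congr (h : Base G lam s)
    (H : Agree [.n1, .n2, .lam, .K] [.outDeg, .outAdj, .inDeg, .inAdj, .outW, .inW, .node1, .node2, .idx1,
      .idx2, .used1, .used2, .subOut, .subIn, .outPtr, .outWPtr, .inPtr, .inWPtr] s s') :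
    Base G lam s' :=
  ⟨h.static.congr H.mono, h.nodes.congr H.mono, h.scans.congr H.mono⟩

theorem pot_congr (H : Agree [.K] [.outPtr, .inPtr] s s') : pot n₁ n₂ s' = pot n₁ n₂ s := by
  obtain ⟨h1, h2⟩ := H
  simp only [List.mem_cons, List.not_mem_nil, or_false, forall_eq_or_imp, forall_eq] at h1 h2
  simp only [pot, h1, h2.1, h2.2]

@[simp] theorem pot_setReg (r : Reg) (a : ℕ) (h : (Reg.K = r) = False) :
    pot n₁ n₂ (s.setReg r a) = pot n₁ n₂ s :=
  pot_congr (by simp [Agree, h])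

@[simp] theorem pot_setCell (A : Arr) (i j a : ℕ) (h1 : (Arr.outPtr = A) = False)
    (h2 : (Arr.inPtr = A) = False) : pot n₁ n₂ (s.setCell A i j a) = pot n₁ n₂ s :=
  pot_congr (by simp [Agree, h1, h2])

@[simp] theorem pot_setB (A : Arr) (i j : ℕ) (h1 : (Arr.outPtr = A) = False)
    (h2 : (Arr.inPtr = A) = False) : pot n₁ n₂ (s.setB lam A i j) = pot n₁ n₂ s :=
  pot_congr (by simp [Agree, h1, h2])

theorem Adj.bitAt {E : ℕ → ℕ → Prop} {n : ℕ} {deg adj W : ℕ → ℕ → ℕ} (h : Adj E lam n deg adj W)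
    (hlam : 0 < lam) (v b : ℕ) : bitAt lam (W v) b = true ↔ E v b := by
  have := h.bit v (b / lam) (b % lam) (Nat.mod_lt _ hlam)
  rwa [Nat.div_add_mod'] at this

theorem sum_update_le {n v : ℕ} {f g : ℕ → ℕ} (hv : v < n) (hg : ∀ w, w ≠ v → g w = f w)
    (hm : f v ≤ g v) :
    ∑ w ∈ Finset.range n, g w = ∑ w ∈ Finset.range n, f w + (g v - f v) := by
  have hv' : v ∈ Finset.range n := Finset.mem_range.2 hv
  have h1 : ∑ w ∈ (Finset.range n).erase v, g w = ∑ w ∈ (Finset.range n).erase v, f w :=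
    Finset.sum_congr rfl fun w hw => hg w (Finset.ne_of_mem_erase hw)
  rw [← Finset.add_sum_erase _ g hv', ← Finset.add_sum_erase _ f hv', h1]
  omega

/-- The alternative in `hp` protects the bound `ptr1`: either the node is matched and the bound does
not apply, or this is its first scan and words keep the list pointer short. -/
theorem wp_findFree (hlam : 0 < lam) (hB : Base G lam s) (hv : s.reg .fv < n₁)
    (hp : s.arr .idx1 (s.reg .fv) 0 ≠ 0 ∨
      (s.reg .uw ≠ 0 ∧ s.arr .outPtr (s.reg .fv) 0 = 0 ∧ s.arr .outWPtr (s.reg .fv) 0 = 0)) :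
    wp lam findFree s (fun t s' => Base G lam s' ∧
      (s'.reg .res = 0 → ∀ b, G.edgeNat (s.reg .fv) b → s.arr .idx2 b 0 ≠ 0) ∧
      (s'.reg .res ≠ 0 → G.edgeNat (s.reg .fv) (s'.reg .res - 1) ∧ s.arr .idx2 (s'.reg .res - 1) 0 = 0) ∧
      (∀ w, w ≠ s.reg .fv → s'.arr .outPtr w 0 = s.arr .outPtr w 0) ∧
      (∀ w, w ≠ s.reg .fv → s'.arr .outWPtr w 0 = s.arr .outWPtr w 0) ∧
      t + pot n₁ n₂ s ≤ pot n₁ n₂ s' + 120) := by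
  have hsc := hB.scans.scan1
  have hst := hB.static.adj1
  refine wp_call (wp_scan (by decide) (by decide) (by decide) hB.static.n2 hB.static.word hst hsc hB.nodes.used2) ?_
  intro t s' F h
  have F : Frame findFree s s' := F
  have hinv := h.inv
  refine ⟨⟨hB.static.congr F.agree, hB.nodes.congr F.agree, ?_⟩, h.fail, h.succ, h.other, h.wother, ?_⟩
  · constructor
    · rw [F.a .outDeg, F.a .outAdj, F.a .idx2]; exact hinv
    · rw [F.a .inDeg, F.a .inAdj, F.a .idx1, F.a .inPtr, F.a .inWPtr]; exact hB.scans.scan2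
    · intro v hv0
      rw [F.a .idx1] at hv0
      by_cases hvv : v = s.reg .fv
      · subst hvv
        rcases hp with hp | ⟨h1, h2, h3⟩
        · exact absurd hv0 hp
        · have h4 := h.words h1
          have h5 := hinv.wle (s.reg .fv)
          -- From `wptr * lam < n₂ + lam` and `n₂ < (n₂ / lam + 1) * lam`.
          have h6 : s'.arr .outWPtr (s.reg .fv) 0 < n₂ / lam + 1 + 1 := by
            have : n₂ < (n₂ / lam + 1) * lam := by
              rw [mul_comm]; exact Nat.lt_mul_div_succ n₂ hlam
            have h7 : s'.arr .outWPtr (s.reg .fv) 0 * lam < (n₂ / lam + 1 + 1) * lam := by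
              rw [add_mul _ 1 lam]; omega
            exact lt_of_mul_lt_mul_right h7 (Nat.zero_le _)
          omega
      · rw [h.other v hvv]; exact hB.scans.ptr1 v hv0
    · rw [F.a .idx2, F.a .inPtr]; exact hB.scans.ptr2
  · have := sum_update_le (f := fun w => s.arr .outPtr w 0) (g := fun w => s'.arr .outPtr w 0)
      hv h.other h.mono
    have h1 := h.time
    have h2 := h.mono
    simp only [pot, F.a .inPtr, F.r .K] at this ⊢
    omega

theorem wp_findStrong (hB : Base G lam s) (hv : s.reg .fb < n₂)
    (hp : s.arr .idx2 (s.reg .fb) 0 ≠ 0) :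
    wp lam findStrong s (fun t s' => Base G lam s' ∧
      (s'.reg .res = 0 → ∀ v, G.edgeNat v (s.reg .fb) → s.arr .idx1 v 0 ≠ 0) ∧
      (s'.reg .res ≠ 0 → G.edgeNat (s'.reg .res - 1) (s.reg .fb) ∧ s.arr .idx1 (s'.reg .res - 1) 0 = 0) ∧
      t + pot n₁ n₂ s ≤ pot n₁ n₂ s' + 120) := by
  have hsc := hB.scans.scan2
  have hst := hB.static.adj2
  refine wp_call (wp_scan (by decide) (by decide) (by decide) hB.static.n1 hB.static.word hst hsc hB.nodes.used1) ?_
  intro t s' F h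
  have F : Frame findStrong s s' := F
  have hinv := h.inv
  refine ⟨⟨hB.static.congr F.agree, hB.nodes.congr F.agree, ?_⟩, h.fail, h.succ, ?_⟩
  · constructor
    · rw [F.a .outDeg, F.a .outAdj, F.a .idx2, F.a .outPtr, F.a .outWPtr]; exact hB.scans.scan1
    · rw [F.a .inDeg, F.a .inAdj, F.a .idx1]; exact hinv
    · rw [F.a .idx1, F.a .outPtr]; exact hB.scans.ptr1
    · intro v hv0
      rw [F.a .idx2] at hv0
      rw [h.other v (by rintro rfl; exact hp hv0)]
      exact hB.scans.ptr2 v hv0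
  · have := sum_update_le (f := fun w => s.arr .inPtr w 0) (g := fun w => s'.arr .inPtr w 0)
      hv h.other h.mono
    have h1 := h.time
    have h2 := h.mono
    simp only [pot, F.a .outPtr, F.r .K] at this ⊢
    omega

end Base

/-! ## Creation of branches and the greedy initialization -/

theorem wp_ifte_hasBit {lam : ℕ} {s : Mem} {Q : ℕ → Mem → Prop} (hl : s.reg .lam = lam)
    (hlam : 0 < lam) {a : Arr} {i j : Expr} {c c' : Cmd} :
    wp lam (.ifte (hasBit a i j) c c') s Q ↔
      (bitAt lam (s.arr a (i.eval lam s)) (j.eval lam s) = true →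
        wp lam c s (fun t s' => Q (i.cost + 2 * j.cost + 8 + t) s')) ∧
      (¬ bitAt lam (s.arr a (i.eval lam s)) (j.eval lam s) = true →
        wp lam c' s (fun t s' => Q (i.cost + 2 * j.cost + 8 + t) s')) := by
  have hc : (hasBit a i j).cost + 1 = i.cost + 2 * j.cost + 8 := by
    simp [hasBit]; omega
  rw [wp_ifte, hc, eval_hasBit_ne hl hlam, ← eval_hasBit_ne hl hlam, not_not]

section Greedy

variable {n₁ n₂ : ℕ} {G : BipGraph n₁ n₂} {lam : ℕ} {s : Mem}

-- The new row and column take time linear in `K`, which the growth of `1000 * K ^ 2` in the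
-- potential pays for.
set_option maxHeartbeats 1000000 in
theorem wp_addNodes (hlam : 0 < lam) (hB : Base G lam s) (hv : s.reg .nv < n₁) (hb : s.reg .nb < n₂)
    (hv0 : s.arr .idx1 (s.reg .nv) 0 = 0) (hb0 : s.arr .idx2 (s.reg .nb) 0 = 0) :
    wp lam addNodes s (fun t s' => Base G lam s' ∧ s'.reg .K = s.reg .K + 1 ∧
      (∀ j, s'.arr .node1 j 0 = if j = s.reg .K then s.reg .nv else s.arr .node1 j 0) ∧
      (∀ j, s'.arr .node2 j 0 = if j = s.reg .K then s.reg .nb else s.arr .node2 j 0) ∧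
      (∀ v, s'.arr .idx1 v 0 = if v = s.reg .nv then s.reg .K + 1 else s.arr .idx1 v 0) ∧
      (∀ b, s'.arr .idx2 b 0 = if b = s.reg .nb then s.reg .K + 1 else s.arr .idx2 b 0) ∧
      t + pot n₁ n₂ s ≤ pot n₁ n₂ s' + 200) := by
  obtain ⟨hSt, hN, hSc⟩ := hB
  have hl := hSt.word
  set K := s.reg .K with hK
  set nv := s.reg .nv with hnv
  set nb := s.reg .nb with hnb
  have key : wp lam addNodes s (fun t s' => s'.reg .K = K + 1 ∧
      s'.arr .node1 = (fun i j => if i = K ∧ j = 0 then nv else s.arr .node1 i j) ∧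
      s'.arr .node2 = (fun i j => if i = K ∧ j = 0 then nb else s.arr .node2 i j) ∧
      s'.arr .idx1 = (fun i j => if i = nv ∧ j = 0 then K + 1 else s.arr .idx1 i j) ∧
      s'.arr .idx2 = (fun i j => if i = nb ∧ j = 0 then K + 1 else s.arr .idx2 i j) ∧
      (∀ v, bitAt lam (s'.arr .used1 0) v = (decide (v = nv) || bitAt lam (s.arr .used1 0) v)) ∧
      (∀ v, bitAt lam (s'.arr .used2 0) v = (decide (v = nb) || bitAt lam (s.arr .used2 0) v)) ∧
      (∀ i j, bitAt lam (s'.arr .subOut i) j = true ↔ G.edgeNat (s'.arr .node1 i 0) (s'.arr .node2 j 0) ∧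
        i < K + 1 ∧ j < K + 1) ∧
      (∀ i j, bitAt lam (s'.arr .subIn j) i = true ↔ G.edgeNat (s'.arr .node1 i 0) (s'.arr .node2 j 0) ∧
        i < K + 1 ∧ j < K + 1) ∧
      t ≤ 200 * (K + 1) + 80) := by
    simp only [addNodes, ↓wp_seq, ↓wp_put]
    rw [wp_setBit (by simp [hl]) hlam]
    simp only [Expr.ofNat_eq, Expr.eval, wp_seq (c := setBit _ _ _)]
    rw [wp_setBit (by simp [hl]) hlam]
    simp only [Expr.ofNat_eq, Expr.eval, wp_assign]
    generalize hS : Mem.setReg _ _ _ = S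
    have eK : S.reg .K = K := by rw [← hS]; simp [hK]
    have env : S.reg .nv = nv := by rw [← hS]; simp [hnv]
    have enb : S.reg .nb = nb := by rw [← hS]; simp [hnb]
    have el : S.reg .lam = lam := by rw [← hS]; simp [hl]
    have eaj : S.reg .aj = 0 := by rw [← hS]; simp
    have en1 : S.arr .node1 = (fun i j => if i = K ∧ j = 0 then nv else s.arr .node1 i j) := by
      rw [← hS]; simp [hK, hnv]
    have en2 : S.arr .node2 = (fun i j => if i = K ∧ j = 0 then nb else s.arr .node2 i j) := by
      rw [← hS]; simp [hK, hnb]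
    have ei1 : S.arr .idx1 = (fun i j => if i = nv ∧ j = 0 then K + 1 else s.arr .idx1 i j) := by
      rw [← hS]; simp [hK, hnv]
    have ei2 : S.arr .idx2 = (fun i j => if i = nb ∧ j = 0 then K + 1 else s.arr .idx2 i j) := by
      rw [← hS]; simp [hK, hnb]
    have eu1 : ∀ v, bitAt lam (S.arr .used1 0) v = (decide (v = nv) || bitAt lam (s.arr .used1 0) v) := by
      rw [← hS]; intro v; simp [bitAt_setB _ hlam, hnv]
    have eu2 : ∀ v, bitAt lam (S.arr .used2 0) v = (decide (v = nb) || bitAt lam (s.arr .used2 0) v) := by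
      rw [← hS]; intro v; simp [bitAt_setB _ hlam, hnb]
    have eso : S.arr .subOut = s.arr .subOut := by rw [← hS]; simp
    have esi : S.arr .subIn = s.arr .subIn := by rw [← hS]; simp
    have eW : S.arr .outW = s.arr .outW := by rw [← hS]; simp
    clear hS
    -- Entries below `K` refer to the same nodes as before; only the row and the column with number
    -- `K` are new.
    have old : ∀ i j, i < K → j < K → (G.edgeNat (s.arr .node1 i 0) (s.arr .node2 j 0) ↔
        G.edgeNat (S.arr .node1 i 0) (S.arr .node2 j 0)) := by
      intro i j hi hj; rw [en1, en2]; simp [hi.ne, hj.ne]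
    refine wp_while (fun t s' => s'.reg .aj ≤ K + 1 ∧ t ≤ 200 * s'.reg .aj ∧
        (∀ i j, bitAt lam (s'.arr .subOut i) j = true ↔ G.edgeNat (S.arr .node1 i 0) (S.arr .node2 j 0) ∧
          ((i < K ∧ j < K) ∨ (i = K ∧ j < s'.reg .aj) ∨ (j = K ∧ i < s'.reg .aj))) ∧
        (∀ i j, bitAt lam (s'.arr .subIn j) i = true ↔ G.edgeNat (S.arr .node1 i 0) (S.arr .node2 j 0) ∧
          ((i < K ∧ j < K) ∨ (i = K ∧ j < s'.reg .aj) ∨ (j = K ∧ i < s'.reg .aj))))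
      (fun s' => K + 1 - s'.reg .aj) ?_ ?_ ?_
    · refine ⟨by omega, by omega, fun i j => ?_, fun i j => ?_⟩
      · rw [eso, hN.subOut, eaj]
        by_cases h : i < K ∧ j < K
        · simp [h, ← old i j h.1 h.2, ← hK]
        · simp only [← hK]; constructor
          · rintro ⟨h1, h2, _⟩; exact absurd ⟨h1, h2⟩ h
          · rintro ⟨_, h1⟩; omega
      · rw [esi, hN.subIn, eaj]
        by_cases h : i < K ∧ j < K
        · simp [h, ← old i j h.1 h.2, ← hK]
        · simp only [← hK]; constructor
          · rintro ⟨h1, h2, _⟩; exact absurd ⟨h1, h2⟩ h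
          · rintro ⟨_, h1⟩; omega
    · rintro t s' F ⟨h1, h2, h3, h4⟩ he
      have fK : s'.reg .K = K := (F.r .K).trans eK
      have fl : s'.reg .lam = lam := (F.r .lam).trans el
      have fnv : s'.reg .nv = nv := (F.r .nv).trans env
      have fnb : s'.reg .nb = nb := (F.r .nb).trans enb
      have f1 := F.a .node1
      have f2 := F.a .node2
      have fW : s'.arr .outW = s.arr .outW := (F.a .outW).trans eW
      have hlt : s'.reg .aj < K + 1 := by simpa [fK] using he
      clear F he
      have nK1 : S.arr .node1 K 0 = nv := by rw [en1]; simp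
      have nK2 : S.arr .node2 K 0 = nb := by rw [en2]; simp
      -- Iteration `aj` contributes exactly the pairs `(K, aj)` and `(aj, K)`, which coincide when
      -- `aj = K`.
      have step : ∀ i j, (G.edgeNat (S.arr .node1 i 0) (S.arr .node2 j 0) ∧
          ((i < K ∧ j < K) ∨ (i = K ∧ j ≤ s'.reg .aj) ∨ (j = K ∧ i ≤ s'.reg .aj))) ↔
          ((G.edgeNat (S.arr .node1 i 0) (S.arr .node2 j 0) ∧
          ((i < K ∧ j < K) ∨ (i = K ∧ j < s'.reg .aj) ∨ (j = K ∧ i < s'.reg .aj))) ∨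
          (i = K ∧ j = s'.reg .aj ∧ G.edgeNat nv (S.arr .node2 (s'.reg .aj) 0)) ∨
          (i = s'.reg .aj ∧ j = K ∧ G.edgeNat (S.arr .node1 (s'.reg .aj) 0) nb)) := by
        intro i j
        constructor
        · rintro ⟨hE, h | ⟨rfl, h⟩ | ⟨rfl, h⟩⟩
          · exact Or.inl ⟨hE, Or.inl h⟩
          · rcases lt_or_eq_of_le h with h | rfl
            · exact Or.inl ⟨hE, Or.inr (Or.inl ⟨rfl, h⟩)⟩
            · exact Or.inr (Or.inl ⟨rfl, rfl, nK1 ▸ hE⟩)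
          · rcases lt_or_eq_of_le h with h | rfl
            · exact Or.inl ⟨hE, Or.inr (Or.inr ⟨rfl, h⟩)⟩
            · exact Or.inr (Or.inr ⟨rfl, rfl, nK2 ▸ hE⟩)
        · rintro (⟨hE, h⟩ | ⟨rfl, rfl, hE⟩ | ⟨rfl, rfl, hE⟩)
          · exact ⟨hE, by omega⟩
          · exact ⟨nK1.symm ▸ hE, by omega⟩
          · exact ⟨nK2.symm ▸ hE, by omega⟩
      have hb1 := hSt.adj1.bitAt hlam nv (S.arr .node2 (s'.reg .aj) 0)
      have hb2 := hSt.adj1.bitAt hlam (S.arr .node1 (s'.reg .aj) 0) nb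
      rw [wp_seq, wp_ifte_hasBit fl hlam]
      simp only [Expr.eval, Arr.el, Expr.ofNat_eq, fnv, fW, f2, hb1]
      -- The second test and the increment, treated once for both outcomes of the first test, whose
      -- cost is at most 60.
      have fin1 : ∀ (S' : Mem), (∀ i j, bitAt lam (S'.arr .subOut i) j = true ↔
          ((i = K ∧ j = s'.reg .aj ∧ G.edgeNat nv (S.arr .node2 (s'.reg .aj) 0)) ∨
            bitAt lam (s'.arr .subOut i) j = true)) →
          (∀ i j, bitAt lam (S'.arr .subIn j) i = true ↔
          ((i = K ∧ j = s'.reg .aj ∧ G.edgeNat nv (S.arr .node2 (s'.reg .aj) 0)) ∨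
            bitAt lam (s'.arr .subIn j) i = true)) → S'.reg = s'.reg → S'.arr .node1 = S.arr .node1 →
          S'.arr .outW = s.arr .outW → ∀ t', t' ≤ 60 →
          wp lam (.seq (.ifte (hasBit .outW (.cell .node1 (.reg .aj) (.lit 0)) (.reg .nb))
            (.seq (setBit .subOut (.reg .aj) (.reg .K)) (setBit .subIn (.reg .K) (.reg .aj))) .skip)
            (incr .aj)) S' (fun t'' s'' => (s''.reg .aj ≤ K + 1 ∧
            t + ((Expr.bin BinOp.lt (.reg .aj) (.bin .add (.reg .K) (.lit 1))).cost + 1 + (t' + t'')) ≤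
              200 * s''.reg .aj ∧
            (∀ i j, bitAt lam (s''.arr .subOut i) j = true ↔
              G.edgeNat (S.arr .node1 i 0) (S.arr .node2 j 0) ∧
              ((i < K ∧ j < K) ∨ (i = K ∧ j < s''.reg .aj) ∨ (j = K ∧ i < s''.reg .aj))) ∧
            (∀ i j, bitAt lam (s''.arr .subIn j) i = true ↔
              G.edgeNat (S.arr .node1 i 0) (S.arr .node2 j 0) ∧
              ((i < K ∧ j < K) ∨ (i = K ∧ j < s''.reg .aj) ∨ (j = K ∧ i < s''.reg .aj)))) ∧
            K + 1 - s''.reg .aj < K + 1 - s'.reg .aj) := by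
        intro S' g1 g2 g3 g4 g5 t' ht'
        rw [wp_seq, wp_ifte_hasBit (by rw [g3, fl]) hlam]
        simp only [Expr.eval, g3, g4, g5, fnb, hb2]
        refine ⟨fun hE => ?_, fun hE => ?_⟩
        · rw [wp_seq, wp_setBit (by rw [g3, fl]) hlam, wp_setBit (by simp [g3, fl]) hlam]
          simp [wp_assign, g3, fK]
          refine ⟨⟨by omega, by omega, fun i j => ?_, fun i j => ?_⟩, by omega⟩
          · rw [step, ← h3 i j, bitAt_setB _ hlam, Bool.or_eq_true, g1]
            simp [hE]; tauto
          · rw [step, ← h4 i j, bitAt_setB _ hlam, Mem.setB_arr_other _ _ _ _ _ (by simp), Bool.or_eq_true, g2]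
            simp [hE]; tauto
        · simp [wp_skip, wp_assign, g3, fK]
          refine ⟨⟨by omega, by omega, fun i j => ?_, fun i j => ?_⟩, by omega⟩
          · rw [step, ← h3 i j, g1]
            simp [hE]; tauto
          · rw [step, ← h4 i j, g2]
            simp [hE]; tauto
      refine ⟨fun hE => ?_, fun hE => ?_⟩
      · rw [wp_seq, wp_setBit fl hlam, wp_setBit (s := Mem.setB _ _ _ _ _) fl hlam]
        refine fin1 _ (fun i j => ?_) (fun i j => ?_) ?_ ?_ ?_ _ ?_
        · rw [Mem.setB_arr_other _ _ _ _ _ (by simp), bitAt_setB _ hlam]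
          simp [hE, fK]
        · rw [bitAt_setB _ hlam, Mem.setB_arr_other _ _ _ _ _ (by simp)]
          simp [hE, fK, and_comm]
        · rfl
        · simp [f1]
        · simp [fW]
        · simp
      · rw [wp_skip]
        refine fin1 _ (fun i j => ?_) (fun i j => ?_) rfl f1 fW _ ?_
        · simp [hE]
        · simp [hE]
        · simp
    · rintro t s' F ⟨h1, h2, h3, h4⟩ he
      have fK : s'.reg .K = K := (F.r .K).trans eK
      have haj : s'.reg .aj = K + 1 := by
        simp [fK] at he; omega
      simp only [incr, wp_assign, Mem.setReg_arr, F.a .node1, F.a .node2, F.a .idx1, F.a .idx2, F.a .used1,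
        F.a .used2]
      refine ⟨by simp [fK], en1, en2, ei1, ei2, eu1, eu2, fun i j => ?_, fun i j => ?_, ?_⟩
      · rw [h3, haj]
        constructor <;> rintro ⟨h, h'⟩ <;> exact ⟨h, by omega⟩
      · rw [h4, haj]
        constructor <;> rintro ⟨h, h'⟩ <;> exact ⟨h, by omega⟩
      · simp; omega
  refine wp_call key fun t s' F ⟨rK, r1, r2, r3, r4, r5, r6, r7, r8, rt⟩ => ?_
  -- Numbered nodes have a nonzero index, and that of `nv` is zero.
  have fresh1 : ∀ j < K, s.arr .node1 j 0 ≠ nv := fun j hj h => by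
    have := hN.idx1_node1 j hj; rw [h, hv0] at this; omega
  have fresh2 : ∀ j < K, s.arr .node2 j 0 ≠ nb := fun j hj h => by
    have := hN.idx2_node2 j hj; rw [h, hb0] at this; omega
  have hle1 := hN.idx1_le
  have hle2 := hN.idx2_le
  refine ⟨⟨hSt.congr F.agree, ?_, ?_⟩, rK, ?_, ?_, ?_, ?_, ?_⟩
  · constructor
    · intro j hj
      rw [rK] at hj
      rw [r1, r3]
      rcases Nat.lt_succ_iff_lt_or_eq.1 hj with hj | rfl
      · simp [hj.ne, fresh1 j hj, hN.idx1_node1 j hj]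
      · simp
    · intro v
      rw [rK, r3]
      have := hle1 v
      simp only [and_true]
      split_ifs <;> omega
    · intro v
      rw [r3, r1]
      have := hle1 v
      by_cases h : v = nv
      · simp [h]
      · simp only [h, and_true, if_false]
        intro h0
        rw [if_neg (by omega)]
        exact hN.node1_idx1 v h0
    · intro j hj
      rw [rK] at hj
      rw [r1]
      rcases Nat.lt_succ_iff_lt_or_eq.1 hj with hj | rfl
      · simp [hj.ne, hN.node1_lt j hj]
      · simpa using hv
    · intro j hj
      rw [rK] at hj
      rw [r2, r4]
      rcases Nat.lt_succ_iff_lt_or_eq.1 hj with hj | rfl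
      · simp [hj.ne, fresh2 j hj, hN.idx2_node2 j hj]
      · simp
    · intro v
      rw [rK, r4]
      have := hle2 v
      simp only [and_true]
      split_ifs <;> omega
    · intro v
      rw [r4, r2]
      have := hle2 v
      by_cases h : v = nb
      · simp [h]
      · simp only [h, and_true, if_false]
        intro h0
        rw [if_neg (by omega)]
        exact hN.node2_idx2 v h0
    · intro j hj
      rw [rK] at hj
      rw [r2]
      rcases Nat.lt_succ_iff_lt_or_eq.1 hj with hj | rfl
      · simp [hj.ne, hN.node2_lt j hj]
      · simpa using hb
    · intro v
      rw [r5, r3]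
      by_cases h : v = nv <;> simp [h, hN.used1]
    · intro v
      rw [r6, r4]
      by_cases h : v = nb <;> simp [h, hN.used2]
    · intro i j
      rw [r7, rK]; tauto
    · intro i j
      rw [r8, rK]; tauto
  · have m1 : ∀ v, s.arr .idx1 v 0 ≠ 0 → s'.arr .idx1 v 0 ≠ 0 := by
      intro v h; rw [r3]; by_cases h' : v = nv <;> simp [h', h]
    have m2 : ∀ v, s.arr .idx2 v 0 ≠ 0 → s'.arr .idx2 v 0 ≠ 0 := by
      intro v h; rw [r4]; by_cases h' : v = nb <;> simp [h', h]
    constructor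
    · rw [F.a .outPtr, F.a .outDeg, F.a .outAdj, F.a .outWPtr]; exact hSc.scan1.mono m2
    · rw [F.a .inPtr, F.a .inDeg, F.a .inAdj, F.a .inWPtr]; exact hSc.scan2.mono m1
    · intro v h
      rw [F.a .outPtr]
      exact hSc.ptr1 v (by by_contra h'; exact m1 v h' h)
    · intro v h
      rw [F.a .inPtr]
      exact hSc.ptr2 v (by by_contra h'; exact m2 v h' h)
  · intro j; simp [r1]
  · intro j; simp [r2]
  · intro j; simp [r3]
  · intro j; simp [r4]
  -- The potential gains `1000 * (2 * K + 1)`, more than the `200 * (K + 1) + 80` steps minus the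
  -- allowance of 200.
  · simp only [pot, rK, F.a .outPtr, F.a .inPtr, ← hK]
    nlinarith

end Greedy

/-! ### The greedy maximal matching -/

section Greedy

variable {n₁ n₂ : ℕ} (G : BipGraph n₁ n₂) {lam : ℕ} {s s' : Mem}

/-- The matching edges are given by the mutually inverse arrays `chl` and `par`. -/
structure Perm (s : Mem) : Prop where
  chl_lt : ∀ j < s.reg .K, s.arr .chl j 0 < s.reg .K
  par_lt : ∀ j < s.reg .K, s.arr .par j 0 < s.reg .K
  par_chl : ∀ j < s.reg .K, s.arr .par (s.arr .chl j 0) 0 = j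
  chl_par : ∀ j < s.reg .K, s.arr .chl (s.arr .par j 0) 0 = j
  edge : ∀ j < s.reg .K, G.edgeNat (s.arr .node1 (s.arr .chl j 0) 0) (s.arr .node2 j 0)

/-- There is no edge between two unmatched nodes. -/
def Maximal (s : Mem) : Prop :=
  ∀ v b, G.edgeNat v b → s.arr .idx1 v 0 ≠ 0 ∨ s.arr .idx2 b 0 ≠ 0

/-- The arrays of the stages are zero beyond the number of branches. -/
structure Clean (lam : ℕ) (s : Mem) : Prop where
  lab : ∀ j, s.reg .K ≤ j → s.arr .lab j 0 = 0
  reached : ∀ j, bitAt lam (s.arr .reached 0) j = true → j < s.reg .K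
  unvis : ∀ j, bitAt lam (s.arr .unvis 0) j = true → j < s.reg .K

variable {G}

theorem Perm.congr (h : Perm G s) (H : Agree [.K] [.chl, .par, .node1, .node2] s s') : Perm G s' := by
  obtain ⟨h1, h2⟩ := H
  simp only [List.mem_cons, List.not_mem_nil, or_false, forall_eq_or_imp, forall_eq] at h1 h2
  obtain ⟨a1, a2, a3, a4⟩ := h2
  constructor <;> simp only [h1, a1, a2, a3, a4]
  exacts [h.1, h.2, h.3, h.4, h.5]

theorem Maximal.congr (h : Maximal G s) (H : Agree [] [.idx1, .idx2] s s') : Maximal G s' := by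
  obtain ⟨h1, h2⟩ := H
  simp only [List.mem_cons, List.not_mem_nil, or_false, forall_eq_or_imp, forall_eq] at h1 h2
  simpa only [Maximal, h2.1, h2.2] using h

theorem Clean.congr (h : Clean lam s) (H : Agree [.K] [.lab, .reached, .unvis] s s') :
    Clean lam s' := by
  obtain ⟨h1, h2⟩ := H
  simp only [List.mem_cons, List.not_mem_nil, or_false, forall_eq_or_imp, forall_eq] at h1 h2
  obtain ⟨a1, a2, a3⟩ := h2
  constructor <;> simp only [h1, a1, a2, a3]
  exacts [h.1, h.2, h.3]

/-- A scan that fails has seen that all neighbours are matched, and they stay matched; this gives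
maximality. The term `600 * n₁` is the constant cost per node beyond the potential. -/
theorem wp_greedy (hlam : 0 < lam) (hB : Base G lam s) (hK : s.reg .K = 0)
    (h0 : ∀ v, s.arr .idx1 v 0 = 0 ∧ s.arr .outPtr v 0 = 0 ∧ s.arr .outWPtr v 0 = 0) :
    wp lam greedy s (fun t s' => Base G lam s' ∧ Perm G s' ∧ Maximal G s' ∧
      t + pot n₁ n₂ s ≤ pot n₁ n₂ s' + 600 * n₁ + 20) := by
  have key : wp lam greedy s (fun t s' => Base G lam s' ∧
      (∀ j < s'.reg .K, s'.arr .chl j 0 = j ∧ s'.arr .par j 0 = j ∧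
        G.edgeNat (s'.arr .node1 j 0) (s'.arr .node2 j 0)) ∧
      (∀ v < n₁, s'.arr .idx1 v 0 = 0 → ∀ b, G.edgeNat v b → s'.arr .idx2 b 0 ≠ 0) ∧
      t + pot n₁ n₂ s ≤ pot n₁ n₂ s' + 600 * n₁ + 20) := by
    simp only [greedy, ↓wp_seq, ↓wp_assign]
    generalize hS : (Mem.setReg _ _ _ : Mem) = S
    have eB : Base G lam S := hB.congr (by rw [← hS]; simp [Agree])
    have eK : S.reg .K = 0 := by rw [← hS]; simp [hK]
    have eu : S.reg .uw = 1 := by rw [← hS]; simp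
    have eg : S.reg .gv = 0 := by rw [← hS]; simp
    have e0 : ∀ v, S.arr .idx1 v 0 = 0 ∧ S.arr .outPtr v 0 = 0 ∧ S.arr .outWPtr v 0 = 0 := by
      rw [← hS]; exact h0
    have ep : pot n₁ n₂ S = pot n₁ n₂ s := pot_congr (by rw [← hS]; simp [Agree])
    clear hS
    refine wp_while (fun t s' => Base G lam s' ∧ s'.reg .gv ≤ n₁ ∧
      -- Nodes whose turn has not come have untouched pointers, as the first scan of an unmatched
      -- node requires.
      (∀ v, s'.reg .gv ≤ v → s'.arr .idx1 v 0 = 0 ∧ s'.arr .outPtr v 0 = 0 ∧ s'.arr .outWPtr v 0 = 0) ∧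
      -- Both ends of a greedy edge enter together, so child and root of each branch have the same
      -- number.
      (∀ j < s'.reg .K, s'.arr .chl j 0 = j ∧ s'.arr .par j 0 = j ∧
        G.edgeNat (s'.arr .node1 j 0) (s'.arr .node2 j 0)) ∧
      (∀ v < s'.reg .gv, s'.arr .idx1 v 0 = 0 → ∀ b, G.edgeNat v b → s'.arr .idx2 b 0 ≠ 0) ∧
      t + pot n₁ n₂ s ≤ pot n₁ n₂ s' + 600 * s'.reg .gv) (fun s' => n₁ - s'.reg .gv) ?_ ?_ ?_
    · refine ⟨eB, by omega, fun v _ => e0 v, fun j hj => by omega, fun v hv => by omega, by omega⟩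
    · rintro t s1 F ⟨hB1, hg, hz, hj, hm, ht⟩ he
      have fu : s1.reg .uw = 1 := (F.r .uw).trans eu
      clear F
      have hgn : s1.reg .gv < n₁ := by simpa [hB1.static.n1] using he
      rw [wp_seq, wp_assign]
      refine wp_call_seq (wp_findFree hlam (s := s1.setReg .fv (s1.reg .gv)) (hB1.congr (by simp [Agree]))
        (by simpa using hgn) (Or.inr ?_)) ?_
      · simpa [fu] using (hz _ le_rfl).2
      rintro t2 s2 F2 ⟨hB2, hf, hs, ho, hwo, ht2⟩
      have g1 : s2.arr .idx1 = s1.arr .idx1 := F2.a .idx1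
      have g2 : s2.arr .idx2 = s1.arr .idx2 := F2.a .idx2
      have g3 : s2.reg .gv = s1.reg .gv := by simpa using F2.r .gv
      have g4 : s2.reg .K = s1.reg .K := by simpa using F2.r .K
      have g5 : s2.arr .chl = s1.arr .chl := F2.a .chl
      have g6 : s2.arr .par = s1.arr .par := F2.a .par
      have g7 : s2.arr .node1 = s1.arr .node1 := F2.a .node1
      have g8 : s2.arr .node2 = s1.arr .node2 := F2.a .node2
      simp only [Mem.setReg_reg, Mem.setReg_arr, if_true] at hf hs ho hwo
      simp at ht2
      rw [wp_seq, wp_ifte]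
      simp only [incr, Expr.eval]
      refine ⟨fun hr => ?_, fun hr => ?_⟩
      · simp only [↓wp_seq, ↓wp_assign, ↓wp_put]
        obtain ⟨hE, hb0⟩ := hs hr
        refine wp_call (wp_addNodes (G := G) hlam (hB2.congr (by simp [Agree])) ?_ ?_ ?_ ?_) ?_
        · simpa [g3] using hgn
        · simpa using hB.static.adj1.lt _ _ hE
        · simpa [g1, g3] using (hz _ le_rfl).1
        · simpa [g2] using hb0
        · rintro t3 s3 F3 ⟨hB3, k1, k2, k3, k4, k5, ht3⟩
          simp at ht3
          have k6 := F3.a .chl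
          have k7 := F3.a .par
          have k8 : s3.reg .gv = s1.reg .gv := by simpa [g3] using F3.r .gv
          have k9 := F3.a .outPtr
          have k10 := F3.a .outWPtr
          simp [g4, g7, g3, g1, g2, g8, g5, g6] at k1 k2 k3 k4 k5 k6 k7 k9 k10
          refine ⟨⟨hB3.congr (by simp [Agree]), ?_, ?_, ?_, ?_, ?_⟩, ?_⟩
          · simpa [k8] using hgn
          · intro v hv
            simp [k8] at hv
            have hne : v ≠ s1.reg .gv := by omega
            simp only [Mem.setReg_arr, k4, if_neg hne, k9, k10, ho v hne, hwo v hne]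
            exact hz v (by omega)
          · intro j hjk
            simp [k1] at hjk
            simp only [Mem.setReg_arr, k6, k7, k2, k3, and_true]
            rcases lt_or_eq_of_le hjk with h | rfl
            · simpa only [if_neg h.ne] using hj j h
            · simpa using hE
          · intro v hv hv0 b hEb
            simp [k8] at hv
            simp only [Mem.setReg_arr, k4, k5] at hv0 ⊢
            split_ifs with h1
            · omega
            · rcases lt_or_eq_of_le hv with h | rfl
              · rw [if_neg h.ne] at hv0
                exact hm v h hv0 b hEb
              · simp at hv0
          · simp [k8]
            omega
          · simp [k8]; omega
      · rw [wp_skip, wp_assign]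
        refine ⟨⟨hB2.congr (by simp [Agree]), ?_, ?_, ?_, ?_, ?_⟩, ?_⟩
        · simpa [g3] using hgn
        · intro v hv
          simp [g3] at hv
          have hne : v ≠ s1.reg .gv := by omega
          simp only [Mem.setReg_arr, g1, ho v hne, hwo v hne]
          exact hz v (by omega)
        · simpa [g4, g5, g6, g7, g8] using hj
        · intro v hv hv0 b hEb
          simp [g3] at hv
          simp only [Mem.setReg_arr, g1, g2] at hv0 ⊢
          rcases lt_or_eq_of_le hv with h | rfl
          · exact hm v h hv0 b hEb
          · exact hf hr b hEb
        · simp [g3]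
          omega
        · simp [g3]; omega
    · rintro t s1 F ⟨hB1, hg, hz, hj, hm, ht⟩ he
      have hgn : s1.reg .gv = n₁ := by
        simp [hB1.static.n1] at he; omega
      refine ⟨hB1, hj, fun v hv => hm v (hgn ▸ hv), ?_⟩
      simp
      rw [hgn] at ht
      omega
  refine wp_call key fun t s' F ⟨h1, h2, h3, h4⟩ => ⟨h1, ?_, ?_, h4⟩
  · constructor
    · intro j hj; rw [(h2 j hj).1]; exact hj
    · intro j hj; rw [(h2 j hj).2.1]; exact hj
    · intro j hj; rw [(h2 j hj).1, (h2 j hj).2.1]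
    · intro j hj; rw [(h2 j hj).2.1, (h2 j hj).1]
    · intro j hj; rw [(h2 j hj).1]; exact (h2 j hj).2.2
  · intro v b hE
    by_cases h : s'.arr .idx1 v 0 = 0
    · exact Or.inr (h3 v (hB.static.adj2.lt b v hE) h b hE)
    · exact Or.inl h

end Greedy

/-! ## The layered network -/

section Layers

variable {n₁ n₂ : ℕ} (G : BipGraph n₁ n₂) (lam : ℕ) {s s' s0 : Mem}

/-- The queue lists the labelled branches without repetition. -/
structure Que (s : Mem) : Prop where
  lt : ∀ i < s.reg .qt, s.arr .queue i 0 < s.reg .K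
  inj : ∀ i < s.reg .qt, ∀ i' < s.reg .qt, s.arr .queue i 0 = s.arr .queue i' 0 → i = i'
  ex : ∀ j, s.arr .lab j 0 ≠ 0 → ∃ i < s.reg .qt, s.arr .queue i 0 = j
  lab : ∀ i < s.reg .qt, s.arr .lab (s.arr .queue i 0) 0 ≠ 0

/-- The labels of `s` arise from those of `s0` by giving the label `p` to some branches with property
`P`. -/
structure Labelling (s0 s : Mem) (P : ℕ → Prop) : Prop where
  que : Que s
  qt_le : s0.reg .qt ≤ s.reg .qt
  old : ∀ i < s0.reg .qt, s.arr .queue i 0 = s0.arr .queue i 0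
  keep : ∀ j, s0.arr .lab j 0 ≠ 0 → s.arr .lab j 0 = s0.arr .lab j 0
  fresh : ∀ j, s0.arr .lab j 0 = 0 → s.arr .lab j 0 ≠ 0 → s.arr .lab j 0 = s.reg .p ∧ P j

/-- The bit vectors REACHED and `V₂LAYER` are correct. -/
structure WordInv (s : Mem) : Prop where
  -- A set bit means that the branch is not reached yet. This vector is indexed by the numbers of
  -- children, `lay2` by those of roots.
  reached : ∀ i, bitAt lam (s.arr .reached 0) i = true ↔ i < s.reg .K ∧ s.arr .lab (s.arr .par i 0) 0 = 0
  lay2 : ∀ p, 1 ≤ p → p ≤ s.reg .p → ∀ j < s.reg .nw * lam,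
    (bitAt lam (s.arr .lay2 p) j = true ↔ s.arr .lab j 0 = p)

variable {G lam}

theorem Que.congr (h : Que s) (H : Agree [.qt, .K] [.queue, .lab] s s') : Que s' := by
  obtain ⟨h1, h2⟩ := H
  simp only [List.mem_cons, List.not_mem_nil, or_false, forall_eq_or_imp, forall_eq] at h1 h2
  constructor <;> simp only [h1.1, h1.2, h2.1, h2.2]
  exacts [h.1, h.2, h.3, h.4]

theorem Labelling.congr {P : ℕ → Prop} (h : Labelling s0 s P) (H : Agree [.qt, .K, .p] [.queue, .lab] s s') :
    Labelling s0 s' P := by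
  have hq := h.que.congr H.mono
  obtain ⟨h1, h2⟩ := H
  simp only [List.mem_cons, List.not_mem_nil, or_false, forall_eq_or_imp, forall_eq] at h1 h2
  refine ⟨hq, ?_, ?_, ?_, ?_⟩ <;> simp only [h1.1, h1.2.2, h2.1, h2.2]
  exacts [h.2, h.3, h.4, h.5]

theorem WordInv.congr (h : WordInv lam s) (H : Agree [.K, .nw, .p] [.reached, .lay2, .lab, .par] s s') :
    WordInv lam s' := by
  obtain ⟨h1, h2⟩ := H
  simp only [List.mem_cons, List.not_mem_nil, or_false, forall_eq_or_imp, forall_eq] at h1 h2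
  obtain ⟨a1, a2, a3, a4⟩ := h2
  obtain ⟨b1, b2, b3⟩ := h1
  constructor <;> simp only [a1, a2, a3, a4, b1, b2, b3]
  exacts [h.1, h.2]

theorem Labelling.refl (h : Que s) (P : ℕ → Prop) : Labelling s s P :=
  ⟨h, le_rfl, fun _ _ => rfl, fun _ _ => rfl, fun _ h0 h1 => absurd h0 h1⟩

/-- An unlabelled branch is not in the queue, so appending it creates no repetition. -/
theorem Que.enqueue {r p : ℕ} (h : Que s) (hr : r < s.reg .K) (h0 : s.arr .lab r 0 = 0) (hp : p ≠ 0)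
    (eK : s'.reg .K = s.reg .K) (eq : s'.reg .qt = s.reg .qt + 1)
    (el : ∀ j, s'.arr .lab j 0 = if j = r then p else s.arr .lab j 0)
    (ea : ∀ i, s'.arr .queue i 0 = if i = s.reg .qt then r else s.arr .queue i 0) : Que s' := by
  have hne : ∀ i < s.reg .qt, s.arr .queue i 0 ≠ r := fun i hi hir => h.lab i hi (hir ▸ h0)
  constructor
  · intro i hi
    rw [ea, eK]
    split_ifs with h1
    · exact hr
    · exact h.lt i (by omega)
  · intro i hi i' hi'
    rw [ea, ea]
    split_ifs with h1 h2 h2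
    · omega
    · intro h3; exact absurd h3.symm (hne i' (by omega))
    · intro h3; exact absurd h3 (hne i (by omega))
    · exact h.inj i (by omega) i' (by omega)
  · intro j
    rw [el]
    split_ifs with h1
    · intro _; exact ⟨s.reg .qt, by omega, by rw [ea, if_pos rfl, h1]⟩
    · intro h2
      obtain ⟨i, hi, h3⟩ := h.ex j h2
      exact ⟨i, by omega, by rw [ea, if_neg (by omega), h3]⟩
  · intro i hi
    rw [ea, el]
    by_cases h1 : i = s.reg .qt
    · simpa [h1] using hp
    · rw [if_neg h1, if_neg (hne i (by omega))]
      exact h.lab i (by omega)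

theorem Labelling.enqueue {P : ℕ → Prop} {r : ℕ} (h : Labelling s0 s P) (hr : r < s.reg .K)
    (h0 : s.arr .lab r 0 = 0) (hp : s.reg .p ≠ 0) (hP : P r)
    (eK : s'.reg .K = s.reg .K) (ep : s'.reg .p = s.reg .p) (eq : s'.reg .qt = s.reg .qt + 1)
    (el : ∀ j, s'.arr .lab j 0 = if j = r then s.reg .p else s.arr .lab j 0)
    (ea : ∀ i, s'.arr .queue i 0 = if i = s.reg .qt then r else s.arr .queue i 0) :
    Labelling s0 s' P := by
  have hq := h.qt_le
  refine ⟨h.que.enqueue hr h0 hp eK eq el ea, by omega, ?_, ?_, ?_⟩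
  · intro i hi; rw [ea, if_neg (by omega), h.old i hi]
  · intro j hj
    rw [el, if_neg, h.keep j hj]
    rintro rfl; exact hj (h.keep j hj ▸ h0)
  · intro j hj hj'
    rw [el] at hj' ⊢
    rw [ep]
    split_ifs with h1
    · exact ⟨rfl, h1 ▸ hP⟩
    · rw [if_neg h1] at hj'
      exact h.fresh j hj hj'

theorem wp_clearLayer :
    wp lam clearLayer s (fun t s' =>
      (∀ x < s.reg .nw, s'.arr .lay1 (s.reg .p) x = 0 ∧ s'.arr .lay2 (s.reg .p) x = 0) ∧
      (∀ q, q ≠ s.reg .p → s'.arr .lay2 q = s.arr .lay2 q) ∧ t ≤ 20 * (s.reg .nw + 1)) := by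
  simp only [clearLayer, wp_seq, wp_assign]
  refine wp_while (fun t s' => s'.reg .x ≤ s.reg .nw ∧
      (∀ x < s'.reg .x, s'.arr .lay1 (s.reg .p) x = 0 ∧ s'.arr .lay2 (s.reg .p) x = 0) ∧
      (∀ q, q ≠ s.reg .p → s'.arr .lay2 q = s.arr .lay2 q) ∧ t ≤ 20 * s'.reg .x)
    (fun s' => s.reg .nw - s'.reg .x) ?_ ?_ ?_
  · simp
  · rintro t s1 F ⟨h1, h2, h3, h4⟩ he
    have fn : s1.reg .nw = s.reg .nw := F.r .nw
    have fp : s1.reg .p = s.reg .p := F.r .p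
    have hx : s1.reg .x < s.reg .nw := by simpa [fn] using he
    simp [wp_seq, wp_put, wp_assign, fp]
    refine ⟨⟨by omega, ?_, ?_, by omega⟩, by omega⟩
    · intro x hx'
      rcases lt_or_eq_of_le hx' with h | rfl
      · simpa [h.ne] using h2 x h
      · simp
    · intro q hq
      funext x
      simp [hq, h3 q hq]
  · rintro t s1 F ⟨h1, h2, h3, h4⟩ he
    have fn : s1.reg .nw = s.reg .nw := F.r .nw
    have hx : s1.reg .x = s.reg .nw := by simp [fn] at he; omega
    rw [hx] at h2
    refine ⟨h2, h3, ?_⟩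
    simp; omega

-- Each word costs a constant, and each bit extracted by `lead` puts one more branch into the queue;
-- hence the charge of 100 per word and 200 per queue entry.
set_option maxHeartbeats 1000000 in
theorem wp_convertLayer (hlam : 0 < lam) (hl : s.reg .lam = lam) (hP : Perm G s) (hQ : Que s)
    (hW : WordInv lam s) (hp : 1 ≤ s.reg .p)
    (hnw : s.reg .nw = s.reg .K / lam + 1) :
    wp lam convertLayer s (fun t s' => WordInv lam s' ∧
      Labelling s s' (fun j => j < s.reg .K ∧ bitAt lam (s.arr .lay1 (s.reg .p)) (s.arr .chl j 0) = true) ∧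
      (∀ j < s.reg .K, bitAt lam (s.arr .lay1 (s.reg .p)) (s.arr .chl j 0) = true → s'.arr .lab j 0 ≠ 0) ∧
      t + 200 * s.reg .qt ≤ 100 * (s.reg .nw + 1) + 200 * s'.reg .qt) := by
  have hKn : s.reg .K < s.reg .nw * lam := by
    rw [hnw, mul_comm]; exact Nat.lt_mul_div_succ _ hlam
  set P : ℕ → Prop := fun j => j < s.reg .K ∧ bitAt lam (s.arr .lay1 (s.reg .p)) (s.arr .chl j 0) = true
    with hPdef
  simp only [convertLayer, wp_seq, wp_assign]
  refine wp_while (fun t s' => s'.reg .x ≤ s.reg .nw ∧ WordInv lam s' ∧ Labelling s s' P ∧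
      (∀ i < s'.reg .x * lam, bitAt lam (s.arr .lay1 (s.reg .p)) i = true →
        bitAt lam (s'.arr .reached 0) i = false) ∧
      (∀ x, s'.reg .x ≤ x → s'.arr .lay1 (s.reg .p) x = s.arr .lay1 (s.reg .p) x) ∧
      t + 200 * s.reg .qt ≤ 100 * s'.reg .x + 200 * s'.reg .qt)
    (fun s' => s.reg .nw - s'.reg .x) ?_ ?_ ?_
  · refine ⟨by simp, hW.congr (by simp [Agree]), (Labelling.refl hQ P).congr (by simp [Agree]), ?_, ?_, ?_⟩ <;> simp
  · rintro t s1 F ⟨h1, h2, h3, h4, h5, h6⟩ he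
    have fn : s1.reg .nw = s.reg .nw := F.r .nw
    have fp : s1.reg .p = s.reg .p := F.r .p
    have fl : s1.reg .lam = lam := (F.r .lam).trans hl
    have fK : s1.reg .K = s.reg .K := F.r .K
    have fpar : s1.arr .par = s.arr .par := F.a .par
    clear F
    have hx : s1.reg .x < s.reg .nw := by simpa [fn] using he
    simp only [↓wp_seq, ↓wp_assign, ↓wp_put]
    generalize hS : Mem.setCell _ _ _ _ _ = S
    have ex : S.reg .x = s1.reg .x := by rw [← hS]; simp
    have eK : S.reg .K = s.reg .K := by rw [← hS]; simp [fK]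
    have ep : S.reg .p = s.reg .p := by rw [← hS]; simp [fp]
    have eq : S.reg .qt = s1.reg .qt := by rw [← hS]; simp
    have el : S.reg .lam = lam := by rw [← hS]; simp [fl]
    have en : S.reg .nw = s.reg .nw := by rw [← hS]; simp [fn]
    have epar : S.arr .par = s.arr .par := by rw [← hS]; simp [fpar]
    have etw : ∀ r < lam, ((S.reg .tw).testBit r = true ↔
        (s.arr .lay1 (s.reg .p) (s1.reg .x)).testBit r = true ∧
        (S.arr .reached 0 (s1.reg .x)).testBit r = true) := by
      intro r hr
      rw [← hS]; simp [fp, h5 _ le_rfl, Nat.testBit_mod_two_pow, hr]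
    have etl : S.reg .tw < 2 ^ lam := by
      rw [← hS]; simp; exact Nat.mod_lt _ (by positivity)
    have eW : WordInv lam S := h2.congr (by rw [← hS]; simp [Agree])
    have eR : Labelling s S P := h3.congr (by rw [← hS]; simp [Agree])
    have ere : S.arr .reached = s1.arr .reached := by rw [← hS]; simp
    have el1 : ∀ x, s1.reg .x + 1 ≤ x → S.arr .lay1 (s.reg .p) x = s.arr .lay1 (s.reg .p) x := by
      intro x hxx
      rw [← hS, ← h5 x (by omega)]
      simp [show x ≠ s1.reg .x by omega]
    clear hS
    -- The bits left in `tw` are those of the layer word whose branches are still unreached. The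
    -- measure is `tw` itself, which loses a power of two in each round.
    refine wp_while (fun t' s' => WordInv lam s' ∧ Labelling s s' P ∧ s'.reg .tw < 2 ^ lam ∧
        (∀ r < lam, ((s'.reg .tw).testBit r = true ↔
          (s.arr .lay1 (s.reg .p) (s1.reg .x)).testBit r = true ∧
          (s'.arr .reached 0 (s1.reg .x)).testBit r = true)) ∧
        (∀ i, bitAt lam (s'.arr .reached 0) i = true → bitAt lam (s1.arr .reached 0) i = true) ∧
        t' + 200 * s1.reg .qt ≤ 200 * s'.reg .qt) (fun s' => s'.reg .tw) ?_ ?_ ?_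
    · exact ⟨eW, eR, etl, etw, by rw [ere]; exact fun _ h => h, by omega⟩
    · rintro t' s2 F ⟨k1, k2, k3, k4, k5, k6⟩ he2
      have gx : s2.reg .x = s1.reg .x := (F.r .x).trans ex
      have gK : s2.reg .K = s.reg .K := (F.r .K).trans eK
      have gp : s2.reg .p = s.reg .p := (F.r .p).trans ep
      have gl : s2.reg .lam = lam := (F.r .lam).trans el
      have gn : s2.reg .nw = s.reg .nw := (F.r .nw).trans en
      have gpar : s2.arr .par = s.arr .par := (F.a .par).trans epar
      clear F
      simp only [Expr.eval] at he2
      obtain ⟨hr, hbit⟩ := lead_ne_zero he2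
      have hsz : Nat.size (s2.reg .tw % 2 ^ lam) ≠ 0 := he2
      set r := Nat.size (s2.reg .tw % 2 ^ lam) - 1 with hrdef
      have hszr : Nat.size (s2.reg .tw % 2 ^ lam) = r + 1 := by omega
      have hb := (k4 r hr).1 hbit
      rw [← bitAt_mul_add _ hr, ← bitAt_mul_add _ hr] at hb
      set i := s1.reg .x * lam + r with hi
      have hrea := (k1.reached i).1 hb.2
      rw [gK, gpar] at hrea
      have hrr := hP.par_lt i hrea.1
      -- The leading bit is present, so subtracting its power of two clears exactly this bit.
      have hand : s2.reg .tw &&& 2 ^ r = 2 ^ r := by rw [Nat.and_two_pow, hbit]; simp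
      have hge : 2 ^ r ≤ s2.reg .tw := hand ▸ Nat.and_le_left
      have hadd : s1.reg .x * lam + (r + 1) - 1 = i := by omega
      simp only [↓wp_seq, ↓wp_assign]
      rw [wp_clearBit (by simp [gl]) hlam]
      simp only [Expr.ofNat_eq, Expr.eval, wp_seq (c := setBit _ _ _)]
      rw [wp_setBit (by simp [gl]) hlam]
      simp only [enqueue, incr, wp_seq, wp_put, wp_assign]
      simp [hszr, gl, gx, gp, gpar, hadd, hr]
      refine ⟨⟨⟨?_, ?_⟩, ?_, by omega, ?_, ?_, ?_⟩, ?_⟩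
      · intro i'
        simp only [Mem.setReg_arr, Mem.setReg_reg, Mem.setB_arr_other, Mem.setCell_arr_other,
          Mem.setCell_arr_self, Mem.setB_reg, Mem.setCell_reg, Mem.clearB_reg, Mem.clearB_arr_other, bitAt_clearB,
          reduceCtorEq, gpar, gK, if_false, and_true, true_and]
        rw [Bool.and_eq_true, k1.reached, gK, gpar]
        simp only [Bool.not_eq_true', decide_eq_false_iff_not]
        constructor
        · rintro ⟨a1, a2, a3⟩
          refine ⟨a2, ?_⟩
          rw [if_neg, a3]
          intro h; apply a1
          rw [← hP.chl_par i' a2, h, hP.chl_par i hrea.1]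
        · rintro ⟨a1, a2⟩
          by_cases h : i' = i
          · subst h; rw [if_pos rfl] at a2; omega
          · refine ⟨h, a1, ?_⟩
            split_ifs at a2 with h'
            · omega
            · exact a2
      · intro p hp1 hp2 j hj
        simp [gp] at hp2
        simp [gn] at hj
        have := k1.lay2 p hp1 (by rw [gp]; exact hp2) j (by rw [gn]; exact hj)
        simp [bitAt_setB _ hlam, this, bitAt_clearB]
        by_cases hj' : j = s.arr .par i 0
        · subst hj'
          simp [hrea.2, show (0 : ℕ) ≠ p by omega, eq_comm]
        · simp [hj']
      · refine k2.enqueue (r := s.arr .par i 0) ?_ hrea.2 (by omega) ⟨hrr, ?_⟩ ?_ ?_ ?_ ?_ ?_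
        · rw [gK]; exact hrr
        · rw [hP.chl_par i hrea.1]; exact hb.1
        · simp
        · simp
        · simp
        · intro j; simp [gp]
        · intro j; simp
      · intro r' hr'
        rw [show s2.reg .tw - 2 ^ r = s2.reg .tw - (s2.reg .tw &&& 2 ^ r) by rw [hand]]
        rw [testBit_sub_and, ← bitAt_mul_add ((Mem.clearB _ _ _ _ _).arr .reached 0) hr', bitAt_clearB, bitAt_mul_add _ hr']
        rw [Bool.and_eq_true, k4 r' hr']
        simp only [Nat.testBit_two_pow, Mem.setReg_arr, bitAt_mul_add _ hr', hi, Bool.not_eq_true',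
          decide_eq_false_iff_not, Bool.and_eq_true, true_and, add_right_inj, and_assoc]
        grind
      · intro i' hi'
        rw [bitAt_clearB] at hi'
        simp at hi'
        exact k5 i' hi'.2
      · omega
      · have : 0 < 2 ^ r := by positivity
        omega
    · rintro t' s2 F ⟨k1, k2, k3, k4, k5, k6⟩ he2
      have gx : s2.reg .x = s1.reg .x := (F.r .x).trans ex
      have glay := F.a .lay1
      simp only [Expr.eval] at he2
      rw [incr, wp_assign]
      simp [gx, glay]
      refine ⟨⟨by omega, k1.congr (by simp [Agree]), k2.congr (by simp [Agree]), ?_, el1, by omega⟩, by omega⟩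
      intro i hi hbit
      by_contra hcon
      rw [Bool.not_eq_false] at hcon
      by_cases hlt : i < s1.reg .x * lam
      · have := h4 i hlt hbit
        rw [k5 i hcon] at this
        exact absurd this (by simp)
      · obtain ⟨r, rfl⟩ := Nat.exists_eq_add_of_le (not_lt.1 hlt)
        have hr : r < lam := by rw [add_mul, one_mul] at hi; omega
        have hz := lead_eq_zero he2 hr
        rw [bitAt_mul_add _ hr] at hbit hcon
        have := (k4 r hr).2 ⟨hbit, hcon⟩
        rw [hz] at this
        exact absurd this (by simp)
  · rintro t s1 F ⟨h1, h2, h3, h4, h5, h6⟩ he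
    have fn : s1.reg .nw = s.reg .nw := F.r .nw
    have fK : s1.reg .K = s.reg .K := F.r .K
    have fpar : s1.arr .par = s.arr .par := F.a .par
    have hx : s1.reg .x = s.reg .nw := by simp [fn] at he; omega
    refine ⟨h2, h3, ?_, by simp; omega⟩
    intro j hj hbit hlab
    have hc := hP.chl_lt j hj
    have := h4 (s.arr .chl j 0) (by rw [hx]; omega) hbit
    have h7 := (h2.reached (s.arr .chl j 0)).2 ⟨by rw [fK]; exact hc, by rw [fpar, hP.par_chl j hj]; exact hlab⟩
    rw [this] at h7
    exact absurd h7 (by simp)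

end Layers

/-! ### Correctness of the layers generated so far -/

section Layers

variable {n₁ n₂ : ℕ} (G : BipGraph n₁ n₂) (lam : ℕ) {s s' s0 : Mem}

/-- The `V₁`-node in the branch with root number `j`. -/
def child (s : Mem) (j : ℕ) : ℕ := s.arr .node1 (s.arr .chl j 0) 0

/-- The layers `1, …, p` are correct; layer `p` is the segment `qh, …, qe - 1` of the queue, and no
branch in an earlier layer has an unmatched neighbour in `V₁`. -/
structure Layers (s : Mem) : Prop where
  pos : 1 ≤ s.reg .p
  nw : s.reg .nw = s.reg .K / lam + 1
  qe : s.reg .qe = s.reg .qt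
  qh_le : s.reg .qh ≤ s.reg .qe
  que : Que s
  early : ∀ i < s.reg .qh, s.arr .lab (s.arr .queue i 0) 0 < s.reg .p
  seg : ∀ i, s.reg .qh ≤ i → i < s.reg .qe → s.arr .lab (s.arr .queue i 0) 0 = s.reg .p
  one : ∀ j < s.reg .K, (s.arr .lab j 0 = 1 ↔ ∃ b, G.edgeNat (child s j) b ∧ s.arr .idx2 b 0 = 0)
  sound : ∀ j k, 1 ≤ k → s.arr .lab j 0 = k + 1 →
    ∃ j' < s.reg .K, s.arr .lab j' 0 = k ∧ G.edgeNat (child s j) (s.arr .node2 j' 0)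
  -- Restricted to labels below `p`, because the predecessors of layer `p` are labelled only when
  -- layer `p + 1` is generated.
  compl : ∀ j < s.reg .K, ∀ j' < s.reg .K, G.edgeNat (child s j) (s.arr .node2 j' 0) →
    s.arr .lab j' 0 ≠ 0 → s.arr .lab j' 0 < s.reg .p →
    s.arr .lab j 0 ≠ 0 ∧ s.arr .lab j 0 ≤ s.arr .lab j' 0 + 1
  strong : ∀ j < s.reg .K, s.arr .lab j 0 ≠ 0 → s.arr .lab j 0 < s.reg .p →
    ∀ v, G.edgeNat v (s.arr .node2 j 0) → s.arr .idx1 v 0 ≠ 0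
  word : s.reg .uw ≠ 0 → WordInv lam s

variable {G lam}

theorem Layers.congr (h : Layers G lam s)
    (H : Agree [.p, .nw, .K, .qe, .qt, .qh, .uw] [.lab, .queue, .idx1, .idx2, .node1, .node2, .chl, .par, .reached,
      .lay2] s s') : Layers G lam s' := by
  have hq := h.que.congr H.mono
  have hw : s.reg .uw ≠ 0 → WordInv lam s' := fun hu => (h.word hu).congr H.mono
  have hq' : s'.reg .uw = s.reg .uw := H.1 _ (by simp)
  obtain ⟨h1, h2⟩ := H
  simp only [List.mem_cons, List.not_mem_nil, or_false, forall_eq_or_imp, forall_eq] at h1 h2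
  obtain ⟨a1, a2, a3, a4, a5, a6, a7, a8, a9⟩ := h2
  obtain ⟨b1, b2, b3, b4, b5, b6, b7⟩ := h1
  refine ⟨?_, ?_, ?_, ?_, hq, ?_, ?_, ?_, ?_, ?_, ?_, by rwa [hq']⟩ <;>
    simp only [child, a1, a2, a3, a4, a5, a6, a7, b1, b2, b3, b4, b5, b6]
  exacts [h.1, h.2, h.3, h.4, h.6, h.7, h.8, h.9, h.10, h.11]

theorem Layers.lab_le (h : Layers G lam s) (j : ℕ) : s.arr .lab j 0 ≤ s.reg .p := by
  by_cases h0 : s.arr .lab j 0 = 0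
  · omega
  · obtain ⟨i, hi, rfl⟩ := h.que.ex j h0
    by_cases hq : i < s.reg .qh
    · exact (h.early i hq).le
    · exact (h.seg i (by omega) (by rw [h.qe]; exact hi)).le

theorem Layers.first (h0 : ∀ j, s.arr .lab j 0 = 0) 
    (H : Agree [.K] [.chl, .node1, .node2, .idx1, .idx2] s s') (hp : s'.reg .p = 1)
    (hnw : s'.reg .nw = s'.reg .K / lam + 1) (hqe : s'.reg .qe = s'.reg .qt) (hqh : s'.reg .qh = 0)
    (R : Labelling s s' (fun j => j < s.reg .K ∧ ∃ b, G.edgeNat (child s j) b ∧ s.arr .idx2 b 0 = 0))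
    (C : ∀ j < s.reg .K, (∃ b, G.edgeNat (child s j) b ∧ s.arr .idx2 b 0 = 0) → s'.arr .lab j 0 ≠ 0)
    (hw : s'.reg .uw ≠ 0 → WordInv lam s') : Layers G lam s' := by
  obtain ⟨h1, h2⟩ := H
  simp only [List.mem_cons, List.not_mem_nil, or_false, forall_eq_or_imp, forall_eq] at h1 h2
  obtain ⟨a1, a2, a3, a4, a5⟩ := h2
  have hch : ∀ j, child s' j = child s j := fun j => by simp only [child, a1, a2]
  have hlab : ∀ j, s'.arr .lab j 0 ≠ 0 → s'.arr .lab j 0 = 1 := fun j hj => by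
    rw [(R.fresh j (h0 j) hj).1, hp]
  constructor
  · omega
  · exact hnw
  · exact hqe
  · omega
  · exact R.que
  · intro i hi; omega
  · intro i _ hi
    rw [hp]; exact hlab _ (R.que.lab i (hqe ▸ hi))
  · intro j hj
    rw [h1] at hj
    simp only [hch, a5]
    constructor
    · intro h; exact (R.fresh j (h0 j) (by omega)).2.2
    · intro h; exact hlab j (C j hj h)
  · intro j k hk hlj
    have := hlab j (by omega)
    omega
  · intro j _ j' _ _ h3 h4
    have := hlab j' h3
    omega
  · intro j _ h3 h4
    have := hlab j h3
    omega
  · exact hw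

/-- Old labels are kept and new ones equal `p + 1`. So only layer `p` needs new information: `C`
says that all its predecessors are labelled now, `hstr` that it has no unmatched neighbour. -/
theorem Layers.next (h : Layers G lam s)
    (hstr : ∀ j < s.reg .K, s.arr .lab j 0 = s.reg .p → ∀ v, G.edgeNat v (s.arr .node2 j 0) →
      s.arr .idx1 v 0 ≠ 0)
    (H : Agree [.K, .nw] [.chl, .node1, .node2, .idx1, .idx2] s s') (hp : s'.reg .p = s.reg .p + 1)
    (hqe : s'.reg .qe = s'.reg .qt) (hqh : s'.reg .qh = s.reg .qe)
    (R : Labelling s s' (fun j => j < s.reg .K ∧ ∃ j' < s.reg .K, s.arr .lab j' 0 = s.reg .p ∧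
      G.edgeNat (child s j) (s.arr .node2 j' 0)))
    (C : ∀ j < s.reg .K, ∀ j' < s.reg .K, s.arr .lab j' 0 = s.reg .p →
      G.edgeNat (child s j) (s.arr .node2 j' 0) → s'.arr .lab j 0 ≠ 0)
    (hw : s'.reg .uw ≠ 0 → WordInv lam s') : Layers G lam s' := by
  obtain ⟨h1, h2⟩ := H
  simp only [List.mem_cons, List.not_mem_nil, or_false, forall_eq_or_imp, forall_eq] at h1 h2
  obtain ⟨a1, a2, a3, a4, a5⟩ := h2
  obtain ⟨b1, b2⟩ := h1
  have hch : ∀ j, child s' j = child s j := fun j => by simp only [child, a1, a2]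
  have hle := h.lab_le
  have hpos := h.pos
  have hqt := R.qt_le
  have hqe0 := h.qe
  have hnew : ∀ j, s.arr .lab j 0 = 0 → s'.arr .lab j 0 ≠ 0 → s'.arr .lab j 0 = s.reg .p + 1 :=
    fun j hj hj' => hp ▸ (R.fresh j hj hj').1
  constructor
  · omega
  · rw [b1, b2]; exact h.nw
  · exact hqe
  · omega
  · exact R.que
  · intro i hi
    rw [R.old i (by omega), R.keep _ (h.que.lab i (by omega)), hp]
    exact Nat.lt_succ_of_le (hle _)
  · intro i hi1 hi2
    rw [hp]
    refine hnew _ ?_ (R.que.lab i (by omega))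
    -- A branch labelled earlier already has a position before the new segment, against the
    -- injectivity of the queue.
    by_contra hne
    obtain ⟨i0, hi0, he⟩ := h.que.ex _ hne
    rw [← R.old i0 hi0] at he
    have := R.que.inj i0 (by omega) i (by omega) he
    omega
  · intro j hj
    rw [b1] at hj
    simp only [hch, a5]
    rw [← h.one j hj]
    by_cases h0 : s.arr .lab j 0 = 0
    · constructor
      · intro h3; have := hnew j h0 (by omega); omega
      · intro h3; omega
    · rw [R.keep j h0]
  · intro j k hk hlj
    simp only [hch, a3, b1]
    by_cases h0 : s.arr .lab j 0 = 0
    · have h3 := hnew j h0 (by omega)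
      obtain ⟨_, j', hj', hl, hE⟩ := (R.fresh j h0 (by omega)).2
      exact ⟨j', hj', by rw [R.keep j' (by omega)]; omega, hE⟩
    · rw [R.keep j h0] at hlj
      obtain ⟨j', hj', hl, hE⟩ := h.sound j k hk hlj
      exact ⟨j', hj', by rw [R.keep j' (by omega), hl], hE⟩
  · intro j hj j' hj' hE h3 h4
    rw [b1] at hj hj'
    rw [hch, a3] at hE
    have h0 : s.arr .lab j' 0 ≠ 0 := fun h0 => by have := hnew j' h0 h3; omega
    rw [R.keep j' h0] at h4 ⊢
    rcases Nat.lt_succ_iff_lt_or_eq.1 (hp ▸ h4) with h5 | h5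
    · obtain ⟨h6, h7⟩ := h.compl j hj j' hj' hE h0 h5
      rw [R.keep j h6]; exact ⟨h6, h7⟩
    · have h6 := C j hj j' hj' h5 hE
      refine ⟨h6, ?_⟩
      by_cases h7 : s.arr .lab j 0 = 0
      · rw [hnew j h7 h6, h5]
      · rw [R.keep j h7]; have := hle j; omega
  · intro j hj h3 h4
    rw [b1] at hj
    have h0 : s.arr .lab j 0 ≠ 0 := fun h0 => by have := hnew j h0 h3; omega
    rw [R.keep j h0] at h4
    rw [a3, a4]
    rcases Nat.lt_succ_iff_lt_or_eq.1 (hp ▸ h4) with h5 | h5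
    · exact h.strong j hj h0 h5
    · exact hstr j hj h5
  · exact hw

/-- The loop reaches only the first `K` entries; for the later ones `Clean` is needed, as they come
into use when `K` grows. -/
theorem wp_resetStage (hlam : 0 < lam) (hl : s.reg .lam = lam) (hC : Clean lam s) :
    wp lam resetStage s (fun t s' => (∀ j, s'.arr .lab j 0 = 0) ∧
      (∀ j < s.reg .K, s'.arr .vis j 0 = 0 ∧ s'.arr .sPtr j 0 = 0 ∧ s'.arr .sWPtr j 0 = 0) ∧
      (∀ j, bitAt lam (s'.arr .reached 0) j = true → j < s.reg .K) ∧
      (∀ j, bitAt lam (s'.arr .unvis 0) j = true → j < s.reg .K) ∧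
      (s.reg .uw ≠ 0 → ∀ j < s.reg .K, bitAt lam (s'.arr .reached 0) j = true ∧
        bitAt lam (s'.arr .unvis 0) j = true) ∧
      s'.reg .nw = s.reg .K / lam + 1 ∧ s'.reg .L = 0 ∧ s'.reg .qh = 0 ∧ s'.reg .qt = 0 ∧
      t ≤ 100 * (s.reg .K + 1)) := by
  simp only [resetStage, wp_seq, wp_assign]
  refine wp_while (fun t s' => s'.reg .sj ≤ s.reg .K ∧
      (∀ j, j < s'.reg .sj ∨ s.reg .K ≤ j → s'.arr .lab j 0 = 0) ∧
      (∀ j < s'.reg .sj, s'.arr .vis j 0 = 0 ∧ s'.arr .sPtr j 0 = 0 ∧ s'.arr .sWPtr j 0 = 0) ∧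
      (∀ j, bitAt lam (s'.arr .reached 0) j = true → j < s.reg .K) ∧
      (∀ j, bitAt lam (s'.arr .unvis 0) j = true → j < s.reg .K) ∧
      (s.reg .uw ≠ 0 → ∀ j < s'.reg .sj, bitAt lam (s'.arr .reached 0) j = true ∧
        bitAt lam (s'.arr .unvis 0) j = true) ∧ t ≤ 70 * s'.reg .sj)
      (fun s' => s.reg .K - s'.reg .sj) ?_ ?_ ?_
  · refine ⟨by simp, fun j hj => ?_, by simp, hC.reached, hC.unvis, by simp, by simp⟩
    rcases hj with hj | hj
    · simp at hj
    · exact hC.lab j hj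
  · rintro t s1 F ⟨h1, h2, h3, h4, h5, h6, h7⟩ he
    have fK : s1.reg .K = s.reg .K := F.r .K
    have fl : s1.reg .lam = lam := (F.r .lam).trans hl
    have fu : s1.reg .uw = s.reg .uw := F.r .uw
    clear F
    have hx : s1.reg .sj < s.reg .K := by simpa [fK] using he
    have c2 : ∀ j, (j ≤ s1.reg .sj ∨ s.reg .K ≤ j) → ¬ j = s1.reg .sj → s1.arr .lab j 0 = 0 :=
      fun j hj h => h2 j (by omega)
    have c3 : ∀ j ≤ s1.reg .sj, (j = s1.reg .sj ∨ j < s1.reg .sj) := fun j hj => by omega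
    simp only [↓wp_seq, ↓wp_put]
    rw [wp_ifte]
    refine ⟨fun hu => ?_, fun hu => ?_⟩
    · rw [wp_seq, wp_setBit (by simp [fl]) hlam, wp_setBit (by simp [fl]) hlam]
      simp [fu] at hu
      simp [wp_assign]
      refine ⟨⟨by omega, c2, ?_, ?_, ?_, ?_, by omega⟩, by omega⟩
      · intro j hj
        rcases c3 j hj with h | h
        · simp [h]
        · simpa [h.ne] using h3 j h
      · intro j
        simp [bitAt_setB _ hlam]
        rintro (rfl | h)
        · exact hx
        · exact h4 j h
      · intro j
        simp [bitAt_setB _ hlam]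
        rintro (rfl | h)
        · exact hx
        · exact h5 j h
      · intro _ j hj
        simp [bitAt_setB _ hlam]
        rcases c3 j hj with h | h
        · simp [h]
        · simp [h6 hu j h]
    · simp [fu] at hu
      rw [wp_skip]
      simp [wp_assign]
      refine ⟨⟨by omega, c2, ?_, h4, h5, fun h => absurd hu h, by omega⟩, by omega⟩
      intro j hj
      rcases c3 j hj with h | h
      · simp [h]
      · simpa [h.ne] using h3 j h
  · rintro t s1 F ⟨h1, h2, h3, h4, h5, h6, h7⟩ he
    have fK : s1.reg .K = s.reg .K := F.r .K
    have fl : s1.reg .lam = lam := (F.r .lam).trans hl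
    have hx : s1.reg .sj = s.reg .K := by simp [fK] at he; omega
    rw [hx] at h2 h3 h6
    simp [fK, fl]
    exact ⟨fun j => h2 j (by omega), h3, h4, h5, h6, by omega⟩

end Layers

/-! ### Generation of the first layer -/

section Layers

variable {n₁ n₂ : ℕ} {G : BipGraph n₁ n₂} {lam : ℕ} {s s' s0 : Mem}

/-- The `j`-th branch is in reach of an unmatched `V₂`-node. -/
def Near (G : BipGraph n₁ n₂) (s : Mem) (j : ℕ) : Prop :=
  ∃ b, G.edgeNat (child s j) b ∧ s.arr .idx2 b 0 = 0

/-- Every `WT₂` branch is tested by one scan, paid by the potential up to a constant. Without words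
a branch is put into the queue at once; with words the bits are collected and converted afterwards.
-/
theorem wp_firstLayer (hlam : 0 < lam) (hB : Base G lam s) (hP : Perm G s)
    (h0 : ∀ j, s.arr .lab j 0 = 0) (hqt : s.reg .qt = 0) (hqh : s.reg .qh = 0)
    (hnw : s.reg .nw = s.reg .K / lam + 1)
    (hre : s.reg .uw ≠ 0 → ∀ j, bitAt lam (s.arr .reached 0) j = true ↔ j < s.reg .K) :
    wp lam firstLayer s (fun t s' => Base G lam s' ∧ Layers G lam s' ∧
      t + pot n₁ n₂ s ≤ pot n₁ n₂ s' + 1000 * (s.reg .K + 1)) := by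
  have hQ : Que s := by
    constructor <;> intro i hi <;> simp [hqt, h0] at hi
  have hnK : s.reg .nw ≤ s.reg .K + 1 := by
    rw [hnw]; have := Nat.div_le_self (s.reg .K) lam; omega
  have hKn : s.reg .K < s.reg .nw * lam := by
    rw [hnw, mul_comm]; exact Nat.lt_mul_div_succ _ hlam
  have hl := hB.static.word
  by_cases hu : s.reg .uw = 0
  · have key : wp lam firstLayer s (fun t s' => Base G lam s' ∧ s'.reg .p = 1 ∧
        s'.reg .qe = s'.reg .qt ∧ Labelling s s' (fun j => j < s.reg .K ∧ Near G s j) ∧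
        (∀ j < s.reg .K, Near G s j → s'.arr .lab j 0 ≠ 0) ∧
        t + pot n₁ n₂ s ≤ pot n₁ n₂ s' + 1000 * (s.reg .K + 1)) := by
      simp only [firstLayer, ↓wp_seq, ↓wp_assign]
      rw [wp_ifte]
      refine ⟨fun h => absurd hu (by simpa using h), fun _ => ?_⟩
      rw [wp_skip]
      generalize hS : Mem.setReg _ _ _ = S
      have eB : Base G lam S := hB.congr (by rw [← hS]; simp [Agree])
      have ep : S.reg .p = 1 := by rw [← hS]; simp
      have eK : S.reg .K = s.reg .K := by rw [← hS]; simp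
      have eu : S.reg .uw = 0 := by rw [← hS]; simpa using hu
      have es : S.reg .sj = 0 := by rw [← hS]; simp
      have eqt : S.reg .qt = 0 := by rw [← hS]; simpa using hqt
      have epot : pot n₁ n₂ S = pot n₁ n₂ s := by rw [← hS]; simp
      have earr : S.arr = s.arr := by rw [← hS]; simp
      have eR : Labelling s S (fun j => j < s.reg .K ∧ Near G s j) :=
        ⟨hQ.congr (by rw [← hS]; simp [Agree]), by omega, by simp [earr], by simp [earr],
          fun j hj hj' => absurd (earr ▸ hj) hj'⟩
      clear hS
      refine wp_while (fun t s' => Base G lam s' ∧ s'.reg .sj ≤ s.reg .K ∧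
        Labelling s s' (fun j => j < s.reg .K ∧ Near G s j) ∧
        -- Labelled branches have a child that was treated before, so the branch of the current
        -- child is still unlabelled when it is put into the queue.
        (∀ j < s.reg .K, s'.arr .lab j 0 ≠ 0 → s.arr .chl j 0 < s'.reg .sj) ∧
        (∀ j < s.reg .K, s.arr .chl j 0 < s'.reg .sj → Near G s j → s'.arr .lab j 0 ≠ 0) ∧
        t + pot n₁ n₂ s ≤ pot n₁ n₂ s' + 300 * s'.reg .sj) (fun s' => s.reg .K - s'.reg .sj) ?_ ?_ ?_
      · refine ⟨eB, by omega, eR, fun j _ h => absurd (h0 j) (earr ▸ h), fun j _ h => by omega, by omega⟩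
      · rintro t s1 F ⟨hB1, h1, h2, h3, h4, h5⟩ he
        have fK : s1.reg .K = s.reg .K := (F.r .K).trans eK
        have fp : s1.reg .p = 1 := (F.r .p).trans ep
        have fu : s1.reg .uw = 0 := (F.r .uw).trans eu
        have fch : s1.arr .chl = s.arr .chl := (F.a .chl).trans (by rw [earr])
        have fpa : s1.arr .par = s.arr .par := (F.a .par).trans (by rw [earr])
        have fn1 : s1.arr .node1 = s.arr .node1 := (F.a .node1).trans (by rw [earr])
        have fi2 : s1.arr .idx2 = s.arr .idx2 := (F.a .idx2).trans (by rw [earr])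
        clear F
        have hx : s1.reg .sj < s.reg .K := by simpa [fK] using he
        rw [wp_seq, wp_assign]
        have hlt := hB1.nodes.node1_lt (s1.reg .sj) (by omega)
        have hidx := hB1.nodes.idx1_node1 (s1.reg .sj) (by omega)
        refine wp_call_seq (wp_findFree (G := G) hlam (hB1.congr (by simp [Agree])) ?_ (Or.inl ?_)) ?_
        · simpa using hlt
        · simp [hidx]
        rintro t2 s2 F2 ⟨hB2, hf, hs, _, _, ht2⟩
        have g1 : s2.reg .K = s.reg .K := by simpa [fK] using F2.r .K
        have g2 : s2.reg .p = 1 := by simpa [fp] using F2.r .p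
        have g3 : s2.reg .uw = 0 := by simpa [fu] using F2.r .uw
        have g4 : s2.reg .sj = s1.reg .sj := by simpa using F2.r .sj
        have g5 : s2.arr .par = s.arr .par := by simpa [fpa] using F2.a .par
        have g6 : s2.arr .lab = s1.arr .lab := by simpa using F2.a .lab
        have g7 : s2.arr .queue = s1.arr .queue := by simpa using F2.a .queue
        have g8 : s2.reg .qt = s1.reg .qt := by simpa using F2.r .qt
        clear F2
        simp [fn1, fi2] at hf hs ht2
        have hpl := hP.par_lt _ hx
        have hcp := hP.chl_par _ hx
        have R2 : Labelling s s2 (fun j => j < s.reg .K ∧ Near G s j) :=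
          h2.congr (by simp [Agree, g1, g2, g6, g7, g8, fK, fp])
        have hcase : ∀ j < s.reg .K, s.arr .chl j 0 ≤ s1.reg .sj →
            s.arr .chl j 0 < s1.reg .sj ∨ j = s.arr .par (s1.reg .sj) 0 := by
          intro j hj hle
          rcases lt_or_eq_of_le hle with h | h
          · exact Or.inl h
          · right; rw [← h, hP.par_chl j hj]
        simp only [↓wp_seq, incr]
        rw [wp_ifte]
        refine ⟨fun hr => ?_, fun hr => ?_⟩
        · simp only [Expr.eval] at hr
          obtain ⟨hE, hb0⟩ := hs hr
          have hnear : Near G s (s.arr .par (s1.reg .sj) 0) :=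
            ⟨_, by rw [child, hcp]; exact hE, hb0⟩
          have hlab0 : s1.arr .lab (s.arr .par (s1.reg .sj) 0) 0 = 0 := by
            by_contra hne
            have := h3 _ hpl hne
            rw [hcp] at this; omega
          rw [wp_ifte]
          refine ⟨fun h => absurd g3 (by simpa using h), fun _ => ?_⟩
          simp [enqueue, incr, wp_seq, wp_put, wp_assign, g1, g2, g4, g5, g6, g7, g8]
          refine ⟨⟨hB2.congr (by simp [Agree]), by omega, ?_, ?_, ?_, by omega⟩, by omega⟩
          · refine R2.enqueue (r := s.arr .par (s1.reg .sj) 0) (by rw [g1]; exact hpl) (by rw [g6]; exact hlab0)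
              (by omega) ⟨hpl, hnear⟩ ?_ ?_ ?_ ?_ ?_ <;> simp [g1, g2, g6, g7, g8]
          · intro j hj hne
            split_ifs at hne with h
            · rw [h, hcp]
            · exact (h3 j hj hne).le
          · intro j hj hle hnr hne
            split_ifs at hne with h7
            rcases hcase j hj hle with h6 | h6
            · exact h4 j hj h6 hnr hne
            · exact h7 h6
        · simp only [Expr.eval] at hr
          rw [wp_skip, wp_assign]
          simp [g4, g6]
          refine ⟨⟨hB2.congr (by simp [Agree]), by omega, R2.congr (by simp [Agree]), ?_, ?_, by omega⟩, by omega⟩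
          · intro j hj hne
            exact (h3 j hj hne).le
          · intro j hj hle hnr
            rcases hcase j hj hle with h6 | h6
            · exact h4 j hj h6 hnr
            · obtain ⟨b, hE, hb0⟩ := hnr
              rw [child, h6, hcp] at hE
              exact absurd hb0 (hf hr b hE)
      · rintro t s1 F ⟨hB1, h1, h2, h3, h4, h5⟩ he
        have fK : s1.reg .K = s.reg .K := (F.r .K).trans eK
        have fp : s1.reg .p = 1 := (F.r .p).trans ep
        have fu : s1.reg .uw = 0 := (F.r .uw).trans eu
        have hx : s1.reg .sj = s.reg .K := by simp [fK] at he; omega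
        rw [wp_ifte]
        refine ⟨fun h => absurd fu (by simpa using h), fun _ => ?_⟩
        simp [wp_skip, wp_assign, fp]
        refine ⟨hB1.congr (by simp [Agree]), h2.congr (by simp [Agree]), ?_, by omega⟩
        intro j hj hnr
        exact h4 j hj (by rw [hx]; exact hP.chl_lt j hj) hnr
    refine wp_call key fun t s' F ⟨h1, h2, h3, h4, h5, h6⟩ => ⟨h1, ?_, h6⟩
    refine Layers.first h0 F.agree h2 ?_ h3 ((F.r .qh).trans hqh) h4 h5 ?_
    · rw [F.r .nw, F.r .K, hnw]
    · intro h; rw [F.r .uw] at h; exact absurd hu h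
  · have key : wp lam firstLayer s (fun t s' => Base G lam s' ∧ s'.reg .p = 1 ∧
        s'.reg .qe = s'.reg .qt ∧ Labelling s s' (fun j => j < s.reg .K ∧ Near G s j) ∧
        (∀ j < s.reg .K, Near G s j → s'.arr .lab j 0 ≠ 0) ∧ WordInv lam s' ∧
        t + pot n₁ n₂ s ≤ pot n₁ n₂ s' + 1000 * (s.reg .K + 1)) := by
      simp only [firstLayer, ↓wp_seq, ↓wp_assign]
      rw [wp_ifte]
      refine ⟨fun _ => ?_, fun h => absurd (by simpa using h) hu⟩
      refine wp_call wp_clearLayer ?_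
      rintro t1 S FS ⟨hz, -, ht1⟩
      simp at hz ht1
      have earr : ∀ A, (A ≠ .lay1 ∧ A ≠ .lay2) → S.arr A = s.arr A := by
        intro A hA
        refine (FS.arr A ?_).trans (by simp)
        cases A <;> first | rfl | (exfalso; simp at hA)
      have ep : S.reg .p = 1 := by simpa using FS.r .p
      have eK : S.reg .K = s.reg .K := by simpa using FS.r .K
      have eu : S.reg .uw ≠ 0 := by rw [show S.reg .uw = s.reg .uw by simpa using FS.r .uw]; exact hu
      have eqt : S.reg .qt = 0 := by rw [← hqt]; simpa using FS.r .qt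
      have enw : S.reg .nw = s.reg .nw := by simpa using FS.r .nw
      have el : S.reg .lam = lam := by rw [← hl]; simpa using FS.r .lam
      have eB : Base G lam S := (hB.congr (s' := s.setReg .p 1) (by simp [Agree])).congr FS.agree
      have epot : pot n₁ n₂ S = pot n₁ n₂ s := by rw [pot_congr FS.agree]; simp
      have elb : S.arr .lab = s.arr .lab := earr _ (by simp)
      have equ : S.arr .queue = s.arr .queue := earr _ (by simp)
      have ech : S.arr .chl = s.arr .chl := earr _ (by simp)
      have epar : S.arr .par = s.arr .par := earr _ (by simp)
      have en1 : S.arr .node1 = s.arr .node1 := earr _ (by simp)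
      have en2 : S.arr .node2 = s.arr .node2 := earr _ (by simp)
      have ei2 : S.arr .idx2 = s.arr .idx2 := earr _ (by simp)
      have ere : S.arr .reached = s.arr .reached := earr _ (by simp)
      have eP : Perm G S := hP.congr (by simp [Agree, *])
      have eQ : Que S := hQ.congr (by simp [Agree, *])
      have eW : WordInv lam S := by
        constructor
        · intro i; rw [ere, elb, hre hu, eK]; simp [h0]
        · intro p hp1 hp2 j hj
          rw [enw] at hj
          rw [elb, h0, show p = 1 by omega, bitAt, (hz _ (Nat.div_lt_of_lt_mul (by rwa [mul_comm]))).2]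
          simp
      clear FS earr
      refine wp_while (fun t s' => Base G lam s' ∧ s'.reg .sj ≤ s.reg .K ∧
        (∀ i < s.reg .nw * lam, bitAt lam (s'.arr .lay1 1) i = true ↔ i < s'.reg .sj ∧
          ∃ b, G.edgeNat (s.arr .node1 i 0) b ∧ s.arr .idx2 b 0 = 0) ∧
        Agree [.qt] [.lab, .queue] S s' ∧
        t + pot n₁ n₂ s ≤ pot n₁ n₂ s' + 300 * s'.reg .sj) (fun s' => s.reg .K - s'.reg .sj) ?_ ?_ ?_
      · refine ⟨eB.congr (by simp [Agree]), by simp, ?_, by simp [Agree], by simp [epot]⟩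
        intro i hi
        simp only [Mem.setReg_arr, bitAt, (hz _ (Nat.div_lt_of_lt_mul (by rwa [mul_comm]))).1]
        simp
      · rintro t s1 F ⟨hB1, h1, h2, hA, h5⟩ he
        have fK : s1.reg .K = s.reg .K := (F.r .K).trans (by simp [eK])
        have fl : s1.reg .lam = lam := hB1.static.word
        have fu : s1.reg .uw ≠ 0 := by rw [F.r .uw]; simpa using eu
        have fn1 : s1.arr .node1 = s.arr .node1 := (F.a .node1).trans en1
        have fi2 : s1.arr .idx2 = s.arr .idx2 := (F.a .idx2).trans ei2
        clear F
        have hx : s1.reg .sj < s.reg .K := by simpa [fK] using he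
        rw [wp_seq, wp_assign]
        have hlt := hB1.nodes.node1_lt (s1.reg .sj) (by omega)
        have hidx := hB1.nodes.idx1_node1 (s1.reg .sj) (by omega)
        refine wp_call_seq (wp_findFree (G := G) hlam (hB1.congr (by simp [Agree])) ?_ (Or.inl ?_)) ?_
        · simpa using hlt
        · simp [hidx]
        rintro t2 s2 F2 ⟨hB2, hf, hs, _, _, ht2⟩
        have g3 : s2.reg .uw ≠ 0 := by rw [F2.r .uw]; simpa using fu
        have g4 : s2.reg .sj = s1.reg .sj := by simpa using F2.r .sj
        have g5 : s2.arr .lay1 = s1.arr .lay1 := by simpa using F2.a .lay1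
        have g6 : s2.reg .lam = lam := hB2.static.word
        have hA2 : Agree [.qt] [.lab, .queue] S s2 := by
          obtain ⟨k1, k2⟩ := hA
          have k3 := F2.r .qt
          have k4 := F2.a .lab
          have k5 := F2.a .queue
          simp at k1 k2 k3 k4 k5
          simp [Agree, *]
        clear F2
        simp [fn1, fi2] at hf hs ht2
        simp only [↓wp_seq, incr]
        rw [wp_ifte]
        refine ⟨fun hr => ?_, fun hr => ?_⟩
        · simp only [Expr.eval] at hr
          rw [wp_ifte]
          refine ⟨fun _ => ?_, fun h => absurd (by simpa using h) g3⟩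
          rw [wp_setBit g6 hlam]
          simp [wp_assign, g4]
          refine ⟨⟨hB2.congr (by simp [Agree]), by omega, ?_, by simpa [Agree] using hA2, by omega⟩, by omega⟩
          intro i hi
          rw [bitAt_setB _ hlam, g5, Bool.or_eq_true, h2 i hi, le_iff_lt_or_eq]
          simp
          constructor
          · rintro (rfl | ⟨h6, h7⟩)
            · exact ⟨Or.inr rfl, _, hs hr⟩
            · exact ⟨Or.inl h6, h7⟩
          · rintro ⟨h6 | h6, h7⟩
            · exact Or.inr ⟨h6, h7⟩
            · exact Or.inl h6
        · simp only [Expr.eval] at hr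
          rw [wp_skip, wp_assign]
          simp [g4, g5]
          refine ⟨⟨hB2.congr (by simp [Agree]), by omega, ?_, by simpa [Agree] using hA2, by omega⟩, by omega⟩
          intro i hi
          rw [h2 i hi, le_iff_lt_or_eq]
          constructor
          · rintro ⟨h6, h7⟩
            exact ⟨Or.inl h6, h7⟩
          · rintro ⟨h6 | h6, b, hE, hb⟩
            · exact ⟨h6, b, hE, hb⟩
            · subst h6; exact absurd hb (hf hr b hE)
      · rintro t s1 F ⟨hB1, h1, h2, hA, h5⟩ he
        have fK : s1.reg .K = s.reg .K := (F.r .K).trans (by simp [eK])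
        have fp : s1.reg .p = 1 := (F.r .p).trans (by simp [ep])
        have fnw : s1.reg .nw = s.reg .nw := (F.r .nw).trans (by simp [enw])
        have fu : s1.reg .uw ≠ 0 := by rw [F.r .uw]; simpa using eu
        have fch : s1.arr .chl = s.arr .chl := (F.a .chl).trans (by simp [ech])
        have fpa : s1.arr .par = s.arr .par := (F.a .par).trans (by simp [epar])
        have fre : s1.arr .reached = S.arr .reached := F.a .reached
        have fl2 : s1.arr .lay2 = S.arr .lay2 := F.a .lay2
        have fn1 : s1.arr .node1 = s.arr .node1 := (F.a .node1).trans (by simp [en1])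
        have fn2 : s1.arr .node2 = s.arr .node2 := (F.a .node2).trans (by simp [en2])
        have hQ1 : Que s1 := eQ.congr (by simp [Agree] at hA ⊢; simp [hA, fK, eK])
        have hW1 : WordInv lam s1 := eW.congr (by simp [Agree] at hA ⊢; simp [*])
        have fqt : s1.reg .qt = 0 := (hA.1 _ (by simp)).trans eqt
        have flab : s1.arr .lab = s.arr .lab := (hA.2 _ (by simp)).trans elb
        have hP1 : Perm G s1 := hP.congr (by simp [Agree, *])
        have hx : s1.reg .sj = s.reg .K := by simp [fK] at he; omega
        clear F
        rw [wp_ifte]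
        refine ⟨fun _ => ?_, fun h => absurd (by simpa using h) fu⟩
        refine wp_call (wp_convertLayer hlam hB1.static.word hP1 hQ1 hW1 (by omega) (by rw [fnw, fK, hnw])) ?_
        rintro t2 s2 F2 ⟨c1, c2, c3, c4⟩
        have gp : s2.reg .p = 1 := (F2.r .p).trans fp
        have epot2 : pot n₁ n₂ s2 = pot n₁ n₂ s1 := pot_congr F2.agree
        have hbit : ∀ j < s.reg .K, (bitAt lam (s1.arr .lay1 1) (s.arr .chl j 0) = true ↔ Near G s j) := by
          intro j hj
          have := hP.chl_lt j hj
          rw [h2 _ (by omega), hx]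
          simp [this, Near, child]
        -- The queue has distinct entries below `K`; this turns the charge per queue entry into a
        -- bound linear in `K`.
        have hlen : s2.reg .qt ≤ s.reg .K := by
          have hK2 : s2.reg .K = s.reg .K := (F2.r .K).trans fK
          have := Finset.card_le_card_of_injOn (s := Finset.range (s2.reg .qt)) (t := Finset.range (s.reg .K))
            (fun i => s2.arr .queue i 0)
            (fun i hi => Finset.mem_coe.2 (Finset.mem_range.2 (hK2 ▸ c2.que.lt i (Finset.mem_range.1 hi))))
            (fun i hi i' hi' h => c2.que.inj i (Finset.mem_range.1 hi) i' (Finset.mem_range.1 hi') h)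
          simpa using this
        rw [fqt, fnw] at c4
        simp [gp]
        rw [fK, fp, fch] at c3
        refine ⟨(hB1.congr F2.agree).congr (by simp [Agree]), ?_, ?_, c1.congr (by simp [Agree]), ?_⟩
        · have c5 : Labelling s s2 (fun j => j < s.reg .K ∧ Near G s j) := by
            refine ⟨c2.que, by omega, fun i hi => by omega, fun j hj => absurd (h0 j) hj, fun j hj hj' => ?_⟩
            obtain ⟨h6, h7, h8⟩ := c2.fresh j (by rw [flab, h0]) hj'
            rw [fK] at h7
            rw [fp, fch, hbit j h7] at h8
            exact ⟨h6, h7, h8⟩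
          exact c5.congr (by simp [Agree])
        · intro j hj hnr
          exact c3 j hj ((hbit j hj).2 hnr)
        · omega
    refine wp_call key fun t s' F ⟨h1, h2, h3, h4, h5, h6, h7⟩ => ⟨h1, ?_, h7⟩
    refine Layers.first h0 F.agree h2 ?_ h3 ((F.r .qh).trans hqh) h4 h5 (fun _ => h6)
    rw [F.r .nw, F.r .K, hnw]

end Layers

/-! ### Generation of the next layer, by lists and by words -/

section Layers

variable {n₁ n₂ : ℕ} {G : BipGraph n₁ n₂} {lam : ℕ} {s s' s0 : Mem}

/-- The time for the generation of the next layer from one branch. -/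
def layerWeight (s : Mem) (j : ℕ) : ℕ :=
  if s.reg .uw = 0 then s.arr .inDeg (s.arr .node2 j 0) 0 + 1 else s.reg .nw + 1

/-- The `j`-th branch is in reach of a branch with label `p`. -/
def Above (G : BipGraph n₁ n₂) (s : Mem) (j : ℕ) : Prop :=
  j < s.reg .K ∧ ∃ j' < s.reg .K, s.arr .lab j' 0 = s.reg .p ∧
      G.edgeNat (child s j) (s.arr .node2 j' 0)

theorem Layers.mem_seg (h : Layers G lam s) {j : ℕ} :
    j < s.reg .K ∧ s.arr .lab j 0 = s.reg .p ↔
      ∃ i, s.reg .qh ≤ i ∧ i < s.reg .qe ∧ s.arr .queue i 0 = j := by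
  have hpos := h.pos
  have hqe := h.qe
  constructor
  · rintro ⟨_, h1⟩
    obtain ⟨i, hi, rfl⟩ := h.que.ex j (by omega)
    refine ⟨i, ?_, by omega, rfl⟩
    by_contra hlt
    have := h.early i (by omega)
    omega
  · rintro ⟨i, h1, h2, rfl⟩
    exact ⟨h.que.lt i (by omega), h.seg i h1 h2⟩

-- Since layer `p` has no unmatched neighbour in `V₁`, every entry of its in-lists is the child of a
-- branch. The in-degrees pay for the scan.
set_option maxHeartbeats 1000000 in
theorem wp_nextLayer_list (hB : Base G lam s) (hP : Perm G s) (h : Layers G lam s)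
    (hu : s.reg .uw = 0)
    (hstr : ∀ j < s.reg .K, s.arr .lab j 0 = s.reg .p → ∀ v, G.edgeNat v (s.arr .node2 j 0) →
      s.arr .idx1 v 0 ≠ 0) :
    wp lam nextLayer s (fun t s' => s'.reg .p = s.reg .p + 1 ∧ s'.reg .qe = s'.reg .qt ∧
      s'.reg .qh = s.reg .qe ∧ Labelling s s' (Above G s) ∧
      (∀ i, s.reg .qh ≤ i → i < s.reg .qe → ∀ j < s.reg .K,
        G.edgeNat (child s j) (s.arr .node2 (s.arr .queue i 0) 0) → s'.arr .lab j 0 ≠ 0) ∧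
      t + 300 * s.reg .qt ≤ 300 * s'.reg .qt + 300 * (∑ i ∈ Finset.Ico (s.reg .qh) (s.reg .qe),
        layerWeight s (s.arr .queue i 0)) + 40) := by
  have hqe := h.qe
  have hle := h.qh_le
  simp only [nextLayer, incr, ↓wp_seq, ↓wp_assign]
  rw [wp_ifte]
  refine ⟨fun h => absurd hu (by simpa using h), fun _ => ?_⟩
  rw [wp_skip]
  generalize hS : Mem.setReg _ .h _ = S
  have eB : Base G lam S := hB.congr (by rw [← hS]; simp [Agree])
  have ep : S.reg .p = s.reg .p + 1 := by rw [← hS]; simp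
  have eK : S.reg .K = s.reg .K := by rw [← hS]; simp
  have eu : S.reg .uw = 0 := by rw [← hS]; simpa using hu
  have eh : S.reg .h = s.reg .qh := by rw [← hS]; simp
  have eqt : S.reg .qt = s.reg .qt := by rw [← hS]; simp
  have eqe : S.reg .qe = s.reg .qe := by rw [← hS]; simp
  have earr : S.arr = s.arr := by rw [← hS]; simp
  have eR : Labelling s S (Above G s) :=
    ⟨h.que.congr (by rw [← hS]; simp [Agree]), by omega, by simp [earr], by simp [earr],
      fun j hj hj' => absurd (earr ▸ hj) hj'⟩
  clear hS
  refine wp_while (fun t s' => s.reg .qh ≤ s'.reg .h ∧ s'.reg .h ≤ s.reg .qe ∧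
    Labelling s s' (Above G s) ∧
    (∀ i, s.reg .qh ≤ i → i < s'.reg .h → ∀ j < s.reg .K,
        G.edgeNat (child s j) (s.arr .node2 (s.arr .queue i 0) 0) → s'.arr .lab j 0 ≠ 0) ∧
    t + 300 * s.reg .qt ≤ 300 * s'.reg .qt + 300 * (∑ i ∈ Finset.Ico (s.reg .qh) (s'.reg .h),
        layerWeight s (s.arr .queue i 0))) (fun s' => s.reg .qe - s'.reg .h) ?_ ?_ ?_
  · refine ⟨by omega, by omega, eR, fun i h1 h2 => by omega, by simp [eqt]⟩
  · rintro t s1 F ⟨h1, h2, h3, h4, h5⟩ he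
    have fK : s1.reg .K = s.reg .K := (F.r .K).trans eK
    have fp : s1.reg .p = s.reg .p + 1 := (F.r .p).trans ep
    have fu : s1.reg .uw = 0 := (F.r .uw).trans eu
    have fqe : s1.reg .qe = s.reg .qe := (F.r .qe).trans eqe
    have fpa : s1.arr .par = s.arr .par := (F.a .par).trans (by rw [earr])
    have fn2 : s1.arr .node2 = s.arr .node2 := (F.a .node2).trans (by rw [earr])
    have fi1 : s1.arr .idx1 = s.arr .idx1 := (F.a .idx1).trans (by rw [earr])
    have fde : s1.arr .inDeg = s.arr .inDeg := (F.a .inDeg).trans (by rw [earr])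
    have fad : s1.arr .inAdj = s.arr .inAdj := (F.a .inAdj).trans (by rw [earr])
    clear F
    have hx : s1.reg .h < s.reg .qe := by simpa [fqe] using he
    have hq : s1.arr .queue (s1.reg .h) 0 = s.arr .queue (s1.reg .h) 0 := h3.old _ (by omega)
    set q := s.arr .queue (s1.reg .h) 0 with hqdef
    obtain ⟨hqK, hql⟩ := h.mem_seg.2 ⟨_, h1, hx, hqdef.symm⟩
    have hw : layerWeight s q = s.arr .inDeg (s.arr .node2 q 0) 0 + 1 := by simp [layerWeight, hu]
    simp only [↓wp_seq, ↓wp_assign]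
    rw [wp_ifte]
    refine ⟨fun h => absurd fu (by simpa using h), fun _ => ?_⟩
    simp only [↓wp_seq, ↓wp_assign]
    generalize hS : Mem.setReg _ .e _ = S2
    have gb : S2.reg .b = s.arr .node2 q 0 := by rw [← hS]; simp [hq, fn2]
    have ge : S2.reg .e = 0 := by rw [← hS]; simp
    have gh : S2.reg .h = s1.reg .h := by rw [← hS]; simp
    have gp : S2.reg .p = s.reg .p + 1 := by rw [← hS]; simp [fp]
    have gqt : S2.reg .qt = s1.reg .qt := by rw [← hS]; simp
    have gK : S2.reg .K = s.reg .K := by rw [← hS]; simp [fK]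
    have garr : S2.arr = s1.arr := by rw [← hS]; simp
    have gR : Labelling s S2 (Above G s) := h3.congr (by rw [← hS]; simp [Agree])
    clear hS
    refine wp_while (fun t s' => s'.reg .e ≤ s.arr .inDeg (s.arr .node2 q 0) 0 ∧
      Labelling s s' (Above G s) ∧
      (∀ i, s.reg .qh ≤ i → i < s1.reg .h → ∀ j < s.reg .K,
        G.edgeNat (child s j) (s.arr .node2 (s.arr .queue i 0) 0) → s'.arr .lab j 0 ≠ 0) ∧
      (∀ e < s'.reg .e, s'.arr .lab (s.arr .par (s.arr .idx1 (s.arr .inAdj (s.arr .node2 q 0) e) 0 - 1) 0) 0 ≠ 0) ∧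
      t + 300 * s1.reg .qt ≤ 300 * s'.reg .qt + 100 * s'.reg .e)
      (fun s' => s.arr .inDeg (s.arr .node2 q 0) 0 - s'.reg .e) ?_ ?_ ?_
    · refine ⟨by omega, gR, by rwa [garr], fun e he => by omega, by omega⟩
    · rintro t' s2 F ⟨k1, k2, k3, k4, k5⟩ he2
      have lb : s2.reg .b = s.arr .node2 q 0 := (F.r .b).trans gb
      have lp : s2.reg .p = s.reg .p + 1 := (F.r .p).trans gp
      have lK : s2.reg .K = s.reg .K := (F.r .K).trans gK
      have lh : s2.reg .h = s1.reg .h := (F.r .h).trans gh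
      have lpa : s2.arr .par = s.arr .par := (F.a .par).trans (by rw [garr, fpa])
      have li1 : s2.arr .idx1 = s.arr .idx1 := (F.a .idx1).trans (by rw [garr, fi1])
      have lde : s2.arr .inDeg = s.arr .inDeg := (F.a .inDeg).trans (by rw [garr, fde])
      have lad : s2.arr .inAdj = s.arr .inAdj := (F.a .inAdj).trans (by rw [garr, fad])
      clear F
      have hy : s2.reg .e < s.arr .inDeg (s.arr .node2 q 0) 0 := by simpa [lb, lde] using he2
      have hE : G.edgeNat (s.arr .inAdj (s.arr .node2 q 0) (s2.reg .e)) (s.arr .node2 q 0) :=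
        hB.static.adj2.mem _ _ hy
      set v := s.arr .inAdj (s.arr .node2 q 0) (s2.reg .e) with hv
      -- The index is nonzero, so subtracting one from it is a genuine branch number and not a
      -- truncated difference.
      have hv0 := hstr q hqK hql v hE
      have hvK := hB.nodes.idx1_le v
      have hrK : s.arr .par (s.arr .idx1 v 0 - 1) 0 < s.reg .K := hP.par_lt _ (by omega)
      have habove : Above G s (s.arr .par (s.arr .idx1 v 0 - 1) 0) := by
        refine ⟨hrK, q, hqK, hql, ?_⟩
        rw [child, hP.chl_par _ (by omega), hB.nodes.node1_idx1 v hv0]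
        exact hE
      simp only [↓wp_seq, ↓wp_assign]
      simp only [Arr.el, Expr.eval, lb, lad, li1, lpa, Expr.sub_eq, Expr.ofNat_eq, BinOp.eval]
      rw [← hv]
      set r := s.arr .par (s.arr .idx1 v 0 - 1) 0 with hr
      rw [wp_ifte]
      refine ⟨fun h0 => ?_, fun h0 => ?_⟩
      · simp at h0
        simp [enqueue, incr, wp_seq, wp_put, wp_assign]
        refine ⟨⟨by omega, ?_, ?_, ?_, by omega⟩, by omega⟩
        · refine k2.enqueue (r := r) (by omega) h0 (by omega) habove ?_ ?_ ?_ ?_ ?_ <;> simp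
        · intro i hi1 hi2 j hj hEj hne
          split_ifs at hne with hjr
          · omega
          · exact k3 i hi1 hi2 j hj hEj hne
        · intro e he3 hne
          split_ifs at hne with hjr
          · omega
          · rcases lt_or_eq_of_le he3 with h6 | h6
            · exact k4 e h6 hne
            · subst h6; exact hjr rfl
      · simp at h0
        simp [incr, wp_skip, wp_assign]
        refine ⟨⟨by omega, k2.congr (by simp [Agree]), k3, ?_, by omega⟩, by omega⟩
        intro e he3
        rcases lt_or_eq_of_le he3 with h6 | h6
        · exact k4 e h6
        · subst h6; exact h0
    · rintro t' s2 F ⟨k1, k2, k3, k4, k5⟩ he2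
      have lb : s2.reg .b = s.arr .node2 q 0 := (F.r .b).trans gb
      have lh : s2.reg .h = s1.reg .h := (F.r .h).trans gh
      have lde : s2.arr .inDeg = s.arr .inDeg := (F.a .inDeg).trans (by rw [garr, fde])
      clear F
      have hy : s2.reg .e = s.arr .inDeg (s.arr .node2 q 0) 0 := by
        simp [lb, lde] at he2; omega
      simp [incr, wp_assign, lh]
      rw [Finset.sum_Ico_succ_top h1, ← hqdef, hw]
      refine ⟨⟨by omega, by omega, k2.congr (by simp [Agree]), ?_, by omega⟩, by omega⟩
      intro i hi1 hi2 j hj hEj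
      rcases lt_or_eq_of_le hi2 with h6 | h6
      · exact k3 i hi1 h6 j hj hEj
      · rw [h6, ← hqdef] at hEj
        obtain ⟨e, he3, he4⟩ := hB.static.adj2.ex _ _ hEj
        have := k4 e (by omega)
        rw [he4, child, hB.nodes.idx1_node1 _ (hP.chl_lt j hj), Nat.add_sub_cancel, hP.par_chl j hj] at this
        exact this
  · rintro t s1 F ⟨h1, h2, h3, h4, h5⟩ he
    have fu : s1.reg .uw = 0 := (F.r .uw).trans eu
    have fp : s1.reg .p = s.reg .p + 1 := (F.r .p).trans ep
    have fqe : s1.reg .qe = s.reg .qe := (F.r .qe).trans eqe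
    clear F
    have hx : s1.reg .h = s.reg .qe := by simp [fqe] at he; omega
    rw [wp_ifte]
    refine ⟨fun h => absurd fu (by simpa using h), fun _ => ?_⟩
    rw [hx] at h4 h5
    simp [wp_skip, wp_assign, fp, fqe]
    exact ⟨h3.congr (by simp [Agree]), h4, by omega⟩

end Layers

section Layers

variable {n₁ n₂ : ℕ} {G : BipGraph n₁ n₂} {lam : ℕ} {s s' s0 : Mem}

-- The union of the SUB-IN words over layer `p` contains exactly the children with a neighbour in
-- the layer; the conversion then discards those that were reached before.
set_option maxHeartbeats 1000000 in
theorem wp_nextLayer_word (hlam : 0 < lam) (hB : Base G lam s) (hP : Perm G s) (h : Layers G lam s)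
    (hu : s.reg .uw ≠ 0) (hlt : s.reg .qh < s.reg .qe) :
    wp lam nextLayer s (fun t s' => s'.reg .p = s.reg .p + 1 ∧ s'.reg .qe = s'.reg .qt ∧
      s'.reg .qh = s.reg .qe ∧ Labelling s s' (Above G s) ∧
      (∀ i, s.reg .qh ≤ i → i < s.reg .qe → ∀ j < s.reg .K,
        G.edgeNat (child s j) (s.arr .node2 (s.arr .queue i 0) 0) → s'.arr .lab j 0 ≠ 0) ∧
      WordInv lam s' ∧
      t + 300 * s.reg .qt ≤ 300 * s'.reg .qt + 300 * (∑ i ∈ Finset.Ico (s.reg .qh) (s.reg .qe),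
        layerWeight s (s.arr .queue i 0)) + 40) := by
  have hqe := h.qe
  have hle := h.qh_le
  have hl := hB.static.word
  have hnw := h.nw
  have hKn : s.reg .K < s.reg .nw * lam := by
    rw [hnw, mul_comm]; exact Nat.lt_mul_div_succ _ hlam
  have hW := h.word hu
  have hpos := h.pos
  have hlable := h.lab_le
  have hsum : ∀ m, ∑ i ∈ Finset.Ico (s.reg .qh) m, layerWeight s (s.arr .queue i 0) =
      (m - s.reg .qh) * (s.reg .nw + 1) := by
    intro m; simp [layerWeight, hu]
  simp only [hsum]
  simp only [nextLayer, incr, ↓wp_seq, ↓wp_assign]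
  rw [wp_ifte]
  refine ⟨fun _ => ?_, fun h => absurd (by simpa using h) hu⟩
  refine wp_call wp_clearLayer ?_
  rintro t1 S FS ⟨hz, hz2, ht1⟩
  simp at hz hz2 ht1
  have earr : ∀ A, (A ≠ .lay1 ∧ A ≠ .lay2) → S.arr A = s.arr A := by
    intro A hA
    refine (FS.arr A ?_).trans (by simp)
    cases A <;> first | rfl | (exfalso; simp at hA)
  have ep : S.reg .p = s.reg .p + 1 := by simpa using FS.r .p
  have eK : S.reg .K = s.reg .K := by simpa using FS.r .K
  have eu : S.reg .uw ≠ 0 := by rw [show S.reg .uw = s.reg .uw by simpa using FS.r .uw]; exact hu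
  have eqt : S.reg .qt = s.reg .qt := by simpa using FS.r .qt
  have eqh : S.reg .qh = s.reg .qh := by simpa using FS.r .qh
  have eqe : S.reg .qe = s.reg .qe := by simpa using FS.r .qe
  have enw : S.reg .nw = s.reg .nw := by simpa using FS.r .nw
  have el : S.reg .lam = lam := by rw [← hl]; simpa using FS.r .lam
  have elb : S.arr .lab = s.arr .lab := earr _ (by simp)
  have equ : S.arr .queue = s.arr .queue := earr _ (by simp)
  have ech : S.arr .chl = s.arr .chl := earr _ (by simp)
  have epar : S.arr .par = s.arr .par := earr _ (by simp)
  have en1 : S.arr .node1 = s.arr .node1 := earr _ (by simp)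
  have en2 : S.arr .node2 = s.arr .node2 := earr _ (by simp)
  have esi : S.arr .subIn = s.arr .subIn := earr _ (by simp)
  have ere : S.arr .reached = s.arr .reached := earr _ (by simp)
  have eW : WordInv lam S := by
    constructor
    · intro i; rw [ere, elb, eK, epar]; exact hW.reached i
    · intro p hp1 hp2 j hj
      rw [enw] at hj
      rw [ep] at hp2
      rcases Nat.lt_succ_iff_lt_or_eq.1 (Nat.lt_succ_of_le hp2) with h6 | h6
      · rw [hz2 p (by omega), elb]; exact hW.lay2 p hp1 (by omega) j hj
      · subst h6
        -- The cleared layer word is correct at this moment, because no label exceeds `p` yet.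
        rw [bitAt, (hz _ (Nat.div_lt_of_lt_mul (by rwa [mul_comm]))).2, elb]
        have := hlable j
        simp; omega
  clear FS earr
  refine wp_while (fun t s' => s.reg .qh ≤ s'.reg .h ∧ s'.reg .h ≤ s.reg .qe ∧
    (∀ i < s.reg .nw * lam, bitAt lam (s'.arr .lay1 (s.reg .p + 1)) i = true ↔
      ∃ k, s.reg .qh ≤ k ∧ k < s'.reg .h ∧ bitAt lam (s.arr .subIn (s.arr .queue k 0)) i = true) ∧
    Agree [.qt] [.lab, .queue] S s' ∧
    t ≤ 100 * ((s'.reg .h - s.reg .qh) * (s.reg .nw + 1))) (fun s' => s.reg .qe - s'.reg .h) ?_ ?_ ?_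
  · refine ⟨by simp [eqh], by simp [eqh]; omega, ?_, by simp [Agree], by simp⟩
    intro i hi
    simp only [Mem.setReg_arr, bitAt, (hz _ (Nat.div_lt_of_lt_mul (by rwa [mul_comm]))).1]
    simp [eqh]
    omega
  · rintro t s1 F ⟨h1, h2, h3, hA, h4⟩ he
    have fp : s1.reg .p = s.reg .p + 1 := (F.r .p).trans (by simp [ep])
    have fl : s1.reg .lam = lam := (F.r .lam).trans (by simp [el])
    have fu : s1.reg .uw ≠ 0 := by rw [F.r .uw]; simpa using eu
    have fnw : s1.reg .nw = s.reg .nw := (F.r .nw).trans (by simp [enw])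
    have fqe : s1.reg .qe = s.reg .qe := (F.r .qe).trans (by simp [eqe])
    have fqu : s1.arr .queue = s.arr .queue := (hA.2 _ (by simp)).trans equ
    have fsi : s1.arr .subIn = s.arr .subIn := (F.a .subIn).trans (by simp [esi])
    clear F
    have hx : s1.reg .h < s.reg .qe := by simpa [fqe] using he
    simp only [↓wp_seq, ↓wp_assign]
    rw [wp_ifte]
    refine ⟨fun _ => ?_, fun h => absurd (by simpa using h) fu⟩
    simp only [↓wp_seq, ↓wp_assign]
    refine wp_while (fun t s' => s'.reg .x ≤ s.reg .nw ∧
      (∀ x, s'.arr .lay1 (s.reg .p + 1) x = if x < s'.reg .x then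
        (s1.arr .lay1 (s.reg .p + 1) x ||| s.arr .subIn (s.arr .queue (s1.reg .h) 0) x) % 2 ^ lam
        else s1.arr .lay1 (s.reg .p + 1) x) ∧ t ≤ 40 * s'.reg .x) (fun s' => s.reg .nw - s'.reg .x) ?_ ?_ ?_
    · simp
    · rintro t' s2 F ⟨k1, k2, k3⟩ he2
      have gp : s2.reg .p = s.reg .p + 1 := (F.r .p).trans (by simp [fp])
      have gl : s2.reg .lam = lam := (F.r .lam).trans (by simp [fl])
      have gh : s2.reg .h = s1.reg .h := (F.r .h).trans (by simp)
      have gnw : s2.reg .nw = s.reg .nw := (F.r .nw).trans (by simp [fnw])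
      have gqu : s2.arr .queue = s.arr .queue := (F.a .queue).trans (by simp [fqu])
      have gsi : s2.arr .subIn = s.arr .subIn := (F.a .subIn).trans (by simp [fsi])
      clear F
      have hy : s2.reg .x < s.reg .nw := by simpa [gnw] using he2
      simp [wp_seq, wp_put, wp_assign, gp, gh, gqu, gsi]
      refine ⟨⟨by omega, ?_, by omega⟩, by omega⟩
      intro x
      by_cases h6 : x = s2.reg .x
      · subst h6; simp [k2]
      · rw [if_neg h6, k2]
        have : x < s2.reg .x ↔ x ≤ s2.reg .x := by omega
        simp [this]
    · rintro t' s2 F ⟨k1, k2, k3⟩ he2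
      have gh : s2.reg .h = s1.reg .h := (F.r .h).trans (by simp)
      have gnw : s2.reg .nw = s.reg .nw := (F.r .nw).trans (by simp [fnw])
      have hA2 : Agree [.qt] [.lab, .queue] S s2 := by
        obtain ⟨k1, k2⟩ := hA
        have k3 := F.r .qt
        have k4 := F.a .lab
        have k5 := F.a .queue
        simp at k1 k2 k3 k4 k5
        simp [Agree, *]
      clear F
      have hy : s2.reg .x = s.reg .nw := by simp [gnw] at he2; omega
      simp [wp_assign, gh]
      refine ⟨⟨by omega, by omega, ?_, by simpa [Agree] using hA2, ?_⟩, by omega⟩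
      · intro i hi
        have hd : i / lam < s.reg .nw := Nat.div_lt_of_lt_mul (by rwa [mul_comm])
        have hm := Nat.mod_lt i hlam
        have h7 : bitAt lam (s2.arr .lay1 (s.reg .p + 1)) i =
            (bitAt lam (s1.arr .lay1 (s.reg .p + 1)) i ||
              bitAt lam (s.arr .subIn (s.arr .queue (s1.reg .h) 0)) i) := by
          simp only [bitAt, k2, hy, if_pos hd, Nat.testBit_mod_two_pow, hm, Nat.testBit_or]
          simp
        rw [h7, Bool.or_eq_true, h3 i hi]
        constructor
        · rintro (⟨k, c1, c2, c3⟩ | c3)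
          · exact ⟨k, c1, by omega, c3⟩
          · exact ⟨_, h1, le_rfl, c3⟩
        · rintro ⟨k, c1, c2, c3⟩
          rcases lt_or_eq_of_le c2 with h6 | h6
          · exact Or.inl ⟨k, c1, h6, c3⟩
          · subst h6; exact Or.inr c3
      · rw [show s1.reg .h + 1 - s.reg .qh = s1.reg .h - s.reg .qh + 1 by omega, add_mul]
        omega
  · rintro t s1 F ⟨h1, h2, h3, hA, h4⟩ he
    have fK : s1.reg .K = s.reg .K := (F.r .K).trans (by simp [eK])
    have fp : s1.reg .p = s.reg .p + 1 := (F.r .p).trans (by simp [ep])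
    have fl : s1.reg .lam = lam := (F.r .lam).trans (by simp [el])
    have fu : s1.reg .uw ≠ 0 := by rw [F.r .uw]; simpa using eu
    have fnw : s1.reg .nw = s.reg .nw := (F.r .nw).trans (by simp [enw])
    have fqe : s1.reg .qe = s.reg .qe := (F.r .qe).trans (by simp [eqe])
    have fqt : s1.reg .qt = s.reg .qt := (hA.1 _ (by simp)).trans eqt
    have flab : s1.arr .lab = s.arr .lab := (hA.2 _ (by simp)).trans elb
    have fqu : s1.arr .queue = s.arr .queue := (hA.2 _ (by simp)).trans equ
    have fch : s1.arr .chl = s.arr .chl := (F.a .chl).trans (by simp [ech])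
    have fpa : s1.arr .par = s.arr .par := (F.a .par).trans (by simp [epar])
    have fn1 : s1.arr .node1 = s.arr .node1 := (F.a .node1).trans (by simp [en1])
    have fn2 : s1.arr .node2 = s.arr .node2 := (F.a .node2).trans (by simp [en2])
    have fre : s1.arr .reached = S.arr .reached := F.a .reached
    have fl2 : s1.arr .lay2 = S.arr .lay2 := F.a .lay2
    clear F
    have hQ1 : Que s1 := h.que.congr (by simp [Agree, *])
    have hW1 : WordInv lam s1 := eW.congr (by simp [Agree] at hA ⊢; simp [*])
    have hP1 : Perm G s1 := hP.congr (by simp [Agree, *])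
    have hx : s1.reg .h = s.reg .qe := by simp [fqe] at he; omega
    rw [wp_ifte]
    refine ⟨fun _ => ?_, fun h => absurd (by simpa using h) fu⟩
    refine wp_call (wp_convertLayer hlam fl hP1 hQ1 hW1 (by omega) (by rw [fnw, fK, hnw])) ?_
    rintro t2 s2 F2 ⟨c1, c2, c3, c4⟩
    have gp : s2.reg .p = s.reg .p + 1 := (F2.r .p).trans fp
    have gqe : s2.reg .qe = s.reg .qe := (F2.r .qe).trans fqe
    have hbit : ∀ j < s.reg .K, (bitAt lam (s1.arr .lay1 (s1.reg .p)) (s1.arr .chl j 0) = true ↔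
        ∃ k, s.reg .qh ≤ k ∧ k < s.reg .qe ∧ G.edgeNat (child s j) (s.arr .node2 (s.arr .queue k 0) 0)) := by
      intro j hj
      have hjc := hP.chl_lt j hj
      rw [fp, fch, h3 _ (by omega), hx]
      constructor
      · rintro ⟨k, d1, d2, d3⟩
        exact ⟨k, d1, d2, ((hB.nodes.subIn _ _).1 d3).2.2⟩
      · rintro ⟨k, d1, d2, d3⟩
        exact ⟨k, d1, d2, (hB.nodes.subIn _ _).2 ⟨hjc, h.que.lt k (by omega), d3⟩⟩
    have c5 : Labelling s s2 (Above G s) := by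
      refine ⟨c2.que, fqt ▸ c2.qt_le, fun i hi => by rw [c2.old i (by omega), fqu],
        fun j hj => by rw [c2.keep j (by rwa [flab]), flab], fun j hj hj' => ?_⟩
      obtain ⟨d1, d2, d3⟩ := c2.fresh j (by rw [flab, hj]) hj'
      rw [fK] at d2
      obtain ⟨k, d4, d5, d6⟩ := (hbit j d2).1 d3
      exact ⟨d1, d2, _, h.que.lt k (by omega), h.seg k d4 d5, d6⟩
    rw [fqt, fnw] at c4
    rw [hx] at h4
    -- Clearing and converting cost `O(nw)` once per layer; the layer is nonempty, so one of its
    -- branches can pay.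
    have h9 : s.reg .nw + 1 ≤ (s.reg .qe - s.reg .qh) * (s.reg .nw + 1) :=
      Nat.le_mul_of_pos_left _ (by omega)
    simp [gp, gqe]
    refine ⟨c5.congr (by simp [Agree]), ?_, c1.congr (by simp [Agree]), by omega⟩
    intro i hi1 hi2 j hj hE
    exact c3 j (by rw [fK]; exact hj) ((hbit j hj).2 ⟨i, hi1, hi2, hE⟩)

theorem wp_nextLayer (hlam : 0 < lam) (hB : Base G lam s) (hP : Perm G s) (h : Layers G lam s)
    (hlt : s.reg .qh < s.reg .qe)
    (hstr : ∀ j < s.reg .K, s.arr .lab j 0 = s.reg .p → ∀ v, G.edgeNat v (s.arr .node2 j 0) →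
      s.arr .idx1 v 0 ≠ 0) :
    wp lam nextLayer s (fun t s' => Layers G lam s' ∧ Labelling s s' (Above G s) ∧ s'.reg .qh = s.reg .qe ∧
      s'.reg .p = s.reg .p + 1 ∧
      t + 300 * s.reg .qt ≤ 300 * s'.reg .qt + 300 * (∑ i ∈ Finset.Ico (s.reg .qh) (s.reg .qe),
        layerWeight s (s.arr .queue i 0)) + 40) := by
  by_cases hu : s.reg .uw = 0
  · refine wp_call (wp_nextLayer_list hB hP h hu hstr) fun t s' F ⟨h1, h2, h3, h4, h5, h6⟩ =>
      ⟨Layers.next h hstr F.agree h1 h2 h3 h4 ?_ ?_, h4, h3, h1, h6⟩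
    · intro j hj j' hj' hl hE
      obtain ⟨i, d1, d2, rfl⟩ := h.mem_seg.1 ⟨hj', hl⟩
      exact h5 i d1 d2 j hj hE
    · intro hu'; exact absurd hu (F.r .uw ▸ hu')
  · refine wp_call (wp_nextLayer_word hlam hB hP h hu hlt) fun t s' F ⟨h1, h2, h3, h4, h5, h6, h7⟩ =>
      ⟨Layers.next h hstr F.agree h1 h2 h3 h4 ?_ (fun _ => h6), h4, h3, h1, h7⟩
    intro j hj j' hj' hl hE
    obtain ⟨i, d1, d2, rfl⟩ := h.mem_seg.1 ⟨hj', hl⟩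
    exact h5 i d1 d2 j hj hE

end Layers

/-! ### Conditions -/

section Conditions

variable {lam : ℕ} {s : Mem} {e f : Expr}

theorem Expr.eval_eq_ne_zero : (Expr.bin .eq e f).eval lam s ≠ 0 ↔ e.eval lam s = f.eval lam s := by
  simp only [Expr.eval, BinOp.eval]; split_ifs with h <;> simp [h]

theorem Expr.eval_lt_ne_zero : (Expr.bin .lt e f).eval lam s ≠ 0 ↔ e.eval lam s < f.eval lam s := by
  simp only [Expr.eval, BinOp.eval]; split_ifs with h <;> simp [h]

theorem Expr.eval_mul_ne_zero :
    (e * f).eval lam s ≠ 0 ↔ e.eval lam s ≠ 0 ∧ f.eval lam s ≠ 0 := by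
  simp only [Expr.mul_eq, Expr.eval, BinOp.eval]; simp

theorem Expr.eval_add_ne_zero :
    (e + f).eval lam s ≠ 0 ↔ e.eval lam s ≠ 0 ∨ f.eval lam s ≠ 0 := by
  simp only [Expr.add_eq, Expr.eval, BinOp.eval]; omega

theorem Expr.eval_reg (r : Reg) : (Expr.reg r).eval lam s = s.reg r := rfl

theorem Expr.eval_num (n : ℕ) : (OfNat.ofNat n : Expr).eval lam s = n := rfl

end Conditions

/-! ### Frames for runs without words -/

/-- Does the command contain a write to the array, when the branches for `uw ≠ 0` are ignored? -/
def Cmd.modListA : Cmd → Arr → Bool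
  | .skip, _ => false
  | .assign _ _, _ => false
  | .put A _ _ _, A' => decide (A = A')
  | .seq c c', r => c.modListA r || c'.modListA r
  | .ifte (.reg .uw) _ c', r => c'.modListA r
  | .ifte _ c c', r => c.modListA r || c'.modListA r
  | .whilst _ c, r => c.modListA r

/-- In a stage without words the vectors `reached` and `unvis` are not written, although the
commands contain writes to them. This is what keeps `Clean` valid through such stages. -/
theorem Exec.frame_list {lam : ℕ} {c : Cmd} {s s' : Mem} {t : ℕ} (h : Exec lam c s t s') :
    c.modR .uw = false → s.reg .uw = 0 → ∀ A, c.modListA A = false → s'.arr A = s.arr A := by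
  induction h with
  | skip s => intros; rfl
  | assign r e s => intros; rfl
  | put A i j e s =>
    intro _ _ A' hA
    have : A' ≠ A := by rintro rfl; simp [Cmd.modListA] at hA
    simp [Mem.setCell, Function.update_of_ne this]
  | seq hx _ ih ih' =>
    intro hm hu A hA
    simp only [Cmd.modListA, Cmd.modR, Bool.or_eq_false_iff] at hA hm
    rw [ih' hm.2 ((hx.frame.reg _ hm.1).trans hu) A hA.2, ih hm.1 hu A hA.1]
  | @ifTrue e c c' s s' t he _ ih =>
    intro hm hu A hA
    simp only [Cmd.modR, Bool.or_eq_false_iff] at hm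
    refine ih hm.1 hu A ?_
    by_cases h : e = .reg .uw
    · subst h; exact absurd hu he
    · rw [Cmd.modListA] at hA
      · simp only [Bool.or_eq_false_iff] at hA; exact hA.1
      · exact h
  | @ifFalse e c c' s s' t he _ ih =>
    intro hm hu A hA
    simp only [Cmd.modR, Bool.or_eq_false_iff] at hm
    refine ih hm.2 hu A ?_
    by_cases h : e = .reg .uw
    · subst h; exact hA
    · rw [Cmd.modListA] at hA
      · simp only [Bool.or_eq_false_iff] at hA; exact hA.2
      · exact h
  | whileTrue _ hx _ ih ih' =>
    intro hm hu A hA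
    rw [ih' hm ((hx.frame.reg _ hm).trans hu) A hA, ih hm hu A hA]
  | whileFalse _ => intros; rfl

theorem wp_call_list {lam : ℕ} {c : Cmd} {s : Mem} {Q R : ℕ → Mem → Prop} (h : wp lam c s R)
    (hm : c.modR .uw = false)
    (k : ∀ t s', Frame c s s' → (s.reg .uw = 0 → ∀ A, c.modListA A = false → s'.arr A = s.arr A) →
      R t s' → Q t s') : wp lam c s Q := by
  obtain ⟨t, s', h, hR⟩ := h
  exact ⟨t, s', h, k t s' h.frame (h.frame_list hm) hR⟩

/-! ### The layered network of a stage -/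

section Layers

variable {n₁ n₂ : ℕ} {G : BipGraph n₁ n₂} {lam : ℕ} {s s' s0 : Mem}

/-- Some branch of layer `p` has an unmatched neighbour in `V₁`. -/
def StrongLayer (G : BipGraph n₁ n₂) (s : Mem) : Prop :=
  ∃ j < s.reg .K, s.arr .lab j 0 = s.reg .p ∧ ∃ v, G.edgeNat v (s.arr .node2 j 0) ∧ s.arr .idx1 v 0 = 0

theorem Layers.card_le (h : Layers G lam s) (w : ℕ → ℕ) :
    ∑ i ∈ Finset.range (s.reg .qt), w (s.arr .queue i 0) ≤ ∑ j ∈ Finset.range (s.reg .K), w j := by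
  rw [← Finset.sum_image (f := w) (g := fun i => s.arr .queue i 0)
    (fun i hi i' hi' he => h.que.inj i (Finset.mem_range.1 hi) i' (Finset.mem_range.1 hi') he)]
  refine Finset.sum_le_sum_of_subset fun j hj => ?_
  obtain ⟨i, hi, rfl⟩ := Finset.mem_image.1 hj
  exact Finset.mem_range.2 (h.que.lt i (Finset.mem_range.1 hi))

/-- The time for the generation of the layered network. -/
def stageWeight (G : BipGraph n₁ n₂) (lam : ℕ) (s : Mem) : ℕ :=
  if s.reg .uw = 0 then G.m + s.reg .K + 1 else (s.reg .K + 1) * (s.reg .K / lam + 3)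

/-- The roots are distinct, so their in-lists have total length at most `m`. With words each of the
`K` branches has weight `K / lam + 2`. -/
theorem Base.sum_layerWeight (hB : Base G lam s) (hnw : s.reg .nw = s.reg .K / lam + 1) :
    ∑ j ∈ Finset.range (s.reg .K), layerWeight s j + s.reg .K + 1 ≤ 2 * stageWeight G lam s := by
  unfold layerWeight stageWeight
  split_ifs with hu
  · rw [Finset.sum_add_distrib, ← Finset.sum_image (f := fun b => s.arr .inDeg b 0)
      (g := fun i => s.arr .node2 i 0)]
    · have : ∑ b ∈ (Finset.range (s.reg .K)).image (fun i => s.arr .node2 i 0), s.arr .inDeg b 0 ≤ G.m := by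
        rw [← hB.static.sum2]
        refine Finset.sum_le_sum_of_subset fun b hb => ?_
        obtain ⟨i, hi, rfl⟩ := Finset.mem_image.1 hb
        exact Finset.mem_range.2 (hB.nodes.node2_lt i (Finset.mem_range.1 hi))
      simp
      omega
    · intro i hi i' hi' he
      have h1 := hB.nodes.idx2_node2 i (Finset.mem_range.1 hi)
      have h2 := hB.nodes.idx2_node2 i' (Finset.mem_range.1 hi')
      simp only at he
      rw [he] at h1
      omega
  · simp [hnw]
    nlinarith [Nat.zero_le (s.reg .K / lam)]

/-- The effect of the generation of the layered network. -/
structure Network (G : BipGraph n₁ n₂) (lam : ℕ) (s : Mem) : Prop where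
  base : Base G lam s
  layers : Layers G lam s
  clean : Clean lam s
  fresh : ∀ j < s.reg .K, s.arr .vis j 0 = 0 ∧ s.arr .sPtr j 0 = 0 ∧ s.arr .sWPtr j 0 = 0
  unvis : s.reg .uw ≠ 0 → ∀ j, bitAt lam (s.arr .unvis 0) j = true ↔ j < s.reg .K
  found : s.reg .L ≠ 0 → s.reg .L = s.reg .p + 1 ∧ StrongLayer G s ∧ (s.reg .uw = 0 → s.reg .L ≤ s.reg .thr)
  none : s.reg .L = 0 → s.reg .qh < s.reg .qe → s.reg .uw = 0 ∧ s.reg .thr ≤ s.reg .p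

-- Each branch is in one layer only, so it is tested for an unmatched neighbour and expanded at most
-- once; its weight pays for both.
set_option maxHeartbeats 1000000 in
theorem wp_layeredNetwork (hlam : 0 < lam) (hB : Base G lam s) (hP : Perm G s) (hC : Clean lam s) :
    wp lam layeredNetwork s (fun t s' => Network G lam s' ∧
      t + pot n₁ n₂ s ≤ pot n₁ n₂ s' + 10000 * stageWeight G lam s) := by
  simp only [layeredNetwork, ↓wp_seq]
  refine wp_call_list (wp_resetStage hlam hB.static.word hC) (by decide) ?_
  rintro t1 s1 F1 F1' ⟨r1, r2, r3, r4, r5, r6, r7, r8, r9, r10⟩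
  have fK : s1.reg .K = s.reg .K := F1.r .K
  have fu : s1.reg .uw = s.reg .uw := F1.r .uw
  have hB1 : Base G lam s1 := hB.congr F1.agree
  have hP1 : Perm G s1 := hP.congr F1.agree
  have hp1 : pot n₁ n₂ s1 = pot n₁ n₂ s := pot_congr F1.agree
  have hre : s1.reg .uw ≠ 0 → ∀ j, bitAt lam (s1.arr .reached 0) j = true ↔ j < s1.reg .K := by
    intro hu j
    rw [fK]; rw [fu] at hu
    exact ⟨r3 j, fun hj => (r5 hu j hj).1⟩
  have hun : s1.reg .uw ≠ 0 → ∀ j, bitAt lam (s1.arr .unvis 0) j = true ↔ j < s1.reg .K := by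
    intro hu j
    rw [fK]; rw [fu] at hu
    exact ⟨r4 j, fun hj => (r5 hu j hj).2⟩
  rw [← fK] at r2 r3 r4 r6 r10
  have hre0 := r3
  have hun0 := r4
  have hvis := r2
  have hL1 := r7
  have hW : stageWeight G lam s = stageWeight G lam s1 := by simp [stageWeight, fK, fu]
  rw [hW]
  have key : wp lam (firstLayer.seq (Cmd.whilst
      (((Expr.bin .eq (.reg .L) 0) * (Expr.bin .lt (.reg .qh) (.reg .qe))) *
        (Expr.reg .uw + Expr.bin .lt (.reg .p) (.reg .thr)))
      ((Cmd.assign .h (.reg .qh)).seq ((Cmd.whilst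
        (Expr.bin .lt (.reg .h) (.reg .qe) * Expr.bin .eq (.reg .L) 0)
        ((Cmd.assign .fb (Arr.node2.el (Arr.queue.el (.reg .h)))).seq (findStrong.seq
          ((Cmd.ifte (.reg .res) (Cmd.assign .L (.reg .p + 1)) .skip).seq (incr .h))))).seq
        (Cmd.ifte (Expr.bin .eq (.reg .L) 0) nextLayer .skip))))) s1 (fun t s' =>
      Base G lam s' ∧ Layers G lam s' ∧
      (s'.reg .L ≠ 0 → s'.reg .L = s'.reg .p + 1 ∧ StrongLayer G s' ∧ (s'.reg .uw = 0 → s'.reg .L ≤ s'.reg .thr)) ∧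
      (s'.reg .L = 0 → s'.reg .qh < s'.reg .qe → s'.reg .uw = 0 ∧ s'.reg .thr ≤ s'.reg .p) ∧
      t + pot n₁ n₂ s1 ≤ pot n₁ n₂ s' + 1400 * (s1.reg .K + 1) +
        2000 * ∑ j ∈ Finset.range (s1.reg .K), layerWeight s1 j) := by
    refine wp_call_seq (wp_firstLayer hlam hB1 hP1 r1 r9 r8 r6 hre) ?_
    rintro t2 S F2 ⟨hB2, hLy2, ht2⟩
    have eL : S.reg .L = 0 := (F2.r .L).trans hL1
    have eK : S.reg .K = s1.reg .K := F2.r .K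
    have eqh : S.reg .qh = 0 := (F2.r .qh).trans r8
    have eP : Perm G S := hP1.congr F2.agree
    have ew : layerWeight S = layerWeight s1 := by
      funext j; simp only [layerWeight, F2.r .uw, F2.a .inDeg, F2.a .node2, F2.r .nw]
    rw [← ew, ← eK]
    have e1 : ∀ j, 1 ≤ layerWeight S j := by intro j; unfold layerWeight; split_ifs <;> omega
    clear F2 ew
    refine wp_while (fun t s' => Base G lam s' ∧ Layers G lam s' ∧
      (s'.reg .L ≠ 0 → s'.reg .L = s'.reg .p + 1 ∧ StrongLayer G s' ∧ (s'.reg .uw = 0 → s'.reg .L ≤ s'.reg .thr)) ∧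
      t2 + t + pot n₁ n₂ s1 ≤ pot n₁ n₂ s' + 1000 * (S.reg .K + 1) + 300 * s'.reg .qt +
        -- While no label is found, the layers before `qh` have been charged. Once it is found, the
        -- last layer has been tested as well, and the whole queue is charged.
        2000 * ∑ i ∈ Finset.range (if s'.reg .L = 0 then s'.reg .qh else s'.reg .qt),
          layerWeight S (s'.arr .queue i 0))
      -- A round either moves `qh` past a nonempty layer or finds the label and thereby ends the
      -- loop.
      (fun s' => if s'.reg .L = 0 then S.reg .K + 1 - s'.reg .qh else 0) ?_ ?_ ?_
    · refine ⟨hB2, hLy2, fun h => absurd eL h, ?_⟩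
      simp [eL, eqh]
      rw [eK]; omega
    · rintro t s2 F ⟨hB3, hLy3, hf, ht3⟩ he
      have gK : s2.reg .K = S.reg .K := F.r .K
      have gP : Perm G s2 := eP.congr F.agree
      have gw : layerWeight s2 = layerWeight S := by
        funext j; simp only [layerWeight, F.r .uw, F.a .inDeg, F.a .node2, F.r .nw]
      clear F
      have he' : (s2.reg .L = 0 ∧ s2.reg .qh < s2.reg .qe) ∧ (s2.reg .uw ≠ 0 ∨ s2.reg .p < s2.reg .thr) := by
        rwa [Expr.eval_mul_ne_zero, Expr.eval_mul_ne_zero, Expr.eval_add_ne_zero, Expr.eval_eq_ne_zero,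
          Expr.eval_lt_ne_zero, Expr.eval_lt_ne_zero] at he
      obtain ⟨⟨hL, hlt⟩, hmode⟩ := he'
      rw [if_pos hL] at ht3
      simp only [↓wp_seq, ↓wp_assign]
      have hqt := hLy3.qe
      refine wp_while (fun t' s' => Base G lam s' ∧ s2.reg .qh ≤ s'.reg .h ∧ s'.reg .h ≤ s2.reg .qe ∧
        (s'.reg .L = 0 → ∀ i, s2.reg .qh ≤ i → i < s'.reg .h →
          ∀ v, G.edgeNat v (s2.arr .node2 (s2.arr .queue i 0) 0) → s2.arr .idx1 v 0 ≠ 0) ∧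
        (s'.reg .L ≠ 0 → s'.reg .L = s2.reg .p + 1 ∧ StrongLayer G s2) ∧
        t' + pot n₁ n₂ s2 ≤ pot n₁ n₂ s' + 200 * (s'.reg .h - s2.reg .qh))
        (fun s' => s2.reg .qe - s'.reg .h) ?_ ?_ ?_
      · refine ⟨hB3.congr (by simp [Agree]), by simp, by simp; omega, ?_, by simp [hL], by simp⟩
        intro _ i h1 h2
        simp at h2; omega
      · rintro t' s3 F ⟨hB4, k1, k2, k3, k4, k5⟩ he2
        have lp : s3.reg .p = s2.reg .p := (F.r .p).trans (by simp)
        have lqe : s3.reg .qe = s2.reg .qe := (F.r .qe).trans (by simp)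
        have ln2 : s3.arr .node2 = s2.arr .node2 := (F.a .node2).trans (by simp)
        have lqu : s3.arr .queue = s2.arr .queue := (F.a .queue).trans (by simp)
        have li1 : s3.arr .idx1 = s2.arr .idx1 := (F.a .idx1).trans (by simp)
        have li2 : s3.arr .idx2 = s2.arr .idx2 := (F.a .idx2).trans (by simp)
        clear F
        have he3 : s3.reg .h < s2.reg .qe ∧ s3.reg .L = 0 := by
          rwa [Expr.eval_mul_ne_zero, Expr.eval_eq_ne_zero, Expr.eval_lt_ne_zero, Expr.eval_reg, Expr.eval_reg,
            lqe] at he2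
        obtain ⟨hh, hL3⟩ := he3
        set q := s2.arr .queue (s3.reg .h) 0 with hq
        obtain ⟨hqK, hql⟩ := hLy3.mem_seg.2 ⟨_, k1, hh, hq.symm⟩
        have hfb : (s3.setReg .fb (s2.arr .node2 q 0)).reg .fb = s2.arr .node2 q 0 := by simp
        rw [wp_seq, wp_assign]
        simp only [Arr.el, Expr.eval, Expr.ofNat_eq, lqu, ln2, ← hq]
        refine wp_call_seq (wp_findStrong (G := G) (hB4.congr (by simp [Agree])) ?_ ?_) ?_
        · rw [hfb]; exact hB3.nodes.node2_lt q hqK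
        · rw [hfb, Mem.setReg_arr, li2, hB3.nodes.idx2_node2 q hqK]; omega
        rintro t3 s4 F4 ⟨hB5, hfl, hsc, ht5⟩
        have mh : s4.reg .h = s3.reg .h := by simpa using F4.r .h
        have mp : s4.reg .p = s2.reg .p := by simpa [lp] using F4.r .p
        have mL : s4.reg .L = 0 := by simpa [hL3] using F4.r .L
        clear F4
        rw [hfb] at hfl hsc
        simp [li1] at hfl hsc ht5
        simp only [↓wp_seq, incr]
        rw [wp_ifte]
        refine ⟨fun hr => ?_, fun hr => ?_⟩
        · simp only [Expr.eval] at hr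
          simp [wp_assign, mh, mp]
          exact ⟨⟨hB5.congr (by simp [Agree]), by omega, by omega, ⟨q, hqK, hql, _, hsc hr⟩, by omega⟩, by omega⟩
        · simp only [Expr.eval] at hr
          simp [wp_assign, wp_skip, mh, mL]
          refine ⟨⟨hB5.congr (by simp [Agree]), by omega, by omega, ?_, by omega⟩, by omega⟩
          intro i h1 h2
          rcases lt_or_eq_of_le h2 with h3 | h3
          · exact k3 hL3 i h1 h3
          · subst h3; exact hfl hr
      · rintro t' s3 F ⟨hB4, k1, k2, k3, k4, k5⟩ he2
        have lK : s3.reg .K = s2.reg .K := (F.r .K).trans (by simp)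
        have lp : s3.reg .p = s2.reg .p := (F.r .p).trans (by simp)
        have lqe : s3.reg .qe = s2.reg .qe := (F.r .qe).trans (by simp)
        have lqh : s3.reg .qh = s2.reg .qh := (F.r .qh).trans (by simp)
        have lqt : s3.reg .qt = s2.reg .qt := (F.r .qt).trans (by simp)
        have lu : s3.reg .uw = s2.reg .uw := (F.r .uw).trans (by simp)
        have lth : s3.reg .thr = s2.reg .thr := (F.r .thr).trans (by simp)
        have lnw : s3.reg .nw = s2.reg .nw := (F.r .nw).trans (by simp)
        have ln2 : s3.arr .node2 = s2.arr .node2 := (F.a .node2).trans (by simp)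
        have lqu : s3.arr .queue = s2.arr .queue := (F.a .queue).trans (by simp)
        have lla : s3.arr .lab = s2.arr .lab := (F.a .lab).trans (by simp)
        have li1 : s3.arr .idx1 = s2.arr .idx1 := (F.a .idx1).trans (by simp)
        have lde : s3.arr .inDeg = s2.arr .inDeg := (F.a .inDeg).trans (by simp)
        have hA : Agree [.p, .nw, .K, .qe, .qt, .qh, .uw] [.lab, .queue, .idx1, .idx2, .node1, .node2, .chl, .par,
            .reached, .lay2] s2 (s2.setReg .h (Expr.eval lam s2 (.reg .qh))) := by simp [Agree]
        have hLy4 : Layers G lam s3 := (hLy3.congr hA).congr F.agree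
        have hP4 : Perm G s3 := (gP.congr hA.mono).congr F.agree
        clear F hA
        have hsum : ∀ k, s2.reg .qh ≤ k → ∑ i ∈ Finset.range k, layerWeight S (s2.arr .queue i 0) =
            ∑ i ∈ Finset.range (s2.reg .qh), layerWeight S (s2.arr .queue i 0) +
            ∑ i ∈ Finset.Ico (s2.reg .qh) k, layerWeight S (s2.arr .queue i 0) :=
          fun k hk => (Finset.sum_range_add_sum_Ico _ hk).symm
        -- All weights are at least one, so they also cover the constant overhead of each test.
        have hqsum : s2.reg .qe - s2.reg .qh ≤
            ∑ i ∈ Finset.Ico (s2.reg .qh) (s2.reg .qe), layerWeight S (s2.arr .queue i 0) := by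
          calc s2.reg .qe - s2.reg .qh = ∑ i ∈ Finset.Ico (s2.reg .qh) (s2.reg .qe), 1 := by simp
            _ ≤ _ := Finset.sum_le_sum fun i _ => e1 _
        have hqq := hsum (s2.reg .qe) hlt.le
        rw [wp_ifte]
        refine ⟨fun hL0 => ?_, fun hL0 => ?_⟩
        · have hL0' : s3.reg .L = 0 := Expr.eval_eq_ne_zero.1 hL0
          have hex : ¬ s3.reg .h < s2.reg .qe := fun hlt => by
            rw [← not_not (a := _ = 0), ← ne_eq, Expr.eval_mul_ne_zero, Expr.eval_eq_ne_zero,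
              Expr.eval_lt_ne_zero, Expr.eval_reg, Expr.eval_reg, lqe] at he2
            exact he2 ⟨hlt, hL0'⟩
          have hstr : ∀ j < s3.reg .K, s3.arr .lab j 0 = s3.reg .p →
              ∀ v, G.edgeNat v (s3.arr .node2 j 0) → s3.arr .idx1 v 0 ≠ 0 := by
            intro j hj hlab
            obtain ⟨i, d1, d2, rfl⟩ := hLy4.mem_seg.1 ⟨hj, hlab⟩
            rw [ln2, li1, lqu]
            exact k3 hL0' i (by omega) (by omega)
          have hw3 : layerWeight s3 = layerWeight S := by
            rw [← gw]; funext j; simp only [layerWeight, lu, lde, ln2, lnw]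
          refine wp_call (wp_nextLayer hlam hB4 hP4 hLy4 (by omega) hstr) ?_
          rintro t3 s4 F4 ⟨c1, c2, c3, c4, c5⟩
          have hL4 : s4.reg .L = 0 := (F4.r .L).trans hL0'
          have hK4 : s4.reg .K = s3.reg .K := F4.r .K
          have hlen : s4.reg .qh ≤ s4.reg .K := by
            have h1 := c1.card_le (fun _ => 1)
            have h2 := c1.qh_le
            have h3 := c1.qe
            simp at h1; omega
          have hqsum4 : ∑ i ∈ Finset.range (s4.reg .qh), layerWeight S (s4.arr .queue i 0) =
              ∑ i ∈ Finset.range (s2.reg .qe), layerWeight S (s2.arr .queue i 0) := by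
            rw [c3, lqe]
            refine Finset.sum_congr rfl fun i hi => ?_
            have := Finset.mem_range.1 hi
            rw [c2.old i (by omega), lqu]
          have hpot4 : pot n₁ n₂ s4 = pot n₁ n₂ s3 := pot_congr F4.agree
          refine ⟨⟨hB4.congr F4.agree, c1, fun h => absurd hL4 h, ?_⟩, ?_⟩
          · rw [hL4, if_pos rfl, hqsum4, hqq, hpot4]
            rw [lqh, lqe, lqt, lqu, hw3] at c5
            simp at k5 ⊢
            omega
          · rw [hL4, hL, if_pos rfl, if_pos rfl]; omega
        · have hL0' : s3.reg .L ≠ 0 := fun h =>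
            Expr.eval_eq_ne_zero.2 (show Expr.eval lam s3 (.reg .L) = Expr.eval lam s3 0 from h) hL0
          obtain ⟨k6, k7⟩ := k4 hL0'
          rw [wp_skip]
          refine ⟨⟨hB4, hLy4, fun _ => ⟨by omega, ?_, fun hu => ?_⟩, ?_⟩, ?_⟩
          · simpa only [StrongLayer, lK, lla, lp, ln2, li1] using k7
          · rw [lu] at hu
            have : s2.reg .p < s2.reg .thr := hmode.resolve_left (not_not.2 hu)
            omega
          · rw [if_neg hL0', lqt, ← hqt, lqu, hqq]
            simp at k5 ⊢
            omega
          · rw [hL, if_neg hL0', if_pos rfl]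
            have h1 := hLy3.card_le (fun _ => 1)
            simp at h1; omega
    · rintro t s2 F ⟨hB3, hLy3, hf, ht3⟩ he
      have gK : s2.reg .K = S.reg .K := F.r .K
      clear F
      refine ⟨hB3, hLy3, hf, fun hL hq => ?_, ?_⟩
      · by_contra hne
        refine absurd he (Expr.eval_mul_ne_zero.2 ⟨Expr.eval_mul_ne_zero.2 ⟨Expr.eval_eq_ne_zero.2 hL,
          Expr.eval_lt_ne_zero.2 hq⟩, Expr.eval_add_ne_zero.2 ?_⟩)
        rw [Expr.eval_lt_ne_zero, Expr.eval_reg, Expr.eval_reg, Expr.eval_reg]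
        omega
      · have h1 := hLy3.card_le (fun _ => 1)
        have h2 := hLy3.card_le (layerWeight S)
        have h3 : ∑ i ∈ Finset.range (if s2.reg .L = 0 then s2.reg .qh else s2.reg .qt),
            layerWeight S (s2.arr .queue i 0) ≤
            ∑ i ∈ Finset.range (s2.reg .qt), layerWeight S (s2.arr .queue i 0) := by
          refine Finset.sum_le_sum_of_subset fun i hi => ?_
          have := hLy3.qe
          have := hLy3.qh_le
          rw [Finset.mem_range] at hi ⊢
          split_ifs at hi <;> omega
        rw [gK] at h2
        simp at h1 ⊢
        omega
  suffices H : wp lam _ s1 (fun t s' => Network G lam s' ∧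
      t1 + t + pot n₁ n₂ s ≤ pot n₁ n₂ s' + 10000 * stageWeight G lam s1) from wp_seq.1 H
  refine wp_call_list key (by decide) ?_
  rintro t s' F F' ⟨h1, h2, h3, h4, h5⟩
  have hK : s'.reg .K = s1.reg .K := F.r .K
  have hu : s'.reg .uw = s1.reg .uw := F.r .uw
  refine ⟨⟨h1, h2, ⟨?_, ?_, ?_⟩, ?_, ?_, h3, h4⟩, ?_⟩
  · intro j hj
    by_contra h0
    obtain ⟨i, hi, rfl⟩ := h2.que.ex j h0
    have := h2.que.lt i hi
    omega
  · intro j hj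
    by_cases hu0 : s'.reg .uw = 0
    · rw [F' (by omega) _ (by decide)] at hj
      rw [hK]; exact hre0 j hj
    · exact (((h2.word hu0).reached j).1 hj).1
  · rw [F.a .unvis, hK]; exact hun0
  · rw [F.a .vis, F.a .sPtr, F.a .sWPtr, hK]; exact hvis
  · rw [F.a .unvis, hK, hu]; exact hun
  · have h6 := hB1.sum_layerWeight r6
    omega

end Layers

/-! ## Distance functions -/

section Potential

variable {n₁ n₂ : ℕ} {G : BipGraph n₁ n₂} {lam : ℕ} {s s' s0 sm : Mem}

/-- There is a function on the `V₂`-nodes that is a lower bound for the labels, and the labels of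
all unmatched `V₁`-nodes are at least `k`. -/
def Dist (G : BipGraph n₁ n₂) (s : Mem) (k : ℕ) : Prop :=
  ∃ Φ : ℕ → ℕ, (∀ b, s.arr .idx2 b 0 = 0 → Φ b = 0) ∧
    (∀ j < s.reg .K, ∀ b, G.edgeNat (child s j) b → Φ (s.arr .node2 j 0) ≤ Φ b + 1) ∧
    (∀ v b, G.edgeNat v b → s.arr .idx1 v 0 = 0 → k ≤ Φ b + 1)

theorem Dist.congr {k : ℕ} (h : Dist G s k)
    (H : Agree [.K] [.chl, .node1, .node2, .idx1, .idx2] s s') : Dist G s' k := by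
  obtain ⟨h1, h2⟩ := H
  simp only [List.mem_cons, List.not_mem_nil, or_false, forall_eq_or_imp, forall_eq] at h1 h2
  obtain ⟨a1, a2, a3, a4, a5⟩ := h2
  simpa only [Dist, child, h1, a1, a2, a3, a4, a5] using h

/-- The witness is zero on unmatched and one on matched nodes; maximality says that an unmatched
`V₁`-node sees only the value one. -/
theorem Dist.of_maximal (h : Maximal G s)
    (h2 : ∀ j < s.reg .K, s.arr .idx2 (s.arr .node2 j 0) 0 = j + 1) : Dist G s 2 := by
  refine ⟨fun b => if s.arr .idx2 b 0 = 0 then 0 else 1, fun b hb => by simp [hb], ?_, ?_⟩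
  · intro j hj b _
    simp [h2 j hj]
  · intro v b hE hv
    have := (h v b hE).resolve_left (not_not.2 hv)
    simp [this]

/-- By induction along `Layers.sound`, `Φ` is at most the label. A branch of layer `p` with an
unmatched neighbour therefore bounds every certified distance by `p + 1`. -/
theorem Dist.le_stage {k : ℕ} (h : Dist G s k) (hL : Layers G lam s) (hS : StrongLayer G s) :
    k ≤ s.reg .p + 1 := by
  obtain ⟨Φ, h1, h2, h3⟩ := h
  have key : ∀ k j, 1 ≤ k → s.arr .lab j 0 = k → Φ (s.arr .node2 j 0) ≤ k := by
    intro k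
    induction k with
    | zero => intro j h; omega
    | succ k ih =>
      intro j _ hj
      have hjK : j < s.reg .K := by
        obtain ⟨i, hi, rfl⟩ := hL.que.ex j (by omega)
        exact hL.que.lt i hi
      by_cases hk : k = 0
      · subst hk
        obtain ⟨b, hE, hb⟩ := (hL.one j hjK).1 hj
        have := h2 j hjK b hE
        rw [h1 b hb] at this
        exact this
      · obtain ⟨j', hj', hl, hE⟩ := hL.sound j k (by omega) hj
        have := h2 j hjK _ hE
        have := ih j' (by omega) hl
        omega
  obtain ⟨j, hj, hl, v, hE, hv⟩ := hS
  have h4 := h3 v _ hE hv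
  have h5 := key _ j hL.pos hl
  omega

/-! ## The invariants of a stage -/

/-- The label of a branch at the start of the stage, where the branches without a label get the
label of the stage. -/
def lift (s0 : Mem) (j : ℕ) : ℕ := if s0.arr .lab j 0 = 0 then s0.reg .L else s0.arr .lab j 0

/-- The label of a `V₂`-node at the start of the stage. -/
def height0 (s0 : Mem) (b : ℕ) : ℕ :=
  if s0.arr .idx2 b 0 = 0 then 0 else lift s0 (s0.arr .idx2 b 0 - 1)

/-- The label of a branch, increased by one for the branches that were visited. -/
def liftVis (s0 s : Mem) (j : ℕ) : ℕ :=
  if j < s0.reg .K then lift s0 j + (if s.arr .vis j 0 = 0 then 0 else 1) else 1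

/-- The label of a `V₂`-node at the start of the stage, increased by one for the nodes in branches that
are new or were visited. -/
def height (s0 s : Mem) (b : ℕ) : ℕ :=
  if s.arr .idx2 b 0 = 0 then 0 else liftVis s0 s (s.arr .idx2 b 0 - 1)

variable (G lam) in
/-- A memory at the start of the mergers of a stage. -/
structure Start (s0 : Mem) : Prop extends Network G lam s0 where
  perm : Perm G s0
  maximal : Maximal G s0
  L_ne : s0.reg .L ≠ 0

theorem Start.L_eq (h : Start G lam s0) : s0.reg .L = s0.reg .p + 1 := (h.found h.L_ne).1

theorem Start.lift_le (h : Start G lam s0) (j : ℕ) : lift s0 j ≤ s0.reg .L := by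
  have := h.layers.lab_le j
  have := h.L_eq
  unfold lift; split_ifs <;> omega

theorem Start.lift_pos (h : Start G lam s0) (j : ℕ) : 1 ≤ lift s0 j := by
  have := h.L_ne
  unfold lift; split_ifs <;> omega

/-- Maximality excludes an unmatched `b`, `Layers.strong` excludes labels below `p`, and unlabelled
branches count as `L`. -/
theorem Start.free_edge (h : Start G lam s0) {v b : ℕ} (hE : G.edgeNat v b)
    (hv : s0.arr .idx1 v 0 = 0) : s0.reg .L ≤ height0 s0 b + 1 := by
  have hb := (h.maximal v b hE).resolve_left (not_not.2 hv)
  have hK := h.base.nodes.idx2_le b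
  have hn := h.base.nodes.node2_idx2 b hb
  have hL := h.L_eq
  rw [height0, if_neg hb, lift]
  split_ifs with h0
  · omega
  · by_contra hlt
    exact h.layers.strong _ (by omega) h0 (by omega) v (by rwa [hn]) hv

/-- Lifted labels never exceed `L = p + 1`, so only neighbours at height below `p` are a
restriction: `Layers.one` settles height zero and `Layers.compl` the others. -/
theorem Start.edge (h : Start G lam s0) {i b : ℕ} (hi : i < s0.reg .K)
    (hE : G.edgeNat (s0.arr .node1 i 0) b) : lift s0 (s0.arr .par i 0) ≤ height0 s0 b + 1 := by
  have hj := h.perm.par_lt i hi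
  have hc : child s0 (s0.arr .par i 0) = s0.arr .node1 i 0 := by rw [child, h.perm.chl_par i hi]
  by_cases hb : s0.arr .idx2 b 0 = 0
  · have := (h.layers.one _ hj).2 ⟨b, by rwa [hc], hb⟩
    simp [lift, this]
  · have hK := h.base.nodes.idx2_le b
    have hn := h.base.nodes.node2_idx2 b hb
    have hle := h.lift_le (s0.arr .par i 0)
    have hL := h.L_eq
    rw [height0, if_neg hb]
    by_cases h0 : s0.arr .lab (s0.arr .idx2 b 0 - 1) 0 = 0
    · rw [show lift s0 (s0.arr .idx2 b 0 - 1) = s0.reg .L by simp [lift, h0]]; omega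
    · rw [show lift s0 (s0.arr .idx2 b 0 - 1) = s0.arr .lab (s0.arr .idx2 b 0 - 1) 0 by simp [lift, h0]]
      by_cases hlt : s0.arr .lab (s0.arr .idx2 b 0 - 1) 0 < s0.reg .p
      · obtain ⟨h1, h2⟩ := h.layers.compl _ hj _ (by omega) (by rwa [hc, hn]) h0 hlt
        rw [lift, if_neg h1]; exact h2
      · omega

variable (G lam) in
/-- The invariants of a stage that do not concern the matching. -/
structure Stage (s0 s : Mem) : Prop where
  base : Base G lam s
  K_le : s0.reg .K ≤ s.reg .K
  node1 : ∀ j < s0.reg .K, s.arr .node1 j 0 = s0.arr .node1 j 0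
  node2 : ∀ j < s0.reg .K, s.arr .node2 j 0 = s0.arr .node2 j 0
  idx1 : ∀ v, s0.arr .idx1 v 0 ≠ 0 → s.arr .idx1 v 0 = s0.arr .idx1 v 0
  idx2 : ∀ b, s0.arr .idx2 b 0 ≠ 0 → s.arr .idx2 b 0 = s0.arr .idx2 b 0
  agree : Agree [.L, .p, .nw, .uw, .qh, .qe, .qt] [.lab, .lay2, .queue, .outDeg, .outAdj] s0 s
  unvis : s.reg .uw ≠ 0 → ∀ j, bitAt lam (s.arr .unvis 0) j = true ↔ j < s0.reg .K ∧ s.arr .vis j 0 = 0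
  le1 : ∀ i < s0.reg .K, s.arr .sPtr i 0 ≤ s.arr .outDeg (s.arr .node1 i 0) 0
  le2 : ∀ i < s0.reg .K, s.arr .sWPtr i 0 ≤ s.reg .nw
  mode1 : s.reg .uw = 0 → ∀ i < s0.reg .K, s.arr .sWPtr i 0 = 0
  mode2 : s.reg .uw ≠ 0 → ∀ i < s0.reg .K, s.arr .sPtr i 0 = 0
  -- `findWeak` is called for labels of at least two only. The neighbours are then matched, so `idx2
  -- - 1` is the number of a branch.
  passed1 : ∀ i < s0.reg .K, 2 ≤ s.arr .lab (s0.arr .par i 0) 0 → ∀ e < s.arr .sPtr i 0,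
    s.arr .lab (s.arr .idx2 (s.arr .outAdj (s.arr .node1 i 0) e) 0 - 1) 0 + 1 =
      s.arr .lab (s0.arr .par i 0) 0 →
    s.arr .vis (s.arr .idx2 (s.arr .outAdj (s.arr .node1 i 0) e) 0 - 1) 0 ≠ 0
  passed2 : ∀ i < s0.reg .K, ∀ j < s.arr .sWPtr i 0 * lam,
    s.arr .lab j 0 + 1 = s.arr .lab (s0.arr .par i 0) 0 →
    G.edgeNat (s.arr .node1 i 0) (s.arr .node2 j 0) → j < s0.reg .K → s.arr .vis j 0 ≠ 0

theorem Stage.lab (h : Stage G lam s0 s) : s.arr .lab = s0.arr .lab := h.agree.2 _ (by simp)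
theorem Stage.L (h : Stage G lam s0 s) : s.reg .L = s0.reg .L := h.agree.1 _ (by simp)

/-- What the pointers have passed is recorded as a set of visited branches, so this record survives
as long as no mark is erased. -/
theorem Stage.rebase (h : Stage G lam s0 s) (hb : Base G lam s')
    (H : Agree [.K, .L, .p, .nw, .uw, .qh, .qe, .qt] [.outDeg, .outAdj, .node1, .node2, .idx1, .idx2,
      .lab, .lay2, .queue, .sPtr, .sWPtr] s s')
    (hv : ∀ j, s.arr .vis j 0 ≠ 0 → s'.arr .vis j 0 ≠ 0)
    (hun : s'.reg .uw ≠ 0 → ∀ j, bitAt lam (s'.arr .unvis 0) j = true ↔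
      j < s0.reg .K ∧ s'.arr .vis j 0 = 0) : Stage G lam s0 s' := by
  obtain ⟨h1, h2⟩ := H
  have ha := h.agree
  simp only [Agree, List.mem_cons, List.not_mem_nil, or_false, forall_eq_or_imp, forall_eq] at h1 h2 ha
  obtain ⟨b4, b5, b6, b7, b8, b9, b10, b11⟩ := h1
  obtain ⟨a1, a2, a7, a8, a9, a10, a19, a20, a21, a24, a25⟩ := h2
  refine ⟨hb, ?_, ?_, ?_, ?_, ?_, ?_, hun, ?_, ?_, ?_, ?_, ?_, ?_⟩ <;>
    simp only [Agree, List.mem_cons, List.not_mem_nil, or_false, forall_eq_or_imp, forall_eq, b4, b5, b6, b7, b8, b9,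
      b10, b11, a1, a2, a7, a8, a9, a10, a19, a20, a21, a24, a25]
  exacts [h.K_le, h.node1, h.node2, h.idx1, h.idx2, ha, h.le1, h.le2, h.mode1, h.mode2,
    fun i hi h2 e he hl => hv _ (h.passed1 i hi h2 e he hl),
    fun i hi e he hl hE hj => hv _ (h.passed2 i hi e he hl hE hj)]

theorem Stage.congr_base (h : Stage G lam s0 s) (hb : Base G lam s')
    (H : Agree [.K, .L, .p, .nw, .uw, .qh, .qe, .qt] [.outDeg, .outAdj, .node1, .node2, .idx1, .idx2,
      .lab, .lay2, .queue, .sPtr, .sWPtr, .vis, .unvis] s s') : Stage G lam s0 s' := by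
  refine h.rebase hb H.mono (fun j => ?_) ?_
  · rw [H.2 .vis (by simp)]; exact id
  · rw [H.1 .uw (by simp), H.2 .vis (by simp), H.2 .unvis (by simp)]; exact h.unvis

theorem Stage.congr (h : Stage G lam s0 s)
    (H : Agree [.n1, .n2, .lam, .K, .L, .p, .nw, .uw, .qh, .qe, .qt] [.outDeg, .outAdj, .inDeg, .inAdj, .outW,
      .inW, .node1, .node2, .idx1, .idx2, .used1, .used2, .subOut, .subIn, .outPtr, .outWPtr, .inPtr, .inWPtr,
      .lab, .lay2, .queue, .unvis, .vis, .sPtr, .sWPtr] s s') :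
    Stage G lam s0 s' :=
  h.congr_base (h.base.congr H.mono) H.mono

theorem Start.height_le (h0 : Start G lam s0) (h : Stage G lam s0 s) (b : ℕ) :
    height0 s0 b ≤ height s0 s b := by
  unfold height0
  split_ifs with hb
  · exact Nat.zero_le _
  · have := h0.base.nodes.idx2_le b
    rw [height, h.idx2 b hb, if_neg hb, liftVis, if_pos (by omega)]
    exact Nat.le_add_right _ _

theorem Start.height_node2 (h : Stage G lam s0 s) {j : ℕ} (hj : j < s.reg .K) :
    height s0 s (s.arr .node2 j 0) = liftVis s0 s j := by
  rw [height, h.base.nodes.idx2_node2 j hj, if_neg (by omega), Nat.add_sub_cancel]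

/-- Matched nodes keep their numbers and marks are not erased, so heights only grow. Inequalities
with a height on the right therefore persist. -/
theorem height_mono (hK : ∀ b, s.arr .idx2 b 0 ≠ 0 → s'.arr .idx2 b 0 = s.arr .idx2 b 0)
    (hv : ∀ j, s.arr .vis j 0 ≠ 0 → s'.arr .vis j 0 ≠ 0) (b : ℕ) :
    height s0 s b ≤ height s0 s' b := by
  unfold height
  by_cases hb : s.arr .idx2 b 0 = 0
  · simp [hb]
  · rw [if_neg hb, hK b hb, if_neg hb, liftVis, liftVis]
    have := hv (s.arr .idx2 b 0 - 1)
    split_ifs <;> omega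

variable (G lam) in
/-- The invariants of a stage between two sequences of mergers. -/
structure Between (s0 s : Mem) : Prop where
  stage : Stage G lam s0 s
  perm : Perm G s
  unv : ∀ j < s0.reg .K, s.arr .vis j 0 = 0 → s.arr .chl j 0 = s0.arr .chl j 0
  settled : ∀ j < s.reg .K, (s0.reg .K ≤ j ∨ s.arr .vis j 0 ≠ 0) →
    ∀ b, G.edgeNat (child s j) b → liftVis s0 s j ≤ height s0 s b + 1
  -- Unsuccessful sequences restore the matching; this is needed to show that some sequence of the
  -- stage succeeds.
  same : s.reg .K = s0.reg .K → ∀ j < s0.reg .K, s.arr .chl j 0 = s0.arr .chl j 0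

theorem Between.congr_base (h : Between G lam s0 s) (hb : Base G lam s')
    (H : Agree [.K, .L, .p, .nw, .uw, .qh, .qe, .qt] [.outDeg, .outAdj, .node1, .node2, .idx1, .idx2,
      .lab, .lay2, .queue, .sPtr, .sWPtr, .vis, .unvis, .chl, .par] s s') :
    Between G lam s0 s' := by
  refine ⟨h.stage.congr_base hb H.mono, h.perm.congr H.mono, ?_, ?_, ?_⟩
  · simpa only [H.2 .vis (by simp), H.2 .chl (by simp)] using h.unv
  · simpa only [H.1 .K (by simp), H.2 .vis (by simp), H.2 .chl (by simp), child, liftVis, height,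
      H.2 .node1 (by simp), H.2 .idx2 (by simp)] using h.settled
  · simpa only [H.1 .K (by simp), H.2 .chl (by simp)] using h.same

/-- If all branches of the last layer were visited or have no unmatched neighbour then the label of the
next stage is larger. -/
theorem Between.dist (h : Between G lam s0 s) (h0 : Start G lam s0)
    (hend : ∀ j < s0.reg .K, s.arr .lab j 0 = s0.reg .p → s.arr .vis j 0 = 0 →
      ∀ v, G.edgeNat v (s.arr .node2 j 0) → s.arr .idx1 v 0 ≠ 0) : Dist G s (s0.reg .L + 1) := by
  have hS := h.stage
  refine ⟨height s0 s, fun b hb => by simp [height, hb], ?_, ?_⟩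
  · intro j hj b hE
    rw [Start.height_node2 hS hj]
    by_cases hV : s0.reg .K ≤ j ∨ s.arr .vis j 0 ≠ 0
    · exact h.settled j hj hV b hE
    -- An old unvisited branch still has its child, so the inequality is the one at the start of the
    -- stage.
    · push Not at hV
      obtain ⟨hjK, hv⟩ := hV
      rw [child, h.unv j hjK hv, hS.node1 _ (h0.perm.chl_lt j hjK)] at hE
      have := h0.edge (h0.perm.chl_lt j hjK) hE
      rw [h0.perm.par_chl j hjK] at this
      rw [liftVis, if_pos hjK, if_pos hv]
      exact this.trans (Nat.add_le_add_right (h0.height_le hS b) 1)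
  · intro v b hE hv
    have hv0 : s0.arr .idx1 v 0 = 0 := by
      by_contra hne; exact hne (hS.idx1 v hne ▸ hv)
    have h1 := h0.free_edge hE hv0
    have hb := (h0.maximal v b hE).resolve_left (not_not.2 hv0)
    have hK := h0.base.nodes.idx2_le b
    have hn := h0.base.nodes.node2_idx2 b hb
    have hL := h0.L_eq
    have hjK : s0.arr .idx2 b 0 - 1 < s0.reg .K := by omega
    rw [height0, if_neg hb] at h1
    rw [height, hS.idx2 b hb, if_neg hb, liftVis, if_pos hjK]
    -- If the branch of `b` was not visited, `hend` rules out the label `p`, which leaves the height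
    -- `L`. If it was visited, the increase by one suffices.
    split_ifs with hvis
    · have h3 := fun hl => hend _ hjK hl hvis v (by rw [hS.node2 _ hjK, hn]; exact hE) hv
      rw [hS.lab] at h3
      by_cases h2 : s0.arr .lab (s0.arr .idx2 b 0 - 1) 0 = 0
      · simp [lift, h2]
      · rw [lift, if_neg h2] at h1 ⊢
        by_contra hlt
        exact h3 (by omega)
    · omega

/-- Without an augmentation the matching is the one at the start of the stage, where a path of label
`L` exists. This contradicts the certificate for `L + 1`. -/
theorem Between.K_lt (h : Between G lam s0 s) (h0 : Start G lam s0) (hD : Dist G s (s0.reg .L + 1)) :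
    s0.reg .K < s.reg .K := by
  refine lt_of_le_of_ne h.stage.K_le fun hK => ?_
  have hS := h.stage
  obtain ⟨hL, hstr, -⟩ := h0.found h0.L_ne
  -- A nonzero index now would be a number below the old `K`, and the node with this number had it
  -- already at the start.
  have hi1 : ∀ v, s0.arr .idx1 v 0 = 0 → s.arr .idx1 v 0 = 0 := by
    intro v hv
    by_contra hne
    have h1 := hS.base.nodes.idx1_le v
    have h2 := hS.base.nodes.node1_idx1 v hne
    rw [hS.node1 _ (by omega)] at h2
    have h3 := h0.base.nodes.idx1_node1 (s.arr .idx1 v 0 - 1) (by omega)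
    rw [h2] at h3
    omega
  have hi2 : ∀ v, s0.arr .idx2 v 0 = 0 → s.arr .idx2 v 0 = 0 := by
    intro v hv
    by_contra hne
    have h1 := hS.base.nodes.idx2_le v
    have h2 := hS.base.nodes.node2_idx2 v hne
    rw [hS.node2 _ (by omega)] at h2
    have h3 := h0.base.nodes.idx2_node2 (s.arr .idx2 v 0 - 1) (by omega)
    rw [h2] at h3
    omega
  obtain ⟨Φ, h1, h2, h3⟩ := hD
  have : Dist G s0 (s0.reg .L + 1) := by
    refine ⟨Φ, fun b hb => h1 b (hi2 b hb), fun j hj b hE => ?_, fun v b hE hv => h3 v b hE (hi1 v hv)⟩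
    rw [← hS.node2 j hj]
    refine h2 j (by omega) b ?_
    rw [child, h.same hK.symm j hj, hS.node1 _ (h0.perm.chl_lt j hj)]
    exact hE
  have := this.le_stage h0.layers hstr
  omega

end Potential

/-! ### The search for a merger with a `WT₂` branch -/

section Weak

variable {n₁ n₂ : ℕ} {G : BipGraph n₁ n₂} {lam : ℕ} {s s' s'' s0 sm : Mem}

variable (G lam) in
/-- The effect of a search for a merger. -/
structure WeakScan (s0 s s' : Mem) : Prop where
  other1 : ∀ i, i ≠ s.reg .rc → s'.arr .sPtr i 0 = s.arr .sPtr i 0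
  other2 : ∀ i, i ≠ s.reg .rc → s'.arr .sWPtr i 0 = s.arr .sWPtr i 0
  le1 : s'.arr .sPtr (s.reg .rc) 0 ≤ s.arr .outDeg (s.arr .node1 (s.reg .rc) 0) 0
  le2 : s'.arr .sWPtr (s.reg .rc) 0 ≤ s.reg .nw
  mono1 : s.arr .sPtr (s.reg .rc) 0 ≤ s'.arr .sPtr (s.reg .rc) 0
  mono2 : s.arr .sWPtr (s.reg .rc) 0 ≤ s'.arr .sWPtr (s.reg .rc) 0
  mode1 : s.reg .uw = 0 → s'.arr .sWPtr (s.reg .rc) 0 = 0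
  mode2 : s.reg .uw ≠ 0 → s'.arr .sPtr (s.reg .rc) 0 = 0
  -- The list pointer moves before the test, so the branch that is found has been passed although it
  -- is not marked yet.
  passed1 : ∀ e < s'.arr .sPtr (s.reg .rc) 0,
    s.arr .lab (s.arr .idx2 (s.arr .outAdj (s.arr .node1 (s.reg .rc) 0) e) 0 - 1) 0 + 1 = s.reg .pl →
    s.arr .vis (s.arr .idx2 (s.arr .outAdj (s.arr .node1 (s.reg .rc) 0) e) 0 - 1) 0 ≠ 0 ∨
      (s'.reg .res ≠ 0 ∧ s.arr .idx2 (s.arr .outAdj (s.arr .node1 (s.reg .rc) 0) e) 0 = s'.reg .res)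
  passed2 : ∀ j < s'.arr .sWPtr (s.reg .rc) 0 * lam, s.arr .lab j 0 + 1 = s.reg .pl →
    G.edgeNat (s.arr .node1 (s.reg .rc) 0) (s.arr .node2 j 0) → j < s0.reg .K → s.arr .vis j 0 ≠ 0
  fail : s'.reg .res = 0 → ∀ j < s0.reg .K, s.arr .lab j 0 + 1 = s.reg .pl →
    G.edgeNat (s.arr .node1 (s.reg .rc) 0) (s.arr .node2 j 0) → s.arr .vis j 0 ≠ 0
  succ : s'.reg .res ≠ 0 → s'.reg .res - 1 < s0.reg .K ∧ s.arr .lab (s'.reg .res - 1) 0 + 1 = s.reg .pl ∧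
    G.edgeNat (s.arr .node1 (s.reg .rc) 0) (s.arr .node2 (s'.reg .res - 1) 0) ∧
    s.arr .vis (s'.reg .res - 1) 0 = 0

/-- A branch whose child had an unmatched neighbour would have received label one, and no matched
node becomes unmatched. -/
theorem Stage.idx2_ne (h0 : Start G lam s0) (h : Stage G lam s0 s) {i b : ℕ} (hi : i < s0.reg .K)
    (hl : 2 ≤ s0.arr .lab (s0.arr .par i 0) 0) (hE : G.edgeNat (s.arr .node1 i 0) b) :
    s.arr .idx2 b 0 ≠ 0 := by
  intro hb
  have hb0 : s0.arr .idx2 b 0 = 0 := by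
    by_contra hne; exact hne (h.idx2 b hne ▸ hb)
  have := (h0.layers.one _ (h0.perm.par_lt i hi)).2 ⟨b, by
    rw [child, h0.perm.chl_par i hi, ← h.node1 i hi]; exact hE, hb0⟩
  omega

theorem Stage.lt_of_lab (h0 : Start G lam s0) (h : Stage G lam s0 s) {j : ℕ} (hj : s.arr .lab j 0 ≠ 0) :
    j < s0.reg .K := by
  by_contra hge
  rw [h.lab] at hj
  exact hj (h0.clean.lab j (by omega))

-- A passed entry either has the wrong label or is visited, and neither changes within the stage. So
-- a search may resume where the previous one stopped.
set_option maxHeartbeats 1000000 in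
theorem wp_findWeak_list (h0 : Start G lam s0) (h : Stage G lam s0 s)
    (hrc : s.reg .rc < s0.reg .K) (hpl : s.reg .pl = s.arr .lab (s0.arr .par (s.reg .rc) 0) 0)
    (hpl2 : 2 ≤ s.reg .pl) (hu : s.reg .uw = 0) :
    wp lam findWeak s (fun t s' => WeakScan G lam s0 s s' ∧
      t + 100 * (s.arr .sPtr (s.reg .rc) 0 + s.arr .sWPtr (s.reg .rc) 0) ≤
        100 * (s'.arr .sPtr (s.reg .rc) 0 + s'.arr .sWPtr (s.reg .rc) 0) + 100) := by
  simp only [findWeak, ↓wp_seq, ↓wp_assign]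
  have hadj := h.base.static.adj1
  set rc := s.reg .rc with hrcdef
  set v := s.arr .node1 rc 0 with hvdef
  have hlab2 : 2 ≤ s0.arr .lab (s0.arr .par rc 0) 0 := by rw [← h.lab]; omega
  have hsw := h.mode1 hu rc hrc
  refine wp_while (fun t s' => (∀ i, i ≠ rc → s'.arr .sPtr i 0 = s.arr .sPtr i 0) ∧
      s'.arr .sWPtr = s.arr .sWPtr ∧ s'.arr .sPtr rc 0 ≤ s.arr .outDeg v 0 ∧
      s.arr .sPtr rc 0 ≤ s'.arr .sPtr rc 0 ∧
      (∀ e < s'.arr .sPtr rc 0, s.arr .lab (s.arr .idx2 (s.arr .outAdj v e) 0 - 1) 0 + 1 = s.reg .pl →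
        s.arr .vis (s.arr .idx2 (s.arr .outAdj v e) 0 - 1) 0 ≠ 0 ∨
          (s'.reg .res ≠ 0 ∧ s.arr .idx2 (s.arr .outAdj v e) 0 = s'.reg .res)) ∧
      (s'.reg .act ≠ 0 → s'.reg .res = 0) ∧
      (s'.reg .act = 0 → s'.reg .res = 0 → s.arr .outDeg v 0 ≤ s'.arr .sPtr rc 0) ∧
      (s'.reg .res ≠ 0 → s'.reg .res - 1 < s0.reg .K ∧ s.arr .lab (s'.reg .res - 1) 0 + 1 = s.reg .pl ∧
        G.edgeNat v (s.arr .node2 (s'.reg .res - 1) 0) ∧ s.arr .vis (s'.reg .res - 1) 0 = 0) ∧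
      t + 100 * s.arr .sPtr rc 0 ≤ 100 * s'.arr .sPtr rc 0 + (if s'.reg .act = 0 then 60 else 0))
    (fun s' => s.arr .outDeg v 0 - s'.arr .sPtr rc 0 + s'.reg .act) ?_ ?_ ?_
  · simp
    refine ⟨h.le1 rc hrc |>.trans_eq (by rw [← hvdef]), ?_⟩
    intro e he hl
    rw [hpl] at hl
    exact h.passed1 rc hrc (by omega) e he hl
  · rintro t s1 F ⟨c1, c2, c3, c4, c5, c6, c7, c8, c9⟩ he
    have f1 : s1.reg .uw = 0 := (F.r .uw).trans (by simpa using hu)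
    have f2 : s1.reg .rc = rc := (F.r .rc).trans (by simp [hrcdef])
    have f3 : s1.reg .pl = s.reg .pl := (F.r .pl).trans (by simp)
    have f4 : s1.arr .node1 = s.arr .node1 := (F.a .node1).trans (by simp)
    have f5 : s1.arr .outDeg = s.arr .outDeg := (F.a .outDeg).trans (by simp)
    have f6 : s1.arr .outAdj = s.arr .outAdj := (F.a .outAdj).trans (by simp)
    have f7 : s1.arr .idx2 = s.arr .idx2 := (F.a .idx2).trans (by simp)
    have f8 : s1.arr .lab = s.arr .lab := (F.a .lab).trans (by simp)
    have f9 : s1.arr .vis = s.arr .vis := (F.a .vis).trans (by simp)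
    clear F
    have hact : s1.reg .act ≠ 0 := he
    have hres := c6 hact
    rw [if_neg hact] at c9
    have c5' : ∀ e < s1.arr .sPtr rc 0, s.arr .lab (s.arr .idx2 (s.arr .outAdj v e) 0 - 1) 0 + 1 = s.reg .pl →
        s.arr .vis (s.arr .idx2 (s.arr .outAdj v e) 0 - 1) 0 ≠ 0 := fun e he hl =>
      (c5 e he hl).resolve_right fun hr => hr.1 hres
    rw [wp_ifte]
    refine ⟨fun h => absurd f1 (by simpa using h), fun _ => ?_⟩
    simp only [↓wp_seq, ↓wp_assign]
    simp only [Arr.el, Expr.eval, Expr.ofNat_eq, f2, f4, Mem.setReg_arr, Mem.setReg_reg, if_true, ← hvdef, reduceCtorEq, if_false]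
    rw [wp_ifte]
    refine ⟨fun hlt => ?_, fun hge => ?_⟩
    · have hlt' : s1.arr .sPtr rc 0 < s.arr .outDeg v 0 := by simpa [f5] using hlt
      simp only [↓wp_seq, ↓wp_assign, ↓wp_put]
      set x := s.arr .outAdj v (s1.arr .sPtr rc 0) with hx
      have hE : G.edgeNat v x := hadj.mem v _ hlt'
      have hx0 : s.arr .idx2 x 0 ≠ 0 := h.idx2_ne h0 hrc hlab2 hE
      have hn : s.arr .node2 (s.arr .idx2 x 0 - 1) 0 = x := h.base.nodes.node2_idx2 x hx0
      have key : ∀ e, e ≤ s1.arr .sPtr rc 0 → e < s1.arr .sPtr rc 0 ∨ s.arr .outAdj v e = x := by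
        intro e he
        rcases lt_or_eq_of_le he with h6 | h6
        · exact Or.inl h6
        · exact Or.inr (by rw [h6])
      rw [wp_ifte]
      refine ⟨fun hc => ?_, fun hc => ?_⟩
      · rw [Expr.eval_mul_ne_zero, Expr.eval_eq_ne_zero, Expr.eval_eq_ne_zero] at hc
        simp [f2, f3, f6, f7, f8, f9, ← hx] at hc
        simp [wp_seq, wp_assign, f2, f6, f7, hx0, ← hx]
        refine ⟨⟨fun i hi => by simp [hi, c1 i hi], c2, hlt', by omega, ?_, ⟨?_, hc.1, ?_, hc.2⟩, by omega⟩, by omega⟩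
        · intro e he hl
          rcases key e he with h6 | h6
          · exact Or.inl (c5' e h6 hl)
          · right; rw [h6]
        · exact h.lt_of_lab h0 (by omega)
        · rw [hn]; exact hE
      · have hc' : ¬ (s.arr .lab (s.arr .idx2 x 0 - 1) 0 + 1 = s.reg .pl ∧ s.arr .vis (s.arr .idx2 x 0 - 1) 0 = 0) := by
          intro hcon
          refine absurd hc (Expr.eval_mul_ne_zero.2 ⟨Expr.eval_eq_ne_zero.2 ?_, Expr.eval_eq_ne_zero.2 ?_⟩)
          · simpa [f2, f3, f6, f7, f8, f9, ← hx] using hcon.1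
          · simpa [f2, f3, f6, f7, f8, f9, ← hx] using hcon.2
        simp [wp_skip, f2, f6, f7, hx0, ← hx, hres, hact]
        refine ⟨⟨fun i hi => by simp [hi, c1 i hi], c2, hlt', by omega, ?_, by omega⟩, by omega⟩
        intro e he hl
        rcases key e he with h6 | h6
        · exact c5' e h6 hl
        · rw [h6] at hl ⊢; exact fun hv => hc' ⟨hl, hv⟩
    · have hge' : s.arr .outDeg v 0 ≤ s1.arr .sPtr rc 0 := by simpa [f5] using hge
      simp [wp_assign, hres]
      exact ⟨⟨c1, c2, c3, c4, c5', hge', by omega⟩, by omega⟩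
  · rintro t s1 F ⟨c1, c2, c3, c4, c5, c6, c7, c8, c9⟩ he
    have hact : s1.reg .act = 0 := he
    rw [if_pos hact] at c9
    refine ⟨⟨c1, by simp [c2], c3, by rw [c2]; exact h.agree.1 .nw (by simp) ▸ h.le2 rc hrc, c4, by rw [c2],
      fun _ => by rw [c2]; exact hsw, fun h => absurd hu h, c5, ?_, ?_, c8⟩, ?_⟩
    · rw [c2, ← hrcdef, hsw]; intro j hj; omega
    · intro hr j hj hl hE
      obtain ⟨e, he1, he2⟩ := hadj.ex _ _ hE
      have h6 := h.base.nodes.idx2_node2 j (hj.trans_le h.K_le)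
      have h7 := c5 e (lt_of_lt_of_le he1 (c7 hact hr))
      rw [he2, h6, Nat.add_sub_cancel] at h7
      exact (h7 hl).resolve_right fun h8 => h8.1 hr
    · rw [c2]; simp; omega

-- A word without admissible bits has none for the rest of the stage: marks only accumulate, and the
-- layers are fixed.
set_option maxHeartbeats 1000000 in
theorem wp_findWeak_word (hlam : 0 < lam) (h0 : Start G lam s0) (h : Stage G lam s0 s)
    (hrc : s.reg .rc < s0.reg .K) (hpl : s.reg .pl = s.arr .lab (s0.arr .par (s.reg .rc) 0) 0)
    (hpl2 : 2 ≤ s.reg .pl) (hu : s.reg .uw ≠ 0) :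
    wp lam findWeak s (fun t s' => WeakScan G lam s0 s s' ∧
      t + 100 * (s.arr .sPtr (s.reg .rc) 0 + s.arr .sWPtr (s.reg .rc) 0) ≤
        100 * (s'.arr .sPtr (s.reg .rc) 0 + s'.arr .sWPtr (s.reg .rc) 0) + 100) := by
  simp only [findWeak, ↓wp_seq, ↓wp_assign]
  set rc := s.reg .rc with hrcdef
  set v := s.arr .node1 rc 0 with hvdef
  have hsp := h.mode2 hu rc hrc
  have hl := h.base.static.word
  have hnw0 : s.reg .nw = s0.reg .nw := h.agree.1 .nw (by simp)
  have hu0 : s0.reg .uw ≠ 0 := by rwa [← h.agree.1 .uw (by simp)]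
  have hKn : s0.reg .K < s.reg .nw * lam := by
    rw [hnw0, h0.layers.nw, mul_comm]; exact Nat.lt_mul_div_succ _ hlam
  have hple : s.reg .pl ≤ s0.reg .p := by
    rw [hpl, h.lab]; exact h0.layers.lab_le _
  have hW := h0.layers.word hu0
  -- The AND of layer word, SUB-OUT word and unvisited word marks exactly the admissible targets. A
  -- new branch is neither labelled nor in `unvis`, so the growth of SUB-OUT does no harm.
  have hbits : ∀ q r, q < s.reg .nw → r < lam →
      (((((s.arr .lay2 (s.reg .pl - 1) q &&& s.arr .subOut rc q) % 2 ^ lam) &&& s.arr .unvis 0 q) % 2 ^ lam).testBit r = true ↔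
        s.arr .lab (q * lam + r) 0 + 1 = s.reg .pl ∧ G.edgeNat v (s.arr .node2 (q * lam + r) 0) ∧
          q * lam + r < s0.reg .K ∧ s.arr .vis (q * lam + r) 0 = 0) := by
    intro q r hq hr
    have h1 : q * lam + r < s0.reg .nw * lam := by
      rw [← hnw0]
      calc q * lam + r < (q + 1) * lam := by rw [add_mul]; omega
        _ ≤ _ := Nat.mul_le_mul_right _ hq
    have h2 := hW.lay2 (s.reg .pl - 1) (by omega) (by omega) _ h1
    have h3 := h.base.nodes.subOut rc (q * lam + r)
    have h4 := h.unvis hu (q * lam + r)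
    rw [bitAt_mul_add _ hr] at h2 h3 h4
    rw [← h.lab, ← h.agree.2 .lay2 (by simp)] at h2
    simp only [Nat.testBit_mod_two_pow, Nat.testBit_and, hr, decide_true, Bool.true_and, Bool.and_eq_true, h2, h3, h4]
    have := h.K_le
    constructor
    · rintro ⟨⟨h5, h6, h7, h8⟩, h9, h10⟩
      exact ⟨by omega, h8, h9, h10⟩
    · rintro ⟨h5, h6, h7, h8⟩
      exact ⟨⟨by omega, by omega, by omega, h6⟩, h7, h8⟩
  refine wp_while (fun t s' => (∀ i, i ≠ rc → s'.arr .sWPtr i 0 = s.arr .sWPtr i 0) ∧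
      s'.arr .sPtr = s.arr .sPtr ∧ s'.arr .sWPtr rc 0 ≤ s.reg .nw ∧
      s.arr .sWPtr rc 0 ≤ s'.arr .sWPtr rc 0 ∧
      (∀ j < s'.arr .sWPtr rc 0 * lam, s.arr .lab j 0 + 1 = s.reg .pl →
        G.edgeNat v (s.arr .node2 j 0) → j < s0.reg .K → s.arr .vis j 0 ≠ 0) ∧
      (s'.reg .act ≠ 0 → s'.reg .res = 0) ∧
      (s'.reg .act = 0 → s'.reg .res = 0 → s.reg .nw ≤ s'.arr .sWPtr rc 0) ∧
      (s'.reg .res ≠ 0 → s'.reg .res - 1 < s0.reg .K ∧ s.arr .lab (s'.reg .res - 1) 0 + 1 = s.reg .pl ∧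
        G.edgeNat v (s.arr .node2 (s'.reg .res - 1) 0) ∧ s.arr .vis (s'.reg .res - 1) 0 = 0) ∧
      t + 100 * s.arr .sWPtr rc 0 ≤ 100 * s'.arr .sWPtr rc 0 + (if s'.reg .act = 0 then 60 else 0))
    (fun s' => s.reg .nw - s'.arr .sWPtr rc 0 + s'.reg .act) ?_ ?_ ?_
  · simp
    refine ⟨hnw0 ▸ h.le2 rc hrc, ?_⟩
    intro j hj hl hE hjK
    rw [hpl] at hl
    exact h.passed2 rc hrc j hj hl hE hjK
  · rintro t s1 F ⟨c1, c2, c3, c4, c5, c6, c7, c8, c9⟩ he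
    have f1 : s1.reg .uw ≠ 0 := by rw [F.r .uw]; simpa using hu
    have f2 : s1.reg .rc = rc := (F.r .rc).trans (by simp [hrcdef])
    have f3 : s1.reg .pl = s.reg .pl := (F.r .pl).trans (by simp)
    have f4 : s1.reg .nw = s.reg .nw := (F.r .nw).trans (by simp)
    have f5 : s1.reg .lam = lam := (F.r .lam).trans (by simpa using hl)
    have f6 : s1.arr .lay2 = s.arr .lay2 := (F.a .lay2).trans (by simp)
    have f7 : s1.arr .subOut = s.arr .subOut := (F.a .subOut).trans (by simp)
    have f8 : s1.arr .unvis = s.arr .unvis := (F.a .unvis).trans (by simp)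
    clear F
    have hact : s1.reg .act ≠ 0 := he
    have hres := c6 hact
    rw [if_neg hact] at c9
    rw [wp_ifte]
    refine ⟨fun _ => ?_, fun h => absurd (by simpa using h) f1⟩
    simp only [↓wp_seq, ↓wp_assign]
    simp only [Arr.el, Expr.eval, Expr.ofNat_eq, f2]
    rw [wp_ifte]
    refine ⟨fun hlt => ?_, fun hge => ?_⟩
    · have hlt' : s1.arr .sWPtr rc 0 < s.reg .nw := by simpa [f4] using hlt
      simp only [↓wp_seq, ↓wp_assign]
      have hb := hbits (s1.arr .sWPtr rc 0)
      set q := s1.arr .sWPtr rc 0 with hq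
      set w := (((s.arr .lay2 (s.reg .pl - 1) q &&& s.arr .subOut rc q) % 2 ^ lam) &&& s.arr .unvis 0 q) % 2 ^ lam with hw
      generalize hS : Mem.setReg _ .tw _ = S
      have g1 : S.reg .tw = w := by
        rw [← hS, hw]
        simp only [Expr.eval, BinOp.eval, Expr.sub_eq, Mem.setReg_arr, Mem.setReg_reg, f2, f3, f6, f7, f8, if_true,
          reduceCtorEq, if_false]
      have g2 : S.reg .rc = rc := by rw [← hS]; simp [f2]
      have g3 : S.reg .tq = q := by rw [← hS]; simp
      have g4 : S.reg .res = 0 := by rw [← hS]; simp [hres]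
      have g5 : S.reg .act = s1.reg .act := by rw [← hS]; simp
      have g6 : S.reg .lam = lam := by rw [← hS]; simp [f5]
      have g7 : S.arr = s1.arr := by rw [← hS]; simp
      clear hS
      rw [wp_ifte]
      refine ⟨fun hc => ?_, fun hc => ?_⟩
      · rw [Expr.eval_eq_ne_zero] at hc
        simp only [Expr.eval, g1, Expr.eval_num] at hc
        simp [wp_put, g2, g3, g4, g5, g7, ← hq, hact]
        refine ⟨⟨fun i hi => by simp [hi, c1 i hi], c2, hlt', by omega, ?_, by omega⟩, by omega⟩
        intro j hj hl hE hjK hv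
        by_cases hlt2 : j < q * lam
        · exact c5 j hlt2 hl hE hjK hv
        · have hr : j - q * lam < lam := by rw [add_mul] at hj; omega
          have h6 := (hb (j - q * lam) hlt' hr).2
          rw [show q * lam + (j - q * lam) = j by omega] at h6
          have h7 := lead_eq_zero (lam := lam) (x := w) (by simpa using hc) hr
          rw [h6 ⟨hl, hE, hjK, hv⟩] at h7
          exact absurd h7 (by simp)
      · have hc' : Nat.size (w % 2 ^ lam) ≠ 0 := by
          intro hcon
          refine absurd hc (Expr.eval_eq_ne_zero.2 ?_)
          simp only [Expr.eval, g1, Expr.eval_num]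
          exact hcon
        obtain ⟨h6, h7⟩ := lead_ne_zero hc'
        simp only [wp_seq, wp_assign]
        generalize hr : Expr.eval lam S (.bin .add _ _) = r
        have hr' : r = q * lam + Nat.size (w % 2 ^ lam) := by
          rw [← hr]; simp only [Expr.mul_eq, Expr.eval, BinOp.eval, g1, g3, g6]
        have hr1 : r - 1 = q * lam + (Nat.size (w % 2 ^ lam) - 1) := by omega
        obtain ⟨d1, d2, d3, d4⟩ := (hb _ hlt' h6).1 h7
        rw [← hr1] at d1 d2 d3 d4
        -- The pointer stays on this word, which may contain further targets.
        simp [g7, ← hq]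
        exact ⟨⟨c1, c2, hlt'.le, c4, c5, by omega, fun _ => ⟨d3, d1, d2, d4⟩, by omega⟩, by omega⟩
    · have hge' : s.reg .nw ≤ s1.arr .sWPtr rc 0 := by simpa [f4] using hge
      simp [wp_assign, hres]
      exact ⟨⟨c1, c2, c3, c4, c5, hge', by omega⟩, by omega⟩
  · rintro t s1 F ⟨c1, c2, c3, c4, c5, c6, c7, c8, c9⟩ he
    have hact : s1.reg .act = 0 := he
    rw [if_pos hact] at c9
    refine ⟨⟨by simp [c2], c1, by rw [c2]; exact h.le1 rc hrc, c3, by rw [c2], c4,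
      fun h => absurd h hu, fun _ => by rw [c2]; exact hsp, ?_, c5, ?_, c8⟩, ?_⟩
    · rw [c2, ← hrcdef, hsp]; intro j hj; omega
    · intro hr j hj hl hE
      refine c5 j (lt_of_lt_of_le (hj.trans hKn) (Nat.mul_le_mul_right _ (c7 hact hr))) hl hE hj
    · rw [c2]; simp; omega

theorem wp_findWeak (hlam : 0 < lam) (h0 : Start G lam s0) (h : Stage G lam s0 s)
    (hrc : s.reg .rc < s0.reg .K) (hpl : s.reg .pl = s.arr .lab (s0.arr .par (s.reg .rc) 0) 0)
    (hpl2 : 2 ≤ s.reg .pl) :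
    wp lam findWeak s (fun t s' => WeakScan G lam s0 s s' ∧
      t + 100 * (s.arr .sPtr (s.reg .rc) 0 + s.arr .sWPtr (s.reg .rc) 0) ≤
        100 * (s'.arr .sPtr (s.reg .rc) 0 + s'.arr .sWPtr (s.reg .rc) 0) + 100) := by
  by_cases hu : s.reg .uw = 0
  · exact wp_findWeak_list h0 h hrc hpl hpl2 hu
  · exact wp_findWeak_word hlam h0 h hrc hpl hpl2 hu

/-- The invariants of a stage persist when, after a search for a merger, the branch that was found is
marked as visited. -/
theorem Stage.scan (h : Stage G lam s0 s)
    (hpl : s.reg .pl = s.arr .lab (s0.arr .par (s.reg .rc) 0) 0) (hw : WeakScan G lam s0 s s')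
    (H : Agree [.n1, .n2, .lam, .K, .L, .p, .nw, .uw, .qh, .qe, .qt] [.outDeg, .outAdj, .inDeg, .inAdj, .outW,
      .inW, .node1, .node2, .idx1, .idx2, .used1, .used2, .subOut, .subIn, .outPtr, .outWPtr, .inPtr, .inWPtr,
      .lab, .lay2, .queue] s s'')
    (H' : Agree [] [.sPtr, .sWPtr] s' s'')
    (hv : ∀ j, s.arr .vis j 0 ≠ 0 → s''.arr .vis j 0 ≠ 0)
    (hr : s'.reg .res ≠ 0 → s''.arr .vis (s'.reg .res - 1) 0 ≠ 0)
    (hun : s''.reg .uw ≠ 0 → ∀ j, bitAt lam (s''.arr .unvis 0) j = true ↔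
      j < s0.reg .K ∧ s''.arr .vis j 0 = 0) : Stage G lam s0 s'' := by
  have hb := h.base.congr H.mono
  obtain ⟨h1, h2⟩ := H
  have ha := h.agree
  have hp := H'.2
  simp only [Agree, List.mem_cons, List.not_mem_nil, or_false, forall_eq_or_imp, forall_eq] at h1 h2 ha hp
  obtain ⟨b1, b2, b3, b4, b5, b6, b7, b8, b9, b10, b11⟩ := h1
  obtain ⟨a1, a2, a3, a4, a5, a6, a7, a8, a9, a10, a11, a12, a13, a14, a15, a16, a17, a18, a19, a20, a21⟩ := h2
  obtain ⟨p1, p2⟩ := hp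
  refine ⟨hb, ?_, ?_, ?_, ?_, ?_, ?_, hun, ?_, ?_, ?_, ?_, ?_, ?_⟩ <;>
    simp only [Agree, List.mem_cons, List.not_mem_nil, or_false, forall_eq_or_imp, forall_eq, b4, b5, b6, b7, b8, b9,
      b10, b11, a1, a2, a7, a8, a9, a10, a19, a20, a21, p1, p2]
  · exact h.K_le
  · exact h.node1
  · exact h.node2
  · exact h.idx1
  · exact h.idx2
  · exact ha
  all_goals
    intro x
    try intro i
  · by_cases hx : x = s.reg .rc
    · rw [hx]; exact hw.le1
    · rw [hw.other1 x hx]; exact h.le1 x i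
  · by_cases hx : x = s.reg .rc
    · rw [hx]; exact hw.le2
    · rw [hw.other2 x hx]; exact h.le2 x i
  · by_cases hi : i = s.reg .rc
    · rw [hi]; exact fun _ => hw.mode1 x
    · rw [hw.other2 i hi]; exact h.mode1 x i
  · by_cases hi : i = s.reg .rc
    · rw [hi]; exact fun _ => hw.mode2 x
    · rw [hw.other1 i hi]; exact h.mode2 x i
  · intro h2 e he hl
    by_cases hx : x = s.reg .rc
    · rw [hx] at he hl ⊢
      rcases hw.passed1 e he (hpl ▸ hl) with h3 | ⟨h3, h4⟩
      · exact hv _ h3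
      · rw [h4]; exact hr h3
    · rw [hw.other1 x hx] at he
      exact hv _ (h.passed1 x i h2 e he hl)
  · intro e he hl hE hj
    by_cases hx : x = s.reg .rc
    · rw [hx] at he hl hE
      exact hv _ (hw.passed2 e he (hpl ▸ hl) hE hj)
    · rw [hw.other2 x hx] at he
      exact hv _ (h.passed2 x i e he hl hE hj)

end Weak

/-! ## Sequences of mergers -/

section Path

variable {n₁ n₂ : ℕ} {G : BipGraph n₁ n₂} {lam : ℕ} {s s' s0 sm : Mem}

/-- The left child of the `m`-th branch in the sequence of mergers. -/
def link (s0 sm s : Mem) (m : ℕ) : ℕ :=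
  if m = 0 then sm.reg .K else s0.arr .chl (s.arr .stk (m - 1) 0) 0

variable (G lam) in
/-- The state during a sequence of mergers that started in the memory `sm`. -/
structure Path (s0 sm s : Mem) : Prop where
  stage : Stage G lam s0 s
  same : Agree [.K, .u] [.idx1, .idx2, .node1, .node2] sm s
  lt : ∀ i ≤ s.reg .d, s.arr .stk i 0 < s0.reg .K
  lab : ∀ i ≤ s.reg .d, s0.arr .lab (s.arr .stk i 0) 0 + i + 1 = s0.reg .L
  pos : s0.arr .lab (s.arr .stk (s.reg .d) 0) 0 ≠ 0
  vis : ∀ i ≤ s.reg .d, s.arr .vis (s.arr .stk i 0) 0 ≠ 0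
  fresh : ∀ i ≤ s.reg .d, sm.arr .vis (s.arr .stk i 0) 0 = 0
  first : s.arr .stk 0 0 = sm.reg .cur
  cur : s.reg .cur = s.arr .stk (s.reg .d) 0
  lc : s.reg .lc = link s0 sm s (s.reg .d)
  rc : s.reg .rc = s0.arr .chl (s.arr .stk (s.reg .d) 0) 0
  -- Only branches strictly below the top of the stack have been rewired in `chl`. The top branch
  -- keeps its old child, which is `rc`; its incoming child is `lc`.
  chl_off : ∀ j < sm.reg .K, (∀ i < s.reg .d, j ≠ s.arr .stk i 0) → s.arr .chl j 0 = sm.arr .chl j 0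
  chl_on : ∀ i < s.reg .d, s.arr .chl (s.arr .stk i 0) 0 = link s0 sm s i
  par_off : ∀ i < sm.reg .K, (∀ m < s.reg .d, i ≠ s0.arr .chl (s.arr .stk m 0) 0) →
    s.arr .par i 0 = sm.arr .par i 0
  par_on : ∀ m ≤ s.reg .d, s.arr .par (link s0 sm s m) 0 = s.arr .stk m 0
  edge : ∀ i < s.reg .d,
    G.edgeNat (sm.arr .node1 (s0.arr .chl (s.arr .stk i 0) 0) 0) (sm.arr .node2 (s.arr .stk (i + 1) 0) 0)
  mono : ∀ j, sm.arr .vis j 0 ≠ 0 → s.arr .vis j 0 ≠ 0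
  -- Branches on the stack are exempt: they become settled when they are removed by backtracking or
  -- when the path succeeds.
  settled : ∀ j < sm.reg .K, (s0.reg .K ≤ j ∨ s.arr .vis j 0 ≠ 0) → (∀ i ≤ s.reg .d, j ≠ s.arr .stk i 0) →
    ∀ b, G.edgeNat (child sm j) b → liftVis s0 s j ≤ height s0 s b + 1

variable (G lam) in
/-- The start of a sequence of mergers. -/
structure Entry (s0 sm : Mem) : Prop extends Between G lam s0 sm where
  start : Start G lam s0
  cur_lt : sm.reg .cur < s0.reg .K
  cur_lab : s0.arr .lab (sm.reg .cur) 0 = s0.reg .p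
  cur_vis : sm.arr .vis (sm.reg .cur) 0 = 0
  u_free : sm.arr .idx1 (sm.reg .u) 0 = 0
  u_edge : G.edgeNat (sm.reg .u) (sm.arr .node2 (sm.reg .cur) 0)

/-- Labels drop by one from each stack entry to the next. -/
theorem Path.inj (h : Path G lam s0 sm s) {i i' : ℕ} (hi : i ≤ s.reg .d) (hi' : i' ≤ s.reg .d)
    (he : s.arr .stk i 0 = s.arr .stk i' 0) : i = i' := by
  have h1 := h.lab i hi
  have h2 := h.lab i' hi'
  rw [he] at h1; omega

theorem Path.chl_eq (hE : Entry G lam s0 sm) (h : Path G lam s0 sm s) {i : ℕ} (hi : i ≤ s.reg .d) :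
    sm.arr .chl (s.arr .stk i 0) 0 = s0.arr .chl (s.arr .stk i 0) 0 :=
  hE.unv _ (h.lt i hi) (h.fresh i hi)

theorem Path.chl_lt (hE : Entry G lam s0 sm) (h : Path G lam s0 sm s) {i : ℕ} (hi : i ≤ s.reg .d) :
    s0.arr .chl (s.arr .stk i 0) 0 < s0.reg .K :=
  hE.start.perm.chl_lt _ (h.lt i hi)

theorem Path.chl_inj (hE : Entry G lam s0 sm) (h : Path G lam s0 sm s) {i i' : ℕ} (hi : i ≤ s.reg .d)
    (hi' : i' ≤ s.reg .d) (he : s0.arr .chl (s.arr .stk i 0) 0 = s0.arr .chl (s.arr .stk i' 0) 0) : i = i' := by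
  apply h.inj hi hi'
  rw [← hE.start.perm.par_chl _ (h.lt i hi), he, hE.start.perm.par_chl _ (h.lt i' hi')]

theorem Path.link_ne (hE : Entry G lam s0 sm) (h : Path G lam s0 sm s) {m i : ℕ} (hm : m ≤ s.reg .d)
    (hi : i ≤ s.reg .d) (hne : m ≠ i + 1) : link s0 sm s m ≠ s0.arr .chl (s.arr .stk i 0) 0 := by
  have h1 := h.chl_lt hE hi
  have h2 := hE.stage.K_le
  unfold link
  split_ifs with h0
  · omega
  · intro he
    have := h.chl_inj hE (by omega) hi he
    omega

theorem Entry.path (hE : Entry G lam s0 sm) (hS : Stage G lam s0 s)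
    (hA : Agree [.K, .u] [.idx1, .idx2, .node1, .node2, .chl] sm s) (hd : s.reg .d = 0)
    (hst : s.arr .stk 0 0 = sm.reg .cur) (hcur : s.reg .cur = sm.reg .cur) (hlc : s.reg .lc = sm.reg .K)
    (hpar : ∀ i, s.arr .par i 0 = if i = sm.reg .K then sm.reg .cur else sm.arr .par i 0)
    (hrc : s.reg .rc = sm.arr .chl (sm.reg .cur) 0)
    (hvis : ∀ j, s.arr .vis j 0 = if j = sm.reg .cur then 1 else sm.arr .vis j 0) :
    Path G lam s0 sm s := by
  have hv : ∀ j, sm.arr .vis j 0 ≠ 0 → s.arr .vis j 0 ≠ 0 := by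
    intro j hj; rw [hvis]; split_ifs
    · simp
    · exact hj
  have hchl := hE.unv _ hE.cur_lt hE.cur_vis
  refine ⟨hS, hA.mono, ?_, ?_, ?_, ?_, ?_, hst, by rw [hd, hst, hcur], ?_, ?_, ?_, ?_, ?_, ?_, ?_, hv, ?_⟩
  · intro i hi
    rw [hd, Nat.le_zero] at hi; subst hi
    rw [hst]; exact hE.cur_lt
  · intro i hi
    rw [hd, Nat.le_zero] at hi; subst hi
    rw [hst, hE.cur_lab, hE.start.L_eq]
  · rw [hd, hst, hE.cur_lab]
    have := hE.start.layers.pos; omega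
  · intro i hi
    rw [hd, Nat.le_zero] at hi; subst hi
    rw [hst, hvis]; simp
  · intro i hi
    rw [hd, Nat.le_zero] at hi; subst hi
    rw [hst]; exact hE.cur_vis
  · rw [hd, hlc]; simp [link]
  · rw [hd, hrc, hst, hchl]
  · intro j _ _; rw [hA.2 .chl (by simp)]
  · intro i hi; omega
  · intro i hi _
    rw [hpar, if_neg hi.ne]
  · intro m hm
    rw [hd, Nat.le_zero] at hm; subst hm
    simp [link, hpar, hst]
  · intro i hi; omega
  · intro j hj hV hoff b hb
    have hjc : j ≠ sm.reg .cur := by rw [← hst]; exact hoff 0 (Nat.zero_le _)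
    rw [hvis, if_neg hjc] at hV
    have h1 := hE.settled j hj hV b hb
    have h2 : liftVis s0 s j = liftVis s0 sm j := by
      simp only [liftVis, hvis, if_neg hjc]
    rw [h2]
    exact h1.trans (Nat.add_le_add_right (height_mono (fun b _ => by rw [hA.2 .idx2 (by simp)]) hv b) 1)

/-- The new top was unvisited. Hence it is not on the stack, and its child is still the one from the
start of the stage. -/
theorem Path.push (hE : Entry G lam s0 sm) (h : Path G lam s0 sm s) (hS : Stage G lam s0 s') {r : ℕ}
    (hr : r < s0.reg .K) (hlab : s0.arr .lab r 0 + 1 = s0.arr .lab (s.reg .cur) 0)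
    (hpos : s0.arr .lab r 0 ≠ 0) (hedge : G.edgeNat (s.arr .node1 (s.reg .rc) 0) (s.arr .node2 r 0))
    (hr0 : s.arr .vis r 0 = 0)
    (hA : Agree [.K, .u] [.idx1, .idx2, .node1, .node2] s s') (hd : s'.reg .d = s.reg .d + 1)
    (hst : ∀ i, s'.arr .stk i 0 = if i = s.reg .d + 1 then r else s.arr .stk i 0)
    (hcur : s'.reg .cur = r) (hlc : s'.reg .lc = s.reg .rc)
    (hchl : ∀ j, s'.arr .chl j 0 = if j = s.reg .cur then s.reg .lc else s.arr .chl j 0)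
    (hpar : ∀ i, s'.arr .par i 0 = if i = s.reg .rc then r else s.arr .par i 0)
    (hrc : s'.reg .rc = s.arr .chl r 0)
    (hvis : ∀ j, s'.arr .vis j 0 = if j = r then 1 else s.arr .vis j 0) :
    Path G lam s0 sm s' := by
  have hst' : ∀ i ≤ s.reg .d, s'.arr .stk i 0 = s.arr .stk i 0 := by
    intro i hi; rw [hst, if_neg (by omega)]
  have hst1 : s'.arr .stk (s.reg .d + 1) 0 = r := by rw [hst, if_pos rfl]
  have hlink : ∀ m ≤ s.reg .d + 1, link s0 sm s' m = link s0 sm s m := by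
    intro m hm
    unfold link
    split_ifs with h0
    · rfl
    · rw [hst' _ (by omega)]
  have hv : ∀ j, s.arr .vis j 0 ≠ 0 → s'.arr .vis j 0 ≠ 0 := by
    intro j hj; rw [hvis]; split_ifs
    · simp
    · exact hj
  have hsame : Agree [.K, .u] [.idx1, .idx2, .node1, .node2] sm s' := by
    have h1 := h.same
    simp only [Agree, List.mem_cons, List.not_mem_nil, or_false, forall_eq_or_imp, forall_eq] at hA h1 ⊢
    simp only [hA, h1, and_self]
  have hlabd := h.lab (s.reg .d) le_rfl
  have hne : ∀ i ≤ s.reg .d, s.arr .stk i 0 ≠ r := by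
    intro i hi he
    have := h.vis i hi
    rw [he] at this; exact this hr0
  have hfr : sm.arr .vis r 0 = 0 := by
    by_contra h1; exact h.mono r h1 hr0
  refine ⟨hS, hsame, ?_, ?_, ?_, ?_, ?_, ?_, by rw [hcur, hd, hst1], ?_, ?_, ?_, ?_, ?_, ?_, ?_,
    fun j hj => hv j (h.mono j hj), ?_⟩
  · intro i hi
    rcases Nat.lt_or_eq_of_le (hd ▸ hi) with h1 | rfl
    · rw [hst' i (by omega)]; exact h.lt i (by omega)
    · rwa [hst1]
  · intro i hi
    rcases Nat.lt_or_eq_of_le (hd ▸ hi) with h1 | rfl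
    · rw [hst' i (by omega)]; exact h.lab i (by omega)
    · rw [hst1]; rw [h.cur] at hlab; omega
  · rwa [hd, hst1]
  · intro i hi
    rcases Nat.lt_or_eq_of_le (hd ▸ hi) with h1 | rfl
    · rw [hst' i (by omega)]; exact hv _ (h.vis i (by omega))
    · rw [hst1, hvis]; simp
  · intro i hi
    rcases Nat.lt_or_eq_of_le (hd ▸ hi) with h1 | rfl
    · rw [hst' i (by omega)]; exact h.fresh i (by omega)
    · rwa [hst1]
  · rw [hst' 0 (by omega)]; exact h.first
  · rw [hlc, hd, hlink _ le_rfl, h.rc]; simp [link]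
  · rw [hrc, hd, hst1, h.chl_off r (lt_of_lt_of_le hr (hE.stage.K_le)) (fun i hi => (hne i hi.le).symm),
      hE.unv r hr hfr]
  · intro j hj hoff
    have h1 := hoff (s.reg .d) (by omega)
    rw [hst' _ le_rfl] at h1
    rw [hchl, h.cur, if_neg h1]
    refine h.chl_off j hj fun i hi => ?_
    rw [← hst' i hi.le]; exact hoff i (by omega)
  · intro i hi
    rw [hst' i (by omega), hlink i (by omega), hchl, h.cur]
    split_ifs with h1
    · rw [h.inj (by omega) le_rfl h1]; exact h.lc
    · refine h.chl_on i (lt_of_le_of_ne (by omega) ?_)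
      rintro rfl; exact h1 rfl
  · intro i hi hoff
    have h1 := hoff (s.reg .d) (by omega)
    rw [hst' _ le_rfl, ← h.rc] at h1
    rw [hpar, if_neg h1]
    refine h.par_off i hi fun m hm => ?_
    rw [← hst' m hm.le]; exact hoff m (by omega)
  · intro m hm
    rw [hd] at hm
    rw [hlink m hm, hpar, h.rc]
    rcases Nat.lt_or_eq_of_le hm with h1 | rfl
    · rw [if_neg (h.link_ne hE (by omega) le_rfl (by omega)), hst' m (by omega)]
      exact h.par_on m (by omega)
    · rw [hst1, if_pos]; simp [link]
  · intro i hi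
    rw [hst' i (by omega)]
    rcases Nat.lt_or_eq_of_le (Nat.le_of_lt_succ (hd ▸ hi)) with h1 | rfl
    · rw [hst' (i + 1) (by omega)]; exact h.edge i h1
    · rw [hst1, ← h.rc, ← h.same.2 .node1 (by simp), ← h.same.2 .node2 (by simp)]; exact hedge
  · intro j hj hV hoff b hb
    have hjr : j ≠ r := by rw [← hst1]; exact hoff _ (by omega)
    rw [hvis, if_neg hjr] at hV
    have h1 := h.settled j hj hV (fun i hi => by rw [← hst' i hi]; exact hoff i (by omega)) b hb
    have h2 : liftVis s0 s' j = liftVis s0 s j := by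
      simp only [liftVis, hvis, if_neg hjr]
    rw [h2]
    exact h1.trans (Nat.add_le_add_right (height_mono (fun b _ => by rw [hA.2 .idx2 (by simp)]) hv b) 1)

/-- The top branch of an unsuccessful sequence of mergers is settled. -/
theorem Path.settle (hE : Entry G lam s0 sm) (h : Path G lam s0 sm s)
    (hf : ∀ b, G.edgeNat (s.arr .node1 (s.reg .rc) 0) b → s0.arr .lab (s.reg .cur) 0 ≤ height s0 s b)
    {j : ℕ} (hj : j < sm.reg .K) (hV : s0.reg .K ≤ j ∨ s.arr .vis j 0 ≠ 0)
    (hoff : ∀ i < s.reg .d, j ≠ s.arr .stk i 0) {b : ℕ} (hb : G.edgeNat (child sm j) b) :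
    liftVis s0 s j ≤ height s0 s b + 1 := by
  by_cases hjd : j = s.arr .stk (s.reg .d) 0
  · have hjK := h.lt _ le_rfl
    have h1 := h.pos
    rw [← hjd] at hjK h1
    rw [child, hjd, h.chl_eq hE le_rfl, ← h.rc, ← h.same.2 .node1 (by simp)] at hb
    have h2 := hf b hb
    rw [h.cur, ← hjd] at h2
    rw [liftVis, if_pos hjK, lift, if_neg h1]
    split_ifs <;> omega
  · refine h.settled j hj hV (fun i hi => ?_) b hb
    rcases Nat.lt_or_eq_of_le hi with h1 | rfl
    · exact hoff i h1
    · exact hjd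

/-- For `d > 0` the left child is the original child of the branch below, so returning it undoes the
last merger. The removed branch is settled by `Path.settle`. -/
theorem Path.pop (hE : Entry G lam s0 sm) (h : Path G lam s0 sm s) (hS : Stage G lam s0 s')
    (hf : ∀ b, G.edgeNat (s.arr .node1 (s.reg .rc) 0) b → s0.arr .lab (s.reg .cur) 0 ≤ height s0 s b)
    (hd0 : s.reg .d ≠ 0)
    (hA : Agree [.K, .u] [.idx1, .idx2, .node1, .node2, .vis, .stk] s s') (hd : s'.reg .d = s.reg .d - 1)
    (hcur : s'.reg .cur = s.arr .stk (s.reg .d - 1) 0) (hrc : s'.reg .rc = s.reg .lc)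
    (hpar : ∀ i, s'.arr .par i 0 = if i = s.reg .lc then s.arr .stk (s.reg .d - 1) 0 else s.arr .par i 0)
    (hlc : s'.reg .lc = s.arr .chl (s.arr .stk (s.reg .d - 1) 0) 0)
    (hchl : ∀ j, s'.arr .chl j 0 = if j = s.arr .stk (s.reg .d - 1) 0 then s.reg .lc else s.arr .chl j 0) :
    Path G lam s0 sm s' := by
  have hsame : Agree [.K, .u] [.idx1, .idx2, .node1, .node2] sm s' := by
    have h1 := h.same
    simp only [Agree, List.mem_cons, List.not_mem_nil, or_false, forall_eq_or_imp, forall_eq] at hA h1 ⊢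
    simp only [hA, h1, and_self]
  have hst : s'.arr .stk = s.arr .stk := hA.2 _ (by simp)
  have hvis : s'.arr .vis = s.arr .vis := hA.2 _ (by simp)
  have hlink : link s0 sm s' = link s0 sm s := by funext m; simp only [link, hst]
  have hlc' : s.reg .lc = s0.arr .chl (s.arr .stk (s.reg .d - 1) 0) 0 := by
    rw [h.lc, link, if_neg hd0]
  refine ⟨hS, hsame, ?_, ?_, ?_, ?_, ?_, ?_, by rw [hcur, hd, hst], ?_, ?_, ?_, ?_, ?_, ?_, ?_, ?_, ?_⟩ <;>
    simp only [hst, hvis, hd, hlink]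
  · exact fun i hi => h.lt i (by omega)
  · exact fun i hi => h.lab i (by omega)
  · have h1 := h.lab (s.reg .d - 1) (by omega)
    have h2 := h.lab (s.reg .d) le_rfl
    have h3 := h.pos
    omega
  · exact fun i hi => h.vis i (by omega)
  · exact fun i hi => h.fresh i (by omega)
  · exact h.first
  · rw [hlc]; exact h.chl_on _ (by omega)
  · rw [hrc, hlc']
  · intro j hj hoff
    rw [hchl]
    split_ifs with h1
    · rw [h1, h.chl_eq hE (by omega), hlc']
    · refine h.chl_off j hj fun i hi => ?_
      rcases Nat.lt_or_eq_of_le (Nat.le_sub_one_of_lt hi) with h2 | rfl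
      · exact hoff i h2
      · exact h1
  · intro i hi
    rw [hchl, if_neg, h.chl_on i (by omega)]
    intro he
    have := h.inj (by omega) (by omega) he
    omega
  · intro i hi hoff
    rw [hpar]
    split_ifs with h1
    · rw [h1, hlc', ← h.chl_eq hE (by omega), hE.perm.par_chl _ (lt_of_lt_of_le (h.lt _ (by omega)) hE.stage.K_le)]
    · refine h.par_off i hi fun m hm => ?_
      rcases Nat.lt_or_eq_of_le (Nat.le_sub_one_of_lt hm) with h2 | rfl
      · exact hoff m h2
      · rw [← hlc']; exact h1
  · intro m hm
    rw [hpar, hlc', if_neg (h.link_ne hE (by omega) (by omega) (by omega))]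
    exact h.par_on m (by omega)
  · exact fun i hi => h.edge i (by omega)
  · exact h.mono
  · intro j hj hV hoff b hb
    have h1 : liftVis s0 s' j = liftVis s0 s j := by simp only [liftVis, hvis]
    have h2 : height s0 s' b = height s0 s b := by simp only [height, liftVis, hvis, hA.2 .idx2 (by simp)]
    rw [h1, h2]
    exact h.settle hE hf hj hV (fun i hi => hoff i (by omega)) hb

/-- At depth zero nothing is rewired, so the matching is the one before the sequence; its first
branch is settled by `Path.settle`. -/
theorem Path.fail (hE : Entry G lam s0 sm) (h : Path G lam s0 sm s) (hS : Stage G lam s0 s')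
    (hf : ∀ b, G.edgeNat (s.arr .node1 (s.reg .rc) 0) b → s0.arr .lab (s.reg .cur) 0 ≤ height s0 s b)
    (hd0 : s.reg .d = 0)
    (hA : Agree [.K] [.idx1, .idx2, .node1, .node2, .vis, .chl, .par] s s') : Between G lam s0 s' := by
  have h1 := h.same
  simp only [Agree, List.mem_cons, List.not_mem_nil, or_false, forall_eq_or_imp, forall_eq] at hA h1
  obtain ⟨a0, a1, a2, a3, a4, a5, a6, a7⟩ := hA
  obtain ⟨⟨b0, b1⟩, b2, b3, b4, b5⟩ := h1
  have hchl : ∀ j < sm.reg .K, s.arr .chl j 0 = sm.arr .chl j 0 :=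
    fun j hj => h.chl_off j hj fun i hi => by omega
  have hpar : ∀ j < sm.reg .K, s.arr .par j 0 = sm.arr .par j 0 :=
    fun j hj => h.par_off j hj fun i hi => by omega
  have hK := hE.stage.K_le
  have hP := hE.perm
  refine ⟨hS, ?_, ?_, ?_, ?_⟩
  · constructor <;> intro j hj <;> rw [a0, b0] at hj <;> simp only [a0, a3, a4, a6, a7, b0, b4, b5]
    · rw [hchl j hj]; exact hP.chl_lt j hj
    · rw [hpar j hj]; exact hP.par_lt j hj
    · rw [hchl j hj, hpar _ (hP.chl_lt j hj), hP.par_chl j hj]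
    · rw [hpar j hj, hchl _ (hP.par_lt j hj), hP.chl_par j hj]
    · rw [hchl j hj]; exact hP.edge j hj
  · intro j hj hv
    rw [a5] at hv
    have : sm.arr .vis j 0 = 0 := by by_contra hne; exact h.mono j hne hv
    rw [a6, hchl j (by omega), hE.unv j hj this]
  · intro j hj hV b hb
    rw [a0, b0] at hj
    rw [child, a6, a3, hchl j hj, b4] at hb
    have h1 : liftVis s0 s' j = liftVis s0 s j := by simp only [liftVis, a5]
    have h2 : height s0 s' b = height s0 s b := by simp only [height, liftVis, a5, a2]
    rw [h1, h2]
    exact h.settle hE hf hj (by rwa [a5] at hV) (fun i hi => by omega) hb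
  · intro hKK j hj
    rw [a0, b0] at hKK
    rw [a6, hchl j (by omega), hE.same hKK j hj]

/-- Augmentation along the stack: the first branch takes `u`, each further one takes the child of
its predecessor, and the last child joins `w` in the new branch number `K`. This is a permutation
again because the stack entries and their children are distinct. -/
theorem Path.win (hE : Entry G lam s0 sm) (h : Path G lam s0 sm s) (hS : Stage G lam s0 s') {w : ℕ}
    (hlab : s0.arr .lab (s.reg .cur) 0 = 1)
    (hw : G.edgeNat (s.arr .node1 (s.reg .rc) 0) w)
    (hK : s'.reg .K = s.reg .K + 1)
    (hn1 : ∀ j, s'.arr .node1 j 0 = if j = s.reg .K then sm.reg .u else s.arr .node1 j 0)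
    (hn2 : ∀ j, s'.arr .node2 j 0 = if j = s.reg .K then w else s.arr .node2 j 0)
    (hi2 : ∀ b, s.arr .idx2 b 0 ≠ 0 → s'.arr .idx2 b 0 = s.arr .idx2 b 0)
    (hvis : s'.arr .vis = s.arr .vis)
    (hchl : ∀ j, s'.arr .chl j 0 =
      if j = s.reg .K then s.reg .rc else if j = s.reg .cur then s.reg .lc else s.arr .chl j 0)
    (hpar : ∀ i, s'.arr .par i 0 = if i = s.reg .rc then s.reg .K else s.arr .par i 0) :
    Between G lam s0 s' := by
  obtain ⟨hS1, hS2⟩ := h.same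
  have b0 : s.reg .K = sm.reg .K := hS1 _ (by simp)
  have b4 : s.arr .node1 = sm.arr .node1 := hS2 _ (by simp)
  have b5 : s.arr .node2 = sm.arr .node2 := hS2 _ (by simp)
  rw [b0] at hK hn1 hn2 hchl hpar
  rw [b4] at hn1 hw
  rw [b5] at hn2
  rw [h.cur] at hlab
  rw [h.rc, h.cur] at hchl
  rw [h.rc] at hw hpar
  have hKle := hE.stage.K_le
  have hP := hE.perm
  have hv : ∀ j, s.arr .vis j 0 ≠ 0 → s'.arr .vis j 0 ≠ 0 := fun j => by rw [hvis]; exact id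
  -- the matching after the augmentation
  have c_on : ∀ i ≤ s.reg .d, s'.arr .chl (s.arr .stk i 0) 0 = link s0 sm s i := by
    intro i hi
    have h1 := h.lt i hi
    rw [hchl, if_neg (by omega)]
    split_ifs with h2
    · rw [h.inj hi le_rfl h2]; exact h.lc
    · refine h.chl_on i (lt_of_le_of_ne hi ?_)
      rintro rfl; exact h2 rfl
  have c_new : s'.arr .chl (sm.reg .K) 0 = s0.arr .chl (s.arr .stk (s.reg .d) 0) 0 := by
    rw [hchl, if_pos rfl]
  have c_off : ∀ j < sm.reg .K, (∀ i ≤ s.reg .d, j ≠ s.arr .stk i 0) → s'.arr .chl j 0 = sm.arr .chl j 0 := by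
    intro j hj hoff
    rw [hchl, if_neg (by omega), if_neg (hoff _ le_rfl)]
    exact h.chl_off j hj fun i hi => hoff i hi.le
  have p_on : ∀ m ≤ s.reg .d, s'.arr .par (link s0 sm s m) 0 = s.arr .stk m 0 := by
    intro m hm
    rw [hpar, if_neg (h.link_ne hE hm le_rfl (by omega))]
    exact h.par_on m hm
  have p_new : s'.arr .par (s0.arr .chl (s.arr .stk (s.reg .d) 0) 0) 0 = sm.reg .K := by
    rw [hpar, if_pos rfl]
  have p_off : ∀ i < sm.reg .K, (∀ m ≤ s.reg .d, i ≠ s0.arr .chl (s.arr .stk m 0) 0) →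
      s'.arr .par i 0 = sm.arr .par i 0 := by
    intro i hi hoff
    rw [hpar, if_neg (hoff _ le_rfl)]
    exact h.par_off i hi fun m hm => hoff m hm.le
  have link_succ : ∀ m, link s0 sm s (m + 1) = s0.arr .chl (s.arr .stk m 0) 0 := fun m => by simp [link]
  have link_zero : link s0 sm s 0 = sm.reg .K := by simp [link]
  have link_lt : ∀ m ≤ s.reg .d, link s0 sm s m < sm.reg .K + 1 := by
    intro m hm
    rcases Nat.eq_zero_or_pos m with rfl | hpos
    · rw [link_zero]; omega
    · obtain ⟨k, rfl⟩ := Nat.exists_eq_add_of_lt hpos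
      rw [Nat.zero_add, link_succ]
      have := h.chl_lt hE (i := k) (by omega)
      omega
  have cases_j : ∀ j < sm.reg .K + 1, j = sm.reg .K ∨ (∃ i ≤ s.reg .d, j = s.arr .stk i 0) ∨
      (j < sm.reg .K ∧ ∀ i ≤ s.reg .d, j ≠ s.arr .stk i 0) := by
    intro j hj
    by_cases h1 : j = sm.reg .K
    · exact Or.inl h1
    · by_cases h2 : ∃ i ≤ s.reg .d, j = s.arr .stk i 0
      · exact Or.inr (Or.inl h2)
      · push Not at h2
        exact Or.inr (Or.inr ⟨by omega, h2⟩)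
  have sm_ne : ∀ j < sm.reg .K, (∀ i ≤ s.reg .d, j ≠ s.arr .stk i 0) → ∀ m ≤ s.reg .d,
      sm.arr .chl j 0 ≠ s0.arr .chl (s.arr .stk m 0) 0 := by
    intro j hj hoff m hm he
    apply hoff m hm
    rw [← h.chl_eq hE hm] at he
    have h1 := h.lt m hm
    rw [← hP.par_chl j hj, he, hP.par_chl _ (by omega)]
  have hch : ∀ j < sm.reg .K + 1, child s' j = if s'.arr .chl j 0 = sm.reg .K then sm.reg .u else
      sm.arr .node1 (s'.arr .chl j 0) 0 := fun j _ => by rw [child, hn1]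
  refine ⟨hS, ?_, ?_, ?_, ?_⟩
  · constructor <;> intro j hj <;> rw [hK] at hj
    · rw [hK]
      rcases cases_j j hj with rfl | ⟨i, hi, rfl⟩ | ⟨h1, h2⟩
      · rw [c_new]; have := h.chl_lt hE (i := s.reg .d) le_rfl; omega
      · rw [c_on i hi]; exact link_lt i hi
      · rw [c_off j h1 h2]; have := hP.chl_lt j h1; omega
    · rw [hK]
      by_cases h1 : j = sm.reg .K
      · rw [h1, ← link_zero, p_on 0 (by omega)]; have := h.lt 0 (by omega); omega
      · by_cases h2 : ∃ m ≤ s.reg .d, j = s0.arr .chl (s.arr .stk m 0) 0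
        · obtain ⟨m, hm, rfl⟩ := h2
          rcases Nat.lt_or_eq_of_le hm with h3 | rfl
          · rw [← link_succ, p_on (m + 1) h3]; have := h.lt (m + 1) h3; omega
          · rw [p_new]; omega
        · push Not at h2
          rw [p_off j (by omega) h2]; have := hP.par_lt j (by omega); omega
    · rcases cases_j j hj with rfl | ⟨i, hi, rfl⟩ | ⟨h1, h2⟩
      · rw [c_new, p_new]
      · rw [c_on i hi, p_on i hi]
      · rw [c_off j h1 h2, p_off _ (hP.chl_lt j h1) (sm_ne j h1 h2), hP.par_chl j h1]
    · by_cases h1 : j = sm.reg .K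
      · have h2 := p_on 0 (by omega)
        rw [link_zero] at h2
        rw [h1, h2, c_on 0 (by omega), link_zero]
      · by_cases h2 : ∃ m ≤ s.reg .d, j = s0.arr .chl (s.arr .stk m 0) 0
        · obtain ⟨m, hm, rfl⟩ := h2
          rcases Nat.lt_or_eq_of_le hm with h3 | rfl
          · rw [← link_succ, p_on _ h3, c_on _ h3]
          · rw [p_new, c_new]
        · push Not at h2
          have h3 : j < sm.reg .K := by omega
          rw [p_off j h3 h2, c_off _ (hP.par_lt j h3), hP.chl_par j h3]
          intro i hi he
          apply h2 i hi
          rw [← h.chl_eq hE hi, ← he, hP.chl_par j h3]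
    · have hcj := hch j hj
      rw [child] at hcj
      rw [hcj, hn2]
      rcases cases_j j hj with rfl | ⟨i, hi, rfl⟩ | ⟨h1, h2⟩
      · have h3 := h.chl_lt hE (i := s.reg .d) le_rfl
        rw [c_new, if_neg (by omega), if_pos rfl]; exact hw
      · have h3 := h.lt i hi
        rw [c_on i hi, if_neg (show s.arr .stk i 0 ≠ sm.reg .K by omega)]
        rcases Nat.eq_zero_or_pos i with rfl | hpos
        · rw [link_zero, if_pos rfl, h.first]; exact hE.u_edge
        · have h4 := h.edge (i - 1) (by omega)
          rw [Nat.sub_add_cancel hpos] at h4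
          have h5 := h.chl_lt hE (i := i - 1) (by omega)
          have h6 := link_succ (i - 1)
          rw [Nat.sub_add_cancel hpos] at h6
          rw [h6, if_neg (by omega)]; exact h4
      · have h3 := hP.chl_lt j h1
        rw [c_off j h1 h2, if_neg (by omega), if_neg (by omega)]; exact hP.edge j h1
  · intro j hj hv0
    rw [hvis] at hv0
    have h1 : sm.arr .vis j 0 = 0 := by by_contra hne; exact h.mono j hne hv0
    rw [c_off j (by omega), hE.unv j hj h1]
    rintro i hi rfl
    exact h.vis i hi hv0
  · intro j hj hV b hb
    rw [hK] at hj
    rw [hvis] at hV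
    rw [hch j hj] at hb
    have hle : height0 s0 b ≤ height s0 s' b := hE.start.height_le hS b
    rcases cases_j j hj with rfl | ⟨i, hi, rfl⟩ | ⟨h1, h2⟩
    -- The new branch has height one, which imposes no condition.
    · rw [liftVis, if_neg (by omega)]; omega
    · have h3 := h.lt i hi
      have h4 := h.lab i hi
      have h5 : s0.arr .lab (s.arr .stk i 0) 0 ≠ 0 := by
        have := h.pos
        have := h.lab _ (le_refl (s.reg .d))
        omega
      have h6 : liftVis s0 s' (s.arr .stk i 0) = s0.arr .lab (s.arr .stk i 0) 0 + 1 := by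
        rw [liftVis, if_pos h3, hvis, if_neg (h.vis i hi), lift, if_neg h5]
      rw [c_on i hi] at hb
      rw [h6]
      rcases Nat.eq_zero_or_pos i with rfl | hpos
      -- The first branch has the visited label `L` and the child `u`, which was unmatched at the
      -- start of the stage.
      · rw [link_zero, if_pos rfl] at hb
        have hu0 : s0.arr .idx1 (sm.reg .u) 0 = 0 := by
          by_contra hne
          have := hE.stage.idx1 _ hne
          rw [hE.u_free] at this; omega
        have := hE.start.free_edge hb hu0
        omega
      -- The visited label equals the old label of the previous branch, from which the child came;
      -- `Start.edge` for that branch gives the bound.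
      · have h7 := h.chl_lt hE (i := i - 1) (by omega)
        have h8 := link_succ (i - 1)
        have h9 := h.lt (i - 1) (by omega)
        have h10 := h.lab (i - 1) (by omega)
        rw [Nat.sub_add_cancel hpos] at h8
        rw [h8, if_neg (by omega), ← b4, h.stage.node1 _ h7] at hb
        have := hE.start.edge h7 hb
        rw [hE.start.perm.par_chl _ h9, lift, if_neg (by omega)] at this
        omega
    · have h3 := hP.chl_lt j h1
      rw [c_off j h1 h2, if_neg (by omega)] at hb
      have h4 := h.settled j h1 hV h2 b hb
      have h5 : liftVis s0 s' j = liftVis s0 s j := by simp only [liftVis, hvis]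
      rw [h5]
      exact h4.trans (Nat.add_le_add_right (height_mono hi2 hv b) 1)
  · intro hKK
    omega

end Path

/-! ### Failed searches, new branches and backtracking -/

section Mergers

variable {n₁ n₂ : ℕ} {G : BipGraph n₁ n₂} {lam : ℕ} {s s' s0 sm : Mem}

theorem Path.congr (h : Path G lam s0 sm s) (hS : Stage G lam s0 s')
    (hA : Agree [.K, .u, .d, .cur, .lc, .rc] [.idx1, .idx2, .node1, .node2, .vis, .stk, .chl, .par] s s') :
    Path G lam s0 sm s' := by
  have h1 := h.same
  simp only [Agree, List.mem_cons, List.not_mem_nil, or_false, forall_eq_or_imp, forall_eq] at hA h1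
  obtain ⟨⟨b1, b2, b3, b4, b5, b6⟩, a1, a2, a3, a4, a5, a6, a7, a8⟩ := hA
  obtain ⟨⟨c1, c2⟩, d1, d2, d3, d4⟩ := h1
  refine ⟨hS, ?_, ?_, ?_, ?_, ?_, ?_, ?_, ?_, ?_, ?_, ?_, ?_, ?_, ?_, ?_, ?_, ?_⟩ <;>
    simp only [Agree, List.mem_cons, List.not_mem_nil, or_false, forall_eq_or_imp, forall_eq, b1, b2, b3, b4, b5, b6,
      a1, a2, a3, a4, a5, a6, a7, a8, link, child, liftVis, height]
  exacts [⟨⟨c1, c2⟩, d1, d2, d3, d4⟩, h.lt, h.lab, h.pos, h.vis, h.fresh, h.first, h.cur, h.lc, h.rc, h.chl_off,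
    h.chl_on, h.par_off, h.par_on, h.edge, h.mono, h.settled]

theorem Path.par_rc (hE : Entry G lam s0 sm) (h : Path G lam s0 sm s) :
    s0.arr .par (s.reg .rc) 0 = s.reg .cur := by
  rw [h.rc, h.cur, hE.start.perm.par_chl _ (h.lt _ le_rfl)]

theorem Path.rc_lt (hE : Entry G lam s0 sm) (h : Path G lam s0 sm s) : s.reg .rc < s0.reg .K := by
  rw [h.rc]; exact h.chl_lt hE le_rfl

/-- By `Start.edge` a neighbour is lower by at most one. Those that were lower by exactly one have
all been visited, and a visit raises the height. -/
theorem Path.fail_weak (hE : Entry G lam s0 sm) (h : Path G lam s0 sm s)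
    (h2 : 2 ≤ s0.arr .lab (s.reg .cur) 0)
    (hf : ∀ j < s0.reg .K, s0.arr .lab j 0 + 1 = s0.arr .lab (s.reg .cur) 0 →
      G.edgeNat (s.arr .node1 (s.reg .rc) 0) (s.arr .node2 j 0) → s.arr .vis j 0 ≠ 0)
    (b : ℕ) (hb : G.edgeNat (s.arr .node1 (s.reg .rc) 0) b) :
    s0.arr .lab (s.reg .cur) 0 ≤ height s0 s b := by
  have hrc := h.rc_lt hE
  have hle := hE.start.height_le h.stage b
  have hlab := hE.start.layers.lab_le (s.reg .cur)
  have hL := hE.start.L_eq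
  have hb' := hb
  rw [h.stage.node1 _ hrc] at hb'
  have h1 := hE.start.edge hrc hb'
  rw [h.par_rc hE, lift, if_neg (by omega)] at h1
  by_contra hlt
  have h3 : s0.arr .idx2 b 0 ≠ 0 := by
    intro h0
    rw [height0, if_pos h0] at h1; omega
  have hK := hE.start.base.nodes.idx2_le b
  have hn := hE.start.base.nodes.node2_idx2 b h3
  have hh : height0 s0 b = lift s0 (s0.arr .idx2 b 0 - 1) := by rw [height0, if_neg h3]
  have h4 : s0.arr .lab (s0.arr .idx2 b 0 - 1) 0 ≠ 0 := by
    intro h0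
    rw [lift, if_pos h0] at hh; omega
  have h5 : lift s0 (s0.arr .idx2 b 0 - 1) = s0.arr .lab (s0.arr .idx2 b 0 - 1) 0 := by rw [lift, if_neg h4]
  have h6 := hf (s0.arr .idx2 b 0 - 1) (by omega) (by omega) (by rw [h.stage.node2 _ (by omega), hn]; exact hb)
  have h7 : height s0 s b = lift s0 (s0.arr .idx2 b 0 - 1) + 1 := by
    rw [height, h.stage.idx2 b h3, if_neg h3, liftVis, if_pos (by omega), if_neg h6]
  omega

theorem Start.height_pos (h0 : Start G lam s0) {b : ℕ} (hb : s.arr .idx2 b 0 ≠ 0) :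
    1 ≤ height s0 s b := by
  rw [height, if_neg hb, liftVis]
  have := h0.lift_pos (s.arr .idx2 b 0 - 1)
  split_ifs <;> omega

/-- New branches have numbers beyond all earlier ones and carry no label in this stage, so the
record of what the searches passed does not concern them. -/
theorem Stage.grow (h0 : Start G lam s0) (h : Stage G lam s0 s) (hb : Base G lam s') (hK : s.reg .K ≤ s'.reg .K)
    (H : Agree [.L, .p, .nw, .uw, .qh, .qe, .qt] [.outDeg, .outAdj, 
      .lab, .lay2, .queue, .sPtr, .sWPtr, .vis, .unvis] s s')
    (hn1 : ∀ j < s.reg .K, s'.arr .node1 j 0 = s.arr .node1 j 0)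
    (hn2 : ∀ j < s.reg .K, s'.arr .node2 j 0 = s.arr .node2 j 0)
    (hi1 : ∀ v, s.arr .idx1 v 0 ≠ 0 → s'.arr .idx1 v 0 = s.arr .idx1 v 0)
    (hi2 : ∀ b, s'.arr .idx2 b 0 = s.arr .idx2 b 0 ∨ s.reg .K < s'.arr .idx2 b 0) : Stage G lam s0 s' := by
  obtain ⟨h1, h2⟩ := H
  have ha := h.agree
  simp only [Agree, List.mem_cons, List.not_mem_nil, or_false, forall_eq_or_imp, forall_eq] at h1 h2 ha
  obtain ⟨b5, b6, b7, b8, b9, b10, b11⟩ := h1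
  obtain ⟨a1, a2, a19, a20, a21, a24, a25, a26, a27⟩ := h2
  have hle := h.K_le
  have hN1 : ∀ j < s0.reg .K, s'.arr .node1 j 0 = s.arr .node1 j 0 := fun j hj => hn1 j (by omega)
  have hN2 : ∀ j < s0.reg .K, s'.arr .node2 j 0 = s.arr .node2 j 0 := fun j hj => hn2 j (by omega)
  refine ⟨hb, by omega, ?_, ?_, ?_, ?_, ?_, ?_, ?_, ?_, ?_, ?_, ?_, ?_⟩ <;>
    try simp only [Agree, List.mem_cons, List.not_mem_nil, or_false, forall_eq_or_imp, forall_eq, b5, b6, b7, b8, b9,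
      b10, b11, a1, a2, a19, a20, a21, a24, a25, a26, a27]
  · intro j hj; rw [hN1 j hj, h.node1 j hj]
  · intro j hj; rw [hN2 j hj, h.node2 j hj]
  · intro v hv
    have := h.idx1 v hv
    rw [hi1 v (by rwa [this]), this]
  · intro b hb0
    have h3 := h.idx2 b hb0
    rcases hi2 b with h4 | h4
    · rw [h4, h3]
    · have h5 := hb.nodes.node2_idx2 b (by omega)
      have h6 := hb.nodes.idx2_node2 (s.arr .idx2 b 0 - 1) (by
        have := h.base.nodes.idx2_le b; omega)
      have h7 := h.base.nodes.idx2_le b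
      rw [hn2 _ (by omega), h.base.nodes.node2_idx2 b (by rwa [h3])] at h6
      omega
  · exact ha
  · exact h.unvis
  · intro i hi; rw [hN1 i hi]; exact h.le1 i hi
  · exact h.le2
  · exact h.mode1
  · exact h.mode2
  · intro i hi h2 e he hl
    rw [hN1 i hi] at hl ⊢
    rcases hi2 (s.arr .outAdj (s.arr .node1 i 0) e) with h4 | h4
    · rw [h4] at hl ⊢; exact h.passed1 i hi h2 e he hl
    -- The hypothesis gives the branch a label, hence a number below the old `K`, which a new branch
    -- does not have.
    · have := h.lt_of_lab h0 (j := s'.arr .idx2 (s.arr .outAdj (s.arr .node1 i 0) e) 0 - 1) (by omega)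
      omega
  · intro i hi j hj hl hE hjK
    rw [hN1 i hi, hN2 j hjK] at hE
    exact h.passed2 i hi j hj hl hE hjK

/-! ### The time for the mergers -/

/-- The progress of the searches for mergers. -/
def ptrSum (s0 s : Mem) : ℕ := ∑ i ∈ Finset.range (s0.reg .K), (s.arr .sPtr i 0 + s.arr .sWPtr i 0)

/-- The number of branches that were visited. -/
def visSum (s0 s : Mem) : ℕ := ∑ i ∈ Finset.range (s0.reg .K), if s.arr .vis i 0 = 0 then 0 else 1

theorem ptrSum_congr (h : Agree [] [.sPtr, .sWPtr] s s') : ptrSum s0 s' = ptrSum s0 s := by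
  simp only [ptrSum, h.2 .sPtr (by simp), h.2 .sWPtr (by simp)]

theorem visSum_congr (h : Agree [] [.vis] s s') : visSum s0 s' = visSum s0 s := by
  simp only [visSum, h.2 .vis (by simp)]

theorem visSum_le : visSum s0 s ≤ s0.reg .K := by
  calc visSum s0 s ≤ ∑ i ∈ Finset.range (s0.reg .K), 1 :=
        Finset.sum_le_sum fun i _ => by split_ifs <;> omega
    _ = _ := by simp

theorem visSum_visit {r : ℕ} (hr : r < s0.reg .K) (h0 : s.arr .vis r 0 = 0)
    (hv : ∀ j, s'.arr .vis j 0 = if j = r then 1 else s.arr .vis j 0) : visSum s0 s' = visSum s0 s + 1 := by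
  have := sum_update_le (n := s0.reg .K) (v := r) (f := fun i => if s.arr .vis i 0 = 0 then 0 else 1)
    (g := fun i => if s'.arr .vis i 0 = 0 then 0 else 1) hr
    (fun w hw => by simp only [hv, if_neg hw]) (by simp [h0])
  simp only [hv, if_true, h0] at this
  simpa [visSum, hv] using this

theorem WeakScan.ptrSum (h : WeakScan G lam s0 s s') (hr : s.reg .rc < s0.reg .K) :
    ptrSum s0 s + (s'.arr .sPtr (s.reg .rc) 0 + s'.arr .sWPtr (s.reg .rc) 0) =
      ptrSum s0 s' + (s.arr .sPtr (s.reg .rc) 0 + s.arr .sWPtr (s.reg .rc) 0) := by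
  have h1 := h.mono1
  have h2 := h.mono2
  have := sum_update_le (n := s0.reg .K) (v := s.reg .rc) (f := fun i => s.arr .sPtr i 0 + s.arr .sWPtr i 0)
    (g := fun i => s'.arr .sPtr i 0 + s'.arr .sWPtr i 0) hr
    (fun w hw => by simp only [h.other1 w hw, h.other2 w hw]) (by omega)
  simp only [MatchingPseudoflow.ptrSum]
  omega

theorem wp_visit (hlam : 0 < lam) (hl : s.reg .lam = lam) :
    wp lam visit s (fun t s' => s'.reg = s.reg ∧
      (∀ j, s'.arr .vis j 0 = if j = s.reg .cur then 1 else s.arr .vis j 0) ∧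
      (s.reg .uw ≠ 0 → ∀ j, bitAt lam (s'.arr .unvis 0) j = true ↔
        j ≠ s.reg .cur ∧ bitAt lam (s.arr .unvis 0) j = true) ∧ t ≤ 60) := by
  simp only [visit, wp_seq, wp_put]
  rw [wp_ifte]
  refine ⟨fun hu => ?_, fun hu => ?_⟩
  · rw [wp_clearBit (by simp [hl]) hlam]
    simp
    intro _ j
    rw [bitAt_clearB]
    simp
  · have : s.reg .uw = 0 := by simpa using hu
    simp [wp_skip, this]

/-- `hf` is what a failed search yields: no neighbour of the right child lies below the label of the
branch, so that this label may be raised by one. -/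
theorem wp_backtrack (hE : Entry G lam s0 sm) (h : Path G lam s0 sm s)
    (hf : ∀ b, G.edgeNat (s.arr .node1 (s.reg .rc) 0) b → s0.arr .lab (s.reg .cur) 0 ≤ height s0 s b) :
    wp lam backtrack s (fun t s' => (s.reg .d = 0 → s'.reg .busy = 0 ∧ s'.reg .d = s.reg .d ∧ Between G lam s0 s') ∧
      (s.reg .d ≠ 0 → s'.reg .busy = s.reg .busy ∧ s'.reg .d + 1 = s.reg .d ∧ Path G lam s0 sm s') ∧
      t ≤ 60) := by
  have key : wp lam backtrack s (fun t s' => (s.reg .d = 0 → s'.reg .busy = 0 ∧ s'.reg .d = s.reg .d ∧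
      Agree [.K] [.idx1, .idx2, .node1, .node2, .vis, .chl, .par] s s') ∧
      (s.reg .d ≠ 0 → s'.reg .busy = s.reg .busy ∧ s'.reg .d = s.reg .d - 1 ∧
        s'.reg .cur = s.arr .stk (s.reg .d - 1) 0 ∧ s'.reg .rc = s.reg .lc ∧
        (∀ i, s'.arr .par i 0 = if i = s.reg .lc then s.arr .stk (s.reg .d - 1) 0 else s.arr .par i 0) ∧
        s'.reg .lc = s.arr .chl (s.arr .stk (s.reg .d - 1) 0) 0 ∧
        ∀ j, s'.arr .chl j 0 = if j = s.arr .stk (s.reg .d - 1) 0 then s.reg .lc else s.arr .chl j 0) ∧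
      t ≤ 60) := by
    rw [backtrack, wp_ifte]
    refine ⟨fun hd => ?_, fun hd => ?_⟩
    · rw [Expr.eval_eq_ne_zero] at hd
      have : s.reg .d = 0 := hd
      simp [wp_assign, this, Agree]
    · have : s.reg .d ≠ 0 := fun h0 =>
        Expr.eval_eq_ne_zero.2 (show Expr.eval lam s (.reg .d) = Expr.eval lam s 0 from h0) hd
      simp [wp_seq, wp_assign, wp_put, this]
  refine wp_call key fun t s' F ⟨h1, h2, h3⟩ => ⟨fun hd => ?_, fun hd => ?_, h3⟩
  · obtain ⟨h4, h6, h5⟩ := h1 hd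
    exact ⟨h4, h6, h.fail hE (h.stage.congr F.agree) hf hd h5⟩
  · obtain ⟨h4, h5, h6, h7, h8, h9, h10⟩ := h2 hd
    exact ⟨h4, by omega, h.pop hE (h.stage.congr F.agree) hf hd F.agree h5 h6 h7 h8 h9 h10⟩

end Mergers

/-! ### Mergers at label one: augmentation or failure -/

section Mergers

variable {n₁ n₂ : ℕ} {G : BipGraph n₁ n₂} {lam : ℕ} {s s' s0 sm : Mem}

theorem wp_seq_assoc {a b c : Cmd} {Q : ℕ → Mem → Prop} :
    wp lam (a.seq (b.seq c)) s Q ↔ wp lam ((a.seq b).seq c) s Q := by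
  simp only [wp_seq, add_assoc]

/-- The result of a sequence of mergers. -/
structure Merged (G : BipGraph n₁ n₂) (lam : ℕ) (s0 sm s : Mem) : Prop where
  between : Between G lam s0 s
  vis : s.arr .vis (sm.reg .cur) 0 ≠ 0
  mono : ∀ j, sm.arr .vis j 0 ≠ 0 → s.arr .vis j 0 ≠ 0
  idx1 : ∀ v, sm.arr .idx1 v 0 ≠ 0 → s.arr .idx1 v 0 ≠ 0

theorem Path.merged (h : Path G lam s0 sm s) (hB : Between G lam s0 s') (hv : s'.arr .vis = s.arr .vis)
    (hi : ∀ v, s.arr .idx1 v 0 ≠ 0 → s'.arr .idx1 v 0 ≠ 0) : Merged G lam s0 sm s' := by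
  refine ⟨hB, ?_, fun j hj => hv ▸ h.mono j hj, fun v hj => hi v (by rwa [h.same.2 .idx1 (by simp)])⟩
  rw [hv, ← h.first]; exact h.vis 0 (by omega)

/-- The time that is available for the mergers. -/
def credit (n₁ n₂ : ℕ) (s0 s : Mem) : ℕ := pot n₁ n₂ s + 100 * ptrSum s0 s + 2000 * visSum s0 s

/-- The last step of a sequence of mergers that reaches label one. -/
theorem wp_lastMerger (hlam : 0 < lam) (hE : Entry G lam s0 sm) (hu : sm.reg .u < n₁)
    (h : Path G lam s0 sm s) (hl1 : s0.arr .lab (s.reg .cur) 0 = 1) :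
    wp lam ((Cmd.assign .fv (Arr.node1.el (.reg .rc))).seq (findFree.seq
      (Cmd.ifte (.reg .res)
        ((Cmd.put .chl (.reg .cur) 0 (.reg .lc)).seq ((Cmd.put .par (.reg .rc) 0 (.reg .K)).seq
          ((Cmd.put .chl (.reg .K) 0 (.reg .rc)).seq ((Cmd.assign .nv (.reg .u)).seq
            ((Cmd.assign .nb (.reg .res - 1)).seq (addNodes.seq (Cmd.assign .busy 0))))))) backtrack))) s
      (fun t s' => ((s'.reg .busy = 0 ∧ s'.reg .d = s.reg .d ∧ visSum s0 s' = visSum s0 s ∧ Merged G lam s0 sm s') ∨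
        (s'.reg .busy = s.reg .busy ∧ s'.reg .d + 1 = s.reg .d ∧ Path G lam s0 sm s' ∧ visSum s0 s' = visSum s0 s)) ∧
        t + credit n₁ n₂ s0 s ≤ credit n₁ n₂ s0 s' + 600) := by
  have hrc := h.rc_lt hE
  have hrcK : s.reg .rc < s.reg .K := lt_of_lt_of_le hrc h.stage.K_le
  have hB := h.stage.base
  have key : wp lam ((Cmd.assign .fv (Arr.node1.el (.reg .rc))).seq findFree) s (fun t s' =>
      Base G lam s' ∧
      (s'.reg .res = 0 → ∀ b, G.edgeNat (s.arr .node1 (s.reg .rc) 0) b → s.arr .idx2 b 0 ≠ 0) ∧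
      (s'.reg .res ≠ 0 → G.edgeNat (s.arr .node1 (s.reg .rc) 0) (s'.reg .res - 1) ∧
        s.arr .idx2 (s'.reg .res - 1) 0 = 0) ∧
      t + pot n₁ n₂ s ≤ pot n₁ n₂ s' + 130) := by
    rw [wp_seq, wp_assign]
    refine wp_call (wp_findFree (G := G) hlam (hB.congr (by simp [Agree])) ?_ (Or.inl ?_)) ?_
    · simpa using hB.nodes.node1_lt _ hrcK
    · simp [hB.nodes.idx1_node1 _ hrcK]
    · rintro t s' F ⟨h1, h2, h3, -, -, h4⟩
      simp at h2 h3 h4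
      exact ⟨h1, h2, h3, by simp; omega⟩
  rw [wp_seq_assoc]
  refine wp_call_seq key ?_
  rintro t s1 F ⟨hB1, hf, hs, ht⟩
  have hS1 : Stage G lam s0 s1 := h.stage.congr_base hB1 F.agree
  have hP1 : Path G lam s0 sm s1 := h.congr hS1 F.agree
  have hv1 : visSum s0 s1 = visSum s0 s := visSum_congr F.agree
  have hp1 : ptrSum s0 s1 = ptrSum s0 s := ptrSum_congr F.agree
  have hcr : t + credit n₁ n₂ s0 s ≤ credit n₁ n₂ s0 s1 + 130 := by simp only [credit]; omega
  have hbusy : s1.reg .busy = s.reg .busy := F.r .busy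
  have hd : s1.reg .d = s.reg .d := F.r .d
  rw [← F.a .node1, ← F.a .idx2, ← F.r .rc] at hf hs
  rw [← F.r .cur] at hl1
  rw [← hbusy, ← hd, ← hv1]
  clear F ht key hp1 hbusy hd hv1 hrc hrcK hB h
  rw [wp_ifte]
  refine ⟨fun hr => ?_, fun hr => ?_⟩
  · simp only [Expr.eval] at hr
    obtain ⟨hE1, hb0⟩ := hs hr
    obtain ⟨-, hwlt, -⟩ := hE1
    have hfv : s1.arr .idx1 (s1.reg .u) 0 = 0 := by
      rw [hP1.same.2 .idx1 (by simp), hP1.same.1 .u (by simp)]; exact hE.u_free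
    simp only [↓wp_seq, ↓wp_put, ↓wp_assign]
    generalize hS : Mem.setReg _ .nb _ = S2
    have e1 : S2.reg .nv = s1.reg .u := by rw [← hS]; simp
    have e2 : S2.reg .nb = s1.reg .res - 1 := by rw [← hS]; simp
    have e3 : S2.reg .K = s1.reg .K := by rw [← hS]; simp
    have e4 : S2.arr .idx1 = s1.arr .idx1 := by rw [← hS]; simp
    have e5 : S2.arr .idx2 = s1.arr .idx2 := by rw [← hS]; simp
    have e6 : S2.arr .node1 = s1.arr .node1 := by rw [← hS]; simp
    have e7 : S2.arr .node2 = s1.arr .node2 := by rw [← hS]; simp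
    have e8 : ∀ j, S2.arr .chl j 0 = if j = s1.reg .K then s1.reg .rc else
      if j = s1.reg .cur then s1.reg .lc else s1.arr .chl j 0 := by rw [← hS]; simp
    have e9 : ∀ i, S2.arr .par i 0 = if i = s1.reg .rc then s1.reg .K else s1.arr .par i 0 := by
      rw [← hS]; simp
    have e10 : Base G lam S2 := hB1.congr (by rw [← hS]; simp [Agree])
    have e11 : Agree [.L, .p, .nw, .uw, .qh, .qe, .qt] [.outDeg, .outAdj, .lab, .lay2, .queue, .sPtr, .sWPtr, .vis,
      .unvis] s1 S2 := by rw [← hS]; simp [Agree]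
    have e13 : S2.reg .d = s1.reg .d := by rw [← hS]; simp
    have e12 : credit n₁ n₂ s0 S2 = credit n₁ n₂ s0 s1 := by
      rw [← hS]; simp [credit, ptrSum, visSum]
    clear hS
    refine wp_call (wp_addNodes (G := G) hlam e10 ?_ ?_ ?_ ?_) ?_
    · rw [e1, hP1.same.1 .u (by simp)]; exact hu
    · rw [e2]; exact hwlt
    · rw [e1, e4]; exact hfv
    · rw [e2, e5]; exact hb0
    rintro t3 s3 F3 ⟨hB3, hK3, hn1, hn2, hi1, hi2, ht3⟩
    have hA3 : Agree [.L, .p, .nw, .uw, .qh, .qe, .qt] [.outDeg, .outAdj, .lab, .lay2, .queue, .sPtr, .sWPtr, .vis,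
        .unvis] s1 s3 := by
      have h1 : Agree [.L, .p, .nw, .uw, .qh, .qe, .qt] [.outDeg, .outAdj, .lab, .lay2, .queue, .sPtr, .sWPtr, .vis,
        .unvis] S2 s3 := F3.agree
      exact ⟨fun r hr => (h1.1 r hr).trans (e11.1 r hr), fun a ha => (h1.2 a ha).trans (e11.2 a ha)⟩
    have hcr3 : t3 + credit n₁ n₂ s0 S2 ≤ credit n₁ n₂ s0 s3 + 200 := by
      have h1 : ptrSum s0 s3 = ptrSum s0 S2 := ptrSum_congr F3.agree
      have h2 : visSum s0 s3 = visSum s0 S2 := visSum_congr F3.agree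
      simp only [credit]; omega
    have hd3 : s3.reg .d = s1.reg .d := (F3.r .d).trans e13
    have hc3 : s3.arr .chl = S2.arr .chl := F3.a .chl
    have hp3 : s3.arr .par = S2.arr .par := F3.a .par
    rw [e3] at hK3
    rw [e1, e3, e6] at hn1
    rw [e2, e3, e7] at hn2
    rw [e1, e3, e4] at hi1
    rw [e2, e3, e5] at hi2
    clear F3 e11
    have hS3 : Stage G lam s0 s3 := hS1.grow hE.start hB3 (by omega) hA3
      (fun j hj => by rw [hn1, if_neg hj.ne]) (fun j hj => by rw [hn2, if_neg hj.ne])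
      (fun v hv => by rw [hi1, if_neg]; rintro rfl; exact hv hfv)
      (fun b => by rw [hi2]; split_ifs <;> omega)
    have hBt : Between G lam s0 s3 := by
      refine hP1.win hE hS3 (w := s1.reg .res - 1) hl1 (hs hr).1 hK3 ?_ hn2 ?_ (hA3.2 _ (by simp)) ?_ ?_
      · rw [← hP1.same.1 .u (by simp)]; exact hn1
      · intro b hb; rw [hi2, if_neg]; rintro rfl; exact hb hb0
      · rw [hc3]; exact e8
      · rw [hp3]; exact e9
    have hM : Merged G lam s0 sm s3 := hP1.merged hBt (hA3.2 _ (by simp))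
      (fun v hv => by rw [hi1]; split_ifs <;> omega)
    have hv3 : visSum s0 s3 = visSum s0 s1 := visSum_congr hA3.mono
    refine ⟨Or.inl ⟨by simp, by simp [hd3], (visSum_congr (by simp [Agree])).trans hv3, ⟨hM.between.congr_base (hB3.congr (by simp [Agree])) (by simp [Agree]), hM.vis,
      hM.mono, hM.idx1⟩⟩, ?_⟩
    have : credit n₁ n₂ s0 (s3.setReg .busy (Expr.eval lam s3 0)) = credit n₁ n₂ s0 s3 := by
      simp only [credit]
      rw [ptrSum_congr (s := s3) (by simp [Agree]), visSum_congr (s := s3) (by simp [Agree])]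
      simp
    rw [this]
    simp
    omega
  · simp only [Expr.eval] at hr
    refine wp_call (wp_backtrack hE hP1 ?_) ?_
    · intro b hb
      -- No unmatched neighbour was found, so all neighbours have height at least one, which is the
      -- label of the branch.
      rw [hl1]
      exact hE.start.height_pos (hf hr b hb)
    · rintro t2 s2 F2 ⟨h1, h2, h3⟩
      have hcr2 : credit n₁ n₂ s0 s2 = credit n₁ n₂ s0 s1 := by
        have h1 : ptrSum s0 s2 = ptrSum s0 s1 := ptrSum_congr F2.agree
        have h2 : visSum s0 s2 = visSum s0 s1 := visSum_congr F2.agree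
        have h3 : pot n₁ n₂ s2 = pot n₁ n₂ s1 := pot_congr F2.agree
        simp only [credit]; omega
      refine ⟨?_, by rw [hcr2]; simp; omega⟩
      by_cases hd0 : s1.reg .d = 0
      · obtain ⟨h4, h6, h5⟩ := h1 hd0
        exact Or.inl ⟨h4, h6, visSum_congr F2.agree, hP1.merged h5 (F2.a .vis) (fun v hv => by rwa [F2.a .idx1])⟩
      · obtain ⟨h4, h5, h6⟩ := h2 hd0
        exact Or.inr ⟨h4, h5, h6, visSum_congr F2.agree⟩

end Mergers

/-! ### Mergers at higher labels, and complete sequences -/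

section Mergers

variable {n₁ n₂ : ℕ} {G : BipGraph n₁ n₂} {lam : ℕ} {s s' s0 sm : Mem}

/-- A step of a sequence of mergers at a label that is at least two. -/
theorem wp_nextMerger (hlam : 0 < lam) (hE : Entry G lam s0 sm)
    (h : Path G lam s0 sm s) (hpl : s.reg .pl = s0.arr .lab (s.reg .cur) 0) (hl2 : 2 ≤ s.reg .pl) :
    wp lam (findWeak.seq (Cmd.ifte (.reg .res)
        ((Cmd.put .chl (.reg .cur) 0 (.reg .lc)).seq ((Cmd.assign .lc (.reg .rc)).seq
          ((Cmd.assign .cur (.reg .res - 1)).seq ((Cmd.put .par (.reg .lc) 0 (.reg .cur)).seq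
            ((Cmd.assign .rc (Arr.chl.el (.reg .cur))).seq ((incr .d).seq
              ((Cmd.put .stk (.reg .d) 0 (.reg .cur)).seq visit))))))) backtrack)) s
      (fun t s' => ((s'.reg .busy = 0 ∧ s'.reg .d = s.reg .d ∧ visSum s0 s' = visSum s0 s ∧ Merged G lam s0 sm s') ∨
        (s'.reg .busy = s.reg .busy ∧ s'.reg .d + 1 = s.reg .d ∧ Path G lam s0 sm s' ∧ visSum s0 s' = visSum s0 s) ∨
        (s'.reg .busy = s.reg .busy ∧ s'.reg .d = s.reg .d + 1 ∧ Path G lam s0 sm s' ∧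
          visSum s0 s' = visSum s0 s + 1)) ∧
        t + credit n₁ n₂ s0 s + 2000 * visSum s0 s' ≤ credit n₁ n₂ s0 s' + 2000 * visSum s0 s + 600) := by
  have hrc := h.rc_lt hE
  have hplr : s.reg .pl = s.arr .lab (s0.arr .par (s.reg .rc) 0) 0 := by
    rw [h.par_rc hE, h.stage.lab, hpl]
  refine wp_call_seq (wp_findWeak hlam hE.start h.stage hrc hplr hl2) ?_
  rintro t s1 F ⟨hw, ht⟩
  have hpt := hw.ptrSum hrc
  have hv1 : visSum s0 s1 = visSum s0 s := visSum_congr F.agree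
  have hp1 : pot n₁ n₂ s1 = pot n₁ n₂ s := pot_congr F.agree
  have hcr : t + credit n₁ n₂ s0 s ≤ credit n₁ n₂ s0 s1 + 100 := by simp only [credit]; omega
  have hlam1 : s1.reg .lam = lam := (F.r .lam).trans h.stage.base.static.word
  have hun1 : s1.reg .uw ≠ 0 → ∀ j, bitAt lam (s1.arr .unvis 0) j = true ↔ j < s0.reg .K ∧ s.arr .vis j 0 = 0 := by
    rw [F.r .uw, F.a .unvis]; exact h.stage.unvis
  rw [wp_ifte]
  refine ⟨fun hr => ?_, fun hr => ?_⟩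
  · simp only [Expr.eval] at hr
    obtain ⟨hw1, hw2, hw3, hw4⟩ := hw.succ hr
    simp only [↓wp_seq, ↓wp_put, ↓wp_assign, incr]
    -- The entry of `chl` at the old root has been overwritten before the right child of the new
    -- root is read; the labels show that the two roots differ.
    have hne : s1.reg .res - 1 ≠ s1.reg .cur := by
      intro he
      rw [h.stage.lab, hpl, ← F.r .cur, he] at hw2
      omega
    generalize hS : Mem.setCell _ .stk _ _ _ = S
    have e1 : S.reg .cur = s1.reg .res - 1 := by rw [← hS]; simp
    have e2 : S.reg .lc = s1.reg .rc := by rw [← hS]; simp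
    have e3 : S.reg .rc = s1.arr .chl (s1.reg .res - 1) 0 := by rw [← hS]; simp [hne]
    have e4 : S.reg .d = s1.reg .d + 1 := by rw [← hS]; simp
    have e5 : ∀ i, S.arr .stk i 0 = if i = s1.reg .d + 1 then s1.reg .res - 1 else s1.arr .stk i 0 := by
      rw [← hS]; simp
    have e6 : ∀ j, S.arr .chl j 0 = if j = s1.reg .cur then s1.reg .lc else s1.arr .chl j 0 := by
      rw [← hS]; simp
    have e7 : ∀ i, S.arr .par i 0 = if i = s1.reg .rc then s1.reg .res - 1 else s1.arr .par i 0 := by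
      rw [← hS]; simp
    have e8 : Agree [.n1, .n2, .lam, .K, .L, .p, .nw, .uw, .qh, .qe, .qt, .u, .busy] [.outDeg, .outAdj, .inDeg, .inAdj,
      .outW, .inW, .node1, .node2, .idx1, .idx2, .used1, .used2, .subOut, .subIn, .outPtr, .outWPtr, .inPtr, .inWPtr,
      .lab, .lay2, .queue, .unvis, .vis, .sPtr, .sWPtr] s1 S := by rw [← hS]; simp [Agree]
    clear hS
    refine wp_call (wp_visit hlam ((e8.1 .lam (by simp)).trans hlam1)) ?_
    rintro t2 s2 F2 ⟨v1, v2, v3, ht2⟩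
    have hpt2 : ptrSum s0 s2 = ptrSum s0 s1 := (ptrSum_congr F2.agree).trans (ptrSum_congr e8.mono)
    have hp2 : pot n₁ n₂ s2 = pot n₁ n₂ s1 := (pot_congr F2.agree).trans (pot_congr e8.mono)
    have hA : Agree [.n1, .n2, .lam, .K, .L, .p, .nw, .uw, .qh, .qe, .qt, .u, .busy] [.outDeg, .outAdj, .inDeg, .inAdj,
      .outW, .inW, .node1, .node2, .idx1, .idx2, .used1, .used2, .subOut, .subIn, .outPtr, .outWPtr, .inPtr, .inWPtr,
      .lab, .lay2, .queue] s s2 := by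
      have f1 : Agree [.n1, .n2, .lam, .K, .L, .p, .nw, .uw, .qh, .qe, .qt, .u, .busy] [.outDeg, .outAdj, .inDeg, .inAdj,
        .outW, .inW, .node1, .node2, .idx1, .idx2, .used1, .used2, .subOut, .subIn, .outPtr, .outWPtr, .inPtr, .inWPtr,
        .lab, .lay2, .queue] s s1 := F.agree
      have f2 : Agree [.n1, .n2, .lam, .K, .L, .p, .nw, .uw, .qh, .qe, .qt, .u, .busy] [.outDeg, .outAdj, .inDeg, .inAdj,
        .outW, .inW, .node1, .node2, .idx1, .idx2, .used1, .used2, .subOut, .subIn, .outPtr, .outWPtr, .inPtr, .inWPtr,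
        .lab, .lay2, .queue] S s2 := F2.agree
      have f3 := e8.mono (R' := [.n1, .n2, .lam, .K, .L, .p, .nw, .uw, .qh, .qe, .qt, .u, .busy])
        (A' := [.outDeg, .outAdj, .inDeg, .inAdj,
        .outW, .inW, .node1, .node2, .idx1, .idx2, .used1, .used2, .subOut, .subIn, .outPtr, .outWPtr, .inPtr, .inWPtr,
        .lab, .lay2, .queue])
      exact ⟨fun r hr => (f2.1 r hr).trans ((f3.1 r hr).trans (f1.1 r hr)),
        fun r hr => (f2.2 r hr).trans ((f3.2 r hr).trans (f1.2 r hr))⟩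
    have hA' : Agree [] [.sPtr, .sWPtr] s1 s2 := by
      have f2 : Agree [] [.sPtr, .sWPtr] S s2 := F2.agree
      have f3 := e8.mono (R' := []) (A' := [.sPtr, .sWPtr])
      exact ⟨fun r hr => (f2.1 r hr).trans (f3.1 r hr), fun r hr => (f2.2 r hr).trans (f3.2 r hr)⟩
    have eb : s2.reg .busy = s.reg .busy := hA.1 _ (by simp)
    have fv : ∀ j, s2.arr .vis j 0 = if j = s1.reg .res - 1 then 1 else s.arr .vis j 0 := by
      intro j; rw [v2, e1, e8.2 .vis (by simp), F.a .vis]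
    have hSt : Stage G lam s0 s2 := by
      refine h.stage.scan hplr hw hA.mono hA' ?_ ?_ ?_
      · intro j hj; rw [fv]; split_ifs
        · simp
        · exact hj
      · intro _; rw [fv]; simp
      · intro hu j
        rw [v1] at hu
        rw [v3 hu j, e1, e8.2 .unvis (by simp), hun1 (by rwa [← e8.1 .uw (by simp)]), fv]
        split_ifs with hj <;> simp [hj]
    have hP2 : Path G lam s0 sm s2 := by
      rw [h.stage.lab] at hw2
      refine h.push hE hSt (r := s1.reg .res - 1) hw1 ?_ (by omega) hw3 hw4 hA.mono ?_ ?_ ?_ ?_ ?_ ?_ ?_ fv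
      · rw [hw2, hpl]
      · rw [v1, e4, F.r .d]
      · intro i; rw [F2.a .stk, e5, F.r .d, F.a .stk]
      · rw [v1, e1]
      · rw [v1, e2, F.r .rc]
      · intro j; rw [F2.a .chl, e6, F.r .cur, F.r .lc, F.a .chl]
      · intro i; rw [F2.a .par, e7, F.r .rc, F.a .par]
      · rw [v1, e3, F.a .chl]
    have hv2 : visSum s0 s2 = visSum s0 s + 1 := visSum_visit hw1 hw4 fv
    have hd2 : s2.reg .d = s.reg .d + 1 := by rw [v1, e4, F.r .d]
    refine ⟨Or.inr (Or.inr ⟨eb, hd2, hP2, hv2⟩), ?_⟩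
    simp only [credit] at hcr ⊢
    simp
    omega
  · simp only [Expr.eval] at hr
    have hSt : Stage G lam s0 s1 := by
      refine h.stage.scan hplr hw F.agree (by simp [Agree]) ?_ (fun h => absurd hr h) ?_
      · rw [F.a .vis]; exact fun _ => id
      · rw [F.a .vis]; exact hun1
    have hP1 : Path G lam s0 sm s1 := h.congr hSt F.agree
    have hfail := h.fail_weak hE (by omega) (by
      have := hw.fail hr
      rwa [h.stage.lab, hpl] at this)
    refine wp_call (wp_backtrack hE hP1 ?_) ?_
    · intro b hb
      rw [F.a .node1, F.r .rc] at hb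
      rw [F.r .cur]
      have h1 := hfail b hb
      have h2 : height s0 s1 b = height s0 s b := by simp only [height, liftVis, F.a .vis, F.a .idx2]
      rwa [h2]
    · rintro t2 s2 F2 ⟨h1, h2, h3⟩
      have hv2 : visSum s0 s2 = visSum s0 s := (visSum_congr F2.agree).trans hv1
      have hcr2 : credit n₁ n₂ s0 s2 = credit n₁ n₂ s0 s1 := by
        have h1 : ptrSum s0 s2 = ptrSum s0 s1 := ptrSum_congr F2.agree
        have h2 : visSum s0 s2 = visSum s0 s1 := visSum_congr F2.agree
        have h3 : pot n₁ n₂ s2 = pot n₁ n₂ s1 := pot_congr F2.agree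
        simp only [credit]; omega
      refine ⟨?_, by rw [hcr2, hv2]; simp; omega⟩
      rw [← F.r .d, ← F.r .busy]
      by_cases hd0 : s1.reg .d = 0
      · obtain ⟨h4, h6, h5⟩ := h1 hd0
        exact Or.inl ⟨h4, h6, hv2, hP1.merged h5 (F2.a .vis) (fun v hv => by rwa [F2.a .idx1])⟩
      · obtain ⟨h4, h5, h6⟩ := h2 hd0
        exact Or.inr (Or.inl ⟨h4, h5, h6, hv2⟩)

-- Every push marks a new branch and every pop undoes a push, so the number of steps is linear in
-- the number of visits, apart from the pointer moves.
set_option maxHeartbeats 1000000 in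
theorem wp_mergers (hlam : 0 < lam) (hE : Entry G lam s0 sm) (hu : sm.reg .u < n₁) :
    wp lam mergers sm (fun t s' => Merged G lam s0 sm s' ∧
      t + credit n₁ n₂ s0 sm ≤ credit n₁ n₂ s0 s' + 1000) := by
  simp only [mergers, ↓wp_seq, ↓wp_put, ↓wp_assign]
  generalize hS : Mem.setReg _ .rc _ = S
  have e1 : S.reg .cur = sm.reg .cur := by rw [← hS]; simp
  have e2 : S.reg .lc = sm.reg .K := by rw [← hS]; simp
  have e3 : S.reg .rc = sm.arr .chl (sm.reg .cur) 0 := by rw [← hS]; simp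
  have e4 : S.reg .d = 0 := by rw [← hS]; simp
  have e5 : S.arr .stk 0 0 = sm.reg .cur := by rw [← hS]; simp
  have e6 : ∀ i, S.arr .par i 0 = if i = sm.reg .K then sm.reg .cur else sm.arr .par i 0 := by rw [← hS]; simp
  have e8 : Agree [.n1, .n2, .lam, .K, .L, .p, .nw, .uw, .qh, .qe, .qt, .u] [.outDeg, .outAdj, .inDeg, .inAdj,
      .outW, .inW, .node1, .node2, .idx1, .idx2, .used1, .used2, .subOut, .subIn, .outPtr, .outWPtr, .inPtr, .inWPtr,
      .lab, .lay2, .queue, .unvis, .vis, .sPtr, .sWPtr, .chl] sm S := by rw [← hS]; simp [Agree]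
  clear hS
  refine wp_call (wp_visit hlam ((e8.1 .lam (by simp)).trans hE.stage.base.static.word)) ?_
  rintro t2 s2 F2 ⟨v1, v2, v3, ht2⟩
  have hA : Agree [.n1, .n2, .lam, .K, .L, .p, .nw, .uw, .qh, .qe, .qt, .u] [.outDeg, .outAdj, .inDeg, .inAdj,
      .outW, .inW, .node1, .node2, .idx1, .idx2, .used1, .used2, .subOut, .subIn, .outPtr, .outWPtr, .inPtr, .inWPtr,
      .lab, .lay2, .queue, .sPtr, .sWPtr, .chl] sm s2 := by
    have f2 : Agree [.n1, .n2, .lam, .K, .L, .p, .nw, .uw, .qh, .qe, .qt, .u] [.outDeg, .outAdj, .inDeg, .inAdj,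
      .outW, .inW, .node1, .node2, .idx1, .idx2, .used1, .used2, .subOut, .subIn, .outPtr, .outWPtr, .inPtr, .inWPtr,
      .lab, .lay2, .queue, .sPtr, .sWPtr, .chl] S s2 := F2.agree
    have f3 := e8.mono (R' := [.n1, .n2, .lam, .K, .L, .p, .nw, .uw, .qh, .qe, .qt, .u])
        (A' := [.outDeg, .outAdj, .inDeg, .inAdj,
        .outW, .inW, .node1, .node2, .idx1, .idx2, .used1, .used2, .subOut, .subIn, .outPtr, .outWPtr, .inPtr, .inWPtr,
        .lab, .lay2, .queue, .sPtr, .sWPtr, .chl])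
    exact ⟨fun r hr => (f2.1 r hr).trans (f3.1 r hr), fun r hr => (f2.2 r hr).trans (f3.2 r hr)⟩
  have fv : ∀ j, s2.arr .vis j 0 = if j = sm.reg .cur then 1 else sm.arr .vis j 0 := by
    intro j; rw [v2, e1, e8.2 .vis (by simp)]
  have hSt : Stage G lam s0 s2 := by
    refine hE.stage.rebase (hE.stage.base.congr hA.mono) hA.mono ?_ ?_
    · intro j hj; rw [fv]; split_ifs
      · simp
      · exact hj
    · intro hu j
      rw [v1] at hu
      rw [v3 hu j, e1, e8.2 .unvis (by simp), hE.stage.unvis (by rwa [← e8.1 .uw (by simp)]), fv]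
      split_ifs with hj <;> simp [hj]
  have hP2 : Path G lam s0 sm s2 :=
    hE.path hSt hA.mono (by rw [v1, e4]) (by rw [F2.a .stk, e5]) (by rw [v1, e1]) (by rw [v1, e2])
      (by rw [F2.a .par]; exact e6) (by rw [v1, e3]) fv
  have hv2 : visSum s0 s2 = visSum s0 sm + 1 := visSum_visit hE.cur_lt hE.cur_vis fv
  have hcr2 : credit n₁ n₂ s0 s2 = credit n₁ n₂ s0 sm + 2000 := by
    have h1 : ptrSum s0 s2 = ptrSum s0 sm := ptrSum_congr hA.mono
    have h3 : pot n₁ n₂ s2 = pot n₁ n₂ sm := pot_congr hA.mono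
    simp only [credit]; omega
  have hd2 : s2.reg .d = 0 := by rw [v1, e4]
  clear F2 v1 v2 v3 hA e1 e2 e3 e4 e5 e6 e8 hSt
  -- Each stack level holds 800 in reserve for its pop. A push earns 2000 through the visit, uses at
  -- most 600 besides the overhead of the loop, and sets this reserve aside.
  refine wp_while (fun t s' => ((s'.reg .busy = 0 ∧ Merged G lam s0 sm s' ∧
        t + credit n₁ n₂ s0 s2 ≤ credit n₁ n₂ s0 s' + 800) ∨
      (s'.reg .busy = 1 ∧ Path G lam s0 sm s' ∧
        t + credit n₁ n₂ s0 s2 + 800 * s'.reg .d ≤ credit n₁ n₂ s0 s')))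
    -- A push lowers the first term by two and raises the depth by one, a pop lowers the depth, and
    -- the end clears `busy`.
    (fun s' => 2 * (s0.reg .K - visSum s0 s') + s'.reg .d + s'.reg .busy) ?_ ?_ ?_
  · right
    refine ⟨by simp, hP2.congr (hP2.stage.congr (by simp [Agree])) (by simp [Agree]), ?_⟩
    have : credit n₁ n₂ s0 (s2.setReg .busy (Expr.eval lam s2 1)) = credit n₁ n₂ s0 s2 := by
      simp only [credit]
      rw [ptrSum_congr (s := s2) (by simp [Agree]), visSum_congr (s := s2) (by simp [Agree])]
      simp
    rw [this]; simp [hd2]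
  · rintro t s3 F h3 he
    obtain ⟨hb3, hP3, ht3⟩ := h3.resolve_left (fun h => he h.1)
    clear h3 F
    rw [wp_seq, wp_assign]
    have hL := hP3.stage.L
    have hld := hP3.lab _ le_rfl
    have hps := hP3.pos
    generalize hS : Mem.setReg _ .pl _ = S
    have g1 : S.reg .pl = s0.arr .lab (s3.reg .cur) 0 := by
      rw [← hS]; simp [hL]; rw [hP3.cur]; omega
    have g2 : S.reg .cur = s3.reg .cur := by rw [← hS]; simp
    have g3 : S.reg .d = s3.reg .d := by rw [← hS]; simp
    have g4 : S.reg .busy = 1 := by rw [← hS]; simp [hb3]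
    have gP : Path G lam s0 sm S :=
      hP3.congr (hP3.stage.congr (by rw [← hS]; simp [Agree])) (by rw [← hS]; simp [Agree])
    have gv : visSum s0 S = visSum s0 s3 := visSum_congr (by rw [← hS]; simp [Agree])
    have gc : credit n₁ n₂ s0 S = credit n₁ n₂ s0 s3 := by
      have h1 : ptrSum s0 S = ptrSum s0 s3 := ptrSum_congr (by rw [← hS]; simp [Agree])
      have h3 : pot n₁ n₂ S = pot n₁ n₂ s3 := pot_congr (by rw [← hS]; simp [Agree])
      simp only [credit]; omega
    clear hS
    have hvle : ∀ s : Mem, visSum s0 s ≤ s0.reg .K := fun s => visSum_le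
    rw [wp_ifte]
    refine ⟨fun hp1 => ?_, fun hp1 => ?_⟩
    · rw [Expr.eval_eq_ne_zero] at hp1
      have hp1' : S.reg .pl = 1 := hp1
      refine wp_call (wp_lastMerger hlam hE hu gP (by rw [g2, ← g1, hp1'])) ?_
      rintro t4 s4 - ⟨hor, ht4⟩
      rcases hor with ⟨h5, h7, h8, h6⟩ | ⟨h5, h6, h7, h8⟩
      · have := hvle s4
        exact ⟨Or.inl ⟨h5, h6, by simp; omega⟩, by omega⟩
      · refine ⟨Or.inr ⟨by omega, h7, by simp; omega⟩, by omega⟩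
    · have hp1' : S.reg .pl ≠ 1 := fun h0 =>
        Expr.eval_eq_ne_zero.2 (show Expr.eval lam S (.reg .pl) = Expr.eval lam S 1 from h0) hp1
      rw [hP3.cur] at g1
      refine wp_call (wp_nextMerger hlam hE gP (by rw [g1, g2, hP3.cur]) (by omega)) ?_
      rintro t4 s4 - ⟨hor, ht4⟩
      rcases hor with ⟨h5, h7, h8, h6⟩ | ⟨h5, h6, h7, h8⟩ | ⟨h5, h6, h7, h8⟩
      · have := hvle s4
        exact ⟨Or.inl ⟨h5, h6, by simp; omega⟩, by omega⟩
      · refine ⟨Or.inr ⟨by omega, h7, by simp; omega⟩, by omega⟩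
      · have := hvle s4
        refine ⟨Or.inr ⟨by omega, h7, by simp; omega⟩, by omega⟩
  · rintro t s3 F h3 he
    have hb3 : s3.reg .busy = 0 := he
    rcases h3 with ⟨h1, h2, h4⟩ | ⟨h1, h2, h4⟩
    · refine ⟨h2, ?_⟩
      simp; omega
    · omega

end Mergers

/-! ### The mergers of a whole stage -/

section RunStage

variable {n₁ n₂ : ℕ} {G : BipGraph n₁ n₂} {lam : ℕ} {s s' s0 sm : Mem}

theorem Start.between (h : Start G lam s0) : Between G lam s0 s0 := by
  have hf := h.fresh
  have hpar := h.perm.par_lt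
  refine ⟨⟨h.base, le_rfl, fun _ _ => rfl, fun _ _ => rfl, fun _ _ => rfl, fun _ _ => rfl,
    ⟨fun _ _ => rfl, fun _ _ => rfl⟩, ?_, ?_, ?_, ?_, ?_, ?_, ?_⟩, h.perm, fun _ _ _ => rfl, ?_, fun _ _ _ => rfl⟩
  · intro hu j
    rw [h.unvis hu j]
    exact ⟨fun hj => ⟨hj, (hf j hj).1⟩, fun hj => hj.1⟩
  · intro i hi; rw [(hf i hi).2.1]; exact Nat.zero_le _
  · intro i hi; rw [(hf i hi).2.2]; exact Nat.zero_le _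
  · exact fun _ i hi => (hf i hi).2.2
  · exact fun _ i hi => (hf i hi).2.1
  · intro i hi _ e he; rw [(hf i hi).2.1] at he; omega
  · intro i hi j hj; rw [(hf i hi).2.2] at hj; omega
  · rintro j hj (hK | hv)
    · omega
    · exact absurd (hf j hj).1 hv

/-- Only one kind of pointer moves in a stage. The lists belong to distinct nodes and have total
length at most `m`; the words number `K / lam + 1` per branch. -/
theorem Stage.ptrSum_le (h : Stage G lam s0 s) (hnw : s0.reg .nw = s0.reg .K / lam + 1) :
    ptrSum s0 s + s0.reg .K ≤ stageWeight G lam s0 := by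
  have hu : s.reg .uw = s0.reg .uw := h.agree.1 _ (by simp)
  have hw : s.reg .nw = s0.reg .nw := h.agree.1 _ (by simp)
  have hK := h.K_le
  unfold ptrSum stageWeight
  split_ifs with h0
  · have h1 : ∑ i ∈ Finset.range (s0.reg .K), (s.arr .sPtr i 0 + s.arr .sWPtr i 0) ≤
        ∑ i ∈ Finset.range (s0.reg .K), s.arr .outDeg (s.arr .node1 i 0) 0 := by
      refine Finset.sum_le_sum fun i hi => ?_
      rw [h.mode1 (by omega) i (Finset.mem_range.1 hi)]
      exact h.le1 i (Finset.mem_range.1 hi)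
    have h2 : ∑ i ∈ Finset.range (s0.reg .K), s.arr .outDeg (s.arr .node1 i 0) 0 ≤ G.m := by
      rw [← Finset.sum_image (f := fun b => s.arr .outDeg b 0) (g := fun i => s.arr .node1 i 0),
        ← h.base.static.sum1]
      · refine Finset.sum_le_sum_of_subset fun b hb => ?_
        obtain ⟨i, hi, rfl⟩ := Finset.mem_image.1 hb
        exact Finset.mem_range.2 (h.base.nodes.node1_lt i ((Finset.mem_range.1 hi).trans_le hK))
      · intro i hi i' hi' he
        have h1 := h.base.nodes.idx1_node1 i ((Finset.mem_range.1 hi).trans_le hK)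
        have h2 := h.base.nodes.idx1_node1 i' ((Finset.mem_range.1 hi').trans_le hK)
        simp only at he
        rw [he] at h1
        omega
    omega
  · have h1 : ∑ i ∈ Finset.range (s0.reg .K), (s.arr .sPtr i 0 + s.arr .sWPtr i 0) ≤
        ∑ i ∈ Finset.range (s0.reg .K), (s0.reg .K / lam + 1) := by
      refine Finset.sum_le_sum fun i hi => ?_
      rw [h.mode2 (by omega) i (Finset.mem_range.1 hi), zero_add, ← hnw, ← hw]
      exact h.le2 i (Finset.mem_range.1 hi)
    simp only [Finset.sum_const, Finset.card_range, smul_eq_mul] at h1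
    nlinarith [Nat.zero_le (s0.reg .K / lam)]

/-- The branch has no unmatched neighbour in `V₁`, or it was visited. -/
def Treated (G : BipGraph n₁ n₂) (s : Mem) (j : ℕ) : Prop :=
  s.arr .vis j 0 ≠ 0 ∨ ∀ v, G.edgeNat v (s.arr .node2 j 0) → s.arr .idx1 v 0 ≠ 0

-- Being treated is permanent, since neither marks nor indices are erased. A single pass over the
-- layer therefore leaves all of its branches treated simultaneously.
set_option maxHeartbeats 1000000 in
theorem wp_treat (hlam : 0 < lam) (h0 : Start G lam s0) (hB : Between G lam s0 s)
    (hq1 : s0.reg .qh ≤ s.reg .h) (hq2 : s.reg .h < s0.reg .qe) :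
    wp lam ((Cmd.assign .cur (Arr.queue.el (.reg .h))).seq ((Cmd.ifte (.bin .eq (Arr.vis.el (.reg .cur)) 0)
      ((Cmd.assign .fb (Arr.node2.el (.reg .cur))).seq (findStrong.seq
        (Cmd.ifte (.reg .res) ((Cmd.assign .u (.reg .res - 1)).seq mergers) .skip))) .skip).seq (incr .h))) s
      (fun t s' => Between G lam s0 s' ∧ s'.reg .h = s.reg .h + 1 ∧
        (∀ j < s0.reg .K, Treated G s j → Treated G s' j) ∧ Treated G s' (s0.arr .queue (s.reg .h) 0) ∧
        t + credit n₁ n₂ s0 s ≤ credit n₁ n₂ s0 s' + 1500) := by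
  have hqu : s.arr .queue = s0.arr .queue := hB.stage.agree.2 _ (by simp)
  have hqt : s.reg .h < s0.reg .qt := by rw [← h0.layers.qe]; exact hq2
  have hjK := h0.layers.que.lt _ hqt
  have hjl := h0.layers.seg _ hq1 hq2
  have hsub : wp lam ((Cmd.assign .cur (Arr.queue.el (.reg .h))).seq (Cmd.ifte (.bin .eq (Arr.vis.el (.reg .cur)) 0)
      ((Cmd.assign .fb (Arr.node2.el (.reg .cur))).seq (findStrong.seq
        (Cmd.ifte (.reg .res) ((Cmd.assign .u (.reg .res - 1)).seq mergers) .skip))) .skip)) s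
      (fun t s' => Between G lam s0 s' ∧
        (∀ j < s0.reg .K, Treated G s j → Treated G s' j) ∧ Treated G s' (s0.arr .queue (s.reg .h) 0) ∧
        t + credit n₁ n₂ s0 s ≤ credit n₁ n₂ s0 s' + 1400) := by
    rw [wp_seq, wp_assign]
    generalize hS : Mem.setReg _ .cur _ = S
    have e1 : S.reg .cur = s0.arr .queue (s.reg .h) 0 := by rw [← hS, ← hqu]; simp
    have eB : Between G lam s0 S := hB.congr_base (hB.stage.base.congr (by rw [← hS]; simp [Agree]))
      (by rw [← hS]; simp [Agree])
    have eT : ∀ j, Treated G s j ↔ Treated G S j := by rw [← hS]; simp [Treated]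
    have eC : credit n₁ n₂ s0 S = credit n₁ n₂ s0 s := by
      have h1 : ptrSum s0 S = ptrSum s0 s := ptrSum_congr (by rw [← hS]; simp [Agree])
      have h2 : visSum s0 S = visSum s0 s := visSum_congr (by rw [← hS]; simp [Agree])
      have h3 : pot n₁ n₂ S = pot n₁ n₂ s := pot_congr (by rw [← hS]; simp [Agree])
      simp only [credit]; omega
    clear hS
    simp only [eT]
    rw [← e1] at hjK hjl ⊢
    rw [wp_ifte]
    refine ⟨fun hv => ?_, fun hv => ?_⟩
    · rw [Expr.eval_eq_ne_zero] at hv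
      have hv' : S.arr .vis (S.reg .cur) 0 = 0 := hv
      have hcK : S.reg .cur < S.reg .K := hjK.trans_le eB.stage.K_le
      have key : wp lam ((Cmd.assign .fb (Arr.node2.el (.reg .cur))).seq findStrong) S (fun t s' =>
          Base G lam s' ∧
          (s'.reg .res = 0 → ∀ v, G.edgeNat v (S.arr .node2 (S.reg .cur) 0) → S.arr .idx1 v 0 ≠ 0) ∧
          (s'.reg .res ≠ 0 → G.edgeNat (s'.reg .res - 1) (S.arr .node2 (S.reg .cur) 0) ∧
            S.arr .idx1 (s'.reg .res - 1) 0 = 0) ∧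
          t + pot n₁ n₂ S ≤ pot n₁ n₂ s' + 130) := by
        rw [wp_seq, wp_assign]
        refine wp_call (wp_findStrong (G := G) (lam := lam) (eB.stage.base.congr (by simp [Agree])) ?_ ?_) ?_
        · simpa using eB.stage.base.nodes.node2_lt _ hcK
        · simp [eB.stage.base.nodes.idx2_node2 _ hcK]
        · rintro t s' F ⟨h1, h2, h3, h4⟩
          simp at h2 h3 h4
          exact ⟨h1, h2, h3, by simp; omega⟩
      rw [wp_seq_assoc]
      refine wp_call_seq key ?_
      rintro t s1 F ⟨hB1, hf, hs, ht⟩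
      have fB : Between G lam s0 s1 := eB.congr_base hB1 F.agree
      have fC : t + credit n₁ n₂ s0 S ≤ credit n₁ n₂ s0 s1 + 130 := by
        have h1 : ptrSum s0 s1 = ptrSum s0 S := ptrSum_congr F.agree
        have h2 : visSum s0 s1 = visSum s0 S := visSum_congr F.agree
        simp only [credit]; omega
      have fT : ∀ j, Treated G S j ↔ Treated G s1 j := by
        intro j; simp only [Treated, F.a .vis, F.a .node2, F.a .idx1]
      rw [← F.a .node2, ← F.a .idx1, ← F.r .cur] at hf hs
      rw [← F.r .cur] at hjK hjl ⊢
      rw [← F.a .vis, ← F.r .cur] at hv'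
      simp only [fT]
      rw [wp_ifte]
      refine ⟨fun hr => ?_, fun hr => ?_⟩
      · rw [wp_seq, wp_assign]
        obtain ⟨hE, hu⟩ := hs hr
        generalize hS : Mem.setReg _ .u _ = S2
        have g1 : S2.reg .u = s1.reg .res - 1 := by rw [← hS]; simp
        have g2 : S2.reg .cur = s1.reg .cur := by rw [← hS]; simp
        have gB : Between G lam s0 S2 := fB.congr_base (hB1.congr (by rw [← hS]; simp [Agree]))
          (by rw [← hS]; simp [Agree])
        have gT : ∀ j, Treated G s1 j ↔ Treated G S2 j := by rw [← hS]; simp [Treated]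
        have gi : S2.arr .idx1 = s1.arr .idx1 := by rw [← hS]; simp
        have gn : S2.arr .node2 = s1.arr .node2 := by rw [← hS]; simp
        have gv : S2.arr .vis = s1.arr .vis := by rw [← hS]; simp
        have gC : credit n₁ n₂ s0 S2 = credit n₁ n₂ s0 s1 := by
          have h1 : ptrSum s0 S2 = ptrSum s0 s1 := ptrSum_congr (by rw [← hS]; simp [Agree])
          have h2 : visSum s0 S2 = visSum s0 s1 := visSum_congr (by rw [← hS]; simp [Agree])
          have h3 : pot n₁ n₂ S2 = pot n₁ n₂ s1 := pot_congr (by rw [← hS]; simp [Agree])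
          simp only [credit]; omega
        clear hS
        have hEn : Entry G lam s0 S2 := ⟨gB, h0, by rwa [g2], by rwa [g2], by rwa [g2, gv], by rwa [g1, gi],
          by rwa [g1, g2, gn]⟩
        refine wp_call (wp_mergers hlam hEn (by rw [g1]; exact hE.1)) ?_
        rintro t3 s3 - ⟨hM, ht3⟩
        refine ⟨hM.between, ?_, Or.inl (by rw [← g2]; exact hM.vis), by simp; omega⟩
        rintro j hj hT
        rcases (gT j).1 hT with hT | hT
        · exact Or.inl (hM.mono j hT)
        · refine Or.inr fun v hv => hM.idx1 v (hT v ?_)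
          rw [hM.between.stage.node2 j hj] at hv
          rwa [gB.stage.node2 j hj]
      · rw [wp_skip]
        exact ⟨fB, fun _ _ => id, Or.inr (hf hr), by simp; omega⟩
    · rw [wp_skip]
      refine ⟨eB, fun _ _ => id, Or.inl fun h0 =>
        Expr.eval_eq_ne_zero.2 (show Expr.eval lam S (Arr.vis.el (.reg .cur)) = Expr.eval lam S 0 from h0) hv,
        by simp; omega⟩
  rw [wp_seq_assoc]
  refine wp_call_seq hsub ?_
  rintro t s1 F ⟨h1, h2, h3, h4⟩
  simp only [incr, wp_assign]
  refine ⟨h1.congr_base (h1.stage.base.congr (by simp [Agree])) (by simp [Agree]), by simp [F.r .h], ?_, ?_, ?_⟩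
  · intro j hj hT
    simpa [Treated] using h2 j hj hT
  · simpa [Treated] using h3
  · have : credit n₁ n₂ s0 (s1.setReg .h (Expr.eval lam s1 (.reg .h + 1))) = credit n₁ n₂ s0 s1 := by
      simp only [credit]
      rw [ptrSum_congr (s := s1) (by simp [Agree]), visSum_congr (s := s1) (by simp [Agree])]
      simp
    rw [this]
    simp
    omega

/-- After the pass no unvisited branch of layer `L - 1` has an unmatched neighbour. This is the
hypothesis of `Between.dist`, and the new certificate forces an augmentation. -/
theorem wp_runStage (hlam : 0 < lam) (h0 : Start G lam s0) :
    wp lam runStage s0 (fun t s' => Base G lam s' ∧ Perm G s' ∧ Maximal G s' ∧ Clean lam s' ∧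
      Dist G s' (s0.reg .L + 1) ∧ s0.reg .K < s'.reg .K ∧
      t + pot n₁ n₂ s0 ≤ pot n₁ n₂ s' + 10000 * stageWeight G lam s0) := by
  have key : wp lam runStage s0 (fun t s' => Between G lam s0 s' ∧
      (∀ i, s0.reg .qh ≤ i → i < s0.reg .qe → Treated G s' (s0.arr .queue i 0)) ∧
      t + credit n₁ n₂ s0 s0 ≤ credit n₁ n₂ s0 s' + 1600 * s0.reg .K + 30) := by
    simp only [runStage, ↓wp_seq, ↓wp_assign]
    have hqe := h0.layers.qh_le
    generalize hS : Mem.setReg _ .h _ = S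
    have e1 : S.reg .h = s0.reg .qh := by rw [← hS]; simp
    have eB : Between G lam s0 S := h0.between.congr_base (h0.base.congr (by rw [← hS]; simp [Agree]))
      (by rw [← hS]; simp [Agree])
    have eC : credit n₁ n₂ s0 S = credit n₁ n₂ s0 s0 := by
      have h1 : ptrSum s0 S = ptrSum s0 s0 := ptrSum_congr (by rw [← hS]; simp [Agree])
      have h2 : visSum s0 S = visSum s0 s0 := visSum_congr (by rw [← hS]; simp [Agree])
      have h3 : pot n₁ n₂ S = pot n₁ n₂ s0 := pot_congr (by rw [← hS]; simp [Agree])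
      simp only [credit]; omega
    clear hS
    refine wp_while (fun t s' => Between G lam s0 s' ∧ s0.reg .qh ≤ s'.reg .h ∧ s'.reg .h ≤ s0.reg .qe ∧
        (∀ i, s0.reg .qh ≤ i → i < s'.reg .h → Treated G s' (s0.arr .queue i 0)) ∧
        -- Each queue entry costs at most 1500 beyond the credit, plus the overhead of the loop.
        t + credit n₁ n₂ s0 s0 + 1600 * s0.reg .qh ≤ credit n₁ n₂ s0 s' + 1600 * s'.reg .h)
      (fun s' => s0.reg .qe - s'.reg .h) ?_ ?_ ?_
    · exact ⟨eB, by omega, by omega, fun i hi hi' => by omega, by omega⟩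
    · rintro t s1 F ⟨h1, h2, h3, h4, h5⟩ he
      rw [Expr.eval_lt_ne_zero] at he
      have hq : s1.reg .qe = s0.reg .qe := h1.stage.agree.1 _ (by simp)
      have he' : s1.reg .h < s0.reg .qe := hq ▸ he
      refine wp_call (wp_treat hlam h0 h1 h2 he') ?_
      rintro t2 s2 - ⟨g1, g2, g3, g4, g5⟩
      refine ⟨⟨g1, by omega, by omega, fun i hi hi' => ?_, by simp; omega⟩, by omega⟩
      by_cases hih : i = s1.reg .h
      · rw [hih]; exact g4
      · exact g3 _ (h0.layers.que.lt i (by rw [← h0.layers.qe]; omega)) (h4 i hi (by omega))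
    · rintro t s1 F ⟨h1, h2, h3, h4, h5⟩ he
      have hq : s1.reg .qe = s0.reg .qe := h1.stage.agree.1 _ (by simp)
      have he' : ¬ s1.reg .h < s0.reg .qe := fun hlt => Expr.eval_lt_ne_zero.2
        (show Expr.eval lam s1 (.reg .h) < Expr.eval lam s1 (.reg .qe) by
          simp only [Expr.eval]; omega) he
      have hc : s0.reg .qt ≤ s0.reg .K := by
        have := h0.layers.card_le (fun _ => 1)
        simpa using this
      have := h0.layers.qe
      exact ⟨h1, fun i hi hi' => h4 i hi (by omega), by simp; omega⟩
  refine wp_call_list key (by decide) ?_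
  rintro t s1 F F' ⟨hB, hT, ht⟩
  have hD := hB.dist h0 (fun j hj hl hv => by
    rw [hB.stage.lab] at hl
    have hp := h0.layers.pos
    obtain ⟨i, hi, rfl⟩ := h0.layers.que.ex j (by omega)
    have hq : s0.reg .qh ≤ i := by
      by_contra hlt
      have := h0.layers.early i (by omega)
      omega
    exact (hT i hq (by rw [h0.layers.qe]; exact hi)).resolve_left (not_not.2 hv))
  have hK := hB.stage.K_le
  have hu : s1.reg .uw = s0.reg .uw := F.r .uw
  refine ⟨hB.stage.base, hB.perm, ?_, ⟨?_, ?_, ?_⟩, hD, hB.K_lt h0 hD, ?_⟩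
  · intro v b hE
    rcases h0.maximal v b hE with h | h
    · left; rwa [hB.stage.idx1 v h]
    · right; rwa [hB.stage.idx2 b h]
  · intro j hj; rw [hB.stage.lab]; exact h0.clean.lab j (by omega)
  · intro j hj
    rw [F.a .reached] at hj
    exact (h0.clean.reached j hj).trans_le hK
  · intro j hj
    by_cases h : s0.reg .uw = 0
    · rw [F' h .unvis (by decide)] at hj
      exact (h0.clean.unvis j hj).trans_le hK
    · exact ((hB.stage.unvis (by omega) j).1 hj).1.trans_le hK
  · have h1 := hB.stage.ptrSum_le h0.layers.nw
    have h2 := visSum_le (s0 := s0) (s := s1)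
    have h3 : 1 ≤ stageWeight G lam s0 := by
      unfold stageWeight; split_ifs
      · omega
      · exact Nat.one_le_iff_ne_zero.2 (by positivity)
    simp only [credit] at ht
    omega

end RunStage

/-! ## Matchings and labels -/

section Duality

variable {n₁ n₂ : ℕ} {G : BipGraph n₁ n₂} {lam : ℕ} {s s' s0 : Mem}

theorem BipGraph.IsMatching.card_le {M : Finset (Fin n₁ × Fin n₂)} (h : G.IsMatching M) : M.card ≤ G.kappa := by
  classical
  unfold BipGraph.kappa
  refine Finset.le_sup (f := Finset.card) ?_
  simp only [Finset.mem_filter, Finset.mem_powerset]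
  exact ⟨h.1, h⟩

theorem BipGraph.kappa_le {k : ℕ} (h : ∀ M, G.IsMatching M → M.card ≤ k) : G.kappa ≤ k := by
  classical
  unfold BipGraph.kappa
  refine Finset.sup_le fun M hM => h M ?_
  simp only [Finset.mem_filter] at hM
  exact hM.2

theorem BipGraph.kappa_le_m : G.kappa ≤ G.m :=
  BipGraph.kappa_le fun _ hM => Finset.card_le_card hM.1

theorem Perm.child_inj (hB : Base G lam s) (hP : Perm G s) {j j' : ℕ} (hj : j < s.reg .K) (hj' : j' < s.reg .K)
    (h : child s j = child s j') : j = j' := by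
  have h1 := hB.nodes.idx1_node1 _ (hP.chl_lt j hj)
  have h2 := hB.nodes.idx1_node1 _ (hP.chl_lt j' hj')
  simp only [child] at h
  rw [h] at h1
  rw [← hP.par_chl j hj, ← hP.par_chl j' hj', show s.arr .chl j 0 = s.arr .chl j' 0 by omega]

theorem Base.node2_inj (hB : Base G lam s) {j j' : ℕ} (hj : j < s.reg .K) (hj' : j' < s.reg .K)
    (h : s.arr .node2 j 0 = s.arr .node2 j' 0) : j = j' := by
  have h1 := hB.nodes.idx2_node2 j hj
  have h2 := hB.nodes.idx2_node2 j' hj'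
  rw [h] at h1
  omega

/-- The branches form a matching. -/
theorem Perm.matching (hB : Base G lam s) (hP : Perm G s) :
    ∃ M : Finset (Fin n₁ × Fin n₂), G.IsMatching M ∧ M.card = s.reg .K ∧
      output s = M.image fun e => ((e.1 : ℕ), (e.2 : ℕ)) := by
  classical
  refine ⟨G.edges.filter (fun e => ∃ j < s.reg .K, child s j = e.1 ∧ s.arr .node2 j 0 = e.2), ⟨?_, ?_⟩, ?_, ?_⟩
  · exact Finset.filter_subset _ _
  · rintro ⟨v, b⟩ he ⟨v', b'⟩ he' hor
    simp only [Finset.mem_filter] at he he'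
    obtain ⟨-, j, hj, h1, h2⟩ := he
    obtain ⟨-, j', hj', h3, h4⟩ := he'
    have hjj : j = j' := by
      rcases hor with h | h
      · exact hP.child_inj hB hj hj' (by rw [h1, h3]; exact congrArg Fin.val h)
      · exact hB.node2_inj hj hj' (by rw [h2, h4]; exact congrArg Fin.val h)
    subst hjj
    exact Prod.ext (Fin.ext (h1.symm.trans h3)) (Fin.ext (h2.symm.trans h4))
  · symm
    refine (Finset.card_range _).symm.trans (Finset.card_bij
      (fun j hj => (⟨child s j, (hP.edge j (Finset.mem_range.1 hj)).1⟩,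
        ⟨s.arr .node2 j 0, (hP.edge j (Finset.mem_range.1 hj)).2.1⟩)) ?_ ?_ ?_)
    · intro j hj
      simp only [Finset.mem_filter]
      exact ⟨(hP.edge j (Finset.mem_range.1 hj)).2.2, j, Finset.mem_range.1 hj, rfl, rfl⟩
    · intro j hj j' hj' h
      simp only [Prod.mk.injEq, Fin.mk.injEq] at h
      exact hB.node2_inj (Finset.mem_range.1 hj) (Finset.mem_range.1 hj') h.2
    · rintro ⟨v, b⟩ he
      simp only [Finset.mem_filter] at he
      obtain ⟨-, j, hj, h1, h2⟩ := he
      exact ⟨j, Finset.mem_range.2 hj, Prod.ext (Fin.ext h1) (Fin.ext h2)⟩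
  · ext ⟨v, b⟩
    simp only [output, Finset.mem_image, Finset.mem_range, Finset.mem_filter, Prod.mk.injEq, Prod.exists]
    constructor
    · rintro ⟨j, hj, rfl, rfl⟩
      obtain ⟨hv, hb, he⟩ := hP.edge j hj
      exact ⟨⟨_, hv⟩, ⟨_, hb⟩, ⟨he, j, hj, rfl, rfl⟩, rfl, rfl⟩
    · rintro ⟨v', b', ⟨-, j, hj, h1, h2⟩, rfl, rfl⟩
      exact ⟨j, hj, h1, h2⟩

theorem Perm.K_le (hB : Base G lam s) (hP : Perm G s) : s.reg .K ≤ G.kappa := by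
  obtain ⟨M, hM, hc, -⟩ := hP.matching hB
  exact hc ▸ hM.card_le

/-- A labelling of the nodes yields a node cover for each label below `k`. -/
theorem kappa_le_level (hB : Base G lam s) (hP : Perm G s) {Φ : ℕ → ℕ} {k i : ℕ}
    (h1 : ∀ b, s.arr .idx2 b 0 = 0 → Φ b = 0)
    (h2 : ∀ j < s.reg .K, ∀ b, G.edgeNat (child s j) b → Φ (s.arr .node2 j 0) ≤ Φ b + 1)
    (h3 : ∀ v b, G.edgeNat v b → s.arr .idx1 v 0 = 0 → k ≤ Φ b + 1) (hi : 1 ≤ i) (hik : i < k) :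
    G.kappa ≤ s.reg .K + ((Finset.range (s.reg .K)).filter (fun j => Φ (s.arr .node2 j 0) = i)).card := by
  classical
  refine BipGraph.kappa_le fun M hM => ?_
  -- The cover consists of the children of `A` and the roots of `B`; level `i` is counted twice.
  set A := (Finset.range (s.reg .K)).filter (fun j => Φ (s.arr .node2 j 0) ≤ i)
  set B := (Finset.range (s.reg .K)).filter (fun j => i ≤ Φ (s.arr .node2 j 0))
  have hAB : A.card + B.card =
      s.reg .K + ((Finset.range (s.reg .K)).filter (fun j => Φ (s.arr .node2 j 0) = i)).card := by
    rw [← Finset.card_union_add_card_inter]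
    congr 1
    · convert Finset.card_range (s.reg .K)
      ext j
      simp only [A, B, Finset.mem_union, Finset.mem_filter]
      have := le_total (Φ (s.arr .node2 j 0)) i
      tauto
    · congr 1
      ext j
      simp only [A, B, Finset.mem_inter, Finset.mem_filter]
      constructor
      · rintro ⟨⟨h, h'⟩, -, h''⟩; exact ⟨h, le_antisymm h' h''⟩
      · rintro ⟨h, h'⟩; exact ⟨⟨h, h'.le⟩, h, h'.ge⟩
  rw [← hAB]
  have hc : M.card ≤ ((A.image (child s)).disjSum (B.image fun j => s.arr .node2 j 0)).card := by
    refine Finset.card_le_card_of_injOn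
      -- An edge is charged to its `V₂`-end if that lies at level `i` or higher, and otherwise to
      -- its `V₁`-end, whose branch then has level at most `i`. Both ends are matched in their
      -- cases, by `h1` with `1 ≤ i` and by `h3` with `i < k`.
      (fun e => if i ≤ Φ e.2 then Sum.inr (e.2 : ℕ) else Sum.inl (e.1 : ℕ)) ?_ ?_
    · rintro ⟨v, b⟩ he
      have hE : G.edgeNat v b := ⟨v.2, b.2, hM.1 he⟩
      simp only [Finset.mem_coe]
      split_ifs with hb
      · rw [Finset.inr_mem_disjSum, Finset.mem_image]
        have hne : s.arr .idx2 b 0 ≠ 0 := fun h0 => by have := h1 b h0; omega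
        have hK := hB.nodes.idx2_le b
        have hn := hB.nodes.node2_idx2 b hne
        exact ⟨s.arr .idx2 b 0 - 1, Finset.mem_filter.2 ⟨Finset.mem_range.2 (by omega), by rwa [hn]⟩, hn⟩
      · rw [Finset.inl_mem_disjSum, Finset.mem_image]
        have hne : s.arr .idx1 v 0 ≠ 0 := fun h0 => by have := h3 v b hE h0; omega
        have hK := hB.nodes.idx1_le v
        have hn := hB.nodes.node1_idx1 v hne
        have hp := hP.par_lt (s.arr .idx1 v 0 - 1) (by omega)
        have hch : child s (s.arr .par (s.arr .idx1 v 0 - 1) 0) = v := by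
          rw [child, hP.chl_par _ (by omega), hn]
        refine ⟨_, Finset.mem_filter.2 ⟨Finset.mem_range.2 hp, ?_⟩, hch⟩
        have := h2 _ hp b (by rwa [hch])
        omega
    · rintro ⟨v, b⟩ he ⟨v', b'⟩ he' h
      simp only at h
      refine hM.2 _ he _ he' ?_
      split_ifs at h
      · exact Or.inr (Fin.ext (Sum.inr.inj h))
      · exact Or.inl (Fin.ext (Sum.inl.inj h))
  rw [Finset.card_disjSum] at hc
  exact hc.trans (Nat.add_le_add Finset.card_image_le Finset.card_image_le)

/-- The levels `1, …, k - 1` are disjoint sets of branches, each of size at least `κ - K`. Hence `(k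
- 1) (κ - K) ≤ K`, and adding `κ - K` gives the claim. -/
theorem Dist.mul_le (hB : Base G lam s) (hP : Perm G s) {k : ℕ} (h : Dist G s k) :
    k * (G.kappa - s.reg .K) ≤ G.kappa := by
  obtain ⟨Φ, h1, h2, h3⟩ := h
  have hK := hP.K_le hB
  have hs : ∑ i ∈ Finset.Ico 1 k, ((Finset.range (s.reg .K)).filter (fun j => Φ (s.arr .node2 j 0) = i)).card ≤
      s.reg .K := by
    rw [← Finset.card_biUnion]
    · calc _ ≤ (Finset.range (s.reg .K)).card := Finset.card_le_card (Finset.biUnion_subset.2 fun i _ =>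
            Finset.filter_subset _ _)
        _ = _ := Finset.card_range _
    · intro i _ i' _ hii
      simp only [Function.onFun, Finset.disjoint_filter]
      intro j _ h h'
      exact hii (h.symm.trans h')
  have hl : ∑ i ∈ Finset.Ico 1 k, (G.kappa - s.reg .K) ≤
      ∑ i ∈ Finset.Ico 1 k, ((Finset.range (s.reg .K)).filter (fun j => Φ (s.arr .node2 j 0) = i)).card := by
    refine Finset.sum_le_sum fun i hi => ?_
    rw [Finset.mem_Ico] at hi
    have := kappa_le_level hB hP h1 h2 h3 hi.1 hi.2
    omega
  simp only [Finset.sum_const, Nat.card_Ico, smul_eq_mul] at hl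
  have h4 := hl.trans hs
  rcases Nat.eq_zero_or_pos k with rfl | hk
  · simp
  · obtain ⟨k, rfl⟩ := Nat.exists_eq_add_of_le' hk
    rw [Nat.add_sub_cancel] at h4
    rw [add_mul]
    omega

/-- The labels of a layered network, where `a` is the label of the branches without a label. -/
theorem Layers.edge_le (hB : Base G lam s) (h : Layers G lam s) {a : ℕ} (ha : s.reg .p ≤ a)
    (hlt : a = s.reg .p ∨ s.reg .qe ≤ s.reg .qh) {Φ : ℕ → ℕ}
    (hΦ : ∀ b, Φ b = if s.arr .idx2 b 0 = 0 then 0 else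
      if s.arr .lab (s.arr .idx2 b 0 - 1) 0 = 0 then a else s.arr .lab (s.arr .idx2 b 0 - 1) 0)
    {j : ℕ} (hj : j < s.reg .K) {b : ℕ} (hE : G.edgeNat (child s j) b) : Φ (s.arr .node2 j 0) ≤ Φ b + 1 := by
  have hp := h.lab_le j
  have hj2 := hB.nodes.idx2_node2 j hj
  have hΦj : Φ (s.arr .node2 j 0) = if s.arr .lab j 0 = 0 then a else s.arr .lab j 0 := by
    rw [hΦ, hj2, if_neg (by omega), Nat.add_sub_cancel]
  have hΦja : Φ (s.arr .node2 j 0) ≤ a := by rw [hΦj]; split_ifs <;> omega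
  by_cases hb : s.arr .idx2 b 0 = 0
  · have h1 := (h.one j hj).2 ⟨b, hE, hb⟩
    rw [hΦj, if_neg (by omega)]
    omega
  · have hK := hB.nodes.idx2_le b
    have hn := hB.nodes.node2_idx2 b hb
    have hΦb := hΦ b
    rw [if_neg hb] at hΦb
    split_ifs at hΦb with h0
    · omega
    · by_cases hlp : s.arr .lab (s.arr .idx2 b 0 - 1) 0 < s.reg .p
      · obtain ⟨h1, h2⟩ := h.compl j hj _ (by omega) (by rwa [hn]) h0 hlp
        rw [hΦj, if_neg h1, hΦb]
        exact h2
      · rcases hlt with hlt | hlt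
        · omega
        · obtain ⟨i, hi, hq⟩ := h.que.ex _ h0
          have h3 := h.qe
          have := h.early i (by omega)
          rw [hq] at this
          exact absurd this hlp

/-- The labels themselves serve as `Φ`, with `p` for the branches that were not reached. This holds
even if the search was cut off by the threshold. -/
theorem Network.dist (h : Network G lam s) (hM : Maximal G s) : Dist G s (s.reg .p + 1) := by
  refine ⟨fun b => if s.arr .idx2 b 0 = 0 then 0 else
      if s.arr .lab (s.arr .idx2 b 0 - 1) 0 = 0 then s.reg .p else s.arr .lab (s.arr .idx2 b 0 - 1) 0,
    fun b hb => by simp [hb], ?_, ?_⟩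
  · intro j hj b hE
    exact h.layers.edge_le h.base le_rfl (Or.inl rfl) (fun _ => rfl) hj hE
  · intro v b hE hv
    have hb := (hM v b hE).resolve_left (not_not.2 hv)
    have hK := h.base.nodes.idx2_le b
    have hn := h.base.nodes.node2_idx2 b hb
    simp only [if_neg hb]
    split_ifs with h0
    · omega
    · by_contra hlt
      exact h.layers.strong _ (by omega) h0 (by omega) v (by rwa [hn]) hv

/-- The last layer is empty, so unreached branches may be put at level `p + 1` without violating any
edge. Level `p` is then empty, and the cover at this level has only `K` nodes. -/
theorem Network.kappa_le (h : Network G lam s) (hP : Perm G s) (hM : Maximal G s) (hq : s.reg .qe ≤ s.reg .qh) :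
    G.kappa ≤ s.reg .K := by
  have hlt : ∀ j, s.arr .lab j 0 ≠ 0 → s.arr .lab j 0 < s.reg .p := by
    intro j h0
    obtain ⟨i, hi, rfl⟩ := h.layers.que.ex j h0
    have h3 := h.layers.qe
    exact h.layers.early i (by omega)
  have key := kappa_le_level (k := s.reg .p + 2) (i := s.reg .p) h.base hP (Φ := fun b => if s.arr .idx2 b 0 = 0 then 0 else
      if s.arr .lab (s.arr .idx2 b 0 - 1) 0 = 0 then s.reg .p + 1 else s.arr .lab (s.arr .idx2 b 0 - 1) 0)
    (fun b hb => by simp [hb])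
    (fun j hj b hE => h.layers.edge_le h.base (Nat.le_succ _) (Or.inr hq) (fun _ => rfl) hj hE) ?_ h.layers.pos
    (by omega)
  · rw [Finset.card_eq_zero.2, add_zero] at key
    · exact key
    · rw [Finset.filter_eq_empty_iff]
      intro j hj
      rw [h.base.nodes.idx2_node2 j (Finset.mem_range.1 hj), if_neg (by omega), Nat.add_sub_cancel]
      split_ifs with h0
      · omega
      · exact (hlt j h0).ne
  · intro v b hE hv
    have hb := (hM v b hE).resolve_left (not_not.2 hv)
    have hK := h.base.nodes.idx2_le b
    have hn := h.base.nodes.node2_idx2 b hb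
    simp only [if_neg hb]
    split_ifs with h0
    · omega
    · exact absurd hv (h.layers.strong _ (by omega) h0 (hlt _ h0) v (by rwa [hn]))

end Duality

/-! ### The main loop: number and cost of the stages -/

section Combined

variable {n₁ n₂ : ℕ} {G : BipGraph n₁ n₂} {lam : ℕ} {s s' s0 : Mem}

/-- The time for a stage without words. -/
noncomputable def listTime (G : BipGraph n₁ n₂) : ℕ := 20100 * (G.m + G.kappa + 1)

/-- The time for a stage with words. -/
noncomputable def wordTime (G : BipGraph n₁ n₂) (lam : ℕ) : ℕ := 20100 * ((G.kappa + 1) * (G.kappa / lam + 3))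

theorem stageWeight_le (hK : s.reg .K ≤ G.kappa) :
    20000 * stageWeight G lam s + 100 ≤ if s.reg .uw = 0 then listTime G else wordTime G lam := by
  unfold stageWeight listTime wordTime
  split_ifs with h
  · omega
  · have h1 : (s.reg .K + 1) * (s.reg .K / lam + 3) ≤ (G.kappa + 1) * (G.kappa / lam + 3) :=
      Nat.mul_le_mul (by omega) (Nat.add_le_add_right (Nat.div_le_div_right hK) 3)
    have h2 : 1 ≤ (G.kappa + 1) * (G.kappa / lam + 3) := Nat.one_le_iff_ne_zero.2 (by positivity)
    omega

variable (G lam) in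
/-- The invariants of the combined algorithm that do not concern the running time. -/
structure Ready (s : Mem) : Prop where
  base : Base G lam s
  perm : Perm G s
  maximal : Maximal G s
  clean : Clean lam s

theorem Ready.congr (h : Ready G lam s)
    (H : Agree [.n1, .n2, .lam, .K] [.outDeg, .outAdj, .inDeg, .inAdj, .outW, .inW, .node1, .node2, .idx1,
      .idx2, .used1, .used2, .subOut, .subIn, .outPtr, .outWPtr, .inPtr, .inWPtr, .chl, .par, .lab, .reached, .unvis]
      s s') : Ready G lam s' :=
  ⟨h.base.congr H.mono, h.perm.congr H.mono, h.maximal.congr H.mono, h.clean.congr H.mono⟩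

variable (G lam) in
/-- The running time up to the memory `s` in the main loop. -/
structure Timed (C T t : ℕ) (s : Mem) : Prop where
  thr : s.reg .thr = T
  uw_le : s.reg .uw ≤ 1
  go_le : s.reg .go ≤ 1
  halt : s.reg .go = 0 → G.kappa ≤ s.reg .K
  -- The certified label is `k + 2` because the greedy phase already certifies two. The term with `1
  -- - go` pays for the final search that finds no label.
  list : s.reg .uw = 0 → ∃ k, Dist G s (k + 2) ∧ k ≤ T ∧
    t ≤ pot n₁ n₂ s + C + k * listTime G + (1 - s.reg .go) * listTime G
  -- `K₁` is the size of the matching when words came in; from then on each stage is charged to an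
  -- augmentation.
  word : s.reg .uw ≠ 0 → ∃ K₁ ≤ s.reg .K, (T + 1) * (G.kappa - K₁) ≤ G.kappa ∧
    t ≤ pot n₁ n₂ s + C + (T + 1) * listTime G + (s.reg .K - K₁) * wordTime G lam +
      (1 - s.reg .go) * wordTime G lam

/-- A pass through the loop augments, or switches to words, or halts; each lowers the measure.
Without words a stage is paid by the increase of the certified label, with words by the increase of
`K`. -/
theorem wp_combinedStep (hlam : 0 < lam) {C T t : ℕ} (hR : Ready G lam s) (hT : Timed G lam C T t s)
    (hgo : s.reg .go ≠ 0) :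
    wp lam (layeredNetwork.seq (Cmd.ifte (.reg .L) runStage
      (Cmd.ifte ((Expr.bin .eq (.reg .uw) 0) * (Expr.bin .lt (.reg .qh) (.reg .qe)))
        (.assign .uw 1) (.assign .go 0)))) s
      -- The two extra steps are the evaluation of the loop condition.
      (fun t' s' => Ready G lam s' ∧ Timed G lam C T (t + t' + 2) s' ∧
        G.kappa - s'.reg .K + (1 - s'.reg .uw) + s'.reg .go < G.kappa - s.reg .K + (1 - s.reg .uw) + s.reg .go) := by
  have hgo1 : s.reg .go = 1 := by have := hT.go_le; omega
  have hKk := hR.perm.K_le hR.base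
  have hw := stageWeight_le (lam := lam) hKk
  refine wp_call_seq (wp_layeredNetwork hlam hR.base hR.perm hR.clean) ?_
  rintro t1 s1 F ⟨hN, ht1⟩
  have hP1 : Perm G s1 := hR.perm.congr F.agree
  have hM1 : Maximal G s1 := hR.maximal.congr F.agree
  have hD : ∀ k, Dist G s k → Dist G s1 k := fun k h => h.congr F.agree
  have fK : s1.reg .K = s.reg .K := F.r .K
  have fu : s1.reg .uw = s.reg .uw := F.r .uw
  have fT : s1.reg .thr = s.reg .thr := F.r .thr
  have fg : s1.reg .go = s.reg .go := F.r .go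
  have hR1 : Ready G lam s1 := ⟨hN.base, hP1, hM1, hN.clean⟩
  have hu1 := hT.uw_le
  have hTt := hT.thr
  clear F
  rw [wp_ifte]
  refine ⟨fun hL => ?_, fun hL => ?_⟩
  · have hL' : s1.reg .L ≠ 0 := hL
    have hst : Start G lam s1 := ⟨hN, hP1, hM1, hL'⟩
    obtain ⟨hLp, hstr, hLt⟩ := hN.found hL'
    have hw1 : stageWeight G lam s1 = stageWeight G lam s := by simp only [stageWeight, fK, fu]
    refine wp_call (wp_runStage hlam hst) ?_
    rintro t2 s2 F2 ⟨hB2, hP2, hM2, hC2, hD2, hK2, ht2⟩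
    have gu : s2.reg .uw = s.reg .uw := (F2.r .uw).trans fu
    have gT : s2.reg .thr = s.reg .thr := (F2.r .thr).trans fT
    have gg : s2.reg .go = s.reg .go := (F2.r .go).trans fg
    have hK2k := hP2.K_le hB2
    clear F2
    refine ⟨⟨hB2, hP2, hM2, hC2⟩, ⟨by omega, by omega, by omega, fun h => by omega, fun hu => ?_, fun hu => ?_⟩,
      by omega⟩
    · have hu' : s.reg .uw = 0 := by omega
      rw [if_pos hu'] at hw
      obtain ⟨k, hk1, hk2, hk3⟩ := hT.list hu'
      -- The label `p + 1` of the stage is at least the certified `k + 2`, so `k` may be replaced by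
      -- the larger `p`; the threshold keeps it within `T`.
      have hle := (hD _ hk1).le_stage hN.layers hstr
      have := hLt (by omega)
      refine ⟨s1.reg .p, ?_, by omega, ?_⟩
      · convert hD2 using 1; omega
      · have hm : (k + 1) * listTime G ≤ s1.reg .p * listTime G := Nat.mul_le_mul_right _ (by omega)
        rw [add_mul, one_mul] at hm
        rw [hgo1] at hk3
        rw [gg, hgo1]
        simp [Expr.cost] at hk3 ⊢
        omega
    · have hu' : s.reg .uw ≠ 0 := by omega
      rw [if_neg hu'] at hw
      obtain ⟨K₁, hk1, hk2, hk3⟩ := hT.word hu'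
      refine ⟨K₁, by omega, hk2, ?_⟩
      have hm : (s.reg .K - K₁ + 1) * wordTime G lam ≤ (s2.reg .K - K₁) * wordTime G lam :=
        Nat.mul_le_mul_right _ (by omega)
      rw [add_mul, one_mul] at hm
      rw [hgo1] at hk3
      rw [gg, hgo1]
      simp [Expr.cost] at hk3 ⊢
      omega
  · have hL' : s1.reg .L = 0 := hL
    rw [wp_ifte]
    refine ⟨fun hc => ?_, fun hc => ?_⟩
    · rw [Expr.eval_mul_ne_zero, Expr.eval_eq_ne_zero, Expr.eval_lt_ne_zero] at hc
      have hu' : s1.reg .uw = 0 := hc.1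
      have hq : s1.reg .qh < s1.reg .qe := hc.2
      have hp := (hN.none hL' hq).2
      -- The search was cut off with `T ≤ p`, so the label `T + 1` is certified, and duality bounds
      -- the number of missing edges.
      have hD1 := (hN.dist hM1).mul_le hN.base hP1
      rw [if_pos (by omega)] at hw
      obtain ⟨k, hk1, hk2, hk3⟩ := hT.list (by omega)
      rw [wp_assign]
      refine ⟨hR1.congr (by simp [Agree]), ⟨by simp; omega, by simp [Expr.eval_num], by simp; omega, ?_, ?_, ?_⟩, ?_⟩
      · intro h; simp at h; omega
      · intro h; simp [Expr.eval_num] at h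
      · intro _
        refine ⟨s1.reg .K, by simp, (Nat.mul_le_mul_right _ (by omega)).trans hD1, ?_⟩
        have hm : (k + 1) * listTime G ≤ (T + 1) * listTime G := Nat.mul_le_mul_right _ (by omega)
        rw [add_mul, one_mul] at hm
        rw [hgo1] at hk3
        simp [fg, hgo1] at hk3 ⊢
        omega
      · simp [Expr.eval_num]
        omega
    · have hk : G.kappa ≤ s1.reg .K := by
        -- If the last layer were nonempty, `Network.none` would put the run in the mode without
        -- words, which is the case just excluded.
        refine hN.kappa_le hP1 hM1 (not_lt.1 fun hq => ?_)
        refine Expr.eval_mul_ne_zero.2 ⟨Expr.eval_eq_ne_zero.2 ?_, Expr.eval_lt_ne_zero.2 ?_⟩ hc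
        · exact (hN.none hL' hq).1
        · exact hq
      rw [wp_assign]
      refine ⟨hR1.congr (by simp [Agree]), ⟨by simp; omega, by simp; omega, by simp [Expr.eval_num], ?_, ?_, ?_⟩, ?_⟩
      · intro _; simpa using hk
      · intro h
        simp at h
        rw [if_pos (by omega)] at hw
        obtain ⟨k, hk1, hk2, hk3⟩ := hT.list (by omega)
        refine ⟨k, (hD _ hk1).congr (by simp [Agree]), hk2, ?_⟩
        rw [hgo1] at hk3
        simp [Expr.eval_num] at hk3 ⊢
        omega
      · intro h
        simp at h
        rw [if_neg (by omega)] at hw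
        obtain ⟨K₁, hk1, hk2, hk3⟩ := hT.word (by omega)
        refine ⟨K₁, by simp; omega, hk2, ?_⟩
        rw [hgo1] at hk3
        simp [Expr.eval_num, fK] at hk3 ⊢
        omega
      · simp [Expr.eval_num]
        omega

/-- The correctness and the running time of the combined algorithm, in terms of the potential. -/
theorem wp_combined (hlam : 0 < lam) (hB : Base G lam s) (hK : s.reg .K = 0)
    (h0 : ∀ v, s.arr .idx1 v 0 = 0 ∧ s.arr .outPtr v 0 = 0 ∧ s.arr .outWPtr v 0 = 0)
    (hC : ∀ j, s.arr .lab j 0 = 0 ∧ s.arr .reached 0 j = 0 ∧ s.arr .unvis 0 j = 0) :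
    wp lam combined s (fun t s' => Base G lam s' ∧ Perm G s' ∧ s'.reg .K = G.kappa ∧
      ∃ W, (s.reg .thr + 1) * W ≤ G.kappa ∧ t ≤ pot n₁ n₂ s' + 600 * n₁ + 100 +
        (s.reg .thr + 1) * listTime G + (W + 1) * wordTime G lam) := by
  simp only [combined, ↓wp_seq, ↓wp_assign]
  refine wp_call (wp_greedy hlam hB hK h0) ?_
  rintro t1 s1 F ⟨hB1, hP1, hM1, ht1⟩
  have fl : s1.arr .lab = s.arr .lab := F.a .lab
  have fr : s1.arr .reached = s.arr .reached := F.a .reached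
  have fv : s1.arr .unvis = s.arr .unvis := F.a .unvis
  have fT : s1.reg .thr = s.reg .thr := F.r .thr
  clear F
  have hC1 : Clean lam s1 := by
    refine ⟨fun j _ => by rw [fl]; exact (hC j).1, fun j hj => ?_, fun j hj => ?_⟩
    · rw [fr] at hj; simp [bitAt, hC] at hj
    · rw [fv] at hj; simp [bitAt, hC] at hj
  generalize hS : Mem.setReg _ .go _ = S
  have e1 : S.reg .uw = 0 := by rw [← hS]; simp [Expr.eval_num]
  have e2 : S.reg .go = 1 := by rw [← hS]; simp [Expr.eval_num]
  have e3 : S.reg .thr = s.reg .thr := by rw [← hS, ← fT]; simp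
  have eR : Ready G lam S := Ready.congr ⟨hB1, hP1, hM1, hC1⟩ (by rw [← hS]; simp [Agree])
  have eP : pot n₁ n₂ S = pot n₁ n₂ s1 := pot_congr (by rw [← hS]; simp [Agree])
  clear hS
  refine wp_while (fun t s' => Ready G lam s' ∧ Timed G lam (600 * n₁ + 50) (s.reg .thr) (t1 + t) s')
    (fun s' => G.kappa - s'.reg .K + (1 - s'.reg .uw) + s'.reg .go) ?_ ?_ ?_
  · refine ⟨eR, e3, by omega, by omega, fun h => by omega, fun _ => ⟨0, ?_, Nat.zero_le _, ?_⟩, fun h => by omega⟩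
    · exact Dist.of_maximal eR.maximal eR.base.nodes.idx2_node2
    · omega
  · rintro t s2 - ⟨hR, hT⟩ he
    refine wp_call (wp_combinedStep hlam hR hT he) ?_
    rintro t2 s3 - ⟨h1, h2, h3⟩
    refine ⟨⟨h1, ?_⟩, h3⟩
    convert h2 using 1
    simp
    omega
  · rintro t s2 - ⟨hR, hT⟩ he
    have hgo : s2.reg .go = 0 := he
    have hKk := hR.perm.K_le hR.base
    have hkK := hT.halt hgo
    refine ⟨hR.base, hR.perm, le_antisymm hKk hkK, ?_⟩
    by_cases hu : s2.reg .uw = 0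
    · obtain ⟨k, -, hk2, hk3⟩ := hT.list hu
      -- The run ended without words, so no stage has to be charged to an augmentation.
      refine ⟨0, by omega, ?_⟩
      have hm : (k + 1) * listTime G ≤ (s.reg .thr + 1) * listTime G := Nat.mul_le_mul_right _ (by omega)
      rw [add_mul, one_mul] at hm
      rw [hgo] at hk3
      simp at hk3 ⊢
      omega
    · obtain ⟨K₁, hk1, hk2, hk3⟩ := hT.word hu
      refine ⟨G.kappa - K₁, hk2, ?_⟩
      have : s2.reg .K = G.kappa := le_antisymm hKk hkK
      rw [this, hgo] at hk3
      rw [add_mul (G.kappa - K₁) 1, one_mul]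
      simp only [Nat.sub_zero, one_mul, Expr.cost] at hk3 ⊢
      omega

end Combined

/-! ## The initial memory -/

section Init

variable {n₁ n₂ : ℕ} {G : BipGraph n₁ n₂} {lam : ℕ} {s s' s0 : Mem}

/-- The next power of two exceeds the sum of all earlier ones, so addition acts as OR. -/
theorem sum_bits (p : ℕ → Prop) [DecidablePred p] (n : ℕ) :
    (∑ r ∈ Finset.range n, if p r then 2 ^ r else 0) < 2 ^ n ∧
      ∀ r, (∑ r ∈ Finset.range n, if p r then 2 ^ r else 0).testBit r = true ↔ r < n ∧ p r := by
  induction n with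
  | zero => simp
  | succ n ih =>
    obtain ⟨h1, h2⟩ := ih
    rw [Finset.sum_range_succ]
    split_ifs with hp
    · refine ⟨by rw [pow_succ]; omega, fun r => ?_⟩
      have h3 := Nat.two_pow_add_eq_or_of_lt h1 1
      rw [mul_one] at h3
      rw [add_comm, h3, Nat.testBit_or, Bool.or_eq_true, h2, Nat.testBit_two_pow, decide_eq_true_eq]
      constructor
      · rintro (rfl | ⟨h, h'⟩)
        · exact ⟨by omega, hp⟩
        · exact ⟨by omega, h'⟩
      · rintro ⟨h, h'⟩
        by_cases hn : n = r
        · exact Or.inl hn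
        · exact Or.inr ⟨by omega, h'⟩
    · refine ⟨by rw [pow_succ]; omega, fun r => ?_⟩
      rw [add_zero, h2]
      constructor
      · rintro ⟨h, h'⟩; exact ⟨by omega, h'⟩
      · rintro ⟨h, h'⟩
        refine ⟨lt_of_le_of_ne (by omega) ?_, h'⟩
        rintro rfl; exact hp h'

theorem Adj.of_lists {n k : ℕ} {E : ℕ → ℕ → Prop} [∀ v b, Decidable (E v b)] {L : Fin n → List (Fin k)}
    (hL : ∀ v, (L v).Nodup)
    (hE : ∀ v b, E v b ↔ ∃ (hv : v < n) (hb : b < k), (⟨b, hb⟩ : Fin k) ∈ L ⟨v, hv⟩) (lam : ℕ) :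
    Adj E lam k (fun v _ => if hv : v < n then (L ⟨v, hv⟩).length else 0)
      (fun v i => if hv : v < n then ((L ⟨v, hv⟩).map Fin.val).getD i 0 else 0)
      (fun v q => ∑ r ∈ Finset.range lam, if E v (q * lam + r) then 2 ^ r else 0) := by
  have hget : ∀ v (hv : v < n) i (hi : i < (L ⟨v, hv⟩).length),
      ((L ⟨v, hv⟩).map Fin.val).getD i 0 = ((L ⟨v, hv⟩)[i] : ℕ) := by
    intro v hv i hi
    rw [List.getD_eq_getElem _ _ (by simpa using hi), List.getElem_map]
  refine ⟨?_, ?_, ?_, ?_, fun v q => (sum_bits _ lam).1, fun v b h => ((hE v b).1 h).2.1⟩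
  · intro v i hi
    split_ifs at hi ⊢ with hv
    · rw [hget v hv i hi, hE]
      exact ⟨hv, Fin.is_lt _, List.getElem_mem hi⟩
    · omega
  · intro v b h
    obtain ⟨hv, hb, hm⟩ := (hE v b).1 h
    obtain ⟨i, hi, hib⟩ := List.mem_iff_getElem.1 hm
    refine ⟨i, by simpa [hv] using hi, ?_⟩
    simp only [dif_pos hv]
    rw [hget v hv i hi, hib]
  · intro v i i' hi hi' h
    split_ifs at hi hi' h with hv
    · rw [hget v hv i hi, hget v hv i' hi'] at h
      exact (hL _).getElem_inj_iff.1 (Fin.ext h)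
    · omega
  · intro v q r hr
    rw [(sum_bits _ lam).2]
    exact ⟨fun h => h.2, fun h => ⟨hr, h⟩⟩

theorem sum_length_eq {α β : Type*} [Fintype α] [DecidableEq α] [DecidableEq β] {L : α → List β}
    (hL : ∀ v, (L v).Nodup) {S : Finset (α × β)} (hS : ∀ v b, b ∈ L v ↔ (v, b) ∈ S) :
    ∑ v, (L v).length = S.card := by
  rw [Finset.card_eq_sum_card_fiberwise (f := Prod.fst) (t := Finset.univ) (fun _ _ => Finset.mem_coe.2 (Finset.mem_univ _))]
  refine Finset.sum_congr rfl fun v _ => ?_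
  rw [← List.toFinset_card_of_nodup (hL v)]
  refine Finset.card_bij (fun b _ => (v, b)) ?_ ?_ ?_
  · intro b hb
    simpa [← hS] using hb
  · intro b _ b' _ h
    exact (Prod.mk.inj h).2
  · rintro ⟨v', b⟩ h
    simp only [Finset.mem_filter] at h
    obtain ⟨h, rfl⟩ := h
    exact ⟨b, by simpa [hS] using h, rfl⟩

theorem sum_range_length {n : ℕ} {β : Type*} (L : Fin n → List β) :
    ∑ v ∈ Finset.range n, (if hv : v < n then (L ⟨v, hv⟩).length else 0) = ∑ v, (L v).length := by
  rw [Finset.sum_range]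
  exact Finset.sum_congr rfl fun v _ => by simp

variable (G lam) in
theorem static_initMem (ℓ : ℕ) : Static G lam (initMem G lam ℓ) := by
  refine ⟨rfl, rfl, rfl, ?_, ?_, ?_, ?_⟩
  · refine @Adj.of_lists n₁ n₂ G.edgeNat (fun _ _ => Classical.propDecidable _) G.outList G.outList_nodup ?_ lam
    intro v b
    simp only [BipGraph.edgeNat, G.mem_outList]
  · refine @Adj.of_lists n₂ n₁ (flip G.edgeNat) (fun _ _ => Classical.propDecidable _) G.inList G.inList_nodup ?_ lam
    intro v b
    simp only [BipGraph.edgeNat, flip, G.mem_inList]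
    exact ⟨fun ⟨h1, h2, h3⟩ => ⟨h2, h1, h3⟩, fun ⟨h1, h2, h3⟩ => ⟨h2, h1, h3⟩⟩
  · refine (sum_range_length G.outList).trans (sum_length_eq G.outList_nodup G.mem_outList)
  · refine (sum_range_length G.inList).trans ?_
    rw [sum_length_eq (S := G.edges.map (Equiv.prodComm _ _).toEmbedding) G.inList_nodup, Finset.card_map]
    · rfl
    · intro b v
      simp [G.mem_inList]

variable (G) in
theorem base_initMem (hlam : 0 < lam) (ℓ : ℕ) : Base G lam (initMem G lam ℓ) := by
  refine ⟨static_initMem G lam ℓ, ?_, ?_⟩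
  · constructor <;> intros <;> simp_all [initMem, bitAt]
  · refine ⟨⟨?_, ?_, ?_, ?_⟩, ⟨?_, ?_, ?_, ?_⟩, ?_, ?_⟩ <;> intros <;> simp_all [initMem]

/-! ### The final potential -/

/-- The entries passed by a pointer are distinct numbered nodes, and there are at most `K` of these.
-/
theorem ScanInv.le_card {E : ℕ → ℕ → Prop} {n K : ℕ} {ptr deg adj idx wptr W node : ℕ → ℕ → ℕ}
    (h : ScanInv E lam n ptr deg adj idx wptr) (hA : Adj E lam n deg adj W) (hi : ∀ b, idx b 0 ≤ K)
    (hn : ∀ b, idx b 0 ≠ 0 → node (idx b 0 - 1) 0 = b) (v : ℕ) : ptr v 0 ≤ K := by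
  rw [← Finset.card_range (ptr v 0), ← Finset.card_range K]
  refine Finset.card_le_card_of_injOn (fun i => idx (adj v i) 0 - 1) ?_ ?_
  · intro i hi'
    have h1 := h.passed v i (by simpa using hi')
    have h2 := hi (adj v i)
    simp only [Finset.coe_range, Set.mem_Iio]
    omega
  · intro i hi i' hi' he
    simp only [Finset.coe_range, Set.mem_Iio] at hi hi' he
    refine hA.inj v i i' (hi.trans_le (h.le v)) (hi'.trans_le (h.le v)) ?_
    rw [← hn _ (h.passed v i hi), ← hn _ (h.passed v i' hi'), he]

theorem sum_indexed_le {n K : ℕ} {idx node : ℕ → ℕ → ℕ} (hi : ∀ b, idx b 0 ≤ K)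
    (hn : ∀ b, idx b 0 ≠ 0 → node (idx b 0 - 1) 0 = b) :
    ∑ b ∈ Finset.range n, (if idx b 0 = 0 then 0 else K) ≤ K * K := by
  have hc : ((Finset.range n).filter (fun b => ¬ idx b 0 = 0)).card ≤ K := by
    rw [← Finset.card_range K]
    refine Finset.card_le_card_of_injOn (fun b => idx b 0 - 1) ?_ ?_
    · intro b hb
      have h1 := hi b
      have h2 := (Finset.mem_filter.1 hb).2
      simp only [Finset.coe_range, Set.mem_Iio]
      omega
    · intro b hb b' hb' he
      simp only at he
      rw [← hn _ (Finset.mem_filter.1 hb).2, ← hn _ (Finset.mem_filter.1 hb').2, he]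
  have : ∑ b ∈ Finset.range n, (if idx b 0 = 0 then 0 else K) =
      ((Finset.range n).filter (fun b => ¬ idx b 0 = 0)).card * K := by
    simp only [← ite_not (p := _ = 0), ← Finset.sum_filter, Finset.sum_const, smul_eq_mul]
  rw [this]
  exact Nat.mul_le_mul_right _ hc

/-- Only the `K` roots have moved pointers, each by at most `K`. -/
theorem Base.sum_inPtr_le (hB : Base G lam s) :
    ∑ b ∈ Finset.range n₂, s.arr .inPtr b 0 ≤ s.reg .K * s.reg .K := by
  refine le_trans (Finset.sum_le_sum fun b _ => ?_) (sum_indexed_le (n := n₂) hB.nodes.idx2_le hB.nodes.node2_idx2)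
  split_ifs with h
  · exact (hB.scans.ptr2 b h).le
  · exact hB.scans.scan2.le_card hB.static.adj2 hB.nodes.idx1_le hB.nodes.node1_idx1 b

/-- The three bounds yield the minimum in the theorem: the list lengths, the number of numbered
nodes, and for unmatched nodes the word bound of `ptr1`, where the matched nodes add `K * K`. -/
theorem Base.sum_outPtr_le (hB : Base G lam s) :
    ∑ v ∈ Finset.range n₁, s.arr .outPtr v 0 ≤ G.m ∧
    ∑ v ∈ Finset.range n₁, s.arr .outPtr v 0 ≤ n₁ * s.reg .K ∧
    ∑ v ∈ Finset.range n₁, s.arr .outPtr v 0 ≤ n₁ * (n₂ / lam + 2) + s.reg .K * s.reg .K := by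
  have hK := hB.scans.scan1.le_card hB.static.adj1 hB.nodes.idx2_le hB.nodes.node2_idx2
  refine ⟨?_, ?_, ?_⟩
  · rw [← hB.static.sum1]
    exact Finset.sum_le_sum fun v _ => hB.scans.scan1.le v
  · calc _ ≤ ∑ v ∈ Finset.range n₁, s.reg .K := Finset.sum_le_sum fun v _ => hK v
      _ = _ := by simp
  · refine le_trans (Finset.sum_le_sum (g := fun v => (n₂ / lam + 2) + if s.arr .idx1 v 0 = 0 then 0 else s.reg .K)
      fun v _ => ?_) ?_
    · split_ifs with h
      · exact hB.scans.ptr1 v h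
      · exact (hK v).trans (Nat.le_add_left _ _)
    · rw [Finset.sum_add_distrib]
      refine Nat.add_le_add (by simp) (sum_indexed_le hB.nodes.idx1_le hB.nodes.node1_idx1)

end Init

/-! ## The running time -/

/-- With `θ = κ √(κ / (m l))` and `x = κ^{3/2} √(m / l)` one has `θ m = x` and `x θ l = κ³`.
Rounding is harmless: `T ≤ θ` serves the first bound and `θ < T + 1` the second. -/
theorem time_bound {c κ m l T W a : ℝ} (hc : 0 < c) (hκ : 1 ≤ κ) (hm : 0 < m) (hl : 0 < l) (hκm : κ ≤ m)
    (hcm : c * m ≤ κ ^ 2) (hl1 : 1 ≤ l)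
    (hT : T ≤ κ * √(κ / (m * l))) (hT' : κ * √(κ / (m * l)) < T + 1) (hT0 : 0 ≤ T)
    (hW0 : 0 ≤ W) (hW : (T + 1) * W ≤ κ) (ha : a ≤ κ / l) (ha0 : 0 ≤ a) :
    (T + 1) * (m + κ + 1) ≤ 3 * (κ ^ (3 / 2 : ℝ) * √(m / l)) + 3 / c * κ ^ 2 ∧
    (W + 1) * ((κ + 1) * (a + 3)) ≤ 2 * (κ ^ (3 / 2 : ℝ) * √(m / l)) + 14 * κ ^ 2 := by
  have hκ0 : 0 < κ := by linarith
  set x := κ ^ (3 / 2 : ℝ) * √(m / l) with hx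
  have hxm : κ * √(κ / (m * l)) * m = x := by
    have h1 : κ ^ (3 / 2 : ℝ) = κ * √κ := by
      rw [Real.sqrt_eq_rpow, ← Real.rpow_one_add' hκ0.le (by norm_num)]
      norm_num
    rw [hx, h1, Real.sqrt_div hκ0.le, Real.sqrt_div hm.le, Real.sqrt_mul hm.le]
    have := Real.sq_sqrt hm.le
    have h2 := Real.sqrt_pos.2 hm
    have h3 := Real.sqrt_pos.2 hl
    field_simp
    rw [this]
  have hxl : x * (κ * √(κ / (m * l))) * l = κ ^ 3 := by
    rw [← hxm]
    have h1 := Real.sq_sqrt (show 0 ≤ κ / (m * l) by positivity)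
    calc _ = κ ^ 2 * m * l * √(κ / (m * l)) ^ 2 := by ring
      _ = κ ^ 3 := by rw [h1]; field_simp
  have hx0 : 0 < x := by rw [← hxm]; positivity
  constructor
  · have h1 : T * m ≤ x := by rw [← hxm]; exact mul_le_mul_of_nonneg_right hT hm.le
    have h2 : m ≤ 1 / c * κ ^ 2 := by
      rw [one_div, ← div_eq_inv_mul, le_div_iff₀ hc]; linarith
    -- Uses `1 ≤ κ ≤ m`. The part `3 * m` without the factor `T` is absorbed by `κ² / c`.
    have h3 : (T + 1) * (m + κ + 1) ≤ (T + 1) * (3 * m) := by gcongr; linarith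
    have h4 : 3 / c * κ ^ 2 = 3 * (1 / c * κ ^ 2) := by ring
    rw [h4]; nlinarith
  · have hal : a ≤ κ := ha.trans (div_le_self hκ0.le hl1)
    have hWκ : W ≤ κ := by nlinarith
    have h0 : κ * √(κ / (m * l)) * W ≤ κ := le_trans (by gcongr) hW
    have h1 : W * (κ * a) ≤ x := by
      have h2 : W * (κ * a) ≤ W * (κ * (κ / l)) := by gcongr
      refine h2.trans ?_
      -- After multiplication with `κ * l` the claim reads `W κ³ ≤ x κ l`, which follows from `κ³ =
      -- x θ l` and `θ W ≤ κ`.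
      have h3 : W * (κ * (κ / l)) * (κ * l) = W * κ ^ 3 := by field_simp
      have h4 : W * κ ^ 3 ≤ x * (κ * l) := by
        rw [← hxl]
        calc W * (x * (κ * √(κ / (m * l))) * l) = (κ * √(κ / (m * l)) * W) * (x * l) := by ring
          _ ≤ κ * (x * l) := by gcongr
          _ = _ := by ring
      have h5 : 0 < κ * l := by positivity
      exact le_of_mul_le_mul_right (h3 ▸ h4) h5
    have h2 : (W + 1) * ((κ + 1) * (a + 3)) ≤ (W + 1) * ((2 * κ) * (a + 3)) := by gcongr; linarith
    -- The terms are `2 W κ a ≤ 2 x` and `6 W κ + 2 κ a + 6 κ ≤ 14 κ²`.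
    nlinarith

end MatchingPseudoflow

/-- The combined algorithm, with `ℓ = κ √(κ / (m λ))`, finds a maximum matching in time
`O(min {n₁ κ, n₁ n₂ / λ, m} + κ² + κ^{1.5} √(m / λ))` when `κ² ∈ Ω(m)`. -/
theorem mainTheorem6 (c : ℝ) (hc : 0 < c) :
    ∃ C : ℝ, 0 < C ∧
      ∀ (n₁ n₂ lam : ℕ) (G : MatchingPseudoflow.BipGraph n₁ n₂),
        0 < lam → lam ≤ n₂ → 0 < G.m → n₁ ≤ G.m →
        c * (G.m : ℝ) ≤ (G.kappa : ℝ) ^ 2 →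
        ∃ (t : ℕ) (s : MatchingPseudoflow.Mem),
          MatchingPseudoflow.Exec lam MatchingPseudoflow.combined
            (MatchingPseudoflow.initMem G lam
              ⌊(G.kappa : ℝ) * Real.sqrt ((G.kappa : ℝ) / ((G.m : ℝ) * (lam : ℝ)))⌋₊) t s ∧
          (∃ M : Finset (Fin n₁ × Fin n₂), G.IsMatching M ∧ M.card = G.kappa ∧
            MatchingPseudoflow.output s = M.image fun e => ((e.1 : ℕ), (e.2 : ℕ))) ∧
          (t : ℝ) ≤ C *
            (min (min ((n₁ : ℝ) * (G.kappa : ℝ)) ((n₁ : ℝ) * (n₂ : ℝ) / (lam : ℝ))) (G.m : ℝ)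
              + (G.kappa : ℝ) ^ 2
              + (G.kappa : ℝ) ^ (3 / 2 : ℝ) * Real.sqrt ((G.m : ℝ) / (lam : ℝ))) := by
  -- `60300 = 3 * 20100` comes from the summand `m` in the cost of a stage without words. The
  -- largest other coefficient is that of `κ²`, below `14 * 20100 + 2000`.
  refine ⟨400000 + 60300 / c, by positivity, ?_⟩
  intro n₁ n₂ lam G hlam hln hm hn1 hcm
  set T := ⌊(G.kappa : ℝ) * Real.sqrt ((G.kappa : ℝ) / ((G.m : ℝ) * (lam : ℝ)))⌋₊ with hTdef
  have hmR : (0 : ℝ) < G.m := by exact_mod_cast hm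
  have hlR : (0 : ℝ) < lam := by exact_mod_cast hlam
  have hκ : 1 ≤ G.kappa := by
    rw [Nat.one_le_iff_ne_zero]
    intro h0
    rw [h0] at hcm
    have : 0 < c * (G.m : ℝ) := by positivity
    norm_num at hcm
    linarith
  have hκm : G.kappa ≤ G.m := MatchingPseudoflow.BipGraph.kappa_le_m
  obtain ⟨t, s, hex, hB, hP, hK, W, hW, ht⟩ := MatchingPseudoflow.wp_combined (G := G) hlam
    (MatchingPseudoflow.base_initMem G hlam T) rfl (fun _ => ⟨rfl, rfl, rfl⟩) (fun _ => ⟨rfl, rfl, rfl⟩)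
  obtain ⟨M, hM, hMc, hMo⟩ := hP.matching hB
  refine ⟨t, s, hex, ⟨M, hM, by omega, hMo⟩, ?_⟩
  have hS2 := hB.sum_inPtr_le
  obtain ⟨hS1, hS1', hS1''⟩ := hB.sum_outPtr_le
  change (T + 1) * W ≤ _ at hW
  change t ≤ _ + _ + _ + (T + 1) * _ + _ at ht
  rw [MatchingPseudoflow.pot, MatchingPseudoflow.listTime, MatchingPseudoflow.wordTime] at ht
  rw [hK] at hS2 hS1' hS1'' ht
  set S1 := ∑ v ∈ Finset.range n₁, s.arr .outPtr v 0
  set S2 := ∑ b ∈ Finset.range n₂, s.arr .inPtr b 0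
  have hκR : (1 : ℝ) ≤ G.kappa := by exact_mod_cast hκ
  have hq : (1 : ℝ) ≤ (n₂ : ℝ) / lam := by rw [le_div_iff₀ hlR, one_mul]; exact_mod_cast hln
  have hn0 : (0 : ℝ) ≤ n₁ := Nat.cast_nonneg _
  obtain ⟨hb1, hb2⟩ := MatchingPseudoflow.time_bound (c := c) (κ := G.kappa) (m := G.m) (l := lam) (T := T)
    (W := W) (a := ((G.kappa / lam : ℕ) : ℝ)) hc hκR hmR hlR (by exact_mod_cast hκm) hcm
    (by exact_mod_cast hlam) (Nat.floor_le (by positivity)) (Nat.lt_floor_add_one _)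
    (Nat.cast_nonneg _) (Nat.cast_nonneg _) (by exact_mod_cast hW) Nat.cast_div_le (Nat.cast_nonneg _)
  set X := (G.kappa : ℝ) ^ (3 / 2 : ℝ) * Real.sqrt ((G.m : ℝ) / (lam : ℝ))
  set A := min (min ((n₁ : ℝ) * (G.kappa : ℝ)) ((n₁ : ℝ) * (n₂ : ℝ) / (lam : ℝ))) (G.m : ℝ) with hA
  have hX0 : 0 ≤ X := by positivity
  -- Each term of the minimum is at least `n₁`, because `1 ≤ κ`, `lam ≤ n₂` and `n₁ ≤ m`; this
  -- absorbs the constant work per node.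
  have hA1 : (n₁ : ℝ) ≤ A := by
    refine le_min (le_min ?_ ?_) (by exact_mod_cast hn1)
    · nlinarith
    · rw [mul_div_assoc]; nlinarith
  -- The factor three comes from `n₂ / lam + 2 ≤ 3 (n₂ / lam)`, where `lam ≤ n₂` is used.
  have hA2 : (S1 : ℝ) ≤ 3 * A + (G.kappa : ℝ) ^ 2 := by
    have h1 : (S1 : ℝ) ≤ G.m := by exact_mod_cast hS1
    have h2 : (S1 : ℝ) ≤ n₁ * G.kappa := by exact_mod_cast hS1'
    have h3 : (S1 : ℝ) ≤ 3 * (n₁ * n₂ / lam) + (G.kappa : ℝ) ^ 2 := by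
      have h4 : (S1 : ℝ) ≤ n₁ * ((n₂ / lam : ℕ) + 2) + G.kappa * G.kappa := by exact_mod_cast hS1''
      have h5 : ((n₂ / lam : ℕ) : ℝ) ≤ (n₂ : ℝ) / lam := Nat.cast_div_le
      rw [mul_div_assoc]
      nlinarith
    -- Solved for `A`, so that the three bounds can be checked against the three terms of the
    -- minimum one by one.
    have h6 : ((S1 : ℝ) - (G.kappa : ℝ) ^ 2) / 3 ≤ A := by
      have h0 : (0 : ℝ) ≤ S1 := Nat.cast_nonneg _
      refine le_min (le_min ?_ ?_) ?_ <;> nlinarith [sq_nonneg (G.kappa : ℝ)]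
    linarith
  have hA3 : (S2 : ℝ) ≤ (G.kappa : ℝ) ^ 2 := by rw [sq]; exact_mod_cast hS2
  have htR : (t : ℝ) ≤ 100 * (S1 + S2) + 1000 * (G.kappa : ℝ) ^ 2 + 600 * n₁ + 100 +
      20100 * ((T + 1) * (G.m + G.kappa + 1)) +
      20100 * ((W + 1) * ((G.kappa + 1) * ((G.kappa / lam : ℕ) + 3))) := by
    refine (Nat.cast_le.2 ht).trans (le_of_eq ?_)
    push_cast
    ring
  have hκ2 : (1 : ℝ) ≤ (G.kappa : ℝ) ^ 2 := one_le_pow₀ hκR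
  have hA0 : 0 ≤ A := hn0.trans hA1
  have hc1 : 0 ≤ 60300 / c * (A + X) := by positivity
  have hc2 : 3 / c * (G.kappa : ℝ) ^ 2 * 20100 = 60300 / c * (G.kappa : ℝ) ^ 2 := by ring
  have hfin : (400000 + 60300 / c) * (A + (G.kappa : ℝ) ^ 2 + X) =
      400000 * A + 400000 * (G.kappa : ℝ) ^ 2 + 400000 * X + 60300 / c * (A + X) +
        60300 / c * (G.kappa : ℝ) ^ 2 := by ring
  rw [hfin]
  linarith
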